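/- Let $\mathcal H$ be a separable complex Hilbert space (finite- or infinite-dimensional), $\mathcal L$ its bounded operators, $\mathcal S^1$ the trace class and $\mathcal S^2$ the Hilbert–Schmidt class on $\mathcal H$. Let $\mathbb D$ be the open unit disc and $dA$ area measure. For a Banach space $\mathcal Y$, $\mathrm{Hol}(\mathcal Y)$ is the space of analytic functions $f:\mathbb D\to\mathcal Y$, with Taylor coefficients $\hat f(n)$ at $0$, and for $a\in\mathbb R$ $$D^a f(z)=\sum_{n\ge 0}(1+n)^a\hat f(n)z^n ,\qquad D=D^1 .$$ For $\mathcal Y=\mathcal H$ or $\mathcal Y=\mathcal S^2$ the Hardy space $H^2(\mathcal Y)$ has the norm $\|f\|^2=\sum_n\|\hat f(n)\|_{\mathcal Y}^2$. Write $(x\otimes y)v=\langle v,y\rangle x$ for $x,y,v\in\mathcal H$. For $\phi\in\mathrm{Hol}(\mathcal L)$ put $$\|\phi\|_{\mathrm{BMOA}_{\mathcal C}}^2=\sup_f\int_{\mathbb D}\|(D\phi)(z)f(\bar z)\|_{\mathcal H}^2(1-|z|^2)\,dA(z),$$ the supremum being over all $f$ with $\|f\|_{H^2(\mathcal H)}=1$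 that extend analytically to a disc $|z|<R$ with $R>1$. Let $\mathrm{BMOA}_{\mathcal C}(\mathcal L)$ be the set of $\phi\in\mathrm{Hol}(\mathcal L)$ with $\|\phi\|_{\mathrm{BMOA}_{\mathcal C}}<\infty$. Put $\phi^\#(z)=\phi(\bar z)^*$, and let $\mathrm{BMOA}_{\mathcal C^\#}(\mathcal L)=\{\phi:\phi^\#\in\mathrm{BMOA}_{\mathcal C}(\mathcal L)\}$ with norm $\|\phi^\#\|_{\mathrm{BMOA}_{\mathcal C}}$. For $a,b\in\mathbb R$ let $(D^aH^2(\mathcal H))\,\hat\otimes\,\overline{D^bH^2(\mathcal H)}$ be the space of functions $$u(z)=\sum_k (D^af_k)(z)\otimes (D^bg_k)(\bar z),\qquad f_k,g_k\in H^2(\mathcal H),\quad \sum_k\|f_k\|_{H^2(\mathcal H)}\|g_k\|_{H^2(\mathcal H)}<\infty,$$ normed by the infimum of $\sum_k\|f_k\|\|g_k\|$ over all such representations of $u$. Let $(D^aH^2(\mathcal S^2))\cdot(D^bH^2(\mathcal S^2))$ be the set of pointwise products $(D^aF)(D^bG)$ with $F,G\in H^2(\mathcal S^2)$, equipped with the infimum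 of $\|F\|\|G\|$ over all such factorizations. The operator $D^{-\alpha}$, which is injective on $\mathrm{Hol}(\mathcal L)$, carries these norms over to the images of these spaces. **Corollary.** Let $\alpha>0$. (1) As sets, and with comparable norms, $$X:=D^{-\alpha}\bigl((D^\alpha H^2(\mathcal H))\,\hat\otimes\,\overline{H^2(\mathcal H)}\bigr)=D^{-\alpha}\bigl((D^\alpha H^2(\mathcal S^2))\cdot H^2(\mathcal S^2)\bigr),$$ and $\mathrm{BMOA}_{\mathcal C}(\mathcal L)$ is the dual of $X$. (2) As sets, and with comparable norms, $$X_\#:=D^{-\alpha}\bigl(H^2(\mathcal H)\,\hat\otimes\,\overline{D^\alpha H^2(\mathcal H)}\bigr)=D^{-\alpha}\bigl(H^2(\mathcal S^2)\cdot (D^\alpha H^2(\mathcal S^2))\bigr),$$ and $\mathrm{BMOA}_{\mathcal C^\#}(\mathcal L)$ is the dual of $X_\#$. Here "$W$ is the dual of $X$" means that there is a conjugate-linear bijection $\ell\mapsto\psi$ from the bounded linear functionals on $X$ onto $W$ such that the norm of $\psi$ in $W$ is comparable to $\|\ell\|$, and such that $$\ell(h)=\lim_{r\uparrow1}\sum_{n\ge0}r^n\,\mathrm{tr}\bigl(\hat\psi(n)^*\hat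 h(n)\bigr)\qquad(h\in X),$$ where the series converges absolutely for $0\le r<1$; moreover $\ell(h)=\sum_n\mathrm{tr}(\hat\psi(n)^*\hat h(n))$ whenever this series converges absolutely. The comparison constants may depend on $\alpha$ and $\mathcal H$. -/

import Mathlib

open Filter Topology MeasureTheory Metric
open scoped ENNReal NNReal ComplexConjugate

noncomputable section

namespace VecBMOA

/-! ### Analytic functions on the unit disc -/

section Hol

variable (Y : Type*) [NormedAddCommGroup Y] [NormedSpace ℂ Y]

/-- The analytic functions on the open unit disc with values in `Y`. A function on the disc is
encoded by its extension by zero to the complex plane. -/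
def holSubmodule : Submodule ℂ (ℂ → Y) where
  carrier := {f | DifferentiableOn ℂ f (ball 0 1) ∧ ∀ z ∉ ball (0 : ℂ) 1, f z = 0}
  add_mem' := by
    rintro f g ⟨hf, hf'⟩ ⟨hg, hg'⟩
    exact ⟨hf.add hg, fun z hz => by simp [hf' z hz, hg' z hz]⟩
  zero_mem' := ⟨differentiableOn_const _, fun _ _ => rfl⟩
  smul_mem' := by
    rintro c f ⟨hf, hf'⟩
    exact ⟨hf.const_smul c, fun z hz => by simp [hf' z hz]⟩

/-- `Hol(Y)`: the space of `Y`-valued analytic functions on the open unit disc. -/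
def Hol : Type _ := ↥(holSubmodule Y)

instance : AddCommGroup (Hol Y) := inferInstanceAs (AddCommGroup ↥(holSubmodule Y))
instance : Module ℂ (Hol Y) := inferInstanceAs (Module ℂ ↥(holSubmodule Y))

variable {Y}

instance : FunLike (Hol Y) ℂ Y := ⟨fun f => f.1, Subtype.val_injective⟩

namespace Hol

theorem diffOn (f : Hol Y) : DifferentiableOn ℂ f (ball 0 1) := f.2.1

@[simp] theorem add_apply (f g : Hol Y) (z : ℂ) : (f + g) z = f z + g z := rfl
@[simp] theorem smul_apply (c : ℂ) (f : Hol Y) (z : ℂ) : (c • f) z = c • f z := rfl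
@[simp] theorem zero_apply (z : ℂ) : (0 : Hol Y) z = 0 := rfl

theorem ext' {f g : Hol Y} (h : ∀ z ∈ ball (0 : ℂ) 1, f z = g z) : f = g := by
  apply Subtype.ext
  funext z
  by_cases hz : z ∈ ball (0 : ℂ) 1
  · exact h z hz
  · rw [f.2.2 z hz, g.2.2 z hz]

/-- The `n`th Taylor coefficient at the origin. -/
def coeff (f : Hol Y) (n : ℕ) : Y := ((n.factorial : ℂ))⁻¹ • iteratedDeriv n (f : ℂ → Y) 0

theorem coeff_smul (c : ℂ) (f : Hol Y) (n : ℕ) : (c • f).coeff n = c • f.coeff n := by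
  have : ((c • f : Hol Y) : ℂ → Y) = c • (f : ℂ → Y) := rfl
  rw [coeff, coeff, this, iteratedDeriv_const_smul_field, smul_comm]

/-- The `H²(Y)`-norm (possibly `∞`) for a Hilbert space `Y`, `‖f‖² = ∑ ‖f̂(n)‖²`. -/
def h2Norm (f : Hol Y) : ℝ≥0∞ := (∑' n : ℕ, ‖f.coeff n‖ₑ ^ 2) ^ (1 / 2 : ℝ)

theorem enorm_coeff_le (f : Hol Y) (n : ℕ) : ‖f.coeff n‖ₑ ≤ f.h2Norm := by
  have h : ‖f.coeff n‖ₑ ^ 2 ≤ ∑' n : ℕ, ‖f.coeff n‖ₑ ^ 2 := ENNReal.le_tsum n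
  calc ‖f.coeff n‖ₑ = (‖f.coeff n‖ₑ ^ 2) ^ (1 / 2 : ℝ) := by
        rw [← ENNReal.rpow_natCast, ← ENNReal.rpow_mul]; norm_num
    _ ≤ _ := ENNReal.rpow_le_rpow h (by norm_num)

theorem h2Norm_smul (c : ℂ) (f : Hol Y) : (c • f).h2Norm = ‖c‖ₑ * f.h2Norm := by
  rw [h2Norm, h2Norm]
  simp only [coeff_smul, enorm_smul, mul_pow]
  rw [ENNReal.tsum_mul_left, ENNReal.mul_rpow_of_nonneg _ _ (by norm_num), ← ENNReal.rpow_natCast,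
    ← ENNReal.rpow_mul]
  norm_num

theorem norm_powTerm (a : ℝ) (f : Hol Y) (n : ℕ) (z : ℂ) :
    ‖((((1 + n : ℝ) ^ a : ℝ) : ℂ) * z ^ n) • f.coeff n‖
      = (1 + n : ℝ) ^ a * ‖z‖ ^ n * ‖f.coeff n‖ := by
  rw [norm_smul, norm_mul, norm_pow, Complex.norm_real, Real.norm_of_nonneg (by positivity)]

theorem h2Norm_zero : (0 : Hol Y).h2Norm = 0 := by
  have := h2Norm_smul (0 : ℂ) (0 : Hol Y)
  simpa using this

variable [CompleteSpace Y]

theorem contDiffAt_zero (f : Hol Y) (n : ℕ) : ContDiffAt ℂ n (f : ℂ → Y) 0 :=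
  (f.diffOn.contDiffOn isOpen_ball).contDiffAt (ball_mem_nhds 0 one_pos)

theorem coeff_add (f g : Hol Y) (n : ℕ) : (f + g).coeff n = f.coeff n + g.coeff n := by
  have : ((f + g : Hol Y) : ℂ → Y) = (f : ℂ → Y) + (g : ℂ → Y) := rfl
  rw [coeff, coeff, coeff, this, iteratedDeriv_add (f.contDiffAt_zero n) (g.contDiffAt_zero n),
    smul_add]

theorem hasSum_coeff (f : Hol Y) {z : ℂ} (hz : z ∈ ball (0 : ℂ) 1) :
    HasSum (fun n => z ^ n • f.coeff n) (f z) := by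
  have h := Complex.hasSum_taylorSeries_on_ball f.diffOn hz
  simp only [sub_zero] at h
  convert h using 2 with n
  rw [coeff, smul_comm]

theorem summable_weight_geom (c : ℝ) {q : ℝ} (hq0 : 0 ≤ q) (hq1 : q < 1) :
    Summable (fun n : ℕ => (1 + n : ℝ) ^ c * q ^ n) := by
  obtain ⟨k, hk⟩ := exists_nat_ge c
  have hp0 : 0 < (1 + q) / 2 := by linarith
  have hp1 : (1 + q) / 2 < 1 := by linarith
  have h1 := (summable_nat_add_iff 1).mpr
    (summable_pow_mul_geometric_of_norm_lt_one (R := ℝ) k (r := (1 + q) / 2)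
      (by rw [Real.norm_of_nonneg hp0.le]; exact hp1))
  refine (h1.mul_right ((1 + q) / 2)⁻¹).of_nonneg_of_le (fun n => by positivity) fun n => ?_
  have e : ((n + 1 : ℕ) : ℝ) ^ k * ((1 + q) / 2) ^ (n + 1) * ((1 + q) / 2)⁻¹
      = (1 + n : ℝ) ^ k * ((1 + q) / 2) ^ n := by
    push_cast
    field_simp
    ring
  rw [e]
  have hb : (1 : ℝ) ≤ 1 + n := by linarith [Nat.cast_nonneg (α := ℝ) n]
  have h2 : (1 + n : ℝ) ^ c ≤ (1 + n : ℝ) ^ k := by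
    rw [← Real.rpow_natCast]
    exact Real.rpow_le_rpow_of_exponent_le hb hk
  have h3 : q ^ n ≤ ((1 + q) / 2) ^ n := pow_le_pow_left₀ hq0 (by linarith) n
  gcongr

theorem summable_coeff (f : Hol Y) (c : ℝ) {r : ℝ} (hr0 : 0 ≤ r) (hr1 : r < 1) :
    Summable (fun n : ℕ => (1 + n : ℝ) ^ c * r ^ n * ‖f.coeff n‖) := by
  have hs0 : 0 < (1 + r) / 2 := by linarith
  have hs1 : (1 + r) / 2 < 1 := by linarith
  have hz : (((1 + r) / 2 : ℝ) : ℂ) ∈ ball (0 : ℂ) 1 := by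
    rw [mem_ball_zero_iff, Complex.norm_real, Real.norm_of_nonneg hs0.le]
    exact hs1
  obtain ⟨M, hM⟩ := ((f.hasSum_coeff hz).summable.tendsto_atTop_zero.norm).bddAbove_range
  have hM' : ∀ n, ((1 + r) / 2) ^ n * ‖f.coeff n‖ ≤ M := fun n => by
    have := hM ⟨n, rfl⟩
    beta_reduce at this
    rwa [norm_smul, norm_pow, Complex.norm_real, Real.norm_of_nonneg hs0.le] at this
  have hg := (summable_weight_geom c (q := r / ((1 + r) / 2)) (by positivity)
    ((div_lt_one hs0).mpr (by linarith))).mul_right M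
  refine hg.of_nonneg_of_le (fun n => by positivity) fun n => ?_
  calc (1 + n : ℝ) ^ c * r ^ n * ‖f.coeff n‖
      = (1 + n : ℝ) ^ c * (r / ((1 + r) / 2)) ^ n * (((1 + r) / 2) ^ n * ‖f.coeff n‖) := by
        rw [div_pow]
        field_simp
    _ ≤ _ := by
        gcongr
        exact hM' n

theorem summable_powTerm (a : ℝ) (f : Hol Y) {z : ℂ} (hz : z ∈ ball (0 : ℂ) 1) :
    Summable (fun n : ℕ => ((((1 + n : ℝ) ^ a : ℝ) : ℂ) * z ^ n) • f.coeff n) := by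
  refine Summable.of_norm ?_
  simp only [norm_powTerm]
  exact f.summable_coeff a (norm_nonneg z) (mem_ball_zero_iff.mp hz)

theorem diffOn_powTerm (a : ℝ) (f : Hol Y) :
    DifferentiableOn ℂ
      (fun z => ∑' n : ℕ, ((((1 + n : ℝ) ^ a : ℝ) : ℂ) * z ^ n) • f.coeff n) (ball 0 1) := by
  intro z hz
  obtain ⟨r, hzr, hr1⟩ := exists_between (mem_ball_zero_iff.mp hz)
  have hr0 : 0 ≤ r := (norm_nonneg z).trans hzr.le
  have := Complex.differentiableOn_tsum_of_summable_norm (U := ball (0 : ℂ) r)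
    (F := fun (n : ℕ) z => ((((1 + n : ℝ) ^ a : ℝ) : ℂ) * z ^ n) • f.coeff n)
    (f.summable_coeff a hr0 hr1)
    (fun n => by fun_prop) isOpen_ball
    (fun n w hw => by
      rw [norm_powTerm]
      have := (mem_ball_zero_iff.mp hw).le
      gcongr)
  exact (this.differentiableAt (isOpen_ball.mem_nhds
    (mem_ball_zero_iff.mpr hzr))).differentiableWithinAt

open Classical in
/-- Fractional differentiation `D^a f (z) = ∑ (1 + n)^a f̂(n) z^n`, as a map on `Hol(Y)`. -/
def fracDeriv (a : ℝ) (f : Hol Y) : Hol Y :=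
  ⟨fun z => if z ∈ ball (0 : ℂ) 1 then
      ∑' n : ℕ, ((((1 + n : ℝ) ^ a : ℝ) : ℂ) * z ^ n) • f.coeff n else 0,
    (f.diffOn_powTerm a).congr fun _ hz => if_pos hz, fun _ hz => if_neg hz⟩

theorem fracDeriv_apply (a : ℝ) (f : Hol Y) {z : ℂ} (hz : z ∈ ball (0 : ℂ) 1) :
    fracDeriv a f z = ∑' n : ℕ, ((((1 + n : ℝ) ^ a : ℝ) : ℂ) * z ^ n) • f.coeff n := if_pos hz

/-- The linear operator `D^a` on `Hol(Y)`. -/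
def Dpow (a : ℝ) : Hol Y →ₗ[ℂ] Hol Y where
  toFun f := fracDeriv a f
  map_add' f g := by
    refine ext' fun z hz => ?_
    rw [add_apply, fracDeriv_apply a _ hz, fracDeriv_apply a _ hz, fracDeriv_apply a _ hz,
      ← (f.summable_powTerm a hz).tsum_add (g.summable_powTerm a hz)]
    exact tsum_congr fun n => by rw [coeff_add, smul_add]
  map_smul' c f := by
    refine ext' fun z hz => ?_
    rw [RingHom.id_apply, smul_apply, fracDeriv_apply a _ hz, fracDeriv_apply a _ hz,
      ← (f.summable_powTerm a hz).tsum_const_smul c]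
    exact tsum_congr fun n => by rw [coeff_smul, smul_comm]

theorem Dpow_apply (a : ℝ) (f : Hol Y) {z : ℂ} (hz : z ∈ ball (0 : ℂ) 1) :
    Dpow a f z = ∑' n : ℕ, ((((1 + n : ℝ) ^ a : ℝ) : ℂ) * z ^ n) • f.coeff n :=
  fracDeriv_apply a f hz

theorem coeff_unique (f : Hol Y) {p : ℕ → Y}
    (hp : ∀ z ∈ ball (0 : ℂ) 1, HasSum (fun n => z ^ n • p n) (f z)) (n : ℕ) :
    f.coeff n = p n := by
  have key : ∀ q : ℕ → Y, (∀ z ∈ ball (0 : ℂ) 1, HasSum (fun n => z ^ n • q n) (f z)) →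
      HasFPowerSeriesAt (f : ℂ → Y)
        (show FormalMultilinearSeries ℂ ℂ Y from
          fun n => ContinuousMultilinearMap.mkPiRing ℂ (Fin n) (q n)) 0 := by
    intro q hq
    refine hasFPowerSeriesAt_iff.mpr ?_
    filter_upwards [ball_mem_nhds (0 : ℂ) one_pos] with z hz
    simpa [FormalMultilinearSeries.coeff] using hq z hz
  have h := (key _ fun z hz => f.hasSum_coeff hz).eq_formalMultilinearSeries (key p hp)
  have h2 := congrArg (fun P : FormalMultilinearSeries ℂ ℂ Y => P.coeff n) h
  simpa [FormalMultilinearSeries.coeff] using h2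

theorem coeff_Dpow (a : ℝ) (f : Hol Y) (n : ℕ) :
    (Dpow a f).coeff n = (((1 + n : ℝ) ^ a : ℝ) : ℂ) • f.coeff n := by
  refine coeff_unique (Dpow a f) (p := fun n => (((1 + n : ℝ) ^ a : ℝ) : ℂ) • f.coeff n)
    (fun z hz => ?_) n
  rw [Dpow_apply a f hz]
  convert (f.summable_powTerm a hz).hasSum using 2 with n
  rw [smul_smul, mul_comm]

theorem Dpow_injective (a : ℝ) : Function.Injective (Dpow (Y := Y) a) := by
  intro f g hfg
  refine ext' fun z hz => ?_
  have hc : ∀ n, f.coeff n = g.coeff n := fun n => by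
    have h := congrArg (fun u : Hol Y => u.coeff n) hfg
    simp only [coeff_Dpow] at h
    refine smul_right_injective Y (Complex.ofReal_ne_zero.mpr ?_) h
    positivity
  rw [← (f.hasSum_coeff hz).tsum_eq, ← (g.hasSum_coeff hz).tsum_eq]
  exact tsum_congr fun n => by rw [hc n]

/-- `f ∈ O(Y)`: the function `f` extends analytically to a larger disc centred at the origin. -/
def ExtendsBeyond (f : Hol Y) : Prop :=
  ∃ R > (1 : ℝ), ∃ F : ℂ → Y, DifferentiableOn ℂ F (ball 0 R) ∧ ∀ z ∈ ball (0 : ℂ) 1, F z = f z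

theorem exists_enorm_Dpow_le (a : ℝ) {z : ℂ} (hz : z ∈ ball (0 : ℂ) 1) :
    ∃ C : ℝ≥0∞, C ≠ ∞ ∧ ∀ f : Hol Y, ‖Dpow a f z‖ₑ ≤ C * f.h2Norm := by
  have hs := summable_weight_geom a (norm_nonneg z) (mem_ball_zero_iff.mp hz)
  refine ⟨∑' n : ℕ, ENNReal.ofReal ((1 + n : ℝ) ^ a * ‖z‖ ^ n), hs.tsum_ofReal_ne_top,
    fun f => ?_⟩
  rw [Dpow_apply a f hz, ← ENNReal.tsum_mul_right]
  refine enorm_tsum_le_tsum_enorm.trans (ENNReal.tsum_le_tsum fun n => ?_)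
  rw [← ofReal_norm, norm_powTerm, ENNReal.ofReal_mul (by positivity), ofReal_norm]
  gcongr
  exact f.enorm_coeff_le n

end Hol
end Hol

/-! ### The tensor product spaces -/

section Tensor

variable {H : Type*} [NormedAddCommGroup H] [InnerProductSpace ℂ H] [CompleteSpace H]

/-- `u(z) = ∑ₖ (D^a fₖ)(z) ⊗ (D^b gₖ)(z̄)` on the disc, with `fₖ, gₖ ∈ H²(H)`. Here `x ⊗ y` is the
rank one operator `v ↦ ⟨v, y⟩ x`. -/
structure IsTensorSum (a b : ℝ) (u : Hol (H →L[ℂ] H)) (f g : ℕ → Hol H) : Prop where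
  left_mem : ∀ k, (f k).h2Norm < ∞
  right_mem : ∀ k, (g k).h2Norm < ∞
  hasSum : ∀ z ∈ ball (0 : ℂ) 1,
    HasSum (fun k => InnerProductSpace.rankOne ℂ (Hol.Dpow a (f k) z) (Hol.Dpow b (g k) (conj z)))
      (u z)

/-- The projective norm (possibly `∞`) on `(D^a H²(H)) ⊗̂ conj (D^b H²(H))`, where `D^a H²(H)` has
the norm making `D^a` an isometry: the infimum of `∑ₖ ‖fₖ‖ ‖gₖ‖` over all representations
`u = ∑ₖ (D^a fₖ) ⊗ conj (D^b gₖ)`. -/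
def tensorNorm (a b : ℝ) (u : Hol (H →L[ℂ] H)) : ℝ≥0∞ :=
  ⨅ (f : ℕ → Hol H) (g : ℕ → Hol H) (_ : IsTensorSum a b u f g),
    ∑' k, (f k).h2Norm * (g k).h2Norm

/-- The norm (possibly `∞`) on `D^(-c) ((D^a H²(H)) ⊗̂ conj (D^b H²(H)))`, carried over by the
injective operator `D^(-c)`. -/
def predualNorm (a b c : ℝ) (h : Hol (H →L[ℂ] H)) : ℝ≥0∞ :=
  ⨅ (u : Hol (H →L[ℂ] H)) (_ : h = Hol.Dpow (-c) u), tensorNorm a b u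

theorem tensorNorm_le {a b : ℝ} {u : Hol (H →L[ℂ] H)} {f g : ℕ → Hol H}
    (h : IsTensorSum a b u f g) : tensorNorm a b u ≤ ∑' k, (f k).h2Norm * (g k).h2Norm :=
  (iInf₂_le f g).trans (iInf_le _ h)


theorem tensorNorm_zero (a b : ℝ) : tensorNorm a b (0 : Hol (H →L[ℂ] H)) = 0 := by
  refine le_antisymm ?_ bot_le
  have h : IsTensorSum a b (0 : Hol (H →L[ℂ] H)) (fun _ => 0) (fun _ => 0) :=
    ⟨fun k => by simp [Hol.h2Norm_zero], fun k => by simp [Hol.h2Norm_zero], fun z hz => by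
      simp⟩
  exact (tensorNorm_le h).trans (by simp [Hol.h2Norm_zero])

theorem tensorNorm_smul_le (a b : ℝ) (c : ℂ) (u : Hol (H →L[ℂ] H)) :
    tensorNorm a b (c • u) ≤ ‖c‖ₑ * tensorNorm a b u := by
  by_cases hc : c = 0
  · simp [hc, tensorNorm_zero]
  have h0 : ‖c‖ₑ ≠ 0 := by simpa using hc
  rw [mul_comm, ← ENNReal.div_le_iff h0 (by simp)]
  refine le_iInf₂ fun f g => le_iInf fun hfg => ?_
  rw [ENNReal.div_le_iff h0 (by simp)]
  have h : IsTensorSum a b (c • u) (fun k => c • f k) g := by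
    refine ⟨fun k => ?_, hfg.right_mem, fun z hz => ?_⟩
    · rw [Hol.h2Norm_smul]
      exact ENNReal.mul_lt_top (by simp) (hfg.left_mem k)
    · simpa using (hfg.hasSum z hz).const_smul c
  refine (tensorNorm_le h).trans ?_
  rw [mul_comm, ← ENNReal.tsum_mul_left]
  simp [Hol.h2Norm_smul, mul_assoc]

theorem tensorNorm_add_le (a b : ℝ) (u v : Hol (H →L[ℂ] H)) :
    tensorNorm a b (u + v) ≤ tensorNorm a b u + tensorNorm a b v := by
  have key : ∀ f g f' g', IsTensorSum a b u f g → IsTensorSum a b v f' g' →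
      tensorNorm a b (u + v) ≤
        ∑' k, (f k).h2Norm * (g k).h2Norm + ∑' k, (f' k).h2Norm * (g' k).h2Norm := by
    intro f g f' g' h h'
    have e0 : ∀ k : ℕ, (2 * k) % 2 = 0 := fun k => by omega
    have e1 : ∀ k : ℕ, (2 * k) / 2 = k := fun k => by omega
    have e2 : ∀ k : ℕ, (2 * k + 1) % 2 = 1 := fun k => by omega
    have e3 : ∀ k : ℕ, (2 * k + 1) / 2 = k := fun k => by omega
    have hs : IsTensorSum a b (u + v) (fun k => if k % 2 = 0 then f (k / 2) else f' (k / 2))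
        (fun k => if k % 2 = 0 then g (k / 2) else g' (k / 2)) := by
      refine ⟨fun k => ?_, fun k => ?_, fun z hz => ?_⟩
      · split_ifs
        exacts [h.left_mem _, h'.left_mem _]
      · split_ifs
        exacts [h.right_mem _, h'.right_mem _]
      · rw [Hol.add_apply]
        refine HasSum.even_add_odd ?_ ?_
        · simpa only [e0, e1, if_true] using h.hasSum z hz
        · simpa only [e2, e3, one_ne_zero, if_false] using h'.hasSum z hz
    refine (tensorNorm_le hs).trans (le_of_eq (HasSum.tsum_eq (HasSum.even_add_odd ?_ ?_)))
    · simpa only [e0, e1, if_true] using ENNReal.summable.hasSum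
    · simpa only [e2, e3, one_ne_zero, if_false] using ENNReal.summable.hasSum
  rw [← tsub_le_iff_left]
  refine le_iInf₂ fun f' g' => le_iInf fun h' => ?_
  rw [tsub_le_iff_right, add_comm (∑' k, _), ← tsub_le_iff_right]
  refine le_iInf₂ fun f g => le_iInf fun h => ?_
  rw [tsub_le_iff_right]
  exact key f g f' g' h h'

theorem eq_zero_of_tensorNorm (a b : ℝ) {u : Hol (H →L[ℂ] H)} (hu : tensorNorm a b u = 0) :
    u = 0 := by
  refine Hol.ext' fun z hz => ?_
  have hz' : conj z ∈ ball (0 : ℂ) 1 := by simpa using hz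
  obtain ⟨C, hC, hC'⟩ := Hol.exists_enorm_Dpow_le (Y := H) a hz
  obtain ⟨K, hK, hK'⟩ := Hol.exists_enorm_Dpow_le (Y := H) b hz'
  have key : ‖u z‖ₑ / (C * K) ≤ tensorNorm a b u := by
    refine le_iInf₂ fun f g => le_iInf fun h => ENNReal.div_le_of_le_mul' ?_
    rw [← (h.hasSum z hz).tsum_eq, ← ENNReal.tsum_mul_left]
    refine enorm_tsum_le_tsum_enorm.trans (ENNReal.tsum_le_tsum fun k => ?_)
    rw [InnerProductSpace.enorm_rankOne]
    calc _ ≤ (C * (f k).h2Norm) * (K * (g k).h2Norm) := mul_le_mul' (hC' _) (hK' _)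
      _ = _ := by ring
  rw [hu, nonpos_iff_eq_zero, ENNReal.div_eq_zero_iff] at key
  rcases key with h | h
  · simpa using h
  · exact absurd h (ENNReal.mul_ne_top hC hK)

theorem predualNorm_zero (a b c : ℝ) : predualNorm a b c (0 : Hol (H →L[ℂ] H)) = 0 :=
  le_antisymm ((iInf₂_le 0 (map_zero _).symm).trans (tensorNorm_zero a b).le) bot_le

theorem predualNorm_smul_le (a b c : ℝ) (l : ℂ) (h : Hol (H →L[ℂ] H)) :
    predualNorm a b c (l • h) ≤ ‖l‖ₑ * predualNorm a b c h := by
  by_cases hl : l = 0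
  · simp [hl, predualNorm_zero]
  have h0 : ‖l‖ₑ ≠ 0 := by simpa using hl
  rw [mul_comm, ← ENNReal.div_le_iff h0 (by simp)]
  refine le_iInf₂ fun u hu => ?_
  rw [ENNReal.div_le_iff h0 (by simp), mul_comm]
  exact (iInf₂_le (l • u) (by rw [map_smul, hu])).trans (tensorNorm_smul_le a b l u)

theorem predualNorm_smul (a b c : ℝ) (l : ℂ) (h : Hol (H →L[ℂ] H)) :
    predualNorm a b c (l • h) = ‖l‖ₑ * predualNorm a b c h := by
  by_cases hl : l = 0
  · simp [hl, predualNorm_zero]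
  have h0 : ‖l‖ₑ ≠ 0 := by simpa using hl
  refine le_antisymm (predualNorm_smul_le a b c l h) ?_
  have := predualNorm_smul_le a b c l⁻¹ (l • h)
  rw [smul_smul, inv_mul_cancel₀ hl, one_smul, enorm_inv hl] at this
  calc _ ≤ ‖l‖ₑ * (‖l‖ₑ⁻¹ * predualNorm a b c (l • h)) := by gcongr
    _ = _ := by rw [← mul_assoc, ENNReal.mul_inv_cancel h0 (by simp), one_mul]

theorem predualNorm_add_le (a b c : ℝ) (h k : Hol (H →L[ℂ] H)) :
    predualNorm a b c (h + k) ≤ predualNorm a b c h + predualNorm a b c k := by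
  rw [← tsub_le_iff_left]
  refine le_iInf₂ fun v hv => ?_
  rw [tsub_le_iff_right, add_comm, ← tsub_le_iff_left]
  refine le_iInf₂ fun u hu => ?_
  rw [tsub_le_iff_left, add_comm]
  rw [add_comm (tensorNorm a b v)]
  exact (iInf₂_le (u + v) (by rw [map_add, hu, hv])).trans (tensorNorm_add_le a b u v)

theorem eq_zero_of_predualNorm (a b c : ℝ) {h : Hol (H →L[ℂ] H)}
    (hh : predualNorm a b c h = 0) : h = 0 := by
  have key : ∀ u, h = Hol.Dpow (-c) u → predualNorm a b c h = tensorNorm a b u := by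
    intro u hu
    refine le_antisymm (iInf₂_le u hu) (le_iInf₂ fun v hv => ?_)
    rw [Hol.Dpow_injective (-c) (hu.symm.trans hv)]
  obtain ⟨u, hu⟩ : ∃ u, h = Hol.Dpow (-c) u := by
    by_contra! hne
    have : predualNorm a b c h = ∞ := by simp [predualNorm, hne]
    simp [this] at hh
  rw [key u hu] at hh
  rw [hu, eq_zero_of_tensorNorm a b hh, map_zero]

variable (H) in
/-- The space `D^(-c) ((D^a H²(H)) ⊗̂ conj (D^b H²(H)))` of operator-valued analytic functions. -/
def predual (a b c : ℝ) : Submodule ℂ (Hol (H →L[ℂ] H)) where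
  carrier := {h | predualNorm a b c h < ∞}
  add_mem' hh hk := (predualNorm_add_le a b c _ _).trans_lt (ENNReal.add_lt_top.mpr ⟨hh, hk⟩)
  zero_mem' := by simp [predualNorm_zero]
  smul_mem' l h hh := by
    simpa [predualNorm_smul] using ENNReal.mul_lt_top (by simp) hh

theorem predualNorm_ne_top {a b c : ℝ} (h : predual H a b c) : predualNorm a b c h.1 ≠ ∞ :=
  h.2.ne

/-- The norm of the predual space. -/
instance (a b c : ℝ) : Norm (predual H a b c) := ⟨fun h => (predualNorm a b c h.1).toReal⟩

theorem predual_core (a b c : ℝ) : NormedSpace.Core ℂ (predual H a b c) where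
  norm_nonneg _ := ENNReal.toReal_nonneg
  norm_smul l h := by
    change (predualNorm a b c (l • h.1)).toReal = _ * (predualNorm a b c h.1).toReal
    rw [predualNorm_smul, ENNReal.toReal_mul, toReal_enorm]
  norm_triangle h k := by
    change (predualNorm a b c (h.1 + k.1)).toReal
      ≤ (predualNorm a b c h.1).toReal + (predualNorm a b c k.1).toReal
    rw [← ENNReal.toReal_add (predualNorm_ne_top h) (predualNorm_ne_top k)]
    exact ENNReal.toReal_mono
      (ENNReal.add_ne_top.mpr ⟨predualNorm_ne_top h, predualNorm_ne_top k⟩)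
      (predualNorm_add_le a b c _ _)
  norm_eq_zero_iff h := by
    constructor
    · intro hh
      exact Subtype.ext (eq_zero_of_predualNorm a b c
        (((ENNReal.toReal_eq_zero_iff _).mp hh).resolve_right (predualNorm_ne_top h)))
    · rintro rfl
      change (predualNorm a b c (0 : Hol (H →L[ℂ] H))).toReal = 0
      rw [predualNorm_zero, ENNReal.toReal_zero]

instance (a b c : ℝ) : NormedAddCommGroup (predual H a b c) :=
  NormedAddCommGroup.ofCore (predual_core a b c)

instance (a b c : ℝ) : NormedSpace ℂ (predual H a b c) :=
  NormedSpace.ofCore (predual_core a b c)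

end Tensor

/-! ### Trace, Hilbert-Schmidt norm, and products of Hardy functions -/

section Schatten

variable (H : Type*) [NormedAddCommGroup H] [InnerProductSpace ℂ H] [CompleteSpace H]

/-- The index set of a fixed orthonormal basis of `H`. -/
def basisIndex : Set H := (exists_hilbertBasis ℂ H).choose

/-- A fixed orthonormal basis of `H`; the trace of a trace class operator and the Hilbert-Schmidt
norm do not depend on its choice. -/
def onb : HilbertBasis (basisIndex H) ℂ H := (exists_hilbertBasis ℂ H).choose_spec.choose

variable {H}

/-- The trace `∑ᵢ ⟨T eᵢ, eᵢ⟩` (of a trace class operator). -/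
def opTrace (T : H →L[ℂ] H) : ℂ := ∑' i, inner ℂ (onb H i) (T (onb H i))

/-- The pairing `⟨T, B⟩ = tr (B* T)` of a trace class operator `T` and a bounded operator `B`. It
is linear in `T` and anti-linear in `B`. -/
def tracePairing (T B : H →L[ℂ] H) : ℂ := opTrace (ContinuousLinearMap.adjoint B ∘L T)

/-- The Hilbert-Schmidt norm (`∞` off the Hilbert-Schmidt class `S²`). -/
def hsNorm (T : H →L[ℂ] H) : ℝ≥0∞ := (∑' i, ‖T (onb H i)‖ₑ ^ 2) ^ (1 / 2 : ℝ)

/-- The `H²(S²)`-norm (possibly `∞`), `‖F‖² = ∑ ‖F̂(n)‖²_{S²}`. -/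
def h2HSNorm (F : Hol (H →L[ℂ] H)) : ℝ≥0∞ :=
  (∑' n : ℕ, hsNorm (F.coeff n) ^ 2) ^ (1 / 2 : ℝ)

/-- `h = D^(-c) ((D^a F) · (D^b G))` with `F, G ∈ H²(S²)`, the product being the pointwise product
of operator-valued functions. -/
def IsProduct (a b c : ℝ) (h F G : Hol (H →L[ℂ] H)) : Prop :=
  h2HSNorm F < ∞ ∧ h2HSNorm G < ∞ ∧ ∃ u : Hol (H →L[ℂ] H),
    (∀ z ∈ ball (0 : ℂ) 1, u z = Hol.Dpow a F z ∘L Hol.Dpow b G z) ∧ h = Hol.Dpow (-c) u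

variable (H) in
/-- The set `D^(-c) ((D^a H²(S²)) · (D^b H²(S²)))`. -/
def prodSpace (a b c : ℝ) : Set (Hol (H →L[ℂ] H)) := {h | ∃ F G, IsProduct a b c h F G}

/-- The infimum of `‖F‖ ‖G‖` over all factorizations `h = D^(-c) ((D^a F) · (D^b G))`. -/
def prodNorm (a b c : ℝ) (h : Hol (H →L[ℂ] H)) : ℝ≥0∞ :=
  ⨅ (F : Hol (H →L[ℂ] H)) (G : Hol (H →L[ℂ] H)) (_ : IsProduct a b c h F G),
    h2HSNorm F * h2HSNorm G

end Schatten

/-! ### Carleson BMOA -/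

section BMOA

variable {H : Type*} [NormedAddCommGroup H] [InnerProductSpace ℂ H] [CompleteSpace H]

/-- The norm (possibly `∞`) of Carleson BMOA: the supremum over all `f ∈ O(H)` of unit
`H²(H)`-norm of `(∫_𝔻 ‖(Dφ)(z) f(z̄)‖² (1 - |z|²) dA(z))^(1/2)`. -/
def bmoaCNorm (φ : Hol (H →L[ℂ] H)) : ℝ≥0∞ :=
  (⨆ (f : Hol H) (_ : f.ExtendsBeyond ∧ f.h2Norm = 1),
    ∫⁻ z in ball (0 : ℂ) 1,
      ‖(Hol.Dpow 1 φ z) (f (conj z))‖ₑ ^ 2 * ENNReal.ofReal (1 - ‖z‖ ^ 2)) ^ (1 / 2 : ℝ)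

variable (H) in
/-- Carleson BMOA. -/
def BMOAC : Set (Hol (H →L[ℂ] H)) := {φ | bmoaCNorm φ < ∞}

/-- Coefficient conjugation `φ^#(z) = φ(z̄)*`. -/
def sharp (φ : Hol (H →L[ℂ] H)) : Hol (H →L[ℂ] H) :=
  ⟨fun z => ContinuousLinearMap.adjoint (φ (conj z)), by
    refine ⟨fun z hz => ?_, fun z hz => ?_⟩
    · have hz' : conj z ∈ ball (0 : ℂ) 1 := by simpa using hz
      have h := (φ.diffOn.differentiableAt (isOpen_ball.mem_nhds hz')).star_conj
      rw [Complex.conj_conj] at h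
      exact h.differentiableWithinAt
    · have hz' : conj z ∉ ball (0 : ℂ) 1 := by simpa using hz
      have h : φ (conj z) = 0 := φ.2.2 _ hz'
      change ContinuousLinearMap.adjoint (φ (conj z)) = 0
      rw [h, map_zero]⟩

variable (H) in
/-- The class of all `φ` for which `φ^#` is in Carleson BMOA. -/
def BMOACsharp : Set (Hol (H →L[ℂ] H)) := {φ | sharp φ ∈ BMOAC H}

/-- The space `W` of operator-valued analytic functions with norm `N` is the dual of
`X = D^(-c) ((D^a H²(H)) ⊗̂ conj (D^b H²(H)))` under the pairing
`⟨h, ψ⟩ = ∑ₙ ⟨ĥ(n), ψ̂(n)⟩`, with equivalence of norms. The map `J` from the bounded linear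
functionals on `X` to their symbols is a conjugate-linear bijection onto `W`, because the pairing is
anti-linear in `ψ`. The pairing is read as `lim_{r ↑ 1} ∑ₙ rⁿ ⟨ĥ(n), ψ̂(n)⟩` for general `h ∈ X`, and
as the sum of the series wherever that is absolutely convergent. -/
def IsDualOfPredual (a b c : ℝ) (W : Set (Hol (H →L[ℂ] H)))
    (N : Hol (H →L[ℂ] H) → ℝ≥0∞) : Prop :=
  ∃ J : (predual H a b c →L[ℂ] ℂ) →ₛₗ[starRingEnd ℂ] Hol (H →L[ℂ] H),
    Function.Injective J ∧ Set.range J = W ∧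
    (∃ C : ℝ≥0, ∀ l, N (J l) ≤ C * ‖l‖ₑ ∧ ‖l‖ₑ ≤ C * N (J l)) ∧
    ∀ (l : predual H a b c →L[ℂ] ℂ) (h : predual H a b c),
      (∀ r ∈ Set.Ico (0 : ℝ) 1, Summable fun n : ℕ =>
        (r : ℂ) ^ n * tracePairing (h.1.coeff n) ((J l).coeff n)) ∧
      Tendsto (fun r : ℝ => ∑' n : ℕ,
        (r : ℂ) ^ n * tracePairing (h.1.coeff n) ((J l).coeff n)) (𝓝[<] 1) (𝓝 (l h)) ∧
      ((Summable fun n : ℕ => tracePairing (h.1.coeff n) ((J l).coeff n)) →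
        l h = ∑' n : ℕ, tracePairing (h.1.coeff n) ((J l).coeff n))

end BMOA

end VecBMOA

end

noncomputable section
namespace VecBMOA

/-! ### Polar coordinates and radial integrals -/

/-! Everything is reduced to a weighted Hankel form. For ψ analytic and α > 0 put B(f, g) = Σ_{j,k}
((1+j)/(1+j+k))^α ⟨f_j, ψ̂(j+k) g_k⟩. The n-th Taylor coefficient of D^(-α)((D^α f) ⊗ g(z̄)) is
Σ_{j+k=n} ((1+j)/(1+j+k))^α f_j ⊗ g_k, so B(f, g) is the trace pairing of this elementary tensor
with ψ. By the nature of a projective norm, bounded functionals on X therefore correspond to symbols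
ψ with bounded B (`HankelBound`). The analytic core is that, for every α > 0, boundedness of B is
equivalent to ψ ∈ BMOA_C, with comparable norms (`exists_bmoaCNorm_hankelBound`).

From Carleson to Hankel (`CarlesonBound.hankelBound`): the radial moments of powers of log(1/|z|²)
are exact powers of 1 + n. Hence B of order β is a constant times the area integral of ⟨(D^N ψ)(z)
g(z̄), (D^β f)(z)⟩ against log(1/|z|²)^(β+N-1). Cauchy–Schwarz separates this into the Carleson
embedding of order N and a weighted Bergman norm of D^β f, which is the Hardy norm of f.

From Hankel to Carleson (`exists_carlesonBound`): let U be the image of g under the Hankel operator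
and N = M - α with M an integer. Then D^N U is an analytic projection of (D^N ψ)(w) g(w̄). Its
difference from (D^N ψ)(z) g(z̄) is a singular integral of (D^N ψ)(w)(g(w̄) - g(z̄)) with kernel Σ
(1+j)^M (z w̄)^j (`reproducing_formula`). The first term is controlled by the Bergman norm of D^N U.
In the second, boundedness of B forces the growth ‖(D^N ψ)(w)‖ ≲ (1-|w|)^(-N)
(`HankelBound.norm_Dpow_le`), and the smoothness of g is measured by a double integral of squared
differences that is bounded by the Hardy norm (`exists_double_integral_le`). This yields the
embedding of order N, not of order one. Going round once more repairs that: order N gives Hankel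
boundedness with exponent M - 1, and this gives order M - (M - 1) = 1 (`exists_carlesonBound_one`).

Duality: the Abel means of the pairing are bounded on X uniformly in r, because r^(j+k) = r^j r^k
only dilates f and g. Monomials span a dense subspace, on which convergence is trivial, so the Abel
means converge to the functional (`tendsto_abelMean`). Existence of the functional for a given
symbol comes from an ultrafilter limit (`exists_functional`). The second dual statement follows by
applying φ ↦ φ^# everywhere.

Products: expanding AB along an orthonormal basis as Σ (A e_i) ⊗ (B* e_i) turns a product of
S²-valued functions into a tensor sum. Conversely, if dim H is infinite, a balanced tensor sum is
relabelled by the basis and its terms become the columns of the two factors. If dim H is finite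
there are too few columns. In that case the square function of the g_k is dominated by the modulus
of a zero-free scalar Hardy function v (`exists_majorant`), and u = (u/v)(v·1) is the factorization.
The bound for u/v uses that for α > 0 the norm of D^α H² is an area integral and so is monotone
under pointwise domination. -/

theorem lintegral_ball_polar_prod (F : ℂ → ℝ≥0∞) :
    ∫⁻ z in ball (0 : ℂ) 1, F z =
      ∫⁻ p in Set.Ioo (0 : ℝ) 1 ×ˢ Set.Ioo (-Real.pi) Real.pi,
        ENNReal.ofReal p.1 * F (p.1 * Complex.exp (p.2 * Complex.I)) := by
  classical
  rw [← lintegral_indicator measurableSet_ball, ← Complex.lintegral_comp_polarCoord_symm,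
    polarCoord_target, ← lintegral_indicator (measurableSet_Ioi.prod measurableSet_Ioo),
    ← lintegral_indicator (measurableSet_Ioo.prod measurableSet_Ioo)]
  refine lintegral_congr fun p => ?_
  have e : Complex.polarCoord.symm p = p.1 * Complex.exp (p.2 * Complex.I) := by
    rw [Complex.polarCoord_symm_apply, Complex.exp_mul_I, Complex.ofReal_cos, Complex.ofReal_sin]
  have hn : ‖(p.1 : ℂ) * Complex.exp (p.2 * Complex.I)‖ = |p.1| := by
    rw [norm_mul, Complex.norm_exp_ofReal_mul_I, mul_one, Complex.norm_real, Real.norm_eq_abs]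
  rw [Set.indicator_apply, Set.indicator_apply, e]
  by_cases h0 : 0 < p.1
  · by_cases h1 : p.1 < 1
    · simp [Set.mem_prod, h0, h1, Set.indicator_apply, abs_of_pos h0]
    · simp [Set.mem_prod, h0, h1, abs_of_pos h0]
  · simp [Set.mem_prod, h0]

theorem norm_mul_exp_I {r : ℝ} (hr : 0 ≤ r) (t : ℝ) :
    ‖(r : ℂ) * Complex.exp (t * Complex.I)‖ = r := by
  rw [norm_mul, Complex.norm_exp_ofReal_mul_I, mul_one, Complex.norm_real, Real.norm_of_nonneg hr]

theorem mul_exp_I_mem_ball {r : ℝ} (hr : r ∈ Set.Ioo (0 : ℝ) 1) (t : ℝ) :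
    (r : ℂ) * Complex.exp (t * Complex.I) ∈ ball (0 : ℂ) 1 := by
  rw [mem_ball_zero_iff, norm_mul_exp_I hr.1.le]
  exact hr.2

/-- Tonelli needs measurability, which is asked only of the extension by zero: functions continuous
on the disc need not be measurable outside it. -/
theorem lintegral_ball_polar {F : ℂ → ℝ≥0∞} (hF : Measurable ((ball (0 : ℂ) 1).indicator F)) :
    ∫⁻ z in ball (0 : ℂ) 1, F z =
      ∫⁻ r in Set.Ioo (0 : ℝ) 1, ∫⁻ t in Set.Ioo (-Real.pi) Real.pi,
        ENNReal.ofReal r * F (r * Complex.exp (t * Complex.I)) := by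
  rw [lintegral_ball_polar_prod]
  have hm : Measurable fun p : ℝ × ℝ => ENNReal.ofReal p.1 *
      (ball (0 : ℂ) 1).indicator F (p.1 * Complex.exp (p.2 * Complex.I)) := by
    refine Measurable.mul (by fun_prop) (hF.comp (by fun_prop))
  have e : ∫⁻ p in Set.Ioo (0 : ℝ) 1 ×ˢ Set.Ioo (-Real.pi) Real.pi,
        ENNReal.ofReal p.1 * F (p.1 * Complex.exp (p.2 * Complex.I)) =
      ∫⁻ p in Set.Ioo (0 : ℝ) 1 ×ˢ Set.Ioo (-Real.pi) Real.pi, ENNReal.ofReal p.1 *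
      (ball (0 : ℂ) 1).indicator F (p.1 * Complex.exp (p.2 * Complex.I)) := by
    refine setLIntegral_congr_fun (measurableSet_Ioo.prod measurableSet_Ioo) fun p hp => ?_
    rw [Set.indicator_of_mem (mul_exp_I_mem_ball hp.1 _)]
  rw [e, Measure.volume_eq_prod, ← Measure.prod_restrict, lintegral_prod _ hm.aemeasurable]
  refine setLIntegral_congr_fun measurableSet_Ioo fun r hr => ?_
  refine lintegral_congr fun t => ?_
  simp only
  rw [Set.indicator_of_mem (mul_exp_I_mem_ball hr _)]

theorem measurable_indicator_enorm {Y : Type*} [NormedAddCommGroup Y] {f : ℂ → Y}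
    (hf : ContinuousOn f (ball 0 1)) :
    Measurable ((ball (0 : ℂ) 1).indicator fun z => ‖f z‖ₑ) := by
  classical
  have : Measurable ((ball (0 : ℂ) 1).piecewise (fun z => ‖f z‖ₑ) fun _ => 0) :=
    ContinuousOn.measurable_piecewise hf.enorm continuousOn_const measurableSet_ball
  change Measurable ((ball (0 : ℂ) 1).piecewise _ 0) at this
  rwa [Set.piecewise_eq_indicator] at this

/-- The radial weight `log (1 / |z|²)`. -/
def logWeight (r : ℝ) : ℝ := -2 * Real.log r

theorem logWeight_nonneg {r : ℝ} (h0 : 0 ≤ r) (h1 : r ≤ 1) : 0 ≤ logWeight r := by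
  have := Real.log_nonpos h0 h1
  rw [logWeight]; linarith

theorem image_exp_neg_Ioi : (fun x : ℝ => Real.exp (-x)) '' Set.Ioi 0 = Set.Ioo 0 1 := by
  ext y
  constructor
  · rintro ⟨x, hx, rfl⟩
    exact ⟨Real.exp_pos _, by rw [Real.exp_lt_one_iff]; simpa using hx⟩
  · rintro ⟨h0, h1⟩
    exact ⟨-Real.log y, by simpa using Real.log_neg h0 h1, by simp [Real.exp_log h0]⟩

/-- The substitution r = exp(-x) produces a Gamma integral. For d = 2n the value is a constant times
(1+n)^(-s), exactly a power of the multiplier of D. This is the reason for using powers of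
log(1/|z|²) instead of powers of 1 - |z|². -/
theorem lintegral_pow_mul_logWeight (d : ℕ) {s : ℝ} (hs : 0 < s) :
    ∫⁻ r in Set.Ioo (0 : ℝ) 1, ENNReal.ofReal (r * (r ^ d * logWeight r ^ (s - 1))) =
      ENNReal.ofReal (2⁻¹ * Real.Gamma s * (1 + (d : ℝ) / 2) ^ (-s)) := by
  rw [← image_exp_neg_Ioi, lintegral_image_eq_lintegral_abs_deriv_mul
    (f' := fun x => -Real.exp (-x)) measurableSet_Ioi]
  rotate_left
  · intro x _
    have := ((hasDerivAt_id x).neg).exp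
    simpa using this.hasDerivWithinAt
  · intro x _ y _ h
    simpa using h
  have hd : (0 : ℝ) < d + 2 := by positivity
  have key := Real.integral_rpow_mul_exp_neg_mul_Ioi hs hd
  have e : ∀ x ∈ Set.Ioi (0 : ℝ), ENNReal.ofReal |-Real.exp (-x)| *
      ENNReal.ofReal (Real.exp (-x) * (Real.exp (-x) ^ d * logWeight (Real.exp (-x)) ^ (s - 1))) =
      ENNReal.ofReal (2 ^ (s - 1) * (x ^ (s - 1) * Real.exp (-((d + 2 : ℝ) * x)))) := by
    intro x hx
    have hx : 0 < x := hx
    rw [← ENNReal.ofReal_mul (abs_nonneg _), abs_neg, abs_of_pos (Real.exp_pos _), logWeight,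
      Real.log_exp, show -2 * -x = 2 * x by ring, Real.mul_rpow zero_le_two hx.le,
      show -((d + 2 : ℝ) * x) = d * (-x) + (-x) + (-x) by ring, Real.exp_add, Real.exp_add,
      ← Real.exp_nat_mul]
    congr 1
    ring
  rw [setLIntegral_congr_fun measurableSet_Ioi e, ← ofReal_integral_eq_lintegral_ofReal,
    integral_const_mul, key]
  · congr 1
    rw [Real.rpow_neg (by positivity), ← Real.inv_rpow (by positivity),
      show (1 + (d : ℝ) / 2)⁻¹ = 2 * (1 / (d + 2)) by field_simp; ring,
      Real.mul_rpow zero_le_two (by positivity), Real.rpow_sub_one two_ne_zero]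
    ring
  · refine Integrable.const_mul ?_ _
    -- Integrability is read off from the known value: the integral of a non-integrable function is
    -- 0 by convention, while the Gamma value is positive.
    by_contra h
    rw [integral_undef h] at key
    have : 0 < (1 / (d + 2 : ℝ)) ^ s * Real.Gamma s :=
      mul_pos (by positivity) (Real.Gamma_pos_of_pos hs)
    linarith
  · refine (ae_restrict_mem measurableSet_Ioi).mono fun x hx => ?_
    have hx : 0 < x := hx
    simp only [Pi.zero_apply]
    positivity

theorem measurable_logWeight : Measurable logWeight := by
  unfold logWeight; fun_prop

theorem integrableOn_pow_mul_logWeight (d : ℕ) {s : ℝ} (hs : 0 < s) :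
    IntegrableOn (fun r => r * (r ^ d * logWeight r ^ (s - 1))) (Set.Ioo 0 1) := by
  refine ⟨?_, ?_⟩
  · have := measurable_logWeight
    exact Measurable.aestronglyMeasurable (by fun_prop)
  · rw [hasFiniteIntegral_iff_ofReal, lintegral_pow_mul_logWeight d hs]
    · exact ENNReal.ofReal_lt_top
    · refine (ae_restrict_mem measurableSet_Ioo).mono fun x hx => ?_
      have := logWeight_nonneg hx.1.le hx.2.le
      have := hx.1.le
      simp only [Pi.zero_apply]
      positivity

theorem integral_pow_mul_logWeight (d : ℕ) {s : ℝ} (hs : 0 < s) :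
    ∫ r in Set.Ioo (0 : ℝ) 1, r * (r ^ d * logWeight r ^ (s - 1)) =
      2⁻¹ * Real.Gamma s * (1 + (d : ℝ) / 2) ^ (-s) := by
  rw [integral_eq_lintegral_of_nonneg_ae, lintegral_pow_mul_logWeight d hs, ENNReal.toReal_ofReal]
  · have := Real.Gamma_pos_of_pos hs
    positivity
  · refine (ae_restrict_mem measurableSet_Ioo).mono fun x hx => ?_
    have := logWeight_nonneg hx.1.le hx.2.le
    have := hx.1.le
    simp only [Pi.zero_apply]
    positivity
  · exact (integrableOn_pow_mul_logWeight d hs).aestronglyMeasurable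

/-! ### Orthogonality on circles -/

theorem integral_exp_int (q : ℤ) :
    ∫ t in Set.Ioo (-Real.pi) Real.pi, Complex.exp (q * (t * Complex.I)) =
      if q = 0 then ((2 * Real.pi : ℝ) : ℂ) else 0 := by
  rw [← integral_Ioc_eq_integral_Ioo, ← intervalIntegral.integral_of_le (by linarith [Real.pi_pos])]
  split_ifs with h
  · subst h
    simp
    ring
  · have hq : (q : ℂ) * Complex.I ≠ 0 := mul_ne_zero (by exact_mod_cast h) Complex.I_ne_zero
    have e : (fun t : ℝ => Complex.exp (q * (t * Complex.I))) =
        fun t : ℝ => Complex.exp (q * Complex.I * t) := by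
      funext t; congr 1; ring
    rw [e, integral_exp_mul_complex hq, div_eq_zero_iff]
    left
    rw [sub_eq_zero, Complex.exp_eq_exp_iff_exists_int]
    exact ⟨q, by push_cast; ring⟩

theorem norm_exp_int (q : ℤ) (t : ℝ) : ‖Complex.exp (q * (t * Complex.I))‖ = 1 := by
  rw [show (q : ℂ) * (t * Complex.I) = ((q * t : ℝ) : ℂ) * Complex.I by push_cast; ring,
    Complex.norm_exp_ofReal_mul_I]

/-- The mean over the circle of an absolutely convergent trigonometric series is the sum of the
terms of frequency zero. -/
theorem integral_trigSeries {V ι : Type*} [NormedAddCommGroup V] [NormedSpace ℂ V]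
    [CompleteSpace V] [Countable ι] {c : ι → V} (hc : Summable fun i => ‖c i‖) (q : ι → ℤ) :
    ∫ t in Set.Ioo (-Real.pi) Real.pi, ∑' i, Complex.exp (q i * (t * Complex.I)) • c i =
      ((2 * Real.pi : ℝ) : ℂ) • ∑' i, if q i = 0 then c i else 0 := by
  have hn : ∀ i, ∀ t : ℝ, ‖Complex.exp (q i * (t * Complex.I)) • c i‖ = ‖c i‖ := fun i t => by
    rw [norm_smul, norm_exp_int, one_mul]
  have hs : Summable fun i => if q i = 0 then c i else 0 := by
    refine Summable.of_norm (hc.of_nonneg_of_le (fun _ => norm_nonneg _) fun i => ?_)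
    split_ifs <;> simp
  rw [← integral_tsum_of_summable_integral_norm, ← hs.tsum_const_smul]
  · refine tsum_congr fun i => ?_
    rw [integral_smul_const, integral_exp_int]
    split_ifs <;> simp
  · intro i
    refine Integrable.smul_const ?_ _
    refine (Continuous.integrableOn_Icc (by fun_prop)).mono_set Set.Ioo_subset_Icc_self
  · simp only [hn, integral_const]
    exact hc.const_smul _

end VecBMOA
end

/-! ### Parseval's identity for Hilbert-space-valued trigonometric series -/

noncomputable section
namespace VecBMOA

section Parseval

variable {Y : Type*} [NormedAddCommGroup Y] [InnerProductSpace ℂ Y] [CompleteSpace Y]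

theorem continuous_trigSeries {V ι : Type*} [NormedAddCommGroup V] [NormedSpace ℂ V]
    [CompleteSpace V] {c : ι → V} (hc : Summable fun i => ‖c i‖) (q : ι → ℤ) :
    Continuous fun t : ℝ => ∑' i, Complex.exp (q i * (t * Complex.I)) • c i := by
  refine continuous_tsum (fun i => by fun_prop) hc fun i t => ?_
  rw [norm_smul, norm_exp_int, one_mul]

theorem inner_tsum_tsum {ι : Type*} {a : ι → Y} (ha : Summable fun i => ‖a i‖) :
    Summable (fun p : ι × ι => ‖inner ℂ (a p.1) (a p.2)‖) ∧
    inner ℂ (∑' i, a i) (∑' i, a i) = ∑' p : ι × ι, inner ℂ (a p.1) (a p.2) := by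
  have hs : Summable fun p : ι × ι => ‖inner ℂ (a p.1) (a p.2)‖ :=
    (ha.mul_of_nonneg ha (fun _ => norm_nonneg _) fun _ => norm_nonneg _).of_nonneg_of_le
      (fun _ => norm_nonneg _) fun p => norm_inner_le_norm _ _
  refine ⟨hs, ?_⟩
  rw [hs.of_norm.tsum_prod]
  have h1 := (innerSLFlip ℂ (∑' i, a i)).hasSum ha.of_norm.hasSum
  simp only [innerSLFlip_apply_apply] at h1
  rw [← h1.tsum_eq]
  refine tsum_congr fun i => ?_
  simpa using ((innerSL ℂ (a i)).hasSum ha.of_norm.hasSum).tsum_eq.symm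

/-- The square expands into an absolutely convergent double series with frequencies q j - q i, and
injectivity of q leaves only the diagonal. The frequencies are kept general because the identity is
used for power series in z, for power series in z̄ and for finite sums. -/
theorem integral_norm_sq_trigSeries {ι : Type*} [Countable ι] {c : ι → Y}
    (hc : Summable fun i => ‖c i‖) {q : ι → ℤ} (hq : Function.Injective q) :
    ∫ t in Set.Ioo (-Real.pi) Real.pi, ‖∑' i, Complex.exp (q i * (t * Complex.I)) • c i‖ ^ 2 =
      2 * Real.pi * ∑' i, ‖c i‖ ^ 2 := by
  classical
  have hn : ∀ t : ℝ, (fun i => ‖Complex.exp (q i * (t * Complex.I)) • c i‖) = fun i => ‖c i‖ :=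
    fun t => funext fun i => by rw [norm_smul, norm_exp_int, one_mul]
  have h1 : ∀ t : ℝ, ((‖∑' i, Complex.exp (q i * (t * Complex.I)) • c i‖ ^ 2 : ℝ) : ℂ) =
      ∑' p : ι × ι, Complex.exp ((q p.2 - q p.1 : ℤ) * (t * Complex.I)) •
        inner ℂ (c p.1) (c p.2) := by
    intro t
    have := (inner_tsum_tsum (a := fun i => Complex.exp (q i * (t * Complex.I)) • c i)
      (by rw [hn t]; exact hc)).2
    rw [inner_self_eq_norm_sq_to_K] at this
    push_cast
    rw [show ((‖∑' i, Complex.exp (q i * (t * Complex.I)) • c i‖ : ℝ) : ℂ) =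
      ((‖∑' i, Complex.exp (q i * (t * Complex.I)) • c i‖ : ℝ) : ℂ) from rfl]
    refine this.trans (tsum_congr fun p => ?_)
    rw [inner_smul_left, inner_smul_right, ← mul_assoc, smul_eq_mul, ← Complex.exp_conj,
      ← Complex.exp_add]
    congr 2
    simp
    ring
  have hs := (inner_tsum_tsum hc).1
  have h2 := integral_trigSeries hs (fun p => q p.2 - q p.1)
  simp only [← h1] at h2
  rw [integral_complex_ofReal] at h2
  have h3 : ∑' p : ι × ι, (if q p.2 - q p.1 = 0 then inner ℂ (c p.1) (c p.2) else 0) =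
      ((∑' i, ‖c i‖ ^ 2 : ℝ) : ℂ) := by
    have hs' : Summable fun p : ι × ι =>
        if q p.2 - q p.1 = 0 then inner ℂ (c p.1) (c p.2) else 0 := by
      refine Summable.of_norm (hs.of_nonneg_of_le (fun _ => norm_nonneg _) fun i => ?_)
      split_ifs <;> simp
    rw [hs'.tsum_prod, Complex.ofReal_tsum]
    refine tsum_congr fun i => ?_
    rw [tsum_eq_single i]
    · simp [inner_self_eq_norm_sq_to_K]
    · intro j hj
      rw [if_neg]
      intro h
      exact hj (hq (by linarith))
  rw [h3, smul_eq_mul, ← Complex.ofReal_mul] at h2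
  exact_mod_cast h2

theorem summable_norm_sq {ι V : Type*} [NormedAddCommGroup V] {c : ι → V}
    (hc : Summable fun i => ‖c i‖) : Summable fun i => ‖c i‖ ^ 2 := by
  have h : ∀ᶠ i in cofinite, ‖c i‖ < 1 := hc.tendsto_cofinite_zero.eventually_lt_const one_pos
  refine summable_of_isBigO (g := fun i => ‖c i‖) hc (Asymptotics.IsBigO.of_bound 1 ?_)
  filter_upwards [h] with i hi
  rw [norm_pow, norm_norm, one_mul]
  nlinarith [norm_nonneg (c i)]

theorem tsum_enorm_sq {ι V : Type*} [NormedAddCommGroup V] {c : ι → V}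
    (hc : Summable fun i => ‖c i‖ ^ 2) :
    ∑' i, ‖c i‖ₑ ^ 2 = ENNReal.ofReal (∑' i, ‖c i‖ ^ 2) := by
  rw [ENNReal.ofReal_tsum_of_nonneg (fun _ => by positivity) hc]
  exact tsum_congr fun i => by rw [ENNReal.ofReal_pow (norm_nonneg _), ofReal_norm]

theorem lintegral_enorm_sq_trigSeries {ι : Type*} [Countable ι] {c : ι → Y}
    (hc : Summable fun i => ‖c i‖) {q : ι → ℤ} (hq : Function.Injective q) :
    ∫⁻ t in Set.Ioo (-Real.pi) Real.pi, ‖∑' i, Complex.exp (q i * (t * Complex.I)) • c i‖ₑ ^ 2 =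
      ENNReal.ofReal (2 * Real.pi) * ∑' i, ‖c i‖ₑ ^ 2 := by
  have hcont := continuous_trigSeries hc q
  rw [tsum_enorm_sq (summable_norm_sq hc), ← ENNReal.ofReal_mul (by positivity),
    ← integral_norm_sq_trigSeries hc hq, ofReal_integral_eq_lintegral_ofReal]
  · refine lintegral_congr fun t => ?_
    rw [ENNReal.ofReal_pow (norm_nonneg _), ofReal_norm]
  · exact (Continuous.integrableOn_Icc (by fun_prop)).mono_set Set.Ioo_subset_Icc_self
  · exact Eventually.of_forall fun t => by positivity

end Parseval

/-! ### Taylor coefficients and weighted Bergman norms -/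

namespace Hol

theorem summable_of_bounded {Y : Type*} [NormedAddCommGroup Y] {p : ℕ → Y} {C : ℝ} (hp : ∀ n, ‖p n‖ ≤ C) :
    ∀ r ∈ Set.Ico (0 : ℝ) 1, Summable fun n => r ^ n * ‖p n‖ := fun _ hr =>
  ((summable_geometric_of_lt_one hr.1 hr.2).mul_right C).of_nonneg_of_le
    (fun _ => mul_nonneg (pow_nonneg hr.1 _) (norm_nonneg _))
    fun n => mul_le_mul_of_nonneg_left (hp n) (pow_nonneg hr.1 _)

section
variable {Y : Type*} [NormedAddCommGroup Y] [NormedSpace ℂ Y]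

theorem h2Norm_sq (f : Hol Y) : f.h2Norm ^ 2 = ∑' n, ‖f.coeff n‖ₑ ^ 2 := by
  rw [h2Norm, ← ENNReal.rpow_natCast, ← ENNReal.rpow_mul]
  norm_num

theorem continuousOn (f : Hol Y) : ContinuousOn f (ball 0 1) := f.diffOn.continuousOn

theorem continuousOn_conj (f : Hol Y) : ContinuousOn (fun z => f (conj z)) (ball 0 1) :=
  f.continuousOn.comp Complex.continuous_conj.continuousOn fun z hz => by simpa using hz

variable [CompleteSpace Y]

theorem ext_coeff {f g : Hol Y} (h : ∀ n, f.coeff n = g.coeff n) : f = g := by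
  refine ext' fun z hz => ?_
  rw [← (f.hasSum_coeff hz).tsum_eq, ← (g.hasSum_coeff hz).tsum_eq]
  exact tsum_congr fun n => by rw [h n]

theorem summable_pow_mul_coeff (f : Hol Y) {r : ℝ} (hr0 : 0 ≤ r) (hr1 : r < 1) :
    Summable fun n : ℕ => r ^ n * ‖f.coeff n‖ := by
  simpa using f.summable_coeff 0 hr0 hr1

open Classical in
/-- The analytic function with prescribed Taylor coefficients. -/
def ofCoeff (p : ℕ → Y) (hp : ∀ r ∈ Set.Ico (0 : ℝ) 1, Summable fun n => r ^ n * ‖p n‖) :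
    Hol Y :=
  ⟨fun z => if z ∈ ball (0 : ℂ) 1 then ∑' n, z ^ n • p n else 0, by
    refine ⟨DifferentiableOn.congr (f := fun z => ∑' n, z ^ n • p n) ?_ fun _ hz => if_pos hz,
      fun _ hz => if_neg hz⟩
    intro z hz
    obtain ⟨r, hzr, hr1⟩ := exists_between (mem_ball_zero_iff.mp hz)
    have hr0 : 0 ≤ r := (norm_nonneg z).trans hzr.le
    have := Complex.differentiableOn_tsum_of_summable_norm (U := ball (0 : ℂ) r)
      (F := fun (n : ℕ) z => z ^ n • p n) (hp r ⟨hr0, hr1⟩)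
      (fun n => by fun_prop) isOpen_ball
      (fun n w hw => by
        rw [norm_smul, norm_pow]
        have := (mem_ball_zero_iff.mp hw).le
        gcongr)
    exact (this.differentiableAt (isOpen_ball.mem_nhds
      (mem_ball_zero_iff.mpr hzr))).differentiableWithinAt⟩

theorem ofCoeff_hasSum {p : ℕ → Y}
    (hp : ∀ r ∈ Set.Ico (0 : ℝ) 1, Summable fun n => r ^ n * ‖p n‖) {z : ℂ}
    (hz : z ∈ ball (0 : ℂ) 1) : HasSum (fun n => z ^ n • p n) (ofCoeff p hp z) := by
  have e : ofCoeff p hp z = ∑' n, z ^ n • p n := if_pos hz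
  rw [e]
  refine (Summable.of_norm ?_).hasSum
  simpa [norm_smul] using hp ‖z‖ ⟨norm_nonneg z, mem_ball_zero_iff.mp hz⟩

@[simp] theorem coeff_ofCoeff {p : ℕ → Y}
    (hp : ∀ r ∈ Set.Ico (0 : ℝ) 1, Summable fun n => r ^ n * ‖p n‖) (n : ℕ) :
    (ofCoeff p hp).coeff n = p n :=
  coeff_unique _ (fun _ hz => ofCoeff_hasSum hp hz) n

theorem apply_polar (f : Hol Y) {r : ℝ} (hr : r ∈ Set.Ioo (0 : ℝ) 1) (t : ℝ) :
    f (r * Complex.exp (t * Complex.I)) =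
      ∑' n : ℕ, Complex.exp ((n : ℤ) * (t * Complex.I)) • ((r : ℂ) ^ n • f.coeff n) := by
  rw [← (f.hasSum_coeff (mul_exp_I_mem_ball hr t)).tsum_eq]
  refine tsum_congr fun n => ?_
  rw [mul_pow, ← Complex.exp_nat_mul, smul_smul, mul_comm]
  norm_cast

end

variable {Y : Type*} [NormedAddCommGroup Y] [InnerProductSpace ℂ Y] [CompleteSpace Y]

/-- Parseval's identity for radial weights on the disc. -/
theorem lintegral_enorm_sq_mul (f : Hol Y) {ω : ℝ → ℝ≥0∞} (hω : Measurable ω) :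
    ∫⁻ z in ball (0 : ℂ) 1, ‖f z‖ₑ ^ 2 * ω ‖z‖ =
      ∑' n, ‖f.coeff n‖ₑ ^ 2 * (ENNReal.ofReal (2 * Real.pi) *
        ∫⁻ r in Set.Ioo (0 : ℝ) 1, ENNReal.ofReal (r * r ^ (2 * n)) * ω r) := by
  have hm : Measurable ((ball (0 : ℂ) 1).indicator fun z => ‖f z‖ₑ ^ 2 * ω ‖z‖) := by
    have h1 := (measurable_indicator_enorm f.continuousOn).pow_const 2
    have h2 : Measurable fun z : ℂ => ω ‖z‖ := hω.comp measurable_norm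
    convert h1.mul h2 using 1
    funext z
    by_cases hz : z ∈ ball (0 : ℂ) 1
    · rw [Pi.mul_apply, Set.indicator_of_mem hz, Set.indicator_of_mem hz]
    · rw [Pi.mul_apply, Set.indicator_of_notMem hz, Set.indicator_of_notMem hz]
      simp
  rw [lintegral_ball_polar hm]
  have e : ∀ r ∈ Set.Ioo (0 : ℝ) 1, ∫⁻ t in Set.Ioo (-Real.pi) Real.pi,
      ENNReal.ofReal r * (‖f (r * Complex.exp (t * Complex.I))‖ₑ ^ 2 *
        ω ‖(r : ℂ) * Complex.exp (t * Complex.I)‖) =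
      ∑' n, ‖f.coeff n‖ₑ ^ 2 * (ENNReal.ofReal (2 * Real.pi) *
        (ENNReal.ofReal (r * r ^ (2 * n)) * ω r)) := by
    intro r hr
    have hs : Summable fun n => ‖(r : ℂ) ^ n • f.coeff n‖ := by
      simpa [norm_smul, abs_of_pos hr.1] using f.summable_pow_mul_coeff hr.1.le hr.2
    have key := lintegral_enorm_sq_trigSeries hs (q := fun n : ℕ => (n : ℤ)) Nat.cast_injective
    simp only [norm_mul_exp_I hr.1.le, f.apply_polar hr]
    rw [lintegral_const_mul' _ _ ENNReal.ofReal_ne_top]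
    rw [lintegral_mul_const, key, ← ENNReal.tsum_mul_left, ← ENNReal.tsum_mul_right,
      ← ENNReal.tsum_mul_left]
    · refine tsum_congr fun n => ?_
      have : ‖(r : ℂ) ^ n • f.coeff n‖ₑ ^ 2 = ENNReal.ofReal (r ^ (2 * n)) * ‖f.coeff n‖ₑ ^ 2 := by
        rw [enorm_smul, mul_pow, ← ofReal_norm, norm_pow, Complex.norm_real,
          Real.norm_of_nonneg hr.1.le, ← ENNReal.ofReal_pow (pow_nonneg hr.1.le _), ← pow_mul,
          mul_comm n 2]
      rw [this, ENNReal.ofReal_mul hr.1.le]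
      ring
    · exact ((continuous_trigSeries hs _).enorm.measurable).pow_const 2
  rw [setLIntegral_congr_fun measurableSet_Ioo e, lintegral_tsum]
  · refine tsum_congr fun n => ?_
    rw [lintegral_const_mul, lintegral_const_mul]
    · exact Measurable.mul (by fun_prop) hω
    · exact (Measurable.mul (by fun_prop) hω).const_mul _
  · exact fun n => (((Measurable.mul (by fun_prop) hω).const_mul _).const_mul _).aemeasurable

theorem lintegral_enorm_sq_mul_logWeight (f : Hol Y) {s : ℝ} (hs : 0 < s) :
    ∫⁻ z in ball (0 : ℂ) 1, ‖f z‖ₑ ^ 2 * ENNReal.ofReal (logWeight ‖z‖ ^ (s - 1)) =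
      ∑' n, ‖f.coeff n‖ₑ ^ 2 *
        ENNReal.ofReal (Real.pi * Real.Gamma s * (1 + n : ℝ) ^ (-s)) := by
  have hm := measurable_logWeight
  rw [f.lintegral_enorm_sq_mul (ω := fun r => ENNReal.ofReal (logWeight r ^ (s - 1)))
    (by fun_prop)]
  refine tsum_congr fun n => ?_
  congr 1
  have e : ∀ r ∈ Set.Ioo (0 : ℝ) 1, ENNReal.ofReal (r * r ^ (2 * n)) *
      ENNReal.ofReal (logWeight r ^ (s - 1)) =
      ENNReal.ofReal (r * (r ^ (2 * n) * logWeight r ^ (s - 1))) := by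
    intro r hr
    have := hr.1.le
    rw [← ENNReal.ofReal_mul (by positivity), mul_assoc]
  rw [setLIntegral_congr_fun measurableSet_Ioo e, lintegral_pow_mul_logWeight _ hs,
    ← ENNReal.ofReal_mul (by positivity)]
  congr 1
  push_cast
  rw [show (2 * n / 2 : ℝ) = n by ring]
  ring

/-- The weighted Bergman norm of `D^b f` is a multiple of the Hardy norm of `f`. -/
theorem lintegral_Dpow_logWeight (f : Hol Y) {b : ℝ} (hb : 0 < b) :
    ∫⁻ z in ball (0 : ℂ) 1, ‖Dpow b f z‖ₑ ^ 2 * ENNReal.ofReal (logWeight ‖z‖ ^ (2 * b - 1)) =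
      ENNReal.ofReal (Real.pi * Real.Gamma (2 * b)) * f.h2Norm ^ 2 := by
  have hG := Real.Gamma_pos_of_pos (show 0 < 2 * b by positivity)
  rw [lintegral_enorm_sq_mul_logWeight _ (by positivity : 0 < 2 * b), h2Norm_sq,
    ← ENNReal.tsum_mul_left]
  refine tsum_congr fun n => ?_
  rw [coeff_Dpow, enorm_smul, mul_pow, ← ofReal_norm, Complex.norm_real,
    Real.norm_of_nonneg (by positivity), ← ENNReal.ofReal_pow (by positivity),
    mul_right_comm, ← ENNReal.ofReal_mul (by positivity)]
  congr 2
  rw [Real.rpow_neg (by positivity), two_mul b, Real.rpow_add (by positivity)]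
  field_simp

end Hol

/-- On each circle only the terms of frequency zero survive; their radial moments are then
integrated term by term. Absolute convergence is assumed inside the disc for all terms (`hc`), and
after radial integration only for the surviving ones (`hdiag`); `hint` justifies Fubini. -/
theorem integral_ball_trigSeries {V ι : Type*} [NormedAddCommGroup V] [NormedSpace ℂ V]
    [CompleteSpace V] [Countable ι] {Φ : ℂ → V} {c : ι → V} {d : ι → ℕ} {q : ι → ℤ} {s : ℝ}
    (hs : 0 < s) (hΦ : ContinuousOn Φ (ball 0 1))
    (hc : ∀ r ∈ Set.Ioo (0 : ℝ) 1, Summable fun i => r ^ d i * ‖c i‖)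
    (hΦc : ∀ r ∈ Set.Ioo (0 : ℝ) 1, ∀ t : ℝ, Φ (r * Complex.exp (t * Complex.I)) =
      ∑' i, Complex.exp (q i * (t * Complex.I)) • ((r : ℂ) ^ d i • c i))
    (hint : ∫⁻ z in ball (0 : ℂ) 1, ‖Φ z‖ₑ * ENNReal.ofReal (logWeight ‖z‖ ^ (s - 1)) < ∞)
    (hdiag : Summable fun i => if q i = 0 then (1 + (d i : ℝ) / 2) ^ (-s) * ‖c i‖ else 0) :
    ∫ z in ball (0 : ℂ) 1, logWeight ‖z‖ ^ (s - 1) • Φ z =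
      ∑' i, if q i = 0 then (Real.pi * Real.Gamma s * (1 + (d i : ℝ) / 2) ^ (-s)) • c i else 0 := by
  classical
  have hml := measurable_logWeight
  set S := Set.Ioo (0 : ℝ) 1 ×ˢ Set.Ioo (-Real.pi) Real.pi with hS
  have hSm : MeasurableSet S := measurableSet_Ioo.prod measurableSet_Ioo
  let F : ℝ × ℝ → V := fun p => p.1 • (logWeight p.1 ^ (s - 1) •
    Φ (p.1 * Complex.exp (p.2 * Complex.I)))
  have hFint : IntegrableOn F S (volume.prod volume) := by
    refine ⟨?_, ?_⟩
    · have h1 : AEStronglyMeasurable (fun p : ℝ × ℝ => Φ (p.1 * Complex.exp (p.2 * Complex.I)))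
          ((volume.prod volume).restrict S) := by
        refine ContinuousOn.aestronglyMeasurable (hΦ.comp (by fun_prop) fun p hp => ?_) hSm
        exact mul_exp_I_mem_ball hp.1 _
      have h2 : Measurable fun p : ℝ × ℝ => logWeight p.1 ^ (s - 1) := by fun_prop
      exact AEStronglyMeasurable.smul (f := fun p : ℝ × ℝ => p.1) (by fun_prop)
        (AEStronglyMeasurable.smul (f := fun p : ℝ × ℝ => logWeight p.1 ^ (s - 1))
          h2.aestronglyMeasurable h1)
    · rw [HasFiniteIntegral, ← Measure.volume_eq_prod]
      rw [lintegral_ball_polar_prod] at hint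
      refine lt_of_eq_of_lt (setLIntegral_congr_fun hSm fun p hp => ?_) hint
      have := logWeight_nonneg hp.1.1.le hp.1.2.le
      simp only [F]
      rw [enorm_smul, enorm_smul, norm_mul_exp_I hp.1.1.le, Real.enorm_of_nonneg hp.1.1.le,
        Real.enorm_of_nonneg (by positivity)]
      ring
  have h1 : ∫ z in ball (0 : ℂ) 1, logWeight ‖z‖ ^ (s - 1) • Φ z = ∫ p in S, F p := by
    rw [← integral_indicator measurableSet_ball, ← Complex.integral_comp_polarCoord_symm,
      polarCoord_target, ← integral_indicator (measurableSet_Ioi.prod measurableSet_Ioo),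
      ← integral_indicator hSm]
    refine integral_congr_ae (Eventually.of_forall fun p => ?_)
    have e : Complex.polarCoord.symm p = p.1 * Complex.exp (p.2 * Complex.I) := by
      rw [Complex.polarCoord_symm_apply, Complex.exp_mul_I, Complex.ofReal_cos, Complex.ofReal_sin]
    have hn : ‖(p.1 : ℂ) * Complex.exp (p.2 * Complex.I)‖ = |p.1| := by
      rw [norm_mul, Complex.norm_exp_ofReal_mul_I, mul_one, Complex.norm_real, Real.norm_eq_abs]
    simp only [F]
    rw [Set.indicator_apply, Set.indicator_apply, e]
    by_cases h0 : 0 < p.1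
    · by_cases h1 : p.1 < 1
      · simp [hS, Set.mem_prod, h0, h1, Set.indicator_apply, abs_of_pos h0]
      · simp [hS, Set.mem_prod, h0, h1, abs_of_pos h0]
    · simp [hS, Set.mem_prod, h0]
  have h2 : ∀ r ∈ Set.Ioo (0 : ℝ) 1, ∫ t in Set.Ioo (-Real.pi) Real.pi, F (r, t) =
      ∑' i, if q i = 0 then (2 * Real.pi * (r * (r ^ d i * logWeight r ^ (s - 1)))) • c i
        else 0 := by
    intro r hr
    simp only [F]
    rw [integral_smul, integral_smul]
    simp only [hΦc r hr]
    rw [integral_trigSeries]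
    · rw [← tsum_const_smul'', ← tsum_const_smul'', ← tsum_const_smul'']
      refine tsum_congr fun i => ?_
      split_ifs
      · simp only [← Complex.coe_smul, smul_smul]
        congr 1
        push_cast
        ring
      · simp
    · simpa [norm_smul, abs_of_pos hr.1] using hc r hr
  rw [h1, Measure.volume_eq_prod, hS, setIntegral_prod _ hFint, setIntegral_congr_fun measurableSet_Ioo h2,
    ← integral_tsum_of_summable_integral_norm]
  · refine tsum_congr fun i => ?_
    split_ifs
    · rw [integral_smul_const, integral_const_mul, integral_pow_mul_logWeight _ hs]
      congr 1
      ring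
    · simp
  · intro i
    split_ifs
    · exact ((integrableOn_pow_mul_logWeight (d i) hs).const_mul _).smul_const _
    · exact integrable_zero _ _ _
  · refine (hdiag.mul_left (Real.pi * Real.Gamma s)).congr fun i => ?_
    split_ifs
    · have e : ∀ r ∈ Set.Ioo (0 : ℝ) 1,
          ‖(2 * Real.pi * (r * (r ^ d i * logWeight r ^ (s - 1)))) • c i‖ =
          2 * Real.pi * ‖c i‖ * (r * (r ^ d i * logWeight r ^ (s - 1))) := by
        intro r hr
        have := logWeight_nonneg hr.1.le hr.2.le
        have := hr.1.le
        rw [norm_smul, Real.norm_of_nonneg (by positivity)]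
        ring
      rw [setIntegral_congr_fun measurableSet_Ioo e, integral_const_mul,
        integral_pow_mul_logWeight _ hs]
      ring
    · simp

end VecBMOA
end

noncomputable section
namespace VecBMOA

/-! ### Elementary estimates -/

theorem one_sub_sq_le_logWeight {r : ℝ} (h0 : 0 < r) : 1 - r ^ 2 ≤ logWeight r := by
  have := Real.log_le_sub_one_of_pos (show 0 < r ^ 2 by positivity)
  rw [Real.log_pow] at this
  push_cast at this
  rw [logWeight]
  linarith

/-- With L = log(1/r²) one has 1/r² = e^L ≥ 1 + L. The factor 1 + L is unavoidable: L is comparable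
to 1 - r² near the circle but unbounded at the origin. -/
theorem logWeight_le {r : ℝ} (h0 : 0 < r) (h1 : r < 1) :
    logWeight r ≤ (1 - r ^ 2) * (1 + logWeight r) := by
  have hL := logWeight_nonneg h0.le h1.le
  have h := Real.add_one_le_exp (logWeight r)
  have e : Real.exp (logWeight r) = (r ^ 2)⁻¹ := by
    rw [logWeight, show -2 * Real.log r = -((2 : ℕ) * Real.log r) by push_cast; ring,
      ← Real.log_pow, Real.exp_neg, Real.exp_log (by positivity)]
  rw [e, le_inv_comm₀ (by positivity) (by positivity)] at h
  have : (logWeight r + 1) * r ^ 2 ≤ 1 := by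
    calc _ ≤ (logWeight r + 1) * (logWeight r + 1)⁻¹ := by gcongr
      _ = 1 := mul_inv_cancel₀ (by positivity)
  nlinarith

/-- The inequality log x ≤ x - 1 is applied to x = r^(-1/q). This exponent makes the q-th power
contribute exactly r⁻¹, a singularity that the factor r of polar coordinates cancels. -/
theorem logWeight_rpow_le {q : ℝ} (hq : 1 ≤ q) {r : ℝ} (h0 : 0 < r) (h1 : r < 1) :
    logWeight r ^ q ≤ (2 * q) ^ q * ((1 - r) ^ q * r⁻¹) := by
  have hq0 : 0 < q := by linarith
  have h2 := Real.log_le_sub_one_of_pos (show 0 < r ^ (-q⁻¹) by positivity)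
  rw [Real.log_rpow h0] at h2
  have h3 : r ^ (-q⁻¹) * r ^ (q⁻¹) = 1 := by rw [← Real.rpow_add h0]; simp
  have h4 : r ≤ r ^ q⁻¹ := by
    calc r = r ^ (1 : ℝ) := (Real.rpow_one r).symm
      _ ≤ _ := Real.rpow_le_rpow_of_exponent_ge h0 h1.le (inv_le_one_of_one_le₀ hq)
  have hp : 0 < r ^ (-q⁻¹) := by positivity
  have h5 : logWeight r ≤ 2 * q * ((1 - r) * r ^ (-q⁻¹)) := by
    have h6 : -Real.log r ≤ q * (r ^ (-q⁻¹) - 1) := by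
      calc -Real.log r = q * (-q⁻¹ * Real.log r) := by field_simp
        _ ≤ _ := by gcongr
    have h7 : r ^ (-q⁻¹) - 1 ≤ (1 - r) * r ^ (-q⁻¹) := by nlinarith
    rw [logWeight]
    nlinarith
  calc logWeight r ^ q ≤ (2 * q * ((1 - r) * r ^ (-q⁻¹))) ^ q :=
        Real.rpow_le_rpow (logWeight_nonneg h0.le h1.le) h5 hq0.le
    _ = _ := by
        rw [Real.mul_rpow (by positivity) (mul_nonneg (by linarith) hp.le),
          Real.mul_rpow (by linarith) hp.le, ← Real.rpow_mul h0.le,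
          show -q⁻¹ * q = -1 by field_simp, Real.rpow_neg_one]

theorem rpow_le_mul_exp {p x : ℝ} (hp : 0 ≤ p) (hx : 0 ≤ x) : x ^ p ≤ p ^ p * Real.exp x := by
  rcases hp.eq_or_lt with rfl | hp
  · simpa using hx
  · have h : x / p ≤ Real.exp (x / p) := by linarith [Real.add_one_le_exp (x / p)]
    have h2 := Real.rpow_le_rpow (by positivity) h hp.le
    rw [Real.div_rpow hx hp.le, ← Real.exp_mul, div_mul_cancel₀ _ hp.ne',
      div_le_iff₀ (by positivity)] at h2
    linarith

/-- Write t^n = s^n · s^n with s = √t. One factor absorbs the polynomial weight, since x^p ≤ p^p e^x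
at x = (1-s)(1+n); the other leaves a geometric series. Finally 1 - s ≥ (1-t)/2. -/
theorem tsum_rpow_mul_geometric_le {p : ℝ} (hp : 0 ≤ p) {t : ℝ} (h0 : 0 ≤ t) (h1 : t < 1) :
    ∑' n : ℕ, (1 + n : ℝ) ^ p * t ^ n ≤
      p ^ p * Real.exp 1 * 2 ^ (p + 1) * (1 - t) ^ (-(p + 1)) := by
  set s := √t with hs
  have hs0 : 0 ≤ s := Real.sqrt_nonneg t
  have hst : s * s = t := Real.mul_self_sqrt h0
  have hs1 : s < 1 := by nlinarith
  have hδ : 0 < 1 - s := by linarith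
  have hterm : ∀ n : ℕ, (1 + n : ℝ) ^ p * t ^ n ≤
      p ^ p * Real.exp 1 * (1 - s) ^ (-p) * s ^ n := by
    intro n
    have h2 : s ^ n ≤ Real.exp (-((1 - s) * n)) := by
      have : s ≤ Real.exp (-(1 - s)) := by linarith [Real.add_one_le_exp (-(1 - s))]
      calc s ^ n ≤ Real.exp (-(1 - s)) ^ n := by gcongr
        _ = _ := by rw [← Real.exp_nat_mul]; congr 1; ring
    have h3 : (1 + n : ℝ) ^ p ≤ (1 - s) ^ (-p) * (p ^ p * Real.exp ((1 - s) * (1 + n))) := by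
      have := rpow_le_mul_exp hp (show 0 ≤ (1 - s) * (1 + n) by positivity)
      rw [Real.mul_rpow hδ.le (by positivity)] at this
      rw [Real.rpow_neg hδ.le, inv_mul_eq_div, le_div_iff₀ (by positivity), mul_comm]
      exact this
    have h4 : Real.exp ((1 - s) * (1 + n)) * Real.exp (-((1 - s) * n)) ≤ Real.exp 1 := by
      rw [← Real.exp_add]
      apply Real.exp_le_exp.mpr
      linarith
    calc (1 + n : ℝ) ^ p * t ^ n = ((1 + n : ℝ) ^ p * s ^ n) * s ^ n := by
          rw [← hst, mul_pow]; ring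
      _ ≤ ((1 - s) ^ (-p) * (p ^ p * Real.exp ((1 - s) * (1 + n))) *
            Real.exp (-((1 - s) * n))) * s ^ n := by gcongr
      _ = ((1 - s) ^ (-p) * p ^ p * (Real.exp ((1 - s) * (1 + n)) *
            Real.exp (-((1 - s) * n)))) * s ^ n := by ring
      _ ≤ ((1 - s) ^ (-p) * p ^ p * Real.exp 1) * s ^ n := by gcongr
      _ = _ := by ring
  have hle := (Hol.summable_weight_geom p h0 h1).tsum_le_tsum hterm
    ((summable_geometric_of_lt_one hs0 hs1).mul_left _)
  rw [tsum_mul_left, tsum_geometric_of_lt_one hs0 hs1] at hle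
  refine hle.trans ?_
  have h5 : (1 - s) ^ (-p) * (1 - s)⁻¹ = (1 - s) ^ (-(p + 1)) := by
    rw [← Real.rpow_neg_one, ← Real.rpow_add hδ]; congr 1; ring
  have h6 : (1 - s) ^ (-(p + 1)) ≤ 2 ^ (p + 1) * (1 - t) ^ (-(p + 1)) := by
    have h7 : (1 - t) / 2 ≤ 1 - s := by nlinarith
    have h8 : 0 < 1 - t := by linarith
    calc (1 - s) ^ (-(p + 1)) ≤ ((1 - t) / 2) ^ (-(p + 1)) :=
          Real.rpow_le_rpow_of_nonpos (by positivity) h7 (by linarith)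
      _ = _ := by
        rw [Real.div_rpow h8.le zero_le_two, Real.rpow_neg zero_le_two, div_inv_eq_mul, mul_comm]
  calc p ^ p * Real.exp 1 * (1 - s) ^ (-p) * (1 - s)⁻¹
      = p ^ p * Real.exp 1 * ((1 - s) ^ (-p) * (1 - s)⁻¹) := by ring
    _ ≤ p ^ p * Real.exp 1 * (2 ^ (p + 1) * (1 - t) ^ (-(p + 1))) := by
        rw [h5]; gcongr
    _ = _ := by ring

theorem lintegral_one_sub_rpow {a u : ℝ} (ha : -1 < a) (hu : u < 1) :
    ∫⁻ r in Set.Ioo u 1, ENNReal.ofReal ((1 - r) ^ a) =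
      ENNReal.ofReal ((1 - u) ^ (a + 1) / (a + 1)) := by
  have hi : IntervalIntegrable (fun r : ℝ => (1 - r) ^ a) volume u 1 := by
    have := (intervalIntegral.intervalIntegrable_rpow' (a := 1 - u) (b := 0) ha).comp_sub_left 1
    simpa using this
  rw [restrict_Ioo_eq_restrict_Ioc, ← ofReal_integral_eq_lintegral_ofReal,
    ← intervalIntegral.integral_of_le hu.le,
    intervalIntegral.integral_comp_sub_left (fun x => x ^ a) 1, integral_rpow (Or.inl ha)]
  · rw [sub_self, Real.zero_rpow (by linarith), sub_zero]
  · exact (intervalIntegrable_iff_integrableOn_Ioc_of_le hu.le).mp hi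
  · refine (ae_restrict_mem measurableSet_Ioc).mono fun x hx => ?_
    have : 0 ≤ 1 - x := by linarith [hx.2]
    simp only [Pi.zero_apply]
    positivity

theorem lintegral_one_sub_rpow_le {e R : ℝ} (he : 0 < e) (hR0 : 0 ≤ R) (hR : R < 1) :
    ∫⁻ r in Set.Ioc 0 R, ENNReal.ofReal ((1 - r) ^ (-e - 1)) ≤
      ENNReal.ofReal ((1 - R) ^ (-e) / e) := by
  have hmem : (0 : ℝ) ∉ Set.uIcc (1 - 0) (1 - R) := by
    rw [Set.uIcc_of_ge (by linarith)]
    intro h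
    linarith [h.1]
  have hi : IntervalIntegrable (fun r : ℝ => (1 - r) ^ (-e - 1)) volume 0 R := by
    have := (intervalIntegral.intervalIntegrable_rpow (r := -e - 1) (μ := volume)
      (Or.inr hmem)).comp_sub_left 1
    simpa using this
  rw [← ofReal_integral_eq_lintegral_ofReal, ← intervalIntegral.integral_of_le hR0,
    intervalIntegral.integral_comp_sub_left (fun x => x ^ (-e - 1)) 1, integral_rpow]
  · refine ENNReal.ofReal_le_ofReal ?_
    rw [show -e - 1 + 1 = -e by ring, sub_zero, Real.one_rpow, div_neg, ← neg_div]
    gcongr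
    linarith
  · refine Or.inr ⟨by linarith, ?_⟩
    rwa [Set.uIcc_comm]
  · exact (intervalIntegrable_iff_integrableOn_Ioc_of_le hR0).mp hi
  · refine (ae_restrict_mem measurableSet_Ioc).mono fun x hx => ?_
    have : 0 ≤ 1 - x := by linarith [hx.2]
    simp only [Pi.zero_apply]
    positivity

/-- The integral is split at r = R: below R use 1 - Rr ≥ 1 - r, above R use 1 - Rr ≥ 1 - R. The
conditions s > a + 2 and a > -1 make the respective pieces of the right size. -/
theorem lintegral_radial_kernel_le {a s R : ℝ} (ha : -1 < a) (hs : a + 2 < s)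
    (hR0 : 0 ≤ R) (hR : R < 1) :
    ∫⁻ r in Set.Ioo (0 : ℝ) 1, ENNReal.ofReal ((1 - r) ^ a * (1 - R * r) ^ (1 - s)) ≤
      ENNReal.ofReal (((s - a - 2)⁻¹ + (a + 1)⁻¹) * (1 - R) ^ (a + 2 - s)) := by
  have hsub : Set.Ioo (0 : ℝ) 1 ⊆ Set.Ioc 0 R ∪ Set.Ioo R 1 := fun x hx => by
    rcases le_or_gt x R with h | h
    · exact Or.inl ⟨hx.1, h⟩
    · exact Or.inr ⟨h, hx.2⟩
  refine (lintegral_mono_set hsub).trans ((lintegral_union_le _ _ _).trans ?_)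
  have hR' : 0 < 1 - R := by linarith
  have hsa : 0 < s - a - 2 := by linarith
  have ha1 : 0 < a + 1 := by linarith
  rw [add_mul, ENNReal.ofReal_add (by positivity) (by positivity)]
  refine add_le_add ?_ ?_
  · calc _ ≤ ∫⁻ r in Set.Ioc 0 R, ENNReal.ofReal ((1 - r) ^ (-(s - a - 2) - 1)) := by
          refine setLIntegral_mono' measurableSet_Ioc fun r hr => ENNReal.ofReal_le_ofReal ?_
          have h1r : 0 < 1 - r := by linarith [hr.2]
          have : (1 - R * r) ^ (1 - s) ≤ (1 - r) ^ (1 - s) :=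
            Real.rpow_le_rpow_of_nonpos h1r (by nlinarith [hr.1]) (by linarith)
          calc _ ≤ (1 - r) ^ a * (1 - r) ^ (1 - s) := by gcongr
            _ = _ := by rw [← Real.rpow_add h1r]; congr 1; ring
      _ ≤ _ := lintegral_one_sub_rpow_le hsa hR0 hR
      _ = _ := by
        rw [show -(s - a - 2) = a + 2 - s by ring, div_eq_inv_mul]
  · calc _ ≤ ∫⁻ r in Set.Ioo R 1, ENNReal.ofReal ((1 - R) ^ (1 - s)) *
            ENNReal.ofReal ((1 - r) ^ a) := by
          refine setLIntegral_mono' measurableSet_Ioo fun r hr => ?_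
          have h1r : 0 < 1 - r := by linarith [hr.2]
          rw [← ENNReal.ofReal_mul (by positivity)]
          refine ENNReal.ofReal_le_ofReal ?_
          have : (1 - R * r) ^ (1 - s) ≤ (1 - R) ^ (1 - s) :=
            Real.rpow_le_rpow_of_nonpos hR' (by nlinarith [hr.1]) (by linarith)
          rw [mul_comm]
          gcongr
      _ = _ := by
          rw [lintegral_const_mul' _ _ ENNReal.ofReal_ne_top, lintegral_one_sub_rpow ha hR,
            ← ENNReal.ofReal_mul (by positivity)]
          congr 1
          rw [show a + 2 - s = (1 - s) + (a + 1) by ring, Real.rpow_add hR' (1 - s) (a + 1)]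
          field_simp

/-- Split at distance δ = 1/(1+m) from the endpoint. Inside, (1-r)^(τ-1) ≤ δ^(τ-1) because τ ≤ 1,
and r^m integrates to at most δ; outside, r^m ≤ 1. Both parts have size δ^τ. -/
theorem lintegral_beta_le {τ : ℝ} (h0 : 0 < τ) (h1 : τ ≤ 1) (m : ℕ) :
    ∫⁻ r in Set.Ioo (0 : ℝ) 1, ENNReal.ofReal (r ^ m * (1 - r) ^ (τ - 1)) ≤
      ENNReal.ofReal ((1 + τ⁻¹) * (1 + m : ℝ) ^ (-τ)) := by
  set δ : ℝ := (1 + m : ℝ)⁻¹ with hδ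
  have hδ0 : 0 < δ := by positivity
  have hδ1 : δ ≤ 1 := inv_le_one_of_one_le₀ (by linarith [Nat.cast_nonneg (α := ℝ) m])
  have hsub : Set.Ioo (0 : ℝ) 1 ⊆ Set.Ioc 0 (1 - δ) ∪ Set.Ioo (1 - δ) 1 := fun x hx => by
    rcases le_or_gt x (1 - δ) with h | h
    · exact Or.inl ⟨hx.1, h⟩
    · exact Or.inr ⟨h, hx.2⟩
  refine (lintegral_mono_set hsub).trans ((lintegral_union_le _ _ _).trans ?_)
  have e1 : (1 + m : ℝ) ^ (-τ) = δ ^ τ := by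
    rw [hδ, Real.inv_rpow (by positivity), Real.rpow_neg (by positivity)]
  rw [e1, add_mul, ENNReal.ofReal_add (by positivity) (by positivity)]
  refine add_le_add ?_ ?_
  · have hpow : ∫⁻ r in Set.Ioc (0 : ℝ) 1, ENNReal.ofReal (r ^ m) = ENNReal.ofReal δ := by
      rw [← ofReal_integral_eq_lintegral_ofReal, ← intervalIntegral.integral_of_le zero_le_one,
        integral_pow]
      · congr 1
        rw [hδ, one_pow, zero_pow (by omega)]
        simp [add_comm]
      · exact (Continuous.integrableOn_Icc (by fun_prop)).mono_set Set.Ioc_subset_Icc_self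
      · refine (ae_restrict_mem measurableSet_Ioc).mono fun x hx => ?_
        exact pow_nonneg hx.1.le _
    calc _ ≤ ∫⁻ r in Set.Ioc 0 (1 - δ), ENNReal.ofReal (δ ^ (τ - 1)) *
            ENNReal.ofReal (r ^ m) := by
          refine setLIntegral_mono' measurableSet_Ioc fun r hr => ?_
          rw [← ENNReal.ofReal_mul (by positivity)]
          refine ENNReal.ofReal_le_ofReal ?_
          have : (1 - r) ^ (τ - 1) ≤ δ ^ (τ - 1) :=
            Real.rpow_le_rpow_of_nonpos hδ0 (by linarith [hr.2]) (by linarith)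
          have := pow_nonneg hr.1.le m
          rw [mul_comm]
          gcongr
      _ ≤ ∫⁻ r in Set.Ioc 0 1, ENNReal.ofReal (δ ^ (τ - 1)) * ENNReal.ofReal (r ^ m) :=
          lintegral_mono_set (Set.Ioc_subset_Ioc_right (by linarith))
      _ = _ := by
          rw [lintegral_const_mul' _ _ ENNReal.ofReal_ne_top, hpow,
            ← ENNReal.ofReal_mul (by positivity), one_mul]
          congr 1
          rw [Real.rpow_sub_one hδ0.ne']
          field_simp
  · calc _ ≤ ∫⁻ r in Set.Ioo (1 - δ) 1, ENNReal.ofReal ((1 - r) ^ (τ - 1)) := by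
          refine setLIntegral_mono' measurableSet_Ioo fun r hr => ENNReal.ofReal_le_ofReal ?_
          have hr0 : 0 ≤ r := by linarith [hr.1]
          have h1r : 0 ≤ 1 - r := by linarith [hr.2]
          have := pow_le_one₀ (n := m) hr0 hr.2.le
          calc _ ≤ 1 * (1 - r) ^ (τ - 1) := by gcongr
            _ = _ := one_mul _
      _ = _ := by
          rw [lintegral_one_sub_rpow (by linarith) (by linarith)]
          congr 1
          rw [show 1 - (1 - δ) = δ by ring, show τ - 1 + 1 = τ by ring, div_eq_inv_mul]

/-- Parseval for the geometric series of (1 - a e^(-it))⁻¹. -/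
theorem lintegral_norm_one_sub_sq {a : ℂ} (ha : ‖a‖ < 1) :
    ∫⁻ t in Set.Ioo (-Real.pi) Real.pi,
      ENNReal.ofReal (‖1 - a * Complex.exp (-(t * Complex.I))‖ ^ (-2 : ℝ)) ≤
      ENNReal.ofReal (2 * Real.pi * (1 - ‖a‖)⁻¹) := by
  have hc : Summable fun n : ℕ => ‖a ^ n‖ := by
    simpa using summable_geometric_of_lt_one (norm_nonneg a) ha
  have key := lintegral_enorm_sq_trigSeries hc (q := fun n : ℕ => -(n : ℤ))
    (fun m n h => by simpa using h)
  have e : ∀ t : ℝ, ∑' n : ℕ, Complex.exp (((-(n : ℤ) : ℤ) : ℂ) * (t * Complex.I)) • a ^ n =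
      (1 - a * Complex.exp (-(t * Complex.I)))⁻¹ := by
    intro t
    have hn : ‖a * Complex.exp (-(t * Complex.I))‖ < 1 := by
      rw [norm_mul, show -(t * Complex.I) = ((-t : ℝ) : ℂ) * Complex.I by push_cast; ring,
        Complex.norm_exp_ofReal_mul_I, mul_one]
      exact ha
    rw [← tsum_geometric_of_norm_lt_one hn]
    refine tsum_congr fun n => ?_
    rw [mul_pow, ← Complex.exp_nat_mul, smul_eq_mul, mul_comm]
    congr 2
    push_cast
    ring
  have e2 : ∀ t : ℝ, ENNReal.ofReal (‖1 - a * Complex.exp (-(t * Complex.I))‖ ^ (-2 : ℝ)) =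
      ‖(1 - a * Complex.exp (-(t * Complex.I)))⁻¹‖ₑ ^ 2 := by
    intro t
    rw [← ofReal_norm, ← ENNReal.ofReal_pow (norm_nonneg _), norm_inv,
      Real.rpow_neg (norm_nonneg _), inv_pow]
    norm_cast
  simp only [e] at key
  simp only [e2]
  rw [key, tsum_enorm_sq (summable_norm_sq hc), ← ENNReal.ofReal_mul (by positivity)]
  refine ENNReal.ofReal_le_ofReal ?_
  gcongr
  rw [← tsum_geometric_of_lt_one (norm_nonneg a) ha]
  refine (summable_norm_sq hc).tsum_le_tsum (fun n => ?_)
    (summable_geometric_of_lt_one (norm_nonneg a) ha)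
  rw [norm_pow, ← pow_mul]
  exact pow_le_pow_of_le_one (norm_nonneg a) ha.le (by omega)

theorem one_sub_norm_le {a b : ℂ} (hb : ‖b‖ ≤ 1) : 1 - ‖a‖ ≤ ‖1 - a * b‖ := by
  have h := norm_sub_norm_le 1 (a * b)
  rw [norm_one, norm_mul] at h
  nlinarith [norm_nonneg a]

theorem norm_exp_neg_mul_I (t : ℝ) : ‖Complex.exp (-(t * Complex.I))‖ = 1 := by
  rw [show -(t * Complex.I) = ((-t : ℝ) : ℂ) * Complex.I by push_cast; ring,
    Complex.norm_exp_ofReal_mul_I]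

/-- The excess power s - 2 is estimated pointwise by |1 - a e^(-it)| ≥ 1 - |a|, leaving the exponent
2, which Parseval handles. -/
theorem lintegral_norm_one_sub_rpow {a : ℂ} (ha : ‖a‖ < 1) {s : ℝ} (hs : 2 ≤ s) :
    ∫⁻ t in Set.Ioo (-Real.pi) Real.pi,
      ENNReal.ofReal (‖1 - a * Complex.exp (-(t * Complex.I))‖ ^ (-s)) ≤
      ENNReal.ofReal (2 * Real.pi * (1 - ‖a‖) ^ (1 - s)) := by
  have ha' : 0 < 1 - ‖a‖ := by linarith
  calc _ ≤ ∫⁻ t in Set.Ioo (-Real.pi) Real.pi, ENNReal.ofReal ((1 - ‖a‖) ^ (2 - s)) *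
        ENNReal.ofReal (‖1 - a * Complex.exp (-(t * Complex.I))‖ ^ (-2 : ℝ)) := by
        refine lintegral_mono fun t => ?_
        rw [← ENNReal.ofReal_mul (by positivity)]
        refine ENNReal.ofReal_le_ofReal ?_
        have h1 := one_sub_norm_le (a := a) (norm_exp_neg_mul_I t).le
        have h2 : ‖1 - a * Complex.exp (-(t * Complex.I))‖ ^ (2 - s) ≤ (1 - ‖a‖) ^ (2 - s) :=
          Real.rpow_le_rpow_of_nonpos ha' h1 (by linarith)
        calc ‖1 - a * Complex.exp (-(t * Complex.I))‖ ^ (-s)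
            = ‖1 - a * Complex.exp (-(t * Complex.I))‖ ^ (2 - s) *
              ‖1 - a * Complex.exp (-(t * Complex.I))‖ ^ (-2 : ℝ) := by
              rw [← Real.rpow_add (by linarith)]; congr 1; ring
          _ ≤ _ := by gcongr
    _ ≤ ENNReal.ofReal ((1 - ‖a‖) ^ (2 - s)) * ENNReal.ofReal (2 * Real.pi * (1 - ‖a‖)⁻¹) := by
        rw [lintegral_const_mul' _ _ ENNReal.ofReal_ne_top]
        gcongr
        exact lintegral_norm_one_sub_sq ha
    _ = _ := by
        rw [← ENNReal.ofReal_mul (by positivity)]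
        congr 1
        rw [show 1 - s = (2 - s) + (-1) by ring, Real.rpow_add ha', Real.rpow_neg_one]
        ring

/-- The weights `(1 - |w|)^a / |w|`. -/
def singWeight (a : ℝ) (w : ℂ) : ℝ≥0∞ := ENNReal.ofReal ((1 - ‖w‖) ^ a * ‖w‖⁻¹)

/-- This is the Forelli–Rudin estimate. The factor 1/|w| in `singWeight` cancels the Jacobian of
polar coordinates, after which the angular and the radial estimates are composed. -/
theorem lintegral_kernel_le {a s : ℝ} (ha : -1 < a) (hs : a + 2 < s) (hs2 : 2 ≤ s) {z : ℂ}
    (hz : ‖z‖ < 1) :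
    ∫⁻ w in ball (0 : ℂ) 1, ENNReal.ofReal (‖1 - z * conj w‖ ^ (-s)) * singWeight a w ≤
      ENNReal.ofReal (2 * Real.pi * ((s - a - 2)⁻¹ + (a + 1)⁻¹) * (1 - ‖z‖) ^ (a + 2 - s)) := by
  rw [lintegral_ball_polar]
  swap
  · refine Measurable.indicator ?_ measurableSet_ball
    unfold singWeight
    fun_prop
  have e : ∀ r ∈ Set.Ioo (0 : ℝ) 1, ∫⁻ t in Set.Ioo (-Real.pi) Real.pi, ENNReal.ofReal r *
      (ENNReal.ofReal (‖1 - z * conj ((r : ℂ) * Complex.exp (t * Complex.I))‖ ^ (-s)) *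
        singWeight a ((r : ℂ) * Complex.exp (t * Complex.I))) ≤
      ENNReal.ofReal (2 * Real.pi) *
        ENNReal.ofReal ((1 - r) ^ a * (1 - ‖z‖ * r) ^ (1 - s)) := by
    intro r hr
    have h1r : 0 < 1 - r := by linarith [hr.2]
    have hr0 := hr.1
    have hzr : ‖z * r‖ = ‖z‖ * r := by
      rw [norm_mul, Complex.norm_real, Real.norm_of_nonneg hr.1.le]
    have hzr1 : ‖z‖ * r < 1 := by nlinarith [norm_nonneg z, hr.1, hr.2]
    have hzr2 : 0 < 1 - ‖z‖ * r := by linarith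
    calc _ = ∫⁻ t in Set.Ioo (-Real.pi) Real.pi, ENNReal.ofReal ((1 - r) ^ a) *
          ENNReal.ofReal (‖1 - (z * r) * Complex.exp (-(t * Complex.I))‖ ^ (-s)) := by
          refine lintegral_congr fun t => ?_
          rw [singWeight, norm_mul_exp_I hr.1.le, ← ENNReal.ofReal_mul (by positivity),
            ← ENNReal.ofReal_mul (by positivity), ← ENNReal.ofReal_mul (by positivity)]
          congr 1
          have : conj ((r : ℂ) * Complex.exp (t * Complex.I)) =
              r * Complex.exp (-(t * Complex.I)) := by
            rw [map_mul, Complex.conj_ofReal, ← Complex.exp_conj]; simp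
          rw [this, ← mul_assoc]
          field_simp
      _ ≤ ENNReal.ofReal ((1 - r) ^ a) * ENNReal.ofReal (2 * Real.pi * (1 - ‖z * r‖) ^ (1 - s)) := by
          rw [lintegral_const_mul' _ _ ENNReal.ofReal_ne_top]
          gcongr
          exact lintegral_norm_one_sub_rpow (by rw [hzr]; exact hzr1) hs2
      _ = _ := by
          rw [hzr, ← ENNReal.ofReal_mul (by positivity), ← ENNReal.ofReal_mul (by positivity)]
          congr 1
          ring
  refine (setLIntegral_mono' measurableSet_Ioo e).trans ?_
  rw [lintegral_const_mul' _ _ ENNReal.ofReal_ne_top, mul_assoc (2 * Real.pi),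
    ENNReal.ofReal_mul (p := 2 * Real.pi) (by positivity)]
  gcongr
  exact lintegral_radial_kernel_le ha hs (norm_nonneg z) hz

theorem summable_pow_mul_choose (M i : ℕ) {ζ : ℂ} (hζ : ‖ζ‖ < 1) :
    Summable fun j : ℕ => (1 + j : ℂ) ^ M * ((j + i).choose i : ℂ) * ζ ^ j := by
  induction M generalizing i with
  | zero => simpa using summable_choose_mul_geometric_of_norm_lt_one i hζ
  | succ M ih =>
    refine (((ih (i + 1)).mul_left (i + 1 : ℂ)).sub ((ih i).mul_left (i : ℂ))).congr fun j => ?_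
    have h : ((i + 1 : ℕ) : ℂ) * ((j + (i + 1)).choose (i + 1) : ℂ) =
        (j + i + 1 : ℂ) * ((j + i).choose i : ℂ) := by
      have := Nat.add_one_mul_choose_eq (j + i) i
      rw [mul_comm]
      exact_mod_cast this.symm
    push_cast at h
    linear_combination (1 + j : ℂ) ^ M * ζ ^ j * h

/-- Induction on M through (1+j) C(j+i, i) = (i+1) C(j+i+1, i+1) - i C(j+i, i), which lowers M by
one and raises i by at most one. At M = 0 the sum is (1-ζ)^(-(i+1)). The binomial factor is present
only to make the induction close; the case i = 0 is what is needed. -/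
theorem exists_norm_tsum_pow_mul_choose_le (M i : ℕ) :
    ∃ C : ℝ, 0 ≤ C ∧ ∀ ζ : ℂ, ‖ζ‖ < 1 →
      ‖∑' j : ℕ, (1 + j : ℂ) ^ M * ((j + i).choose i : ℂ) * ζ ^ j‖ ≤
        C * (‖1 - ζ‖⁻¹) ^ (M + i + 1) := by
  induction M generalizing i with
  | zero =>
    refine ⟨1, zero_le_one, fun ζ hζ => ?_⟩
    simp only [pow_zero, one_mul]
    rw [tsum_choose_mul_geometric_of_norm_lt_one i hζ, norm_div, norm_one, norm_pow, one_div,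
      inv_pow]
    simp
  | succ M ih =>
    obtain ⟨C₁, h₁, H₁⟩ := ih (i + 1)
    obtain ⟨C₂, h₂, H₂⟩ := ih i
    refine ⟨(i + 1) * C₁ + i * C₂ * 2, by positivity, fun ζ hζ => ?_⟩
    have e : ∑' j : ℕ, (1 + j : ℂ) ^ (M + 1) * ((j + i).choose i : ℂ) * ζ ^ j =
        (i + 1 : ℂ) * ∑' j : ℕ, (1 + j : ℂ) ^ M * ((j + (i + 1)).choose (i + 1) : ℂ) * ζ ^ j -
        (i : ℂ) * ∑' j : ℕ, (1 + j : ℂ) ^ M * ((j + i).choose i : ℂ) * ζ ^ j := by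
      rw [← tsum_mul_left, ← tsum_mul_left, ← Summable.tsum_sub
        ((summable_pow_mul_choose M (i + 1) hζ).mul_left _)
        ((summable_pow_mul_choose M i hζ).mul_left _)]
      refine tsum_congr fun j => ?_
      have h : ((i + 1 : ℕ) : ℂ) * ((j + (i + 1)).choose (i + 1) : ℂ) =
          (j + i + 1 : ℂ) * ((j + i).choose i : ℂ) := by
        have := Nat.add_one_mul_choose_eq (j + i) i
        rw [mul_comm]
        exact_mod_cast this.symm
      push_cast at h
      linear_combination -(1 + j : ℂ) ^ M * ζ ^ j * h
    have hpos : 0 < ‖1 - ζ‖ := by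
      have := one_sub_norm_le (a := ζ) (b := 1) (by simp)
      rw [mul_one] at this
      linarith
    -- Since |1 - ζ| ≤ 2, the lower-order term may be promoted to the higher power at the cost of a
    -- factor 2.
    have h2 : 1 ≤ 2 * ‖1 - ζ‖⁻¹ := by
      have : ‖1 - ζ‖ ≤ 2 := (norm_sub_le _ _).trans (by rw [norm_one]; linarith)
      rw [← div_eq_mul_inv, le_div_iff₀ hpos]
      linarith
    have hi : ‖((i : ℂ) + 1)‖ = i + 1 := by
      rw [show (i : ℂ) + 1 = ((i + 1 : ℕ) : ℂ) by push_cast; ring, Complex.norm_natCast]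
      push_cast; ring
    rw [e]
    refine (norm_sub_le _ _).trans ?_
    rw [norm_mul, norm_mul, Complex.norm_natCast, hi]
    have h3 := H₁ ζ hζ
    have h4 := H₂ ζ hζ
    calc _ ≤ (i + 1) * (C₁ * (‖1 - ζ‖⁻¹) ^ (M + (i + 1) + 1)) +
          i * (C₂ * (‖1 - ζ‖⁻¹) ^ (M + i + 1)) * 1 := by rw [mul_one]; gcongr
      _ ≤ (i + 1) * (C₁ * (‖1 - ζ‖⁻¹) ^ (M + (i + 1) + 1)) +
          i * (C₂ * (‖1 - ζ‖⁻¹) ^ (M + i + 1)) * (2 * ‖1 - ζ‖⁻¹) := by gcongr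
      _ = _ := by ring

/-- The kernel `∑ (1 + j)^M ζ^j`. -/
def powKernel (M : ℕ) (ζ : ℂ) : ℂ := ∑' j : ℕ, (1 + j : ℂ) ^ M * ζ ^ j

theorem summable_powKernel (M : ℕ) {ζ : ℂ} (hζ : ‖ζ‖ < 1) :
    Summable fun j : ℕ => (1 + j : ℂ) ^ M * ζ ^ j := by
  simpa using summable_pow_mul_choose M 0 hζ

theorem exists_norm_powKernel_le (M : ℕ) :
    ∃ C : ℝ, 0 ≤ C ∧ ∀ ζ : ℂ, ‖ζ‖ < 1 → ‖powKernel M ζ‖ ≤ C * ‖1 - ζ‖ ^ (-(M + 1 : ℝ)) := by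
  obtain ⟨C, h, H⟩ := exists_norm_tsum_pow_mul_choose_le M 0
  refine ⟨C, h, fun ζ hζ => ?_⟩
  have := H ζ hζ
  simp only [add_zero, Nat.choose_zero_right, Nat.cast_one, mul_one] at this
  rw [Real.rpow_neg (norm_nonneg _), ← Real.inv_rpow (norm_nonneg _), powKernel]
  refine this.trans_eq ?_
  norm_cast

end VecBMOA
end

/-! ### From Carleson embeddings to bounded weighted Hankel matrices -/

noncomputable section
namespace VecBMOA

namespace Hol

theorem summable_truncated {Y : Type*} [NormedAddCommGroup Y] (n : ℕ) (f : ℕ → Y) : ∀ r ∈ Set.Ico (0 : ℝ) 1,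
    Summable fun k => r ^ k * ‖(if k < n then f k else 0 : Y)‖ := fun _ _ =>
  summable_of_ne_finset_zero (s := Finset.range n) fun k hk => by
    rw [if_neg (by simpa using hk), norm_zero, mul_zero]

section
variable {Y : Type*} [NormedAddCommGroup Y] [NormedSpace ℂ Y] [CompleteSpace Y]

/-- The polynomial `∑_{k < n} z^k f_k`. -/
def poly (n : ℕ) (f : ℕ → Y) : Hol Y := ofCoeff _ (summable_truncated n f)

@[simp] theorem coeff_poly (n : ℕ) (f : ℕ → Y) (k : ℕ) :
    (poly n f).coeff k = if k < n then f k else 0 := coeff_ofCoeff _ _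

theorem poly_apply (n : ℕ) (f : ℕ → Y) {z : ℂ} (hz : z ∈ ball (0 : ℂ) 1) :
    poly n f z = ∑ k ∈ Finset.range n, z ^ k • f k := by
  rw [poly, ← (ofCoeff_hasSum (summable_truncated n f) hz).tsum_eq, tsum_eq_sum (s := Finset.range n)]
  · exact Finset.sum_congr rfl fun k hk => by rw [if_pos (by simpa using hk)]
  · intro k hk
    rw [if_neg (by simpa using hk), smul_zero]

theorem Dpow_poly (a : ℝ) (n : ℕ) (f : ℕ → Y) :
    Dpow a (poly n f) = poly n fun k => (((1 + k : ℝ) ^ a : ℝ) : ℂ) • f k := by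
  refine ext_coeff fun k => ?_
  rw [coeff_Dpow, coeff_poly, coeff_poly]
  split_ifs <;> simp

theorem h2Norm_poly_sq (n : ℕ) (f : ℕ → Y) :
    (poly n f).h2Norm ^ 2 = ENNReal.ofReal (∑ k ∈ Finset.range n, ‖f k‖ ^ 2) := by
  rw [h2Norm_sq, tsum_eq_sum (s := Finset.range n), ENNReal.ofReal_sum_of_nonneg
    (fun _ _ => by positivity)]
  · refine Finset.sum_congr rfl fun k hk => ?_
    rw [coeff_poly, if_pos (by simpa using hk), ENNReal.ofReal_pow (norm_nonneg _), ofReal_norm]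
  · intro k hk
    rw [coeff_poly, if_neg (by simpa using hk)]
    simp

end

variable {Y : Type*} [NormedAddCommGroup Y] [InnerProductSpace ℂ Y] [CompleteSpace Y]

/-- An additional power p of the weight multiplies the n-th moment by (1+n)^(-p) up to a constant,
so the Hardy norm remains an upper bound. -/
theorem lintegral_Dpow_logWeight_add_le (f : Hol Y) {b p : ℝ} (hb : 0 < b) (hp : 0 ≤ p) :
    ∫⁻ z in ball (0 : ℂ) 1, ‖Dpow b f z‖ₑ ^ 2 *
      ENNReal.ofReal (logWeight ‖z‖ ^ (2 * b + p - 1)) ≤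
      ENNReal.ofReal (Real.pi * Real.Gamma (2 * b + p)) * f.h2Norm ^ 2 := by
  have hG := Real.Gamma_pos_of_pos (show 0 < 2 * b + p by positivity)
  rw [lintegral_enorm_sq_mul_logWeight _ (by positivity : 0 < 2 * b + p), h2Norm_sq,
    ← ENNReal.tsum_mul_left]
  refine ENNReal.tsum_le_tsum fun n => ?_
  rw [coeff_Dpow, enorm_smul, mul_pow, ← ofReal_norm, Complex.norm_real,
    Real.norm_of_nonneg (by positivity), ← ENNReal.ofReal_pow (by positivity),
    mul_right_comm, ← ENNReal.ofReal_mul (by positivity)]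
  gcongr ENNReal.ofReal ?_ * _
  have h1 : (1 : ℝ) ≤ 1 + n := by linarith [Nat.cast_nonneg (α := ℝ) n]
  have h2 : ((1 + n : ℝ) ^ b) ^ 2 * (1 + n : ℝ) ^ (-(2 * b + p)) ≤ 1 := by
    rw [← Real.rpow_natCast, ← Real.rpow_mul (by positivity), ← Real.rpow_add (by positivity)]
    refine Real.rpow_le_one_of_one_le_of_nonpos h1 ?_
    push_cast
    linarith
  calc _ = Real.pi * Real.Gamma (2 * b + p) *
        (((1 + n : ℝ) ^ b) ^ 2 * (1 + n : ℝ) ^ (-(2 * b + p))) := by ring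
    _ ≤ Real.pi * Real.Gamma (2 * b + p) * 1 := by gcongr
    _ = _ := mul_one _

end Hol

variable {H : Type*} [NormedAddCommGroup H] [InnerProductSpace ℂ H] [CompleteSpace H]

theorem enorm_inner_le {Y : Type*} [NormedAddCommGroup Y] [InnerProductSpace ℂ Y] (x y : Y) :
    ‖inner ℂ x y‖ₑ ≤ ‖x‖ₑ * ‖y‖ₑ := by
  rw [← ofReal_norm, ← ofReal_norm, ← ofReal_norm, ← ENNReal.ofReal_mul (norm_nonneg _)]
  exact ENNReal.ofReal_le_ofReal (norm_inner_le_norm x y)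

/-- The weights `((1 + j) / (1 + j + k))^α`. -/
def hankelWeight (α : ℝ) (j k : ℕ) : ℝ := (1 + j : ℝ) ^ α * (1 + (j + k : ℕ) : ℝ) ^ (-α)

/-- The weighted Hankel matrix `((1 + j)^α (1 + j + k)^(-α) p_{j+k})` is bounded by `C`. -/
def HankelBound (α : ℝ) (p : ℕ → H →L[ℂ] H) (C : ℝ) : Prop :=
  ∀ (n : ℕ) (f g : ℕ → H),
    ‖∑ j ∈ Finset.range n, ∑ k ∈ Finset.range n,
      (hankelWeight α j k : ℂ) * inner ℂ (p (j + k) (g k)) (f j)‖ ≤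
      C * √(∑ j ∈ Finset.range n, ‖f j‖ ^ 2) * √(∑ k ∈ Finset.range n, ‖g k‖ ^ 2)

/-- The Carleson embedding condition of order `N`, on polynomials. -/
def CarlesonBound (N : ℝ) (ψ : Hol (H →L[ℂ] H)) (C : ℝ) : Prop :=
  ∀ (n : ℕ) (g : ℕ → H),
    ∫⁻ z in ball (0 : ℂ) 1, ‖Hol.Dpow N ψ z (Hol.poly n g (conj z))‖ₑ ^ 2 *
      ENNReal.ofReal ((1 - ‖z‖ ^ 2) ^ (2 * N - 1)) ≤
      ENNReal.ofReal (C ^ 2 * ∑ k ∈ Finset.range n, ‖g k‖ ^ 2)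

theorem Hol.continuousOn_apply_conj (Ψ : Hol (H →L[ℂ] H)) (g : Hol H) :
    ContinuousOn (fun z => Ψ z (g (conj z))) (ball 0 1) :=
  Ψ.continuousOn.clm_apply g.continuousOn_conj

/-- Carleson embeddings are measured with 1 - |z|², exact identities with log(1/|z|²). This
inequality exchanges p powers of one for the other; the unboundedness at the origin is paid for by a
second term with a larger exponent. -/
theorem logWeight_rpow_sq_le {β p : ℝ} (hp : 0 ≤ p) {r : ℝ} (h0 : 0 < r) (h1 : r < 1) :
    logWeight r ^ (2 * β - 1 + p) ≤ (1 - r ^ 2) ^ p *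
      (2 ^ p * (logWeight r ^ (2 * β - 1) + logWeight r ^ (2 * β + p - 1))) := by
  have hr2 : 0 < 1 - r ^ 2 := by nlinarith
  have hL : 0 < logWeight r := by
    have := Real.log_neg h0 h1
    rw [logWeight]; linarith
  have h2 : (1 + logWeight r) ^ p ≤ 2 ^ p * (1 + logWeight r ^ p) := by
    rcases le_total (logWeight r) 1 with h | h
    · calc (1 + logWeight r) ^ p ≤ 2 ^ p := Real.rpow_le_rpow (by positivity) (by linarith) hp
        _ ≤ _ := by
          have : 0 ≤ logWeight r ^ p := by positivity
          have : (0 : ℝ) ≤ 2 ^ p := by positivity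
          nlinarith
    · calc (1 + logWeight r) ^ p ≤ (2 * logWeight r) ^ p :=
            Real.rpow_le_rpow (by positivity) (by linarith) hp
        _ = 2 ^ p * logWeight r ^ p := Real.mul_rpow zero_le_two hL.le
        _ ≤ _ := by gcongr; linarith
  have h3 : logWeight r ^ p ≤ (1 - r ^ 2) ^ p * (2 ^ p * (1 + logWeight r ^ p)) := by
    calc logWeight r ^ p ≤ ((1 - r ^ 2) * (1 + logWeight r)) ^ p :=
          Real.rpow_le_rpow hL.le (logWeight_le h0 h1) hp
      _ = (1 - r ^ 2) ^ p * (1 + logWeight r) ^ p := Real.mul_rpow hr2.le (by positivity)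
      _ ≤ _ := by gcongr
  rw [Real.rpow_add hL, show 2 * β + p - 1 = 2 * β - 1 + p by ring, Real.rpow_add hL]
  have : 0 ≤ logWeight r ^ (2 * β - 1) := by positivity
  calc _ ≤ logWeight r ^ (2 * β - 1) * ((1 - r ^ 2) ^ p * (2 ^ p * (1 + logWeight r ^ p))) := by
        gcongr
    _ = _ := by ring

/-- Cauchy–Schwarz, with the squared weight L^(2β-1) L^(2N-1) split so that `A` receives
(1-|z|²)^(2N-1) and `B` receives the rest. -/
theorem lintegral_mul_logWeight_le {E : Type*} [NormedAddCommGroup E] {A B : ℂ → E} (hA : ContinuousOn A (ball 0 1))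
    (hB : ContinuousOn B (ball 0 1)) {β N : ℝ} (hβ : 0 < β) (hN : 1 ≤ N) :
    ∫⁻ z in ball (0 : ℂ) 1, ‖A z‖ₑ * ‖B z‖ₑ * ENNReal.ofReal (logWeight ‖z‖ ^ (β + N - 1)) ≤
      (∫⁻ z in ball (0 : ℂ) 1, ‖A z‖ₑ ^ 2 *
        ENNReal.ofReal ((1 - ‖z‖ ^ 2) ^ (2 * N - 1))) ^ (1 / 2 : ℝ) *
      (∫⁻ z in ball (0 : ℂ) 1, ‖B z‖ₑ ^ 2 * ENNReal.ofReal (2 ^ (2 * N - 1) *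
        (logWeight ‖z‖ ^ (2 * β - 1) + logWeight ‖z‖ ^ (2 * β + (2 * N - 1) - 1)))) ^
        (1 / 2 : ℝ) := by
  have hml := measurable_logWeight
  let a : ℂ → ℝ≥0∞ := fun z => ‖A z‖ₑ * ENNReal.ofReal ((1 - ‖z‖ ^ 2) ^ (2 * N - 1)) ^ (1 / 2 : ℝ)
  let b : ℂ → ℝ≥0∞ := fun z => ‖B z‖ₑ * ENNReal.ofReal (2 ^ (2 * N - 1) *
        (logWeight ‖z‖ ^ (2 * β - 1) + logWeight ‖z‖ ^ (2 * β + (2 * N - 1) - 1))) ^ (1 / 2 : ℝ)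
  have ha : AEMeasurable a (volume.restrict (ball 0 1)) :=
    (hA.enorm.aemeasurable measurableSet_ball).mul (by fun_prop)
  have hb : AEMeasurable b (volume.restrict (ball 0 1)) :=
    (hB.enorm.aemeasurable measurableSet_ball).mul (by fun_prop)
  have hsq : ∀ x : ℝ≥0∞, (x ^ (1 / 2 : ℝ)) ^ (2 : ℝ) = x := fun x => by
    rw [← ENNReal.rpow_mul]; norm_num
  have h := ENNReal.lintegral_mul_le_Lp_mul_Lq (volume.restrict (ball (0 : ℂ) 1))
    Real.HolderConjugate.two_two ha hb
  have ea : ∀ z, a z ^ (2 : ℝ) = ‖A z‖ₑ ^ 2 * ENNReal.ofReal ((1 - ‖z‖ ^ 2) ^ (2 * N - 1)) := by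
    intro z
    simp only [a]
    rw [ENNReal.mul_rpow_of_nonneg _ _ zero_le_two, hsq]
    norm_cast
  have eb : ∀ z, b z ^ (2 : ℝ) = ‖B z‖ₑ ^ 2 * ENNReal.ofReal (2 ^ (2 * N - 1) *
        (logWeight ‖z‖ ^ (2 * β - 1) + logWeight ‖z‖ ^ (2 * β + (2 * N - 1) - 1))) := by
    intro z
    simp only [b]
    rw [ENNReal.mul_rpow_of_nonneg _ _ zero_le_two, hsq]
    norm_cast
  simp only [ea, eb] at h
  refine le_trans (setLIntegral_mono' measurableSet_ball fun z hz => ?_) h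
  have hz1 : ‖z‖ < 1 := mem_ball_zero_iff.mp hz
  simp only [a, b, Pi.mul_apply]
  rw [mul_mul_mul_comm]
  gcongr
  -- At z = 0 the logarithm takes its default value 0, and the exponent β + N - 1 is positive, so
  -- the left side vanishes.
  rcases (norm_nonneg z).eq_or_lt with h0 | h0
  · rw [← h0, logWeight, Real.log_zero, mul_zero, Real.zero_rpow (by linarith)]
    simp
  · have hL := logWeight_nonneg h0.le hz1.le
    have hr2 : 0 ≤ 1 - ‖z‖ ^ 2 := by nlinarith
    rw [← ENNReal.mul_rpow_of_nonneg _ _ (by norm_num), ← ENNReal.ofReal_mul (by positivity)]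
    refine le_trans ?_ (ENNReal.rpow_le_rpow (ENNReal.ofReal_le_ofReal
      (logWeight_rpow_sq_le (β := β) (p := 2 * N - 1) (by linarith) h0 hz1)) (by norm_num))
    rw [ENNReal.ofReal_rpow_of_nonneg (by positivity) (by norm_num), ← Real.rpow_mul hL]
    refine le_of_eq ?_
    congr 2
    ring

/-- Carleson embeddings bound the pairing with weighted Bergman functions. -/
theorem CarlesonBound.lintegral_le {N C β : ℝ} {ψ : Hol (H →L[ℂ] H)} (hψ : CarlesonBound N ψ C)
    (hN : 1 ≤ N) (hβ : 0 < β) (hC : 0 ≤ C) (n : ℕ) (f g : ℕ → H) :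
    ∫⁻ z in ball (0 : ℂ) 1, ‖Hol.Dpow N ψ z (Hol.poly n g (conj z))‖ₑ *
      ‖Hol.Dpow β (Hol.poly n f) z‖ₑ * ENNReal.ofReal (logWeight ‖z‖ ^ (β + N - 1)) ≤
      ENNReal.ofReal (C * √(2 ^ (2 * N - 1) * Real.pi *
        (Real.Gamma (2 * β) + Real.Gamma (2 * β + (2 * N - 1)))) *
        √(∑ j ∈ Finset.range n, ‖f j‖ ^ 2) * √(∑ k ∈ Finset.range n, ‖g k‖ ^ 2)) := by
  have hml := measurable_logWeight
  have hp : 0 ≤ 2 * N - 1 := by linarith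
  have hG1 := Real.Gamma_pos_of_pos (show 0 < 2 * β by positivity)
  have hG2 := Real.Gamma_pos_of_pos (show 0 < 2 * β + (2 * N - 1) by positivity)
  refine (lintegral_mul_logWeight_le (Hol.continuousOn_apply_conj _ _) (Hol.continuousOn _)
    hβ hN).trans ?_
  have h1 := hψ n g
  have h2 : ∫⁻ z in ball (0 : ℂ) 1, ‖Hol.Dpow β (Hol.poly n f) z‖ₑ ^ 2 *
      ENNReal.ofReal (2 ^ (2 * N - 1) *
        (logWeight ‖z‖ ^ (2 * β - 1) + logWeight ‖z‖ ^ (2 * β + (2 * N - 1) - 1))) ≤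
      ENNReal.ofReal (2 ^ (2 * N - 1) * Real.pi *
        (Real.Gamma (2 * β) + Real.Gamma (2 * β + (2 * N - 1))) *
        ∑ j ∈ Finset.range n, ‖f j‖ ^ 2) := by
    have e : ∀ z ∈ ball (0 : ℂ) 1, ‖Hol.Dpow β (Hol.poly n f) z‖ₑ ^ 2 *
        ENNReal.ofReal (2 ^ (2 * N - 1) *
          (logWeight ‖z‖ ^ (2 * β - 1) + logWeight ‖z‖ ^ (2 * β + (2 * N - 1) - 1))) =
        ENNReal.ofReal (2 ^ (2 * N - 1)) * (‖Hol.Dpow β (Hol.poly n f) z‖ₑ ^ 2 *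
          ENNReal.ofReal (logWeight ‖z‖ ^ (2 * β - 1)) + ‖Hol.Dpow β (Hol.poly n f) z‖ₑ ^ 2 *
          ENNReal.ofReal (logWeight ‖z‖ ^ (2 * β + (2 * N - 1) - 1))) := by
      intro z hz
      have := logWeight_nonneg (norm_nonneg z) (mem_ball_zero_iff.mp hz).le
      rw [ENNReal.ofReal_mul (by positivity), ENNReal.ofReal_add (by positivity) (by positivity)]
      ring
    have hm : AEMeasurable (fun z => ‖Hol.Dpow β (Hol.poly n f) z‖ₑ ^ 2 *
          ENNReal.ofReal (logWeight ‖z‖ ^ (2 * β - 1))) (volume.restrict (ball 0 1)) :=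
      (((Hol.continuousOn _).enorm.aemeasurable measurableSet_ball).pow_const 2).mul (by fun_prop)
    rw [setLIntegral_congr_fun measurableSet_ball e, lintegral_const_mul' _ _ ENNReal.ofReal_ne_top,
      lintegral_add_left' hm]
    calc _ ≤ ENNReal.ofReal (2 ^ (2 * N - 1)) * (ENNReal.ofReal (Real.pi * Real.Gamma (2 * β)) *
          (Hol.poly n f).h2Norm ^ 2 + ENNReal.ofReal (Real.pi * Real.Gamma (2 * β + (2 * N - 1))) *
          (Hol.poly n f).h2Norm ^ 2) := by
          gcongr
          · exact (Hol.lintegral_Dpow_logWeight _ hβ).le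
          · exact Hol.lintegral_Dpow_logWeight_add_le _ hβ hp
      _ = _ := by
          rw [Hol.h2Norm_poly_sq, ← add_mul, ← ENNReal.ofReal_add (by positivity) (by positivity),
            ← ENNReal.ofReal_mul (by positivity), ← ENNReal.ofReal_mul (by positivity)]
          congr 1
          ring
  calc _ ≤ ENNReal.ofReal (C ^ 2 * ∑ k ∈ Finset.range n, ‖g k‖ ^ 2) ^ (1 / 2 : ℝ) *
        ENNReal.ofReal (2 ^ (2 * N - 1) * Real.pi *
          (Real.Gamma (2 * β) + Real.Gamma (2 * β + (2 * N - 1))) *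
          ∑ j ∈ Finset.range n, ‖f j‖ ^ 2) ^ (1 / 2 : ℝ) := by gcongr
    _ = _ := by
        rw [ENNReal.ofReal_rpow_of_nonneg (by positivity) (by norm_num),
          ENNReal.ofReal_rpow_of_nonneg (by positivity) (by norm_num),
          ← ENNReal.ofReal_mul (by positivity), ← Real.sqrt_eq_rpow, ← Real.sqrt_eq_rpow,
          Real.sqrt_mul (by positivity), Real.sqrt_sq hC, Real.sqrt_mul (by positivity) (∑ j ∈ _, _)]
        congr 1
        ring

/-- Integration over angles selects the coefficient of index j + k. There the total power of r is
2(j+k), so the radial moment is an exact power of 1 + j + k. -/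
theorem integral_inner_monomials (Ψ : Hol (H →L[ℂ] H)) (x y : H) (j k : ℕ) {s : ℝ} (hs : 0 < s)
    (hint : ∫⁻ z in ball (0 : ℂ) 1, ‖inner ℂ (Ψ z (conj z ^ k • y)) (z ^ j • x)‖ₑ *
      ENNReal.ofReal (logWeight ‖z‖ ^ (s - 1)) < ∞) :
    ∫ z in ball (0 : ℂ) 1, logWeight ‖z‖ ^ (s - 1) • inner ℂ (Ψ z (conj z ^ k • y)) (z ^ j • x) =
      (Real.pi * Real.Gamma s * (1 + (j + k : ℕ) : ℝ) ^ (-s)) •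
        inner ℂ (Ψ.coeff (j + k) y) x := by
  have hsum : ∀ r ∈ Set.Ioo (0 : ℝ) 1, Summable fun m : ℕ =>
      r ^ (m + (j + k)) * ‖inner ℂ (Ψ.coeff m y) x‖ := by
    intro r hr
    refine ((Ψ.summable_pow_mul_coeff hr.1.le hr.2).mul_right (‖y‖ * ‖x‖)).of_nonneg_of_le
      (fun m => by have := hr.1.le; positivity) fun m => ?_
    have h1 : ‖inner ℂ (Ψ.coeff m y) x‖ ≤ ‖Ψ.coeff m‖ * ‖y‖ * ‖x‖ :=
      (norm_inner_le_norm _ _).trans (by gcongr; exact (Ψ.coeff m).le_opNorm y)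
    have h2 : r ^ (m + (j + k)) ≤ r ^ m := pow_le_pow_of_le_one hr.1.le hr.2.le (by omega)
    have h3 := pow_nonneg hr.1.le m
    calc _ ≤ r ^ m * (‖Ψ.coeff m‖ * ‖y‖ * ‖x‖) := by gcongr
      _ = _ := by ring
  rw [integral_ball_trigSeries (ι := ℕ) (c := fun m => inner ℂ (Ψ.coeff m y) x)
    (d := fun m => m + (j + k)) (q := fun m => ((j + k : ℕ) : ℤ) - m) hs ?_ hsum ?_ hint ?_]
  · rw [tsum_eq_single (j + k)]
    · rw [if_pos (by simp)]
      congr 3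
      push_cast
      ring
    · intro m hm
      rw [if_neg]
      intro h
      apply hm
      have : ((j + k : ℕ) : ℤ) = m := by linarith
      exact_mod_cast this.symm
  · refine ContinuousOn.inner ?_ (by fun_prop)
    exact Ψ.continuousOn.clm_apply
      ((Complex.continuous_conj.pow k).smul continuous_const).continuousOn
  · intro r hr t
    have hz := mul_exp_I_mem_ball hr t
    set z := (r : ℂ) * Complex.exp (t * Complex.I) with hzdef
    have h1 := Ψ.hasSum_coeff hz
    have h2 : HasSum (fun m => z ^ m • Ψ.coeff m (conj z ^ k • y)) (Ψ z (conj z ^ k • y)) := by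
      simpa using h1.mapL (ContinuousLinearMap.apply ℂ H (conj z ^ k • y))
    have h3 := (innerSLFlip ℂ (z ^ j • x)).hasSum h2
    simp only [innerSLFlip_apply_apply] at h3
    rw [← h3.tsum_eq]
    refine tsum_congr fun m => ?_
    have hcz : conj z = r * Complex.exp (-(t * Complex.I)) := by
      rw [hzdef, map_mul, Complex.conj_ofReal, ← Complex.exp_conj]
      simp
    rw [map_smul, inner_smul_left, inner_smul_left, inner_smul_right, map_pow, map_pow,
      Complex.conj_conj, hcz, hzdef, mul_pow, mul_pow, mul_pow, ← Complex.exp_nat_mul,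
      ← Complex.exp_nat_mul, ← Complex.exp_nat_mul, smul_eq_mul, smul_eq_mul]
    have he : Complex.exp ((((j + k : ℕ) : ℤ) - (m : ℤ) : ℤ) * (t * Complex.I)) =
        Complex.exp (m * -(t * Complex.I)) * Complex.exp (k * (t * Complex.I)) *
          Complex.exp (j * (t * Complex.I)) := by
      rw [← Complex.exp_add, ← Complex.exp_add]
      congr 1
      push_cast
      ring
    rw [he, pow_add, pow_add]
    ring
  · refine summable_of_ne_finset_zero (s := {j + k}) fun m hm => ?_
    rw [if_neg]
    intro h
    apply hm
    have : ((j + k : ℕ) : ℤ) = m := by linarith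
    rw [Finset.mem_singleton]
    exact_mod_cast this.symm

theorem Hol.poly_single_apply {Y : Type*} [NormedAddCommGroup Y] [NormedSpace ℂ Y]
    [CompleteSpace Y] {n k : ℕ} (hk : k < n) (y : Y) {z : ℂ} (hz : z ∈ ball (0 : ℂ) 1) :
    Hol.poly n (Pi.single k y) z = z ^ k • y := by
  rw [Hol.poly_apply _ _ hz, Finset.sum_eq_single k]
  · rw [Pi.single_eq_same]
  · intro m _ hm
    rw [Pi.single_eq_of_ne hm, smul_zero]
  · intro h
    exact absurd (Finset.mem_range.mpr hk) h

/-- A Carleson embedding condition bounds all weighted Hankel matrices. -/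
theorem CarlesonBound.hankelBound {N C β : ℝ} {ψ : Hol (H →L[ℂ] H)} (hψ : CarlesonBound N ψ C)
    (hN : 1 ≤ N) (hβ : 0 < β) (hC : 0 ≤ C) :
    HankelBound β ψ.coeff ((Real.pi * Real.Gamma (β + N))⁻¹ * √(2 ^ (2 * N - 1) * Real.pi *
        (Real.Gamma (2 * β) + Real.Gamma (2 * β + (2 * N - 1)))) * C) := by
  intro n f g
  have hml := measurable_logWeight
  have hs : 0 < β + N := by linarith
  have hΓ := Real.Gamma_pos_of_pos hs
  have hD : ∀ j ∈ Finset.range n, ∀ x : H, ∀ z ∈ ball (0 : ℂ) 1,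
      Hol.Dpow β (Hol.poly n (Pi.single j x)) z = (((1 + j : ℝ) ^ β : ℝ) : ℂ) • z ^ j • x := by
    intro j hj x z hz
    have : (fun k : ℕ => (((1 + k : ℝ) ^ β : ℝ) : ℂ) • (Pi.single j x : ℕ → H) k) =
        Pi.single j ((((1 + j : ℝ) ^ β : ℝ) : ℂ) • x) := by
      funext k
      by_cases h : k = j
      · subst h; simp
      · simp [Pi.single_eq_of_ne h]
    rw [Hol.Dpow_poly, this, Hol.poly_single_apply (Finset.mem_range.mp hj) _ hz, smul_comm]
  -- Integrability of each pair of monomials comes from the Carleson estimate itself, applied to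
  -- polynomials with a single term.
  have hfin : ∀ j ∈ Finset.range n, ∀ k ∈ Finset.range n,
      ∫⁻ z in ball (0 : ℂ) 1, ‖inner ℂ (Hol.Dpow N ψ z (conj z ^ k • g k)) (z ^ j • f j)‖ₑ *
      ENNReal.ofReal (logWeight ‖z‖ ^ (β + N - 1)) < ∞ := by
    intro j hj k hk
    refine lt_of_le_of_lt (setLIntegral_mono' measurableSet_ball fun z hz => ?_)
      ((hψ.lintegral_le hN hβ hC n (Pi.single j (f j)) (Pi.single k (g k))).trans_lt
        ENNReal.ofReal_lt_top)
    have hz' : conj z ∈ ball (0 : ℂ) 1 := by simpa using hz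
    rw [hD j hj _ z hz, Hol.poly_single_apply (Finset.mem_range.mp hk) _ hz']
    gcongr
    refine (enorm_inner_le _ _).trans ?_
    gcongr
    rw [enorm_smul (((1 + j : ℝ) ^ β : ℝ) : ℂ), ← ofReal_norm (((1 + j : ℝ) ^ β : ℝ) : ℂ), Complex.norm_real,
      Real.norm_of_nonneg (by positivity)]
    -- D^β multiplies the monomial by (1+j)^β ≥ 1, so dropping D^β only makes the integrand smaller.
    have h1 : (1 : ℝ) ≤ (1 + j : ℝ) ^ β :=
      Real.one_le_rpow (by linarith [Nat.cast_nonneg (α := ℝ) j]) hβ.le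
    calc ‖z ^ j • f j‖ₑ = 1 * ‖z ^ j • f j‖ₑ := (one_mul _).symm
      _ ≤ _ := by gcongr; exact ENNReal.one_le_ofReal.mpr h1
  have hcont : ∀ j k : ℕ, ContinuousOn
      (fun z => inner ℂ (Hol.Dpow N ψ z (conj z ^ k • g k)) (z ^ j • f j)) (ball 0 1) := by
    intro j k
    refine ContinuousOn.inner ?_ (by fun_prop)
    exact (Hol.continuousOn _).clm_apply
      ((Complex.continuous_conj.pow k).smul continuous_const).continuousOn
  have hmeas : Measurable fun z : ℂ => logWeight ‖z‖ ^ (β + N - 1) := by fun_prop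
  have hI : ∀ j ∈ Finset.range n, ∀ k ∈ Finset.range n, IntegrableOn (fun z =>
      logWeight ‖z‖ ^ (β + N - 1) •
        inner ℂ (Hol.Dpow N ψ z (conj z ^ k • g k)) (z ^ j • f j)) (ball 0 1) := by
    intro j hj k hk
    refine ⟨AEStronglyMeasurable.smul (f := fun z : ℂ => logWeight ‖z‖ ^ (β + N - 1))
      hmeas.aestronglyMeasurable ((hcont j k).aestronglyMeasurable measurableSet_ball), ?_⟩
    refine lt_of_eq_of_lt (setLIntegral_congr_fun measurableSet_ball fun z hz => ?_)
      (hfin j hj k hk)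
    have := logWeight_nonneg (norm_nonneg z) (mem_ball_zero_iff.mp hz).le
    simp only
    rw [enorm_smul, Real.enorm_of_nonneg (by positivity), mul_comm]
  have hexp : ∀ z ∈ ball (0 : ℂ) 1, logWeight ‖z‖ ^ (β + N - 1) •
      inner ℂ (Hol.Dpow N ψ z (Hol.poly n g (conj z))) (Hol.Dpow β (Hol.poly n f) z) =
      ∑ j ∈ Finset.range n, ∑ k ∈ Finset.range n, ((1 + j : ℝ) ^ β) •
        (logWeight ‖z‖ ^ (β + N - 1) •
          inner ℂ (Hol.Dpow N ψ z (conj z ^ k • g k)) (z ^ j • f j)) := by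
    intro z hz
    have hz' : conj z ∈ ball (0 : ℂ) 1 := by simpa using hz
    rw [Hol.Dpow_poly, Hol.poly_apply _ _ hz, Hol.poly_apply _ _ hz', map_sum, inner_sum,
      Finset.smul_sum]
    refine Finset.sum_congr rfl fun j _ => ?_
    rw [sum_inner, Finset.smul_sum]
    refine Finset.sum_congr rfl fun k _ => ?_
    rw [smul_comm (z ^ j), inner_smul_right, ← Complex.real_smul, smul_comm]
  -- The moment (1+j+k)^(-(β+N)), the factor (1+j+k)^N from D^N ψ and the factor (1+j)^β from D^β f
  -- combine to the Hankel weight of order β, whatever N is.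
  have hval : ∫ z in ball (0 : ℂ) 1, logWeight ‖z‖ ^ (β + N - 1) •
      inner ℂ (Hol.Dpow N ψ z (Hol.poly n g (conj z))) (Hol.Dpow β (Hol.poly n f) z) =
      (Real.pi * Real.Gamma (β + N)) • ∑ j ∈ Finset.range n, ∑ k ∈ Finset.range n,
        (hankelWeight β j k : ℂ) * inner ℂ (ψ.coeff (j + k) (g k)) (f j) := by
    rw [setIntegral_congr_fun measurableSet_ball hexp, integral_finsetSum, Finset.smul_sum]
    · refine Finset.sum_congr rfl fun j hj => ?_
      rw [integral_finsetSum, Finset.smul_sum]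
      · refine Finset.sum_congr rfl fun k hk => ?_
        rw [integral_smul, integral_inner_monomials _ _ _ _ _ hs (hfin j hj k hk), Hol.coeff_Dpow,
          hankelWeight, smul_apply, inner_smul_left, Complex.conj_ofReal]
        simp only [Complex.real_smul]
        have e : (1 + (j + k : ℕ) : ℝ) ^ (-(β + N)) * (1 + (j + k : ℕ) : ℝ) ^ N =
            (1 + (j + k : ℕ) : ℝ) ^ (-β) := by
          rw [← Real.rpow_add (by positivity)]; congr 1; ring
        rw [← e]
        push_cast
        ring
      · exact fun k hk => (hI j hj k hk).smul ((1 + j : ℝ) ^ β)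
    · exact fun j hj => integrable_finsetSum _ fun k hk => (hI j hj k hk).smul ((1 + j : ℝ) ^ β)
  have hle : ‖∫ z in ball (0 : ℂ) 1, logWeight ‖z‖ ^ (β + N - 1) •
      inner ℂ (Hol.Dpow N ψ z (Hol.poly n g (conj z))) (Hol.Dpow β (Hol.poly n f) z)‖ₑ ≤
      ENNReal.ofReal (C * √(2 ^ (2 * N - 1) * Real.pi *
        (Real.Gamma (2 * β) + Real.Gamma (2 * β + (2 * N - 1)))) *
        √(∑ j ∈ Finset.range n, ‖f j‖ ^ 2) * √(∑ k ∈ Finset.range n, ‖g k‖ ^ 2)) := by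
    refine (enorm_integral_le_lintegral_enorm _).trans (le_trans ?_
      (hψ.lintegral_le hN hβ hC n f g))
    refine setLIntegral_mono' measurableSet_ball fun z hz => ?_
    have := logWeight_nonneg (norm_nonneg z) (mem_ball_zero_iff.mp hz).le
    rw [enorm_smul, Real.enorm_of_nonneg (by positivity), mul_comm]
    gcongr
    exact enorm_inner_le _ _
  rw [hval, ← ofReal_norm, ENNReal.ofReal_le_ofReal_iff (by positivity), norm_smul,
    Real.norm_of_nonneg (by positivity)] at hle
  rw [← mul_le_mul_iff_right₀ (show 0 < Real.pi * Real.Gamma (β + N) by positivity)]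
  refine hle.trans (le_of_eq ?_)
  field_simp

end VecBMOA
end

noncomputable section
namespace VecBMOA

/-! ### A double integral estimate -/

theorem norm_pow_sub_pow_le_mul (x y : ℂ) {m : ℝ} (hx : ‖x‖ ≤ m) (hy : ‖y‖ ≤ m) (k : ℕ) :
    ‖x ^ k - y ^ k‖ ≤ k * m ^ (k - 1) * ‖x - y‖ := by
  have hm : 0 ≤ m := (norm_nonneg x).trans hx
  rw [← (Commute.all x y).geom_sum₂_mul, norm_mul]
  gcongr
  refine (norm_sum_le _ _).trans ?_
  calc _ ≤ ∑ i ∈ Finset.range k, m ^ (k - 1) := by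
        refine Finset.sum_le_sum fun i hi => ?_
        have : i < k := Finset.mem_range.mp hi
        rw [norm_mul, norm_pow, norm_pow]
        calc _ ≤ m ^ i * m ^ (k - 1 - i) := by gcongr
          _ = _ := by rw [← pow_add]; congr 1; omega
    _ = _ := by simp

/-- The difference of the squares is (1-|v|²)(1-|z|²) ≥ 0. This allows differences of points to be
absorbed into the kernel. -/
theorem norm_sub_le_norm_one_sub {v z : ℂ} (hv : ‖v‖ ≤ 1) (hz : ‖z‖ ≤ 1) :
    ‖v - z‖ ≤ ‖1 - z * conj v‖ := by
  have h : ‖1 - z * conj v‖ ^ 2 - ‖v - z‖ ^ 2 = (1 - ‖v‖ ^ 2) * (1 - ‖z‖ ^ 2) := by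
    simp only [← Complex.normSq_eq_norm_sq, Complex.normSq_apply]
    simp
    ring
  have h1 : 0 ≤ (1 - ‖v‖ ^ 2) * (1 - ‖z‖ ^ 2) := by
    have := norm_nonneg v
    have := norm_nonneg z
    exact mul_nonneg (by nlinarith) (by nlinarith)
  exact le_of_sq_le_sq (by linarith) (norm_nonneg _)

/-- With m = max(|x|, |y|), interpolate between the trivial bound 2m^(k-1), used with exponent 2 -
τ, and the Lipschitz bound k m^(k-1) |x - y|, used with exponent τ. The small gain |x - y|^τ lowers
the singularity of the kernel, and its price k^τ is recovered later from the decay of the moments.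
-/
theorem norm_pow_sub_pow_sq_le {τ : ℝ} (h0 : 0 < τ) (h1 : τ ≤ 1) {x y : ℂ} (hx : ‖x‖ ≤ 1)
    (hy : ‖y‖ ≤ 1) {k : ℕ} (hk : 1 ≤ k) :
    ‖x ^ k - y ^ k‖ ^ 2 ≤ 4 * (k : ℝ) ^ τ * (‖x‖ ^ (2 * k - 2) + ‖y‖ ^ (2 * k - 2)) *
      ‖x - y‖ ^ τ := by
  set m := max ‖x‖ ‖y‖ with hm
  have hm0 : 0 ≤ m := (norm_nonneg x).trans (le_max_left _ _)
  have hm1 : m ≤ 1 := max_le hx hy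
  have hk1 : (1 : ℝ) ≤ k := by exact_mod_cast hk
  have hA : ‖x ^ k - y ^ k‖ ≤ 2 * m ^ (k - 1) := by
    have e : ∀ w : ℂ, ‖w‖ ≤ m → ‖w ^ k‖ ≤ m ^ (k - 1) := fun w hw => by
      rw [norm_pow]
      exact (pow_le_pow_left₀ (norm_nonneg w) hw k).trans
        (pow_le_pow_of_le_one hm0 hm1 (Nat.sub_le k 1))
    have := norm_sub_le (x ^ k) (y ^ k)
    have := e x (le_max_left _ _)
    have := e y (le_max_right _ _)
    linarith
  have hB := norm_pow_sub_pow_le_mul x y (le_max_left ‖x‖ ‖y‖) (le_max_right _ _) k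
  rw [← hm] at hB
  have hX := norm_nonneg (x ^ k - y ^ k)
  have hpow : m ^ (2 * k - 2) ≤ ‖x‖ ^ (2 * k - 2) + ‖y‖ ^ (2 * k - 2) := by
    have := pow_nonneg (norm_nonneg x) (2 * k - 2)
    have := pow_nonneg (norm_nonneg y) (2 * k - 2)
    rcases max_choice ‖x‖ ‖y‖ with h | h <;> rw [hm, h] <;> linarith
  have hmk : 0 ≤ m ^ (k - 1) := pow_nonneg hm0 _
  have h2 : (2 : ℝ) ^ (2 - τ) ≤ 4 := by
    calc (2 : ℝ) ^ (2 - τ) ≤ 2 ^ (2 : ℝ) :=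
          Real.rpow_le_rpow_of_exponent_le one_le_two (by linarith)
      _ = 4 := by norm_num
  calc ‖x ^ k - y ^ k‖ ^ 2 = ‖x ^ k - y ^ k‖ ^ (2 - τ) * ‖x ^ k - y ^ k‖ ^ τ := by
        rw [← Real.rpow_add' hX (by norm_num), ← Real.rpow_natCast]
        congr 1
        push_cast; ring
    _ ≤ (2 * m ^ (k - 1)) ^ (2 - τ) * (k * m ^ (k - 1) * ‖x - y‖) ^ τ := by
        gcongr
        linarith
    _ = 2 ^ (2 - τ) * (k : ℝ) ^ τ * ((m ^ (k - 1)) ^ (2 - τ) * (m ^ (k - 1)) ^ τ) * ‖x - y‖ ^ τ := by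
        rw [Real.mul_rpow zero_le_two hmk, Real.mul_rpow (by positivity) (norm_nonneg _),
          Real.mul_rpow (by positivity) hmk]
        ring
    _ = 2 ^ (2 - τ) * (k : ℝ) ^ τ * m ^ (2 * k - 2) * ‖x - y‖ ^ τ := by
        rw [← Real.rpow_add' hmk (by norm_num), show 2 - τ + τ = ((2 : ℕ) : ℝ) by push_cast; ring,
          Real.rpow_natCast, ← pow_mul]
        congr 3
        omega
    _ ≤ _ := by gcongr

/-- For fixed |v| only the kernel depends on the angle, so the angular estimate turns the area
integral into a radial one. -/
theorem lintegral_singWeight_mul_le {a s : ℝ} (hs : 2 ≤ s) {φ : ℝ → ℝ≥0∞} (hφ : Measurable φ)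
    {ρ : ℝ} (h0 : 0 ≤ ρ) (h1 : ρ < 1) :
    ∫⁻ v in ball (0 : ℂ) 1, singWeight a v * (ENNReal.ofReal (‖1 - ρ * conj v‖ ^ (-s)) * φ ‖v‖) ≤
      ∫⁻ r in Set.Ioo (0 : ℝ) 1, ENNReal.ofReal (2 * Real.pi) *
        (ENNReal.ofReal ((1 - r) ^ a * (1 - ρ * r) ^ (1 - s)) * φ r) := by
  rw [lintegral_ball_polar]
  swap
  · refine Measurable.indicator ?_ measurableSet_ball
    unfold singWeight
    fun_prop
  refine setLIntegral_mono' measurableSet_Ioo fun r hr => ?_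
  have h1r : 0 < 1 - r := by linarith [hr.2]
  have hr0 := hr.1
  have hzr : ‖(ρ : ℂ) * r‖ = ρ * r := by
    rw [norm_mul, Complex.norm_real, Complex.norm_real, Real.norm_of_nonneg hr.1.le,
      Real.norm_of_nonneg h0]
  have hzr1 : ρ * r < 1 := by nlinarith [hr.1, hr.2]
  have hzr2 : 0 < 1 - ρ * r := by linarith
  calc _ = ∫⁻ t in Set.Ioo (-Real.pi) Real.pi, (ENNReal.ofReal ((1 - r) ^ a) * φ r) *
        ENNReal.ofReal (‖1 - (ρ * r : ℂ) * Complex.exp (-(t * Complex.I))‖ ^ (-s)) := by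
        refine lintegral_congr fun t => ?_
        have : conj ((r : ℂ) * Complex.exp (t * Complex.I)) =
            r * Complex.exp (-(t * Complex.I)) := by
          rw [map_mul, Complex.conj_ofReal, ← Complex.exp_conj]; simp
        rw [singWeight, norm_mul_exp_I hr.1.le, this, ← mul_assoc (ρ : ℂ),
          ← mul_assoc (ENNReal.ofReal r), ← ENNReal.ofReal_mul hr0.le, show r * ((1 - r) ^ a * r⁻¹) = (1 - r) ^ a by
            field_simp]
        ring
    _ ≤ (ENNReal.ofReal ((1 - r) ^ a) * φ r) *
          ENNReal.ofReal (2 * Real.pi * (1 - ‖(ρ : ℂ) * r‖) ^ (1 - s)) := by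
        rw [lintegral_const_mul _ (by fun_prop)]
        gcongr
        exact lintegral_norm_one_sub_rpow (by rw [hzr]; exact hzr1) hs
    _ = _ := by
        rw [hzr, ENNReal.ofReal_mul (p := 2 * Real.pi) (by positivity),
          ENNReal.ofReal_mul (p := (1 - r) ^ a) (by positivity)]
        ring

/-- The inner integral is at most a constant times (1-ρ)^(τ-b-1) by the radial kernel estimate,
which needs τ < b + 1. Together with (1-ρ)^b this leaves the weight (1-ρ)^(τ-1), whose m-th moment
is of order (1+m)^(-τ). -/
theorem lintegral_lintegral_kernel_pow_le {a b τ : ℝ} (ha : -1 < a) (hτ : 0 < τ)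
    (hτ1 : τ ≤ 1) (hτb : τ < b + 1) (m : ℕ) :
    ∫⁻ ρ in Set.Ioo (0 : ℝ) 1, ENNReal.ofReal ((1 - ρ) ^ b) *
      ∫⁻ r in Set.Ioo (0 : ℝ) 1, ENNReal.ofReal ((1 - r) ^ a * (1 - ρ * r) ^ (τ - a - b - 2)) *
        ENNReal.ofReal (ρ ^ m) ≤
      ENNReal.ofReal (((b + 1 - τ)⁻¹ + (a + 1)⁻¹) * (1 + τ⁻¹) * (1 + m : ℝ) ^ (-τ)) := by
  have hb1 : 0 < b + 1 - τ := by linarith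
  have ha1 : 0 < a + 1 := by linarith
  have e : ∀ ρ ∈ Set.Ioo (0 : ℝ) 1, ENNReal.ofReal ((1 - ρ) ^ b) *
      ∫⁻ r in Set.Ioo (0 : ℝ) 1, ENNReal.ofReal ((1 - r) ^ a * (1 - ρ * r) ^ (τ - a - b - 2)) *
        ENNReal.ofReal (ρ ^ m) ≤ ENNReal.ofReal ((b + 1 - τ)⁻¹ + (a + 1)⁻¹) *
          ENNReal.ofReal (ρ ^ m * (1 - ρ) ^ (τ - 1)) := by
    intro ρ hρ
    have h1 : 0 < 1 - ρ := by linarith [hρ.2]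
    have h0 := hρ.1
    rw [lintegral_mul_const' _ _ ENNReal.ofReal_ne_top]
    have := lintegral_radial_kernel_le (a := a) (s := a + b + 3 - τ) ha (by linarith) hρ.1.le hρ.2
    rw [show 1 - (a + b + 3 - τ) = τ - a - b - 2 by ring] at this
    calc _ ≤ ENNReal.ofReal ((1 - ρ) ^ b) * (ENNReal.ofReal (((a + b + 3 - τ - a - 2)⁻¹ +
          (a + 1)⁻¹) * (1 - ρ) ^ (a + 2 - (a + b + 3 - τ))) * ENNReal.ofReal (ρ ^ m)) := by gcongr
      _ = _ := by
        rw [show a + b + 3 - τ - a - 2 = b + 1 - τ by ring,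
          ← ENNReal.ofReal_mul (by positivity), ← ENNReal.ofReal_mul (by positivity),
          ← ENNReal.ofReal_mul (by positivity), show τ - 1 = b + (a + 2 - (a + b + 3 - τ)) by ring,
          Real.rpow_add h1]
        congr 1
        ring
  refine (setLIntegral_mono' measurableSet_Ioo e).trans ?_
  rw [lintegral_const_mul' _ _ ENNReal.ofReal_ne_top, mul_assoc, ENNReal.ofReal_mul (by positivity)]
  gcongr
  exact lintegral_beta_le hτ hτ1 m

/-- The same estimate with the power on the other variable: Tonelli exchanges the roles of ρ and r,
hence of a and b. -/
theorem lintegral_lintegral_kernel_pow_le' {a b τ : ℝ} (hb : -1 < b) (hτ : 0 < τ)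
    (hτ1 : τ ≤ 1) (hτa : τ < a + 1) (m : ℕ) :
    ∫⁻ ρ in Set.Ioo (0 : ℝ) 1, ENNReal.ofReal ((1 - ρ) ^ b) *
      ∫⁻ r in Set.Ioo (0 : ℝ) 1, ENNReal.ofReal ((1 - r) ^ a * (1 - ρ * r) ^ (τ - a - b - 2)) *
        ENNReal.ofReal (r ^ m) ≤
      ENNReal.ofReal (((a + 1 - τ)⁻¹ + (b + 1)⁻¹) * (1 + τ⁻¹) * (1 + m : ℝ) ^ (-τ)) := by
  refine le_trans (le_of_eq ?_) (lintegral_lintegral_kernel_pow_le hb hτ hτ1 hτa m)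
  have e1 : ∀ ρ ∈ Set.Ioo (0 : ℝ) 1, ENNReal.ofReal ((1 - ρ) ^ b) *
      ∫⁻ r in Set.Ioo (0 : ℝ) 1, ENNReal.ofReal ((1 - r) ^ a * (1 - ρ * r) ^ (τ - a - b - 2)) *
        ENNReal.ofReal (r ^ m) = ∫⁻ r in Set.Ioo (0 : ℝ) 1, ENNReal.ofReal ((1 - r) ^ a) *
          (ENNReal.ofReal ((1 - ρ) ^ b * (1 - r * ρ) ^ (τ - b - a - 2)) *
            ENNReal.ofReal (r ^ m)) := by
    intro ρ hρ
    have h1 : 0 < 1 - ρ := by linarith [hρ.2]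
    rw [← lintegral_const_mul' _ _ ENNReal.ofReal_ne_top]
    refine setLIntegral_congr_fun measurableSet_Ioo fun r hr => ?_
    have h2 : 0 < 1 - r := by linarith [hr.2]
    rw [ENNReal.ofReal_mul (by positivity), ENNReal.ofReal_mul (by positivity), mul_comm r ρ,
      show τ - b - a - 2 = τ - a - b - 2 by ring]
    ring
  rw [setLIntegral_congr_fun measurableSet_Ioo e1, lintegral_lintegral_swap (by fun_prop)]
  refine lintegral_congr fun r => ?_
  rw [lintegral_const_mul' _ _ ENNReal.ofReal_ne_top]

/-- The estimate for one monomial. -/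
theorem exists_lintegral_monomial_le {a b τ : ℝ} (ha : -1 < a) (hb : -1 < b) (hτ : 0 < τ)
    (hτ1 : τ ≤ 1) (hτa : τ < a + 1) (hτb : τ < b + 1) (hab : 0 ≤ a + b) :
    ∃ K : ℝ, 0 ≤ K ∧ ∀ k : ℕ,
      ∫⁻ ρ in Set.Ioo (0 : ℝ) 1, ENNReal.ofReal ((1 - ρ) ^ b) *
        ∫⁻ v in ball (0 : ℂ) 1, singWeight a v *
          (ENNReal.ofReal (‖1 - ρ * conj v‖ ^ (-(a + b + 3))) *
            ENNReal.ofReal (‖conj v ^ k - (ρ : ℂ) ^ k‖ ^ 2)) ≤ ENNReal.ofReal K := by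
  have ha1 : 0 < a + 1 := by linarith
  have hb1 : 0 < b + 1 := by linarith
  have ha2 : 0 < a + 1 - τ := by linarith
  have hb2 : 0 < b + 1 - τ := by linarith
  refine ⟨4 * (2 * Real.pi) * ((((a + 1 - τ)⁻¹ + (b + 1)⁻¹) * (1 + τ⁻¹)) +
    (((b + 1 - τ)⁻¹ + (a + 1)⁻¹) * (1 + τ⁻¹))), by positivity, fun k => ?_⟩
  rcases Nat.eq_zero_or_pos k with rfl | hk
  · simp
  set m := 2 * k - 2 with hm
  have hk0 : (0 : ℝ) < k := by exact_mod_cast hk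
  have hmk : (k : ℝ) ≤ 1 + m := by
    have : k ≤ 1 + m := by omega
    exact_mod_cast this
  have hinner : ∀ ρ ∈ Set.Ioo (0 : ℝ) 1, ∫⁻ v in ball (0 : ℂ) 1, singWeight a v *
          (ENNReal.ofReal (‖1 - ρ * conj v‖ ^ (-(a + b + 3))) *
            ENNReal.ofReal (‖conj v ^ k - (ρ : ℂ) ^ k‖ ^ 2)) ≤
        ENNReal.ofReal (4 * (k : ℝ) ^ τ * (2 * Real.pi)) *
        ∫⁻ r in Set.Ioo (0 : ℝ) 1, ENNReal.ofReal ((1 - r) ^ a * (1 - ρ * r) ^ (τ - a - b - 2)) *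
          (ENNReal.ofReal (r ^ m) + ENNReal.ofReal (ρ ^ m)) := by
    intro ρ hρ
    have hρn : ‖(ρ : ℂ)‖ = ρ := by rw [Complex.norm_real, Real.norm_of_nonneg hρ.1.le]
    have hρ0 := hρ.1
    calc _ ≤ ∫⁻ v in ball (0 : ℂ) 1, ENNReal.ofReal (4 * (k : ℝ) ^ τ) * (singWeight a v *
          (ENNReal.ofReal (‖1 - ρ * conj v‖ ^ (-(a + b + 3 - τ))) *
            ((fun r => ENNReal.ofReal (r ^ m) + ENNReal.ofReal (ρ ^ m)) ‖v‖))) := by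
          refine setLIntegral_mono' measurableSet_ball fun v hv => ?_
          have hv1 : ‖v‖ < 1 := mem_ball_zero_iff.mp hv
          have h1 := norm_pow_sub_pow_sq_le hτ hτ1 (x := conj v) (y := (ρ : ℂ))
            (by simpa using hv1.le) (by rw [hρn]; exact hρ.2.le) hk
          -- The gain |v̄ - ρ|^τ is converted into a power of the kernel, whose exponent drops from
          -- a + b + 3 to a + b + 3 - τ.
          have h2 : ‖conj v - (ρ : ℂ)‖ ≤ ‖1 - ρ * conj v‖ := by
            have := norm_sub_le_norm_one_sub hv1.le (z := (ρ : ℂ)) (by rw [hρn]; exact hρ.2.le)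
            rwa [← Complex.norm_conj (v - (ρ : ℂ)), map_sub, Complex.conj_ofReal] at this
          have h3 : 0 < ‖1 - ρ * conj v‖ := by
            have := one_sub_norm_le (a := (ρ : ℂ)) (b := conj v) (by simpa using hv1.le)
            rw [hρn] at this
            linarith [hρ.2]
          rw [Complex.norm_conj, hρn] at h1
          simp only
          rw [← ENNReal.ofReal_add (by positivity) (by positivity),
            mul_left_comm (ENNReal.ofReal (4 * (k : ℝ) ^ τ))]
          refine mul_le_mul' le_rfl ?_
          rw [← ENNReal.ofReal_mul (by positivity), ← ENNReal.ofReal_mul (by positivity),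
            ← ENNReal.ofReal_mul (by positivity)]
          refine ENNReal.ofReal_le_ofReal ?_
          calc _ ≤ ‖1 - ρ * conj v‖ ^ (-(a + b + 3)) * (4 * (k : ℝ) ^ τ *
                (‖v‖ ^ (2 * k - 2) + ρ ^ (2 * k - 2)) * ‖1 - ρ * conj v‖ ^ τ) := by
                gcongr
                refine h1.trans ?_
                gcongr
            _ = _ := by
                rw [show -(a + b + 3 - τ) = -(a + b + 3) + τ by ring, Real.rpow_add h3]
                ring
      _ ≤ ENNReal.ofReal (4 * (k : ℝ) ^ τ) * ∫⁻ r in Set.Ioo (0 : ℝ) 1,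
          ENNReal.ofReal (2 * Real.pi) * (ENNReal.ofReal ((1 - r) ^ a *
            (1 - ρ * r) ^ (1 - (a + b + 3 - τ))) *
              (ENNReal.ofReal (r ^ m) + ENNReal.ofReal (ρ ^ m))) := by
          rw [lintegral_const_mul' _ _ ENNReal.ofReal_ne_top]
          gcongr
          exact lintegral_singWeight_mul_le (by linarith) (by fun_prop) hρ.1.le hρ.2
      _ = _ := by
          rw [lintegral_const_mul' _ _ ENNReal.ofReal_ne_top, ← mul_assoc,
            ← ENNReal.ofReal_mul (by positivity)]
          rw [show 1 - (a + b + 3 - τ) = τ - a - b - 2 by ring]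
  have houter : ∀ ρ ∈ Set.Ioo (0 : ℝ) 1, ENNReal.ofReal ((1 - ρ) ^ b) *
        ∫⁻ v in ball (0 : ℂ) 1, singWeight a v *
          (ENNReal.ofReal (‖1 - ρ * conj v‖ ^ (-(a + b + 3))) *
            ENNReal.ofReal (‖conj v ^ k - (ρ : ℂ) ^ k‖ ^ 2)) ≤
        ENNReal.ofReal (4 * (k : ℝ) ^ τ * (2 * Real.pi)) *
        (ENNReal.ofReal ((1 - ρ) ^ b) * (∫⁻ r in Set.Ioo (0 : ℝ) 1,
          ENNReal.ofReal ((1 - r) ^ a * (1 - ρ * r) ^ (τ - a - b - 2)) * ENNReal.ofReal (r ^ m)) +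
        ENNReal.ofReal ((1 - ρ) ^ b) * (∫⁻ r in Set.Ioo (0 : ℝ) 1,
          ENNReal.ofReal ((1 - r) ^ a * (1 - ρ * r) ^ (τ - a - b - 2)) *
            ENNReal.ofReal (ρ ^ m))) := by
    intro ρ hρ
    rw [← mul_add, ← lintegral_add_left (by fun_prop), mul_left_comm]
    simp only [← mul_add]
    gcongr
    exact hinner ρ hρ
  refine (setLIntegral_mono' measurableSet_Ioo houter).trans ?_
  rw [lintegral_const_mul' _ _ ENNReal.ofReal_ne_top, lintegral_add_left]
  swap
  · refine Measurable.mul (by fun_prop) (Measurable.lintegral_prod_right' (f := fun p : ℝ × ℝ =>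
      ENNReal.ofReal ((1 - p.2) ^ a * (1 - p.1 * p.2) ^ (τ - a - b - 2)) *
        ENNReal.ofReal (p.2 ^ m)) (by fun_prop))
  calc _ ≤ ENNReal.ofReal (4 * (k : ℝ) ^ τ * (2 * Real.pi)) *
        (ENNReal.ofReal (((a + 1 - τ)⁻¹ + (b + 1)⁻¹) * (1 + τ⁻¹) * (1 + m : ℝ) ^ (-τ)) +
        ENNReal.ofReal (((b + 1 - τ)⁻¹ + (a + 1)⁻¹) * (1 + τ⁻¹) * (1 + m : ℝ) ^ (-τ))) := by
        gcongr
        · exact lintegral_lintegral_kernel_pow_le' hb hτ hτ1 hτa m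
        · exact lintegral_lintegral_kernel_pow_le ha hτ hτ1 hτb m
    _ ≤ _ := by
        rw [← ENNReal.ofReal_add (by positivity) (by positivity),
          ← ENNReal.ofReal_mul (by positivity)]
        refine ENNReal.ofReal_le_ofReal ?_
        -- With m = 2k - 2 one has k ≤ 1 + m, so the loss k^τ is compensated uniformly in k.
        have h1 : (k : ℝ) ^ τ * (1 + m : ℝ) ^ (-τ) ≤ 1 := by
          rw [Real.rpow_neg (by positivity), ← div_eq_mul_inv, div_le_one (by positivity)]
          gcongr
        calc _ = 4 * (2 * Real.pi) * ((((a + 1 - τ)⁻¹ + (b + 1)⁻¹) * (1 + τ⁻¹)) +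
            (((b + 1 - τ)⁻¹ + (a + 1)⁻¹) * (1 + τ⁻¹))) * ((k : ℝ) ^ τ * (1 + m : ℝ) ^ (-τ)) := by
              ring
          _ ≤ 4 * (2 * Real.pi) * ((((a + 1 - τ)⁻¹ + (b + 1)⁻¹) * (1 + τ⁻¹)) +
            (((b + 1 - τ)⁻¹ + (a + 1)⁻¹) * (1 + τ⁻¹))) * 1 := by gcongr
          _ = _ := mul_one _

end VecBMOA
end

noncomputable section
namespace VecBMOA

theorem setLIntegral_ball_rotate (t : ℝ) (F : ℂ → ℝ≥0∞) :
    ∫⁻ v in ball (0 : ℂ) 1, F (Complex.exp (t * Complex.I) * v) = ∫⁻ w in ball (0 : ℂ) 1, F w := by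
  have hmp : MeasurePreserving (rotation (Circle.exp t)) := (rotation (Circle.exp t)).measurePreserving
  have := hmp.setLIntegral_comp_preimage_emb
    (rotation (Circle.exp t)).toHomeomorph.measurableEmbedding F (ball 0 1)
  rw [← this]
  have hpre : (rotation (Circle.exp t)) ⁻¹' ball (0 : ℂ) 1 = ball 0 1 := by
    ext z
    rw [Set.mem_preimage, mem_ball_zero_iff, mem_ball_zero_iff, LinearIsometryEquiv.norm_map]
  rw [hpre]
  simp [rotation_apply, Circle.coe_exp]

variable {H : Type*} [NormedAddCommGroup H] [InnerProductSpace ℂ H] [CompleteSpace H]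

theorem enorm_sq_eq_ofReal {E : Type*} [NormedAddCommGroup E] (x : E) : ‖x‖ₑ ^ 2 = ENNReal.ofReal (‖x‖ ^ 2) := by
  rw [ENNReal.ofReal_pow (norm_nonneg _), ofReal_norm]

/-- When both points rotate together the k-th term has frequency -k and coefficient (v̄^k - ρ^k)
g_k. Parseval in the angle then decouples the monomials. -/
theorem lintegral_polynomial_difference (n : ℕ) (g : ℕ → H) (v : ℂ) (ρ : ℝ) :
    ∫⁻ t in Set.Ioo (-Real.pi) Real.pi,
      ‖∑ k ∈ Finset.range n, conj (Complex.exp (t * Complex.I) * v) ^ k • g k -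
        ∑ k ∈ Finset.range n, conj (ρ * Complex.exp (t * Complex.I)) ^ k • g k‖ₑ ^ 2 =
      ENNReal.ofReal (2 * Real.pi) * ∑ k ∈ Finset.range n,
        ENNReal.ofReal (‖conj v ^ k - (ρ : ℂ) ^ k‖ ^ 2) * ‖g k‖ₑ ^ 2 := by
  have key := lintegral_enorm_sq_trigSeries (ι := Fin n)
    (c := fun k => (conj v ^ (k : ℕ) - (ρ : ℂ) ^ (k : ℕ)) • g k) (Summable.of_finite)
    (q := fun k => -((k : ℕ) : ℤ)) (fun i j h => by
      ext; simpa using h)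
  simp only [tsum_fintype] at key
  rw [← Fin.sum_univ_eq_sum_range (fun k => ENNReal.ofReal (‖conj v ^ k - (ρ : ℂ) ^ k‖ ^ 2) *
    ‖g k‖ₑ ^ 2)]
  have e : ∀ k : ℕ, ENNReal.ofReal (‖conj v ^ k - (ρ : ℂ) ^ k‖ ^ 2) * ‖g k‖ₑ ^ 2 =
      ‖(conj v ^ k - (ρ : ℂ) ^ k) • g k‖ₑ ^ 2 := fun k => by
    rw [enorm_smul, mul_pow, ENNReal.ofReal_pow (norm_nonneg _), ofReal_norm]
  simp only [e]
  rw [← key]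
  refine lintegral_congr fun t => ?_
  rw [← Finset.sum_sub_distrib, Fin.sum_univ_eq_sum_range
    (fun k => Complex.exp (((-(k : ℤ) : ℤ) : ℂ) * (t * Complex.I)) •
      ((conj v ^ k - (ρ : ℂ) ^ k) • g k))]
  congr 2
  refine Finset.sum_congr rfl fun k _ => ?_
  rw [← sub_smul, smul_smul]
  congr 1
  have h1 : conj (Complex.exp (t * Complex.I)) ^ k =
      Complex.exp (((-(k : ℤ) : ℤ) : ℂ) * (t * Complex.I)) := by
    rw [← Complex.exp_conj, ← Complex.exp_nat_mul]
    congr 1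
    simp
  rw [map_mul, map_mul, Complex.conj_ofReal, mul_pow, mul_pow, h1]
  ring

/-- The weighted square of differences of a polynomial is dominated by its Hardy norm. -/
theorem exists_double_integral_le {a b : ℝ} (ha : -1 < a) (hb : -1 < b) (hab : 0 ≤ a + b) :
    ∃ K : ℝ, 0 ≤ K ∧ ∀ (n : ℕ) (g : ℕ → H),
      ∫⁻ z in ball (0 : ℂ) 1, singWeight b z * ∫⁻ w in ball (0 : ℂ) 1, singWeight a w *
        (ENNReal.ofReal (‖1 - z * conj w‖ ^ (-(a + b + 3))) *
          ‖∑ k ∈ Finset.range n, conj w ^ k • g k - ∑ k ∈ Finset.range n, conj z ^ k • g k‖ₑ ^ 2) ≤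
      ENNReal.ofReal (K * ∑ k ∈ Finset.range n, ‖g k‖ ^ 2) := by
  -- Any positive τ below a + 1, b + 1 and 1 would do; half of the minimum satisfies all three
  -- strictly.
  set τ : ℝ := min (a + 1) (min (b + 1) 1) / 2 with hτdef
  have hmin : 0 < min (a + 1) (min (b + 1) 1) :=
    lt_min (by linarith) (lt_min (by linarith) one_pos)
  have hτ : 0 < τ := by positivity
  have hτa : τ < a + 1 := (half_lt_self hmin).trans_le (min_le_left _ _)
  have hτb : τ < b + 1 :=
    (half_lt_self hmin).trans_le ((min_le_right _ _).trans (min_le_left _ _))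
  have hτ1 : τ ≤ 1 :=
    ((half_lt_self hmin).trans_le ((min_le_right _ _).trans (min_le_right _ _))).le
  obtain ⟨K, hK, hKk⟩ := exists_lintegral_monomial_le ha hb hτ hτ1 hτa hτb hab
  refine ⟨2 * Real.pi * K, by positivity, fun n g => ?_⟩
  set P : ℂ → H := fun w => ∑ k ∈ Finset.range n, w ^ k • g k with hP
  have hPc : Continuous P := by fun_prop
  have hmD : Measurable fun p : ℂ × ℂ => ‖P (conj p.2) - P (conj p.1)‖ₑ ^ 2 :=
    Continuous.measurable (by fun_prop)
  let F : ℂ → ℂ → ℝ≥0∞ := fun z w => singWeight a w *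
    (ENNReal.ofReal (‖1 - z * conj w‖ ^ (-(a + b + 3))) * ‖P (conj w) - P (conj z)‖ₑ ^ 2)
  have hmS : ∀ c, Measurable (singWeight c) := fun c => by unfold singWeight; fun_prop
  have hmF : Measurable fun p : ℂ × ℂ => F p.1 p.2 :=
    ((hmS a).comp measurable_snd).mul (Measurable.mul (by fun_prop) hmD)
  have hmI : Measurable fun z : ℂ => ∫⁻ w in ball (0 : ℂ) 1, F z w :=
    Measurable.lintegral_prod_right' (f := fun p : ℂ × ℂ => F p.1 p.2) hmF
  change ∫⁻ z in ball (0 : ℂ) 1, singWeight b z * ∫⁻ w in ball (0 : ℂ) 1, F z w ≤ _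
  rw [lintegral_ball_polar (F := fun z => singWeight b z * ∫⁻ w in ball (0 : ℂ) 1, F z w)
    (((hmS b).mul hmI).indicator measurableSet_ball)]
  have e1 : ∀ ρ ∈ Set.Ioo (0 : ℝ) 1, ∫⁻ t in Set.Ioo (-Real.pi) Real.pi, ENNReal.ofReal ρ *
      (singWeight b (ρ * Complex.exp (t * Complex.I)) *
        ∫⁻ w in ball (0 : ℂ) 1, F (ρ * Complex.exp (t * Complex.I)) w) =
      ENNReal.ofReal (2 * Real.pi) * ∑ k ∈ Finset.range n, ‖g k‖ₑ ^ 2 *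
      (ENNReal.ofReal ((1 - ρ) ^ b) *
        ∫⁻ v in ball (0 : ℂ) 1, singWeight a v *
          (ENNReal.ofReal (‖1 - ρ * conj v‖ ^ (-(a + b + 3))) *
            ENNReal.ofReal (‖conj v ^ k - (ρ : ℂ) ^ k‖ ^ 2))) := by
    intro ρ hρ
    have h1 : 0 < 1 - ρ := by linarith [hρ.2]
    have h0 := hρ.1
    -- With z = ρ e^(it) and w = e^(it) v, the kernel and the weight no longer depend on t; only the
    -- polynomial difference does.
    have hF : ∀ t : ℝ, ∀ v : ℂ, F (ρ * Complex.exp (t * Complex.I))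
        (Complex.exp (t * Complex.I) * v) =
        (singWeight a v * ENNReal.ofReal (‖1 - ρ * conj v‖ ^ (-(a + b + 3)))) *
          ‖P (conj (Complex.exp (t * Complex.I) * v)) -
            P (conj (ρ * Complex.exp (t * Complex.I)))‖ₑ ^ 2 := by
      intro t v
      have hu : Complex.exp (t * Complex.I) * conj (Complex.exp (t * Complex.I)) = 1 := by
        rw [Complex.mul_conj, Complex.normSq_eq_norm_sq, Complex.norm_exp_ofReal_mul_I]
        simp
      have e : (ρ : ℂ) * Complex.exp (t * Complex.I) * conj (Complex.exp (t * Complex.I) * v) =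
          ρ * conj v := by
        rw [map_mul]
        linear_combination (ρ : ℂ) * conj v * hu
      simp only [F]
      rw [e, singWeight, singWeight, norm_mul, Complex.norm_exp_ofReal_mul_I, one_mul, mul_assoc]
    have e2 : ∀ t : ℝ, ENNReal.ofReal ρ * (singWeight b (ρ * Complex.exp (t * Complex.I)) *
        ∫⁻ w in ball (0 : ℂ) 1, F (ρ * Complex.exp (t * Complex.I)) w) =
        ENNReal.ofReal ((1 - ρ) ^ b) * ∫⁻ v in ball (0 : ℂ) 1,
          (singWeight a v * ENNReal.ofReal (‖1 - ρ * conj v‖ ^ (-(a + b + 3)))) *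
          ‖P (conj (Complex.exp (t * Complex.I) * v)) -
            P (conj (ρ * Complex.exp (t * Complex.I)))‖ₑ ^ 2 := by
      intro t
      rw [← setLIntegral_ball_rotate t, ← mul_assoc, singWeight, norm_mul_exp_I hρ.1.le,
        ← ENNReal.ofReal_mul h0.le, show ρ * ((1 - ρ) ^ b * ρ⁻¹) = (1 - ρ) ^ b by field_simp]
      simp only [hF]
    simp only [e2]
    have hm3 : Measurable fun p : ℝ × ℂ =>
        (singWeight a p.2 * ENNReal.ofReal (‖1 - ρ * conj p.2‖ ^ (-(a + b + 3)))) *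
          ‖P (conj (Complex.exp (p.1 * Complex.I) * p.2)) -
            P (conj (ρ * Complex.exp (p.1 * Complex.I)))‖ₑ ^ 2 := by
      refine Measurable.mul (((hmS a).comp measurable_snd).mul (by fun_prop)) ?_
      exact Continuous.measurable (by fun_prop)
    rw [lintegral_const_mul' _ _ ENNReal.ofReal_ne_top,
      lintegral_lintegral_swap hm3.aemeasurable]
    have e3 : ∀ v : ℂ, ∫⁻ t in Set.Ioo (-Real.pi) Real.pi,
        (singWeight a v * ENNReal.ofReal (‖1 - ρ * conj v‖ ^ (-(a + b + 3)))) *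
          ‖P (conj (Complex.exp (t * Complex.I) * v)) -
            P (conj (ρ * Complex.exp (t * Complex.I)))‖ₑ ^ 2 =
        ∑ k ∈ Finset.range n, ENNReal.ofReal (2 * Real.pi) * ‖g k‖ₑ ^ 2 * (singWeight a v *
          (ENNReal.ofReal (‖1 - ρ * conj v‖ ^ (-(a + b + 3))) *
            ENNReal.ofReal (‖conj v ^ k - (ρ : ℂ) ^ k‖ ^ 2))) := by
      intro v
      rw [lintegral_const_mul', lintegral_polynomial_difference, Finset.mul_sum, Finset.mul_sum]
      · refine Finset.sum_congr rfl fun k _ => ?_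
        ring
      · exact ENNReal.mul_ne_top ENNReal.ofReal_ne_top ENNReal.ofReal_ne_top
    simp only [e3]
    rw [lintegral_finsetSum, Finset.mul_sum, Finset.mul_sum]
    · refine Finset.sum_congr rfl fun k _ => ?_
      rw [lintegral_const_mul]
      · ring
      · exact (hmS a).mul (by fun_prop)
    · exact fun k _ => ((hmS a).mul (by fun_prop)).const_mul _
  rw [setLIntegral_congr_fun measurableSet_Ioo e1, lintegral_const_mul' _ _ ENNReal.ofReal_ne_top,
    lintegral_finsetSum]
  · calc _ ≤ ENNReal.ofReal (2 * Real.pi) * ∑ k ∈ Finset.range n, ‖g k‖ₑ ^ 2 *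
          ENNReal.ofReal K := by
          gcongr with k
          rw [lintegral_const_mul' _ _ (by simp)]
          gcongr
          exact hKk k
      _ = _ := by
          rw [← Finset.sum_mul, mul_assoc (2 * Real.pi),
            ENNReal.ofReal_mul (p := 2 * Real.pi) (by positivity), ENNReal.ofReal_mul hK,
            ENNReal.ofReal_sum_of_nonneg (fun _ _ => by positivity)]
          simp only [enorm_sq_eq_ofReal]
          ring
  · intro k _
    refine (Measurable.mul (by fun_prop) ?_).const_mul _
    refine Measurable.lintegral_prod_right' (f := fun p : ℝ × ℂ => singWeight a p.2 *
          (ENNReal.ofReal (‖1 - p.1 * conj p.2‖ ^ (-(a + b + 3))) *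
            ENNReal.ofReal (‖conj p.2 ^ k - (p.1 : ℂ) ^ k‖ ^ 2))) ?_
    exact ((hmS a).comp measurable_snd).mul (by fun_prop)

end VecBMOA
end

/-! ### Growth of symbols of bounded weighted Hankel matrices -/

noncomputable section
namespace VecBMOA

/-- There are n + 1 pairs with j + k = n, whence the factor 1 + n in the hypothesis. -/
theorem summable_of_antidiagonal_bound {E : Type*} [NormedAddCommGroup E] [CompleteSpace E]
    {F : ℕ × ℕ → E} {b : ℕ → ℝ} (hb : Summable fun n : ℕ => (1 + n : ℝ) * b n)
    (hF : ∀ j k, ‖F (j, k)‖ ≤ b (j + k)) : Summable fun p => ‖F p‖ := by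
  rw [← Finset.HasAntidiagonal.sigmaAntidiagonalEquivProd.summable_iff]
  change Summable fun x => ‖F (Finset.HasAntidiagonal.sigmaAntidiagonalEquivProd x)‖
  rw [summable_sigma_of_nonneg fun x => norm_nonneg (F (Finset.HasAntidiagonal.sigmaAntidiagonalEquivProd x))]
  refine ⟨fun n => (hasSum_fintype _).summable, ?_⟩
  refine hb.of_nonneg_of_le (fun n => tsum_nonneg fun _ => norm_nonneg _) fun n => ?_
  rw [tsum_fintype]
  refine (Finset.sum_le_card_nsmul _ _ (b n) fun p _ => ?_).trans_eq ?_
  · have := hF p.1.1 p.1.2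
    rwa [Finset.HasAntidiagonal.mem_antidiagonal.mp p.2] at this
  · simp [add_comm]

theorem hasSum_of_antidiagonal {E : Type*} [NormedAddCommGroup E] [CompleteSpace E]
    {F : ℕ × ℕ → E} (hF : Summable fun p => ‖F p‖) {s : E}
    (hs : HasSum (fun n => ∑ p ∈ Finset.HasAntidiagonal.antidiagonal n, F p) s) : HasSum F s := by
  have h := hF.of_norm
  have h2 := (Finset.HasAntidiagonal.sigmaAntidiagonalEquivProd (A := ℕ)).hasSum_iff.mpr h.hasSum
  have h3 := h2.sigma fun n => hasSum_fintype _
  have h4 : HasSum (fun n => ∑ p ∈ Finset.HasAntidiagonal.antidiagonal n, F p) (∑' p, F p) := by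
    convert h3 using 2 with n
    exact (Finset.sum_coe_sort _ _).symm
  rw [hs.unique h4]
  exact h.hasSum

theorem tendsto_sum_range_prod {E : Type*} [NormedAddCommGroup E]
    {F : ℕ × ℕ → E} {s : E} (h : HasSum F s) :
    Tendsto (fun n => ∑ j ∈ Finset.range n, ∑ k ∈ Finset.range n, F (j, k)) atTop (𝓝 s) := by
  have ht : Tendsto (fun n => Finset.range n ×ˢ Finset.range n) atTop atTop := by
    refine tendsto_atTop_finset_of_monotone (fun a b hab => ?_) fun p => ⟨p.1 + p.2 + 1, ?_⟩
    · exact Finset.product_subset_product (Finset.range_mono hab) (Finset.range_mono hab)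
    · simp only [Finset.mem_product, Finset.mem_range]; omega
  refine (h.comp ht).congr fun n => ?_
  rw [Function.comp_apply, Finset.sum_product]

variable {H : Type*} [NormedAddCommGroup H] [InnerProductSpace ℂ H] [CompleteSpace H]

theorem pow_succ_sub_pow_le (M j : ℕ) :
    ((1 + j : ℝ) ^ M - (j : ℝ) ^ M) ≤ M * (1 + j : ℝ) ^ (M - 1) := by
  have := abs_pow_sub_pow_le (1 + j : ℝ) j M
  have hj : (0 : ℝ) ≤ j := Nat.cast_nonneg j
  rw [abs_of_nonneg (by linarith : (0 : ℝ) ≤ 1 + j), abs_of_nonneg hj, max_eq_left (by linarith)] at this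
  simpa using (le_abs_self _).trans this

/-- M comes from (1+j)^M - j^M ≤ M (1+j)^(M-1). The root is that of the constant in
`tsum_rpow_mul_geometric_le` for p = 2(N-1). -/
def blochConst (M : ℕ) (N : ℝ) : ℝ :=
  M * √((2 * (N - 1)) ^ (2 * (N - 1)) * Real.exp 1 * 2 ^ (2 * (N - 1) + 1))

/-- Boundedness of the weighted Hankel matrices controls the growth of the symbol. -/
theorem HankelBound.norm_Dpow_le {α C : ℝ} {M : ℕ} {ψ : Hol (H →L[ℂ] H)}
    (h : HankelBound α ψ.coeff C) (hα : 0 < α) (hN : 1 ≤ M - α) (hC : 0 ≤ C) {w : ℂ}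
    (hw : w ∈ ball (0 : ℂ) 1) :
    ‖Hol.Dpow (M - α) ψ w‖ ≤ blochConst M (M - α) * C * (1 - ‖w‖) ^ (-(M - α)) := by
  have hw1 := mem_ball_zero_iff.mp hw
  have hM0 : M ≠ 0 := by
    rintro rfl
    norm_num at hN
    linarith
  set N : ℝ := M - α with hNdef
  have hp : 0 ≤ 2 * (N - 1) := by linarith
  refine ContinuousLinearMap.opNorm_le_bound _ (by unfold blochConst; have : 0 < 1 - ‖w‖ := by linarith
                                                   positivity) fun y => ?_
  by_cases hy0 : Hol.Dpow N ψ w y = 0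
  · rw [hy0, norm_zero]
    have : 0 < 1 - ‖w‖ := by linarith
    unfold blochConst
    positivity
  -- Testing against x, the vector to be estimated, makes the form equal to ‖x‖²; one factor ‖x‖ is
  -- cancelled at the end.
  set x := Hol.Dpow N ψ w y with hx
  -- These weights telescope: Σ_{j≤n} γ_j = (1+n)^M. With the sequences f and g below, the
  -- antidiagonal sum at level n of the Hankel form is therefore (1+n)^(M-α) w̄^n ⟨x, ψ̂(n) y⟩, so
  -- the whole form is the pairing of x with (D^N ψ)(w) y.
  let γ : ℕ → ℝ := fun j => (1 + j : ℝ) ^ M - (j : ℝ) ^ M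
  have hγ0 : ∀ j, 0 ≤ γ j := fun j => by
    have : (j : ℝ) ^ M ≤ (1 + j : ℝ) ^ M := by gcongr; linarith
    simp only [γ]; linarith
  let f : ℕ → H := fun j => (((1 + j : ℝ) ^ (-α) * γ j : ℝ) : ℂ) • conj w ^ j • x
  let g : ℕ → H := fun k => w ^ k • y
  let F : ℕ × ℕ → ℂ := fun p => (hankelWeight α p.1 p.2 : ℂ) *
    inner ℂ (ψ.coeff (p.1 + p.2) (g p.2)) (f p.1)
  have hFe : ∀ p, F p = (((1 + (p.1 + p.2 : ℕ) : ℝ) ^ (-α) * γ p.1 : ℝ) : ℂ) *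
      (conj w ^ (p.1 + p.2) * inner ℂ (ψ.coeff (p.1 + p.2) y) x) := by
    intro p
    have e : (1 + p.1 : ℝ) ^ α * (1 + p.1 : ℝ) ^ (-α) = 1 := by
      rw [← Real.rpow_add (by positivity)]; simp
    have e' : (((1 + p.1 : ℝ) ^ α : ℝ) : ℂ) * (((1 + p.1 : ℝ) ^ (-α) : ℝ) : ℂ) = 1 := by
      rw [← Complex.ofReal_mul, e, Complex.ofReal_one]
    simp only [F, f, g, hankelWeight, map_smul, inner_smul_left, inner_smul_right, map_pow,
      Complex.ofReal_mul]
    rw [pow_add]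
    linear_combination ((((1 + (p.1 + p.2 : ℕ) : ℝ) ^ (-α) : ℝ) : ℂ) * γ p.1 *
      conj w ^ p.1 * conj w ^ p.2 * inner ℂ (ψ.coeff (p.1 + p.2) y) x) * e'
  let b : ℕ → ℝ := fun n => (1 + n : ℝ) ^ M * ‖w‖ ^ n * ‖ψ.coeff n‖ * (‖y‖ * ‖x‖)
  have hb : Summable fun n : ℕ => (1 + n : ℝ) * b n := by
    refine ((ψ.summable_coeff (M + 1 : ℕ) (norm_nonneg w) hw1).mul_right (‖y‖ * ‖x‖)).congr
      fun n => ?_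
    simp only [b]
    rw [Real.rpow_natCast, pow_succ]
    ring
  have hFb : ∀ j k, ‖F (j, k)‖ ≤ b (j + k) := by
    intro j k
    rw [hFe]
    simp only [norm_mul, norm_pow, RCLike.norm_conj, Complex.norm_real, b]
    rw [Real.norm_of_nonneg (by positivity), Real.norm_of_nonneg (hγ0 j)]
    have h1 : (1 + (j + k : ℕ) : ℝ) ^ (-α) ≤ 1 :=
      Real.rpow_le_one_of_one_le_of_nonpos (by linarith [Nat.cast_nonneg (α := ℝ) (j + k)])
        (by linarith)
    have h2 : γ j ≤ (1 + (j + k : ℕ) : ℝ) ^ M := by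
      have h3 : (1 + j : ℝ) ^ M ≤ (1 + (j + k : ℕ) : ℝ) ^ M := by
        gcongr; omega
      have h4 : (0 : ℝ) ≤ (j : ℝ) ^ M := by positivity
      simp only [γ]; linarith
    have h5 : ‖inner ℂ (ψ.coeff (j + k) y) x‖ ≤ ‖ψ.coeff (j + k)‖ * ‖y‖ * ‖x‖ :=
      (norm_inner_le_norm _ _).trans (by gcongr; exact (ψ.coeff (j + k)).le_opNorm y)
    calc _ ≤ 1 * (1 + (j + k : ℕ) : ℝ) ^ M *
          (‖w‖ ^ (j + k) * (‖ψ.coeff (j + k)‖ * ‖y‖ * ‖x‖)) := by gcongr; exact hγ0 j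
      _ = _ := by ring
  have hsumF := summable_of_antidiagonal_bound hb hFb
  have hsum : HasSum F (inner ℂ x x) := by
    refine hasSum_of_antidiagonal hsumF ?_
    have h0 : HasSum (fun n : ℕ => (((1 + n : ℝ) ^ N : ℝ) : ℂ) • w ^ n • ψ.coeff n y) x := by
      have h1 := ((Hol.Dpow N ψ).hasSum_coeff hw).mapL (ContinuousLinearMap.apply ℂ H y)
      simpa [Hol.coeff_Dpow, smul_comm (w ^ _)] using h1
    have h2 := (innerSLFlip ℂ x).hasSum h0
    simp only [innerSLFlip_apply_apply] at h2
    refine (congrArg (fun u : ℕ → ℂ => HasSum u (inner ℂ x x)) (funext fun n => ?_)).mpr h2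
    have e1 : ∀ p ∈ Finset.HasAntidiagonal.antidiagonal n, F p = (γ p.1 : ℂ) *
        ((((1 + n : ℝ) ^ (-α) : ℝ) : ℂ) * (conj w ^ n * inner ℂ (ψ.coeff n y) x)) := by
      intro p hp
      rw [hFe, Finset.HasAntidiagonal.mem_antidiagonal.mp hp]
      push_cast
      ring
    have e2 : ∑ p ∈ Finset.HasAntidiagonal.antidiagonal n, (γ p.1 : ℂ) = (((1 + n : ℝ) ^ M : ℝ) : ℂ) := by
      rw [← Complex.ofReal_sum,
        Finset.Nat.sum_antidiagonal_eq_sum_range_succ_mk (fun p : ℕ × ℕ => γ p.1)]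
      congr 1
      have := Finset.sum_range_sub (fun j : ℕ => (j : ℝ) ^ M) (n + 1)
      simp only [Nat.cast_add, Nat.cast_one, Nat.cast_zero, zero_pow hM0, sub_zero] at this
      simp only [γ]
      rw [add_comm (1 : ℝ) n, ← this]
      exact Finset.sum_congr rfl fun j _ => by rw [add_comm]
    have e3 : (((1 + n : ℝ) ^ M : ℝ) : ℂ) * (((1 + n : ℝ) ^ (-α) : ℝ) : ℂ) =
        (((1 + n : ℝ) ^ N : ℝ) : ℂ) := by
      rw [← Complex.ofReal_mul, ← Real.rpow_natCast, ← Real.rpow_add (by positivity), hNdef,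
        sub_eq_add_neg]
    rw [Finset.sum_congr rfl e1, ← Finset.sum_mul, e2, inner_smul_left, inner_smul_left, map_pow,
      Complex.conj_ofReal, ← e3]
    ring
  have hle : ∀ n : ℕ, ‖∑ j ∈ Finset.range n, ∑ k ∈ Finset.range n, F (j, k)‖ ≤
      blochConst M N * C * (1 - ‖w‖) ^ (-N) * ‖y‖ * ‖x‖ := by
    intro n
    refine (h n f g).trans ?_
    have hw0 := norm_nonneg w
    have hw2 : ‖w‖ ^ 2 < 1 := by nlinarith
    have hpos : 0 < 1 - ‖w‖ ^ 2 := by linarith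
    have hpos' : 0 < 1 - ‖w‖ := by linarith
    set A : ℝ := (2 * (N - 1)) ^ (2 * (N - 1)) * Real.exp 1 * 2 ^ (2 * (N - 1) + 1) with hA
    have hA0 : 0 ≤ A := by positivity
    have hf : ∑ j ∈ Finset.range n, ‖f j‖ ^ 2 ≤
        M ^ 2 * (A * (1 - ‖w‖ ^ 2) ^ (-(2 * (N - 1) + 1))) * ‖x‖ ^ 2 := by
      have e : ∀ j ∈ Finset.range n, ‖f j‖ ^ 2 ≤
          (M ^ 2 * ‖x‖ ^ 2) * ((1 + j : ℝ) ^ (2 * (N - 1)) * (‖w‖ ^ 2) ^ j) := by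
        intro j _
        have h1 : (1 + j : ℝ) ^ (-α) * γ j ≤ M * (1 + j : ℝ) ^ (N - 1) := by
          calc (1 + j : ℝ) ^ (-α) * γ j ≤ (1 + j : ℝ) ^ (-α) * (M * (1 + j : ℝ) ^ (M - 1)) := by
                gcongr; exact pow_succ_sub_pow_le M j
            _ = M * ((1 + j : ℝ) ^ (-α) * (1 + j : ℝ) ^ ((M - 1 : ℕ) : ℝ)) := by
                rw [Real.rpow_natCast]; ring
            _ = _ := by
                rw [← Real.rpow_add (by positivity), Nat.cast_sub (by omega)]
                congr 2
                rw [hNdef]; push_cast; ring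
        simp only [f, norm_smul, norm_pow, RCLike.norm_conj, Complex.norm_real]
        rw [Real.norm_of_nonneg (mul_nonneg (by positivity) (hγ0 j))]
        calc _ ≤ (M * (1 + j : ℝ) ^ (N - 1) * (‖w‖ ^ j * ‖x‖)) ^ 2 := by
              have := mul_nonneg (show 0 ≤ (1 + j : ℝ) ^ (-α) by positivity) (hγ0 j)
              gcongr
          _ = _ := by
              rw [two_mul, Real.rpow_add (by positivity), ← pow_mul]
              ring
      refine (Finset.sum_le_sum e).trans ?_
      rw [← Finset.mul_sum]
      have h2 := tsum_rpow_mul_geometric_le hp (sq_nonneg ‖w‖) hw2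
      have h3 := (Hol.summable_weight_geom (2 * (N - 1)) (sq_nonneg ‖w‖) hw2).sum_le_tsum
        (Finset.range n) (fun j _ => by positivity)
      calc _ ≤ M ^ 2 * ‖x‖ ^ 2 * (A * (1 - ‖w‖ ^ 2) ^ (-(2 * (N - 1) + 1))) := by
            gcongr; exact h3.trans h2
        _ = _ := by ring
    have hg : ∑ k ∈ Finset.range n, ‖g k‖ ^ 2 ≤ (1 - ‖w‖ ^ 2) ^ (-1 : ℝ) * ‖y‖ ^ 2 := by
      have e : ∀ k ∈ Finset.range n, ‖g k‖ ^ 2 = (‖w‖ ^ 2) ^ k * ‖y‖ ^ 2 := by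
        intro k _
        simp only [g, norm_smul, norm_pow]
        ring
      rw [Finset.sum_congr rfl e, ← Finset.sum_mul, Real.rpow_neg_one,
        ← tsum_geometric_of_lt_one (sq_nonneg ‖w‖) hw2]
      gcongr
      exact (summable_geometric_of_lt_one (sq_nonneg ‖w‖) hw2).sum_le_tsum _
        (fun j _ => by positivity)
    -- The exponents 2(N-1) + 1 from f and 1 from g add up to 2N, so the square root gives the
    -- growth exponent N.
    calc _ ≤ C * √(M ^ 2 * (A * (1 - ‖w‖ ^ 2) ^ (-(2 * (N - 1) + 1))) * ‖x‖ ^ 2) *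
          √((1 - ‖w‖ ^ 2) ^ (-1 : ℝ) * ‖y‖ ^ 2) := by gcongr
      _ = blochConst M N * C * (1 - ‖w‖ ^ 2) ^ (-N) * ‖y‖ * ‖x‖ := by
          rw [mul_assoc, ← Real.sqrt_mul (by positivity)]
          have e : (1 - ‖w‖ ^ 2) ^ (-(2 * (N - 1) + 1)) * (1 - ‖w‖ ^ 2) ^ (-1 : ℝ) =
              ((1 - ‖w‖ ^ 2) ^ (-N)) ^ 2 := by
            rw [← Real.rpow_add hpos, sq (_ ^ (-N)), ← Real.rpow_add hpos]
            congr 1; ring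
          have e2 : M ^ 2 * (A * (1 - ‖w‖ ^ 2) ^ (-(2 * (N - 1) + 1))) * ‖x‖ ^ 2 *
              ((1 - ‖w‖ ^ 2) ^ (-1 : ℝ) * ‖y‖ ^ 2) =
              A * (M * (1 - ‖w‖ ^ 2) ^ (-N) * ‖x‖ * ‖y‖) ^ 2 := by
            linear_combination (M ^ 2 * A * ‖x‖ ^ 2 * ‖y‖ ^ 2) * e
          rw [e2, Real.sqrt_mul hA0, Real.sqrt_sq (by positivity), blochConst]
          ring
      _ ≤ _ := by
          have : (1 - ‖w‖ ^ 2) ^ (-N) ≤ (1 - ‖w‖) ^ (-N) :=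
            Real.rpow_le_rpow_of_nonpos hpos' (by nlinarith) (by linarith)
          unfold blochConst
          gcongr
  have hfin := le_of_tendsto (tendsto_sum_range_prod hsum).norm (Eventually.of_forall hle)
  rw [inner_self_eq_norm_sq_to_K] at hfin
  have hx0 : 0 < ‖x‖ := norm_pos_iff.mpr hy0
  rw [← mul_le_mul_iff_left₀ hx0]
  refine le_trans (le_of_eq ?_) hfin
  simp [sq]

end VecBMOA
end

/-! ### Area integrals against the reproducing kernel -/

noncomputable section
namespace VecBMOA

variable {H : Type*} [NormedAddCommGroup H] [InnerProductSpace ℂ H] [CompleteSpace H]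

/-- The weight of the reproducing formula times the growth bound of the symbol is integrable near
the circle because α - 1 > -1 when α > 0. At the origin the logarithmic power is dominated by 1/|w|.
-/
theorem logWeight_mul_rpow_le {α : ℝ} {M : ℕ} (hM : 2 ≤ M) {w : ℂ} (hw : w ∈ ball (0 : ℂ) 1) :
    ENNReal.ofReal (logWeight ‖w‖ ^ ((M : ℝ) - 1) * (1 - ‖w‖) ^ (-(M - α))) ≤
      ENNReal.ofReal ((2 * ((M : ℝ) - 1)) ^ ((M : ℝ) - 1)) * singWeight (α - 1) w := by
  have hM' : (2 : ℝ) ≤ M := by exact_mod_cast hM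
  have hq : 1 ≤ (M : ℝ) - 1 := by linarith
  have hw1 := mem_ball_zero_iff.mp hw
  have hpos : 0 < 1 - ‖w‖ := by linarith
  rcases (norm_nonneg w).eq_or_lt with h0 | h0
  · rw [← h0, logWeight, Real.log_zero, mul_zero, Real.zero_rpow (by linarith), zero_mul]
    simp
  · rw [singWeight, ← ENNReal.ofReal_mul (by positivity)]
    refine ENNReal.ofReal_le_ofReal ?_
    calc _ ≤ (2 * ((M : ℝ) - 1)) ^ ((M : ℝ) - 1) * ((1 - ‖w‖) ^ ((M : ℝ) - 1) * ‖w‖⁻¹) *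
          (1 - ‖w‖) ^ (-(M - α)) := by
          gcongr; exact logWeight_rpow_le hq h0 hw1
      _ = (2 * ((M : ℝ) - 1)) ^ ((M : ℝ) - 1) *
          (((1 - ‖w‖) ^ ((M : ℝ) - 1) * (1 - ‖w‖) ^ (-(M - α))) * ‖w‖⁻¹) := by ring
      _ = _ := by
          rw [← Real.rpow_add hpos, show (M : ℝ) - 1 + -(M - α) = α - 1 by ring]

theorem lintegral_singWeight_lt_top {a : ℝ} (ha : -1 < a) :
    ∫⁻ w in ball (0 : ℂ) 1, singWeight a w < ∞ := by
  have h := lintegral_kernel_le (z := 0) (s := a + 3) ha (by linarith) (by linarith) (by simp)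
  simp only [zero_mul, sub_zero, norm_one, Real.one_rpow, ENNReal.ofReal_one, one_mul] at h
  exact h.trans_lt ENNReal.ofReal_lt_top

theorem continuousOn_powKernel (M : ℕ) {z : ℂ} (hz : z ∈ ball (0 : ℂ) 1) :
    ContinuousOn (fun w => powKernel M (z * conj w)) (ball 0 1) := by
  have hs := (Hol.summable_weight_geom M (norm_nonneg z) (mem_ball_zero_iff.mp hz))
  refine continuousOn_tsum (fun j => ?_) hs fun j w hw => ?_
  · exact Continuous.continuousOn (by fun_prop)
  · have hw1 := (mem_ball_zero_iff.mp hw).le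
    have e : ‖(1 + j : ℂ)‖ = 1 + j := by
      rw [show (1 + j : ℂ) = ((1 + j : ℝ) : ℂ) by push_cast; rfl, Complex.norm_real,
        Real.norm_of_nonneg (by positivity)]
    rw [norm_mul, norm_pow, norm_pow, e, Real.rpow_natCast, norm_mul, RCLike.norm_conj]
    gcongr
    exact mul_le_of_le_one_right (norm_nonneg z) hw1

theorem enorm_powKernel_le {M : ℕ} {C : ℝ} (hC : 0 ≤ C)
    (h : ∀ ζ : ℂ, ‖ζ‖ < 1 → ‖powKernel M ζ‖ ≤ C * ‖1 - ζ‖ ^ (-(M + 1 : ℝ))) {z w : ℂ}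
    (hz : z ∈ ball (0 : ℂ) 1) (hw : w ∈ ball (0 : ℂ) 1) :
    ‖powKernel M (z * conj w)‖ₑ ≤
      ENNReal.ofReal C * ENNReal.ofReal (‖1 - z * conj w‖ ^ (-(M + 1 : ℝ))) := by
  have hw1 := mem_ball_zero_iff.mp hw
  have hz1 := mem_ball_zero_iff.mp hz
  rw [← ENNReal.ofReal_mul hC, ← ofReal_norm]
  refine ENNReal.ofReal_le_ofReal (h _ ?_)
  rw [norm_mul, RCLike.norm_conj]
  exact mul_lt_one_of_nonneg_of_lt_one_left (norm_nonneg _) hz1 hw1.le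

/-- Integrability of the terms of the reproducing formula. -/
theorem lintegral_powKernel_mul_lt_top {α B : ℝ} {M : ℕ} (hM : 2 ≤ M) (hα : 0 < α)
    {Ψ : Hol (H →L[ℂ] H)}
    (hB : ∀ w ∈ ball (0 : ℂ) 1, ‖Ψ w‖ ≤ B * (1 - ‖w‖) ^ (-(M - α))) (hB0 : 0 ≤ B) {z : ℂ}
    (hz : z ∈ ball (0 : ℂ) 1) (k : ℕ) (y : H) :
    ∫⁻ w in ball (0 : ℂ) 1, ‖(powKernel M (z * conj w) * conj w ^ k) • Ψ w y‖ₑ *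
      ENNReal.ofReal (logWeight ‖w‖ ^ ((M : ℝ) - 1)) < ∞ := by
  obtain ⟨C, hC, h⟩ := exists_norm_powKernel_le M
  have hz1 := mem_ball_zero_iff.mp hz
  have hpos : 0 < 1 - ‖z‖ := by linarith
  have key : ∀ w ∈ ball (0 : ℂ) 1, ‖(powKernel M (z * conj w) * conj w ^ k) • Ψ w y‖ₑ *
      ENNReal.ofReal (logWeight ‖w‖ ^ ((M : ℝ) - 1)) ≤
      (ENNReal.ofReal C * ENNReal.ofReal ((1 - ‖z‖) ^ (-(M + 1 : ℝ))) * ENNReal.ofReal B * ‖y‖ₑ *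
        ENNReal.ofReal ((2 * ((M : ℝ) - 1)) ^ ((M : ℝ) - 1))) * singWeight (α - 1) w := by
    intro w hw
    have hw1 := mem_ball_zero_iff.mp hw
    have hwpos : 0 < 1 - ‖w‖ := by linarith
    have hL := logWeight_nonneg (norm_nonneg w) hw1.le
    have h1 := enorm_powKernel_le hC h hz hw
    have h2 : ‖1 - z * conj w‖ ^ (-(M + 1 : ℝ)) ≤ (1 - ‖z‖) ^ (-(M + 1 : ℝ)) :=
      Real.rpow_le_rpow_of_nonpos hpos (one_sub_norm_le (by simpa using hw1.le)) (by linarith [Nat.cast_nonneg (α := ℝ) M])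
    have h3 : ‖conj w ^ k‖ₑ ≤ 1 := by
      rw [← ofReal_norm, norm_pow, RCLike.norm_conj]
      exact ENNReal.ofReal_le_one.mpr (pow_le_one₀ (norm_nonneg _) hw1.le)
    have h4 : ‖Ψ w y‖ₑ ≤ ENNReal.ofReal B * ENNReal.ofReal ((1 - ‖w‖) ^ (-(M - α))) * ‖y‖ₑ := by
      refine ((Ψ w).le_opENorm y).trans ?_
      gcongr
      rw [← ENNReal.ofReal_mul hB0, ← ofReal_norm]
      exact ENNReal.ofReal_le_ofReal (hB w hw)
    calc _ ≤ (ENNReal.ofReal C * ENNReal.ofReal ((1 - ‖z‖) ^ (-(M + 1 : ℝ)))) * 1 *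
          (ENNReal.ofReal B * ENNReal.ofReal ((1 - ‖w‖) ^ (-(M - α))) * ‖y‖ₑ) *
          ENNReal.ofReal (logWeight ‖w‖ ^ ((M : ℝ) - 1)) := by
          rw [enorm_smul, enorm_mul]
          gcongr
          refine h1.trans ?_
          gcongr
      _ = (ENNReal.ofReal C * ENNReal.ofReal ((1 - ‖z‖) ^ (-(M + 1 : ℝ))) * ENNReal.ofReal B *
          ‖y‖ₑ) * ENNReal.ofReal (logWeight ‖w‖ ^ ((M : ℝ) - 1) * (1 - ‖w‖) ^ (-(M - α))) := by
          rw [ENNReal.ofReal_mul (by positivity)]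
          ring
      _ ≤ _ := by
          rw [mul_assoc _ (ENNReal.ofReal ((2 * ((M : ℝ) - 1)) ^ ((M : ℝ) - 1)))]
          gcongr
          exact logWeight_mul_rpow_le hM hw
  refine (setLIntegral_mono' measurableSet_ball key).trans_lt ?_
  have hfin : ENNReal.ofReal C * ENNReal.ofReal ((1 - ‖z‖) ^ (-(M + 1 : ℝ))) * ENNReal.ofReal B *
      ‖y‖ₑ * ENNReal.ofReal ((2 * ((M : ℝ) - 1)) ^ ((M : ℝ) - 1)) ≠ ∞ := by
    simp [ENNReal.mul_eq_top]
  rw [lintegral_const_mul' _ _ hfin]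
  exact ENNReal.mul_lt_top hfin.lt_top (lintegral_singWeight_lt_top (by linarith))

/-- In the product of the kernel series with the Taylor series of Ψ, the angles select the pairs (j,
j+k). Their radial moment is a constant times (1+j+k)^(-M). For k = 0 this cancels (1+j)^M and the
integral reproduces Ψ; for k > 0 it is a weighted projection of w̄^k Ψ(w) y onto analytic functions.
-/
theorem integral_powKernel_mul {α B : ℝ} {M : ℕ} (hM : 2 ≤ M) (hα : 0 < α)
    {Ψ : Hol (H →L[ℂ] H)}
    (hB : ∀ w ∈ ball (0 : ℂ) 1, ‖Ψ w‖ ≤ B * (1 - ‖w‖) ^ (-(M - α))) (hB0 : 0 ≤ B) {z : ℂ}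
    (hz : z ∈ ball (0 : ℂ) 1) (k : ℕ) (y : H) :
    HasSum (fun j : ℕ => (Real.pi * Real.Gamma M * ((1 + j : ℝ) ^ M *
      (1 + (j + k : ℕ) : ℝ) ^ (-(M : ℝ)))) • z ^ j • Ψ.coeff (j + k) y)
      (∫ w in ball (0 : ℂ) 1, logWeight ‖w‖ ^ ((M : ℝ) - 1) •
        (powKernel M (z * conj w) * conj w ^ k) • Ψ w y) := by
  have hz1 := mem_ball_zero_iff.mp hz
  have e1 : ∀ j : ℕ, ‖(1 + j : ℂ)‖ = 1 + j := fun j => by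
    rw [show (1 + j : ℂ) = ((1 + j : ℝ) : ℂ) by push_cast; rfl, Complex.norm_real,
      Real.norm_of_nonneg (by positivity)]
  let c : ℕ × ℕ → H := fun p => ((1 + p.1 : ℂ) ^ M * z ^ p.1) • Ψ.coeff p.2 y
  let d : ℕ × ℕ → ℕ := fun p => p.1 + p.2 + k
  let q : ℕ × ℕ → ℤ := fun p => p.2 - p.1 - k
  -- This map parametrizes the set q = 0, the only pairs that contribute.
  let ι : ℕ → ℕ × ℕ := fun j => (j, j + k)
  have hι : Function.Injective ι := fun i j h => congrArg Prod.fst h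
  have hq0 : ∀ p, q p = 0 → p ∈ Set.range ι := by
    rintro ⟨j, m⟩ h
    refine ⟨j, Prod.ext rfl ?_⟩
    simp only [q] at h
    simp only [ι]
    omega
  have hqι : ∀ j, q (ι j) = 0 := fun j => by simp [q, ι]
  have hdι : ∀ j, (1 + (d (ι j) : ℝ) / 2) = 1 + (j + k : ℕ) := fun j => by
    simp only [d, ι]; push_cast; ring
  have hΦ : ContinuousOn (fun w => (powKernel M (z * conj w) * conj w ^ k) • Ψ w y) (ball 0 1) :=
    ((continuousOn_powKernel M hz).mul (by fun_prop)).smul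
      (Ψ.continuousOn.clm_apply continuousOn_const)
  have hc : ∀ r ∈ Set.Ioo (0 : ℝ) 1, Summable fun i => r ^ d i * ‖c i‖ := by
    intro r hr
    have h1 := Hol.summable_weight_geom M (norm_nonneg z) hz1
    have h2 := (Ψ.summable_pow_mul_coeff hr.1.le hr.2).mul_right ‖y‖
    have h3 := h1.mul_of_nonneg h2 (fun _ => by positivity)
      (fun _ => mul_nonneg (mul_nonneg (pow_nonneg hr.1.le _) (norm_nonneg _)) (norm_nonneg _))
    refine h3.of_nonneg_of_le (fun p => mul_nonneg (pow_nonneg hr.1.le _) (norm_nonneg _))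
      fun p => ?_
    have hr1 := hr.1.le
    simp only [c, d]
    rw [norm_smul, norm_mul, norm_pow, norm_pow, e1, Real.rpow_natCast]
    have h4 := (Ψ.coeff p.2).le_opNorm y
    have h5 : r ^ (p.1 + p.2 + k) ≤ r ^ p.2 :=
      pow_le_pow_of_le_one hr1 hr.2.le (by omega)
    calc _ ≤ r ^ p.2 * ((1 + p.1 : ℝ) ^ M * ‖z‖ ^ p.1 * (‖Ψ.coeff p.2‖ * ‖y‖)) := by gcongr
      _ = _ := by ring
  have hΦc : ∀ r ∈ Set.Ioo (0 : ℝ) 1, ∀ t : ℝ,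
      (fun w => (powKernel M (z * conj w) * conj w ^ k) • Ψ w y)
        (r * Complex.exp (t * Complex.I)) =
      ∑' i, Complex.exp (q i * (t * Complex.I)) • ((r : ℂ) ^ d i • c i) := by
    intro r hr t
    set w : ℂ := r * Complex.exp (t * Complex.I) with hw
    have hwb : w ∈ ball (0 : ℂ) 1 := mul_exp_I_mem_ball hr t
    have hcw : conj w = r * Complex.exp (-(t * Complex.I)) := by
      rw [hw, map_mul, Complex.conj_ofReal, ← Complex.exp_conj, map_mul, Complex.conj_ofReal,
        Complex.conj_I, mul_neg]
    have hzw : ‖z * conj w‖ < 1 := by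
      rw [norm_mul, RCLike.norm_conj]
      exact mul_lt_one_of_nonneg_of_lt_one_left (norm_nonneg _) hz1 (mem_ball_zero_iff.mp hwb).le
    have h1 := (summable_powKernel M hzw).hasSum
    have h2 : HasSum (fun m => w ^ m • Ψ.coeff m y) (Ψ w y) := by
      simpa using (Ψ.hasSum_coeff hwb).mapL (ContinuousLinearMap.apply ℂ H y)
    have hterm : ∀ p : ℕ × ℕ, Complex.exp (q p * (t * Complex.I)) • ((r : ℂ) ^ d p • c p) =
        conj w ^ k • (((1 + p.1 : ℂ) ^ M * (z * conj w) ^ p.1) • (w ^ p.2 • Ψ.coeff p.2 y)) := by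
      intro p
      simp only [c, smul_smul, d, q]
      congr 1
      rw [hcw, hw]
      simp only [mul_pow, ← Complex.exp_nat_mul]
      have : Complex.exp (((p.2 - p.1 - k : ℤ) : ℂ) * (t * Complex.I)) =
          Complex.exp (k * -(t * Complex.I)) * Complex.exp (p.1 * -(t * Complex.I)) *
          Complex.exp (p.2 * (t * Complex.I)) := by
        rw [← Complex.exp_add, ← Complex.exp_add]
        congr 1
        push_cast
        ring
      rw [this]
      ring
    have hs : Summable fun p : ℕ × ℕ =>
        (((1 + p.1 : ℂ) ^ M * (z * conj w) ^ p.1) • (w ^ p.2 • Ψ.coeff p.2 y)) := by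
      refine Summable.of_norm ?_
      have h3 := h1.summable.norm.mul_of_nonneg
        (g := fun m => ‖w‖ ^ m * ‖Ψ.coeff m‖ * ‖y‖)
        ((Ψ.summable_pow_mul_coeff (norm_nonneg w) (mem_ball_zero_iff.mp hwb)).mul_right ‖y‖)
        (fun _ => norm_nonneg _) (fun _ => by positivity)
      refine h3.of_nonneg_of_le (fun p => norm_nonneg _) fun p => ?_
      rw [norm_smul, norm_smul, norm_pow w, mul_assoc (‖w‖ ^ p.2)]
      gcongr
      exact (Ψ.coeff p.2).le_opNorm y
    simp only [hterm]
    rw [tsum_const_smul'', ← tsum_smul_tsum h1.summable h2.summable hs, h2.tsum_eq, powKernel,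
      smul_smul, mul_comm]
  have hdsum : Summable fun j : ℕ => ‖((1 + j : ℝ) ^ M *
      (1 + (j + k : ℕ) : ℝ) ^ (-(M : ℝ))) • z ^ j • Ψ.coeff (j + k) y‖ := by
    obtain ⟨r, hzr, hr1⟩ := exists_between hz1
    have hr0 : 0 < r := (norm_nonneg z).trans_lt hzr
    have h1 := (Ψ.summable_pow_mul_coeff hr0.le hr1).comp_injective (add_left_injective k)
    refine (h1.mul_right ((r ^ k)⁻¹ * ‖y‖)).of_nonneg_of_le (fun _ => norm_nonneg _) fun j => ?_
    rw [norm_smul, norm_smul, norm_pow, Real.norm_of_nonneg (by positivity)]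
    have h2 : (1 + j : ℝ) ^ M * (1 + (j + k : ℕ) : ℝ) ^ (-(M : ℝ)) ≤ 1 := by
      rw [Real.rpow_neg (by positivity), Real.rpow_natCast, ← div_eq_mul_inv,
        div_le_one (by positivity)]
      gcongr
      omega
    calc _ ≤ 1 * (r ^ j * (‖Ψ.coeff (j + k)‖ * ‖y‖)) := by
          gcongr
          exact (Ψ.coeff (j + k)).le_opNorm y
      _ = _ := by
          simp only [Function.comp_apply]
          rw [pow_add]
          field_simp
  have hcι : ∀ j, (1 + (d (ι j) : ℝ) / 2) ^ (-(M : ℝ)) • c (ι j) = ((1 + j : ℝ) ^ M *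
      (1 + (j + k : ℕ) : ℝ) ^ (-(M : ℝ))) • z ^ j • Ψ.coeff (j + k) y := by
    intro j
    rw [hdι]
    simp only [c, ι, ← Complex.coe_smul, smul_smul]
    congr 1
    push_cast
    ring
  have hdiag : Summable fun i => if q i = 0 then (1 + (d i : ℝ) / 2) ^ (-(M : ℝ)) * ‖c i‖ else 0 := by
    rw [← hι.summable_iff]
    · refine hdsum.congr fun j => ?_
      rw [← hcι, Function.comp_apply, if_pos (hqι j), norm_smul,
        Real.norm_of_nonneg (by positivity)]
    · intro p hp
      exact if_neg fun h => hp (hq0 p h)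
  have hM0 : (0 : ℝ) < M := by exact_mod_cast (by omega : 0 < M)
  rw [integral_ball_trigSeries hM0 hΦ hc hΦc
    (lintegral_powKernel_mul_lt_top hM hα hB hB0 hz k y) hdiag]
  rw [← hι.tsum_eq]
  · have h1 : ∀ j, (if q (ι j) = 0 then (Real.pi * Real.Gamma M *
        (1 + (d (ι j) : ℝ) / 2) ^ (-(M : ℝ))) • c (ι j) else 0) =
        (Real.pi * Real.Gamma M * ((1 + j : ℝ) ^ M *
          (1 + (j + k : ℕ) : ℝ) ^ (-(M : ℝ)))) • z ^ j • Ψ.coeff (j + k) y := by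
      intro j
      rw [if_pos (hqι j), ← smul_smul, hcι, smul_smul]
    simp only [h1]
    refine Summable.hasSum ?_
    simp only [← smul_smul (Real.pi * Real.Gamma M)]
    exact hdsum.of_norm.const_smul _
  · intro p hp
    by_contra h
    exact hp (if_neg fun h' => h (hq0 p h'))

end VecBMOA
end

/-! ### The commutator formula and its pointwise estimate -/

noncomputable section
namespace VecBMOA

variable {H : Type*} [NormedAddCommGroup H] [InnerProductSpace ℂ H] [CompleteSpace H]

/-- The image of a polynomial under a weighted Hankel matrix. -/
def hankelApply (α : ℝ) (p : ℕ → H →L[ℂ] H) (n : ℕ) (g : ℕ → H) (j : ℕ) : H :=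
  ∑ k ∈ Finset.range n, (hankelWeight α j k : ℂ) • p (j + k) (g k)

/-- The form is tested on its own output: for f = u the double sum is Σ ‖u_j‖². Since `HankelBound`
uses one common length for both sequences, g is padded by zeros up to max(m, n). -/
theorem HankelBound.sum_norm_sq_le {α C : ℝ} {p : ℕ → H →L[ℂ] H} (h : HankelBound α p C)
    (n : ℕ) (g : ℕ → H) (m : ℕ) :
    ∑ j ∈ Finset.range m, ‖hankelApply α p n g j‖ ^ 2 ≤
      C ^ 2 * ∑ k ∈ Finset.range n, ‖g k‖ ^ 2 := by
  set l := max m n with hl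
  have hnl : n ≤ l := le_max_right _ _
  set u := hankelApply α p n g with hu
  let g' : ℕ → H := fun k => if k < n then g k else 0
  have hg' : ∑ k ∈ Finset.range l, ‖g' k‖ ^ 2 = ∑ k ∈ Finset.range n, ‖g k‖ ^ 2 := by
    rw [← Finset.sum_subset (Finset.range_mono hnl)]
    · refine Finset.sum_congr rfl fun k hk => ?_
      simp only [g', if_pos (Finset.mem_range.mp hk)]
    · intro k _ hk
      simp [g', if_neg (fun h => hk (Finset.mem_range.mpr h))]
  have hinner : ∀ j, ∑ k ∈ Finset.range l,
      (hankelWeight α j k : ℂ) * inner ℂ (p (j + k) (g' k)) (u j) = inner ℂ (u j) (u j) := by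
    intro j
    rw [← Finset.sum_subset (Finset.range_mono hnl)]
    · conv_rhs => rw [hu, hankelApply, sum_inner]
      refine Finset.sum_congr rfl fun k hk => ?_
      simp only [g', if_pos (Finset.mem_range.mp hk), inner_smul_left, Complex.conj_ofReal]
      rw [hu, hankelApply]
    · intro k _ hk
      simp [g', if_neg (fun h => hk (Finset.mem_range.mpr h))]
  have key := h l u g'
  simp only [hinner] at key
  set S := ∑ j ∈ Finset.range l, ‖u j‖ ^ 2 with hS
  have hS0 : 0 ≤ S := Finset.sum_nonneg fun _ _ => by positivity
  have e : ∑ j ∈ Finset.range l, inner ℂ (u j) (u j) = (S : ℂ) := by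
    rw [hS, Complex.ofReal_sum]
    refine Finset.sum_congr rfl fun j _ => ?_
    rw [inner_self_eq_norm_sq_to_K]
    push_cast
    rfl
  rw [e, Complex.norm_real, Real.norm_of_nonneg hS0, hg'] at key
  have hG : 0 ≤ ∑ k ∈ Finset.range n, ‖g k‖ ^ 2 := Finset.sum_nonneg fun _ _ => by positivity
  set G := ∑ k ∈ Finset.range n, ‖g k‖ ^ 2
  have hSG : S ≤ C ^ 2 * G := by
    rcases hS0.eq_or_lt with h0 | h0
    · rw [← h0]; positivity
    have hs := Real.sqrt_pos.mpr h0
    have h1 : √S ≤ C * √G := by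
      rw [← mul_le_mul_iff_left₀ hs, Real.mul_self_sqrt hS0]
      linarith
    calc S = √S ^ 2 := (Real.sq_sqrt hS0).symm
      _ ≤ (C * √G) ^ 2 := by gcongr
      _ = _ := by rw [mul_pow, Real.sq_sqrt hG]
  refine le_trans ?_ hSG
  exact Finset.sum_le_sum_of_subset_of_nonneg (Finset.range_mono (le_max_left _ _))
    fun _ _ _ => by positivity

theorem HankelBound.norm_hankelApply_le {α C : ℝ} {p : ℕ → H →L[ℂ] H} (h : HankelBound α p C)
    (n : ℕ) (g : ℕ → H) (j : ℕ) :
    ‖hankelApply α p n g j‖ ≤ √(C ^ 2 * ∑ k ∈ Finset.range n, ‖g k‖ ^ 2) := by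
  refine Real.le_sqrt_of_sq_le ((?_ : _ ≤ _).trans (h.sum_norm_sq_le n g (j + 1)))
  exact Finset.single_le_sum (f := fun j => ‖hankelApply α p n g j‖ ^ 2)
    (fun _ _ => by positivity) (Finset.mem_range.mpr (Nat.lt_succ_self j))

/-- Cauchy–Schwarz with half of the kernel put on each factor, as in Schur's test. -/
theorem lintegral_mul_sq_le {X : Type*} [MeasurableSpace X] {μ : Measure X} {k h : X → ℝ≥0∞}
    (hk : AEMeasurable k μ) (hh : AEMeasurable h μ) :
    (∫⁻ x, k x * h x ∂μ) ^ 2 ≤ (∫⁻ x, k x ∂μ) * ∫⁻ x, k x * h x ^ 2 ∂μ := by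
  have key := ENNReal.lintegral_mul_le_Lp_mul_Lq μ Real.HolderConjugate.two_two
    (hk.pow_const (1 / 2 : ℝ)) ((hk.pow_const (1 / 2 : ℝ)).mul hh)
  have e0 : ∀ a : ℝ≥0∞, a ^ (1 / 2 : ℝ) * a ^ (1 / 2 : ℝ) = a := fun a => by
    rw [← ENNReal.rpow_add_of_nonneg _ _ (by norm_num) (by norm_num)]; norm_num
  have e1 : ∀ a : ℝ≥0∞, (a ^ (1 / 2 : ℝ)) ^ (2 : ℝ) = a := fun a => by
    rw [← ENNReal.rpow_mul]; norm_num
  simp only [Pi.mul_apply, ← mul_assoc, e0, e1, ENNReal.mul_rpow_of_nonneg _ _ zero_le_two,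
    ENNReal.rpow_two] at key
  calc _ ≤ ((∫⁻ x, k x ∂μ) ^ (1 / 2 : ℝ) * (∫⁻ x, k x * h x ^ 2 ∂μ) ^ (1 / 2 : ℝ)) ^ 2 := by
        gcongr
    _ = _ := by
        rw [mul_pow, ← ENNReal.rpow_natCast, ← ENNReal.rpow_natCast, ← ENNReal.rpow_mul,
          ← ENNReal.rpow_mul]
        norm_num

/-- The commutator of multiplication by `D^N ψ` with evaluation, as a singular integral. -/
theorem reproducing_formula {α B : ℝ} {M : ℕ} (hM : 2 ≤ M) (hα : 0 < α) {ψ : Hol (H →L[ℂ] H)}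
    (hB : ∀ w ∈ ball (0 : ℂ) 1, ‖Hol.Dpow (M - α) ψ w‖ ≤ B * (1 - ‖w‖) ^ (-(M - α))) (hB0 : 0 ≤ B)
    (n : ℕ) (g : ℕ → H) {U : Hol H} (hU : ∀ j, U.coeff j = hankelApply α ψ.coeff n g j) {z : ℂ}
    (hz : z ∈ ball (0 : ℂ) 1) :
    ∫ w in ball (0 : ℂ) 1, logWeight ‖w‖ ^ ((M : ℝ) - 1) • powKernel M (z * conj w) •
      Hol.Dpow (M - α) ψ w (∑ k ∈ Finset.range n, conj w ^ k • g k -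
        ∑ k ∈ Finset.range n, conj z ^ k • g k) =
    (Real.pi * Real.Gamma M) • (Hol.Dpow (M - α) U z -
      Hol.Dpow (M - α) ψ z (∑ k ∈ Finset.range n, conj z ^ k • g k)) := by
  set N : ℝ := M - α with hN
  set Ψ := Hol.Dpow N ψ with hΨ
  have hml := measurable_logWeight
  have hI : ∀ (k : ℕ) (y : H), IntegrableOn (fun w => logWeight ‖w‖ ^ ((M : ℝ) - 1) •
      (powKernel M (z * conj w) * conj w ^ k) • Ψ w y) (ball 0 1) := by
    intro k y
    have hcont : ContinuousOn (fun w => (powKernel M (z * conj w) * conj w ^ k) • Ψ w y)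
        (ball 0 1) := ((continuousOn_powKernel M hz).mul (by fun_prop)).smul
      (Ψ.continuousOn.clm_apply continuousOn_const)
    have hmeas : Measurable fun w : ℂ => logWeight ‖w‖ ^ ((M : ℝ) - 1) := by fun_prop
    refine ⟨AEStronglyMeasurable.smul (f := fun w : ℂ => logWeight ‖w‖ ^ ((M : ℝ) - 1))
      hmeas.aestronglyMeasurable (hcont.aestronglyMeasurable measurableSet_ball), ?_⟩
    refine lt_of_eq_of_lt (setLIntegral_congr_fun measurableSet_ball fun w hw => ?_)
      (lintegral_powKernel_mul_lt_top hM hα hB hB0 hz k y)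
    have := logWeight_nonneg (norm_nonneg w) (mem_ball_zero_iff.mp hw).le
    simp only
    rw [enorm_smul, Real.enorm_of_nonneg (by positivity), mul_comm]
  have hexp : ∀ w ∈ ball (0 : ℂ) 1, logWeight ‖w‖ ^ ((M : ℝ) - 1) • powKernel M (z * conj w) •
      Ψ w (∑ k ∈ Finset.range n, conj w ^ k • g k - ∑ k ∈ Finset.range n, conj z ^ k • g k) =
      ∑ k ∈ Finset.range n, (logWeight ‖w‖ ^ ((M : ℝ) - 1) •
        (powKernel M (z * conj w) * conj w ^ k) • Ψ w (g k)) -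
      ∑ k ∈ Finset.range n, (logWeight ‖w‖ ^ ((M : ℝ) - 1) •
        (powKernel M (z * conj w) * conj w ^ 0) • Ψ w (conj z ^ k • g k)) := by
    intro w _
    simp only [map_sub, map_sum, smul_sub, Finset.smul_sum, map_smul, pow_zero, mul_one,
      mul_smul]
  rw [setIntegral_congr_fun measurableSet_ball hexp, integral_sub, integral_finsetSum,
    integral_finsetSum, smul_sub]
  rotate_left
  · exact fun k _ => hI 0 _
  · exact fun k _ => hI k _
  · exact integrable_finsetSum _ fun k _ => hI k _
  · exact integrable_finsetSum _ fun k _ => hI 0 _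
  have hM0 : (0 : ℝ) < M := by exact_mod_cast (by omega : 0 < M)
  -- The terms with w̄^k g_k assemble D^N U; the terms evaluated at z̄ are constant in w, so the
  -- case k = 0 merely reproduces D^N ψ.
  congr 1
  · have h1 := hasSum_sum fun k (_ : k ∈ Finset.range n) =>
      integral_powKernel_mul hM hα hB hB0 hz k (g k)
    have h2 := ((Hol.Dpow N U).hasSum_coeff hz).const_smul (Real.pi * Real.Gamma M)
    refine h1.unique ((congrArg (fun v : ℕ → H => HasSum v _) (funext fun j => ?_)).mpr h2)
    rw [Hol.coeff_Dpow, hU, hankelApply, Finset.smul_sum, Finset.smul_sum, Finset.smul_sum]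
    refine Finset.sum_congr rfl fun k _ => ?_
    rw [hΨ, Hol.coeff_Dpow, smul_apply, hankelWeight]
    simp only [← Complex.coe_smul, smul_smul]
    congr 1
    -- Here M = N + α is decisive: (1+j)^M splits into the multiplier of D^N and the numerator of
    -- the Hankel weight, and (1+j+k)^(-M) absorbs the multiplier of D^N ψ to leave the denominator.
    have e1 : ((1 + j : ℝ) ^ M : ℝ) = (1 + j : ℝ) ^ N * (1 + j : ℝ) ^ α := by
      rw [← Real.rpow_add (by positivity), hN, sub_add_cancel, Real.rpow_natCast]
    have e2 : (1 + (j + k : ℕ) : ℝ) ^ (-α) =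
        (1 + (j + k : ℕ) : ℝ) ^ (-(M : ℝ)) * (1 + (j + k : ℕ) : ℝ) ^ N := by
      rw [← Real.rpow_add (by positivity), hN]; congr 1; ring
    rw [e1, e2]
    push_cast
    ring
  · rw [map_sum, Finset.smul_sum]
    refine Finset.sum_congr rfl fun k _ => ?_
    have h1 := integral_powKernel_mul hM hα hB hB0 hz 0 (conj z ^ k • g k)
    have h2 : HasSum (fun j => z ^ j • Ψ.coeff j (conj z ^ k • g k)) (Ψ z (conj z ^ k • g k)) := by
      simpa using (Ψ.hasSum_coeff hz).mapL (ContinuousLinearMap.apply ℂ H (conj z ^ k • g k))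
    refine h1.unique ((congrArg (fun v : ℕ → H => HasSum v _) (funext fun j => ?_)).mpr
      (h2.const_smul (Real.pi * Real.Gamma M)))
    have e : (1 + j : ℝ) ^ M * (1 + (j + 0 : ℕ) : ℝ) ^ (-(M : ℝ)) = 1 := by
      rw [add_zero, Real.rpow_neg (by positivity), Real.rpow_natCast,
        mul_inv_cancel₀ (by positivity)]
    rw [e, mul_one, add_zero]

/-- The growth of Ψ reduces the integrand to a positive kernel times ‖Δ‖. Cauchy–Schwarz with that
kernel as measure gives its total mass, at most a multiple of (1-|z|)^(-(M-α)) by Forelli–Rudin,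
times the integral of ‖Δ‖² against it. -/
theorem enorm_singular_integral_sq_le {α B K : ℝ} {M : ℕ} (hM : 2 ≤ M) (hα : 0 < α)
    (hαM : α < M) {Ψ : Hol (H →L[ℂ] H)}
    (hB : ∀ w ∈ ball (0 : ℂ) 1, ‖Ψ w‖ ≤ B * (1 - ‖w‖) ^ (-(M - α))) (hB0 : 0 ≤ B) (hK : 0 ≤ K)
    (hKer : ∀ ζ : ℂ, ‖ζ‖ < 1 → ‖powKernel M ζ‖ ≤ K * ‖1 - ζ‖ ^ (-(M + 1 : ℝ)))
    {Δ : ℂ → H} (hΔ : Continuous Δ) {z : ℂ} (hz : z ∈ ball (0 : ℂ) 1) :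
    ‖∫ w in ball (0 : ℂ) 1, logWeight ‖w‖ ^ ((M : ℝ) - 1) • powKernel M (z * conj w) •
      Ψ w (Δ w)‖ₑ ^ 2 ≤
    ENNReal.ofReal ((K * B * (2 * ((M : ℝ) - 1)) ^ ((M : ℝ) - 1)) ^ 2 *
        (2 * Real.pi * ((M - α)⁻¹ + α⁻¹)) * (1 - ‖z‖) ^ (-(M - α))) *
      ∫⁻ w in ball (0 : ℂ) 1, singWeight (α - 1) w *
        (ENNReal.ofReal (‖1 - z * conj w‖ ^ (-(M + 1 : ℝ))) * ‖Δ w‖ₑ ^ 2) := by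
  have hz1 := mem_ball_zero_iff.mp hz
  have hM' : (2 : ℝ) ≤ M := by exact_mod_cast hM
  have hpos : 0 < 1 - ‖z‖ := by linarith
  have hNp : 0 < M - α := by linarith
  have hbase : 0 ≤ 2 * ((M : ℝ) - 1) := by linarith
  set c := (2 * ((M : ℝ) - 1)) ^ ((M : ℝ) - 1) with hc
  have hc0 : 0 ≤ c := by positivity
  set ker : ℂ → ℝ≥0∞ := fun w =>
    ENNReal.ofReal (‖1 - z * conj w‖ ^ (-(M + 1 : ℝ))) * singWeight (α - 1) w with hker
  have hkerm : Measurable ker := by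
    simp only [hker]; unfold singWeight; fun_prop
  have h1 : ∀ w ∈ ball (0 : ℂ) 1, ‖logWeight ‖w‖ ^ ((M : ℝ) - 1) • powKernel M (z * conj w) •
      Ψ w (Δ w)‖ₑ ≤ ENNReal.ofReal (K * B * c) * (ker w * ‖Δ w‖ₑ) := by
    intro w hw
    have hw1 := mem_ball_zero_iff.mp hw
    have hwpos : 0 < 1 - ‖w‖ := by linarith
    have hL := logWeight_nonneg (norm_nonneg w) hw1.le
    have h4 : ‖Ψ w (Δ w)‖ₑ ≤ ENNReal.ofReal B * ENNReal.ofReal ((1 - ‖w‖) ^ (-(M - α))) * ‖Δ w‖ₑ := by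
      refine ((Ψ w).le_opENorm _).trans ?_
      gcongr
      rw [← ENNReal.ofReal_mul hB0, ← ofReal_norm]
      exact ENNReal.ofReal_le_ofReal (hB w hw)
    calc _ ≤ ENNReal.ofReal (logWeight ‖w‖ ^ ((M : ℝ) - 1)) *
          ((ENNReal.ofReal K * ENNReal.ofReal (‖1 - z * conj w‖ ^ (-(M + 1 : ℝ)))) *
          (ENNReal.ofReal B * ENNReal.ofReal ((1 - ‖w‖) ^ (-(M - α))) * ‖Δ w‖ₑ)) := by
          rw [enorm_smul, enorm_smul, Real.enorm_of_nonneg (by positivity)]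
          gcongr
          exact enorm_powKernel_le hK hKer hz hw
      _ = (ENNReal.ofReal K * ENNReal.ofReal B *
          ENNReal.ofReal (‖1 - z * conj w‖ ^ (-(M + 1 : ℝ))) * ‖Δ w‖ₑ) *
          ENNReal.ofReal (logWeight ‖w‖ ^ ((M : ℝ) - 1) * (1 - ‖w‖) ^ (-(M - α))) := by
          rw [ENNReal.ofReal_mul (by positivity)]
          ring
      _ ≤ (ENNReal.ofReal K * ENNReal.ofReal B *
          ENNReal.ofReal (‖1 - z * conj w‖ ^ (-(M + 1 : ℝ))) * ‖Δ w‖ₑ) *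
          (ENNReal.ofReal c * singWeight (α - 1) w) := by
          gcongr
          exact logWeight_mul_rpow_le hM hw
      _ = _ := by
          rw [ENNReal.ofReal_mul (by positivity), ENNReal.ofReal_mul hK]
          ring
  have h2 : ‖∫ w in ball (0 : ℂ) 1, logWeight ‖w‖ ^ ((M : ℝ) - 1) • powKernel M (z * conj w) •
      Ψ w (Δ w)‖ₑ ≤ ENNReal.ofReal (K * B * c) * ∫⁻ w in ball (0 : ℂ) 1, ker w * ‖Δ w‖ₑ := by
    refine (enorm_integral_le_lintegral_enorm _).trans ?_
    rw [← lintegral_const_mul' _ _ ENNReal.ofReal_ne_top]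
    exact setLIntegral_mono' measurableSet_ball h1
  have h3 : ∫⁻ w in ball (0 : ℂ) 1, ker w ≤
      ENNReal.ofReal (2 * Real.pi * ((M - α)⁻¹ + α⁻¹) * (1 - ‖z‖) ^ (-(M - α))) := by
    have := lintegral_kernel_le (a := α - 1) (s := M + 1) (by linarith) (by linarith) (by linarith) hz1
    refine this.trans_eq ?_
    congr 3 <;> ring_nf
  calc _ ≤ (ENNReal.ofReal (K * B * c) * ∫⁻ w in ball (0 : ℂ) 1, ker w * ‖Δ w‖ₑ) ^ 2 := by gcongr
    _ ≤ ENNReal.ofReal (K * B * c) ^ 2 *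
        (ENNReal.ofReal (2 * Real.pi * ((M - α)⁻¹ + α⁻¹) * (1 - ‖z‖) ^ (-(M - α))) *
          ∫⁻ w in ball (0 : ℂ) 1, ker w * ‖Δ w‖ₑ ^ 2) := by
        rw [mul_pow]
        gcongr
        refine (lintegral_mul_sq_le hkerm.aemeasurable hΔ.enorm.measurable.aemeasurable).trans ?_
        gcongr
    _ = _ := by
        rw [← mul_assoc, ← ENNReal.ofReal_pow (by positivity), ← ENNReal.ofReal_mul (by positivity)]
        congr 1
        · congr 1; ring
        · refine lintegral_congr fun w => ?_
          simp only [hker]; ring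

end VecBMOA
end

/-! ### From bounded weighted Hankel matrices to Carleson embeddings -/

noncomputable section
namespace VecBMOA

set_option linter.unusedSectionVars false

variable {H : Type*} [NormedAddCommGroup H] [InnerProductSpace ℂ H] [CompleteSpace H]

theorem ae_ne_zero_restrict_ball : ∀ᵐ z ∂(volume.restrict (ball (0 : ℂ) 1)), z ≠ 0 ∧ z ∈ ball (0 : ℂ) 1 := by
  have h1 : ∀ᵐ z ∂(volume.restrict (ball (0 : ℂ) 1)), z ≠ 0 :=
    ae_restrict_of_ae (Measure.ae_ne volume 0)
  filter_upwards [h1, ae_restrict_mem measurableSet_ball] with z hz hz' using ⟨hz, hz'⟩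

theorem enorm_sub_sq_le {E : Type*} [NormedAddCommGroup E] (x y : E) :
    ‖x - y‖ₑ ^ 2 ≤ 2 * ‖x‖ₑ ^ 2 + 2 * ‖y‖ₑ ^ 2 := by
  have h : ‖x - y‖ ^ 2 ≤ 2 * ‖x‖ ^ 2 + 2 * ‖y‖ ^ 2 := by
    have := norm_sub_le x y
    nlinarith [sq_nonneg (‖x‖ - ‖y‖), norm_nonneg (x - y)]
  rw [enorm_sq_eq_ofReal, enorm_sq_eq_ofReal, enorm_sq_eq_ofReal]
  calc _ ≤ ENNReal.ofReal (2 * ‖x‖ ^ 2 + 2 * ‖y‖ ^ 2) := ENNReal.ofReal_le_ofReal h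
    _ = _ := by
      rw [ENNReal.ofReal_add (by positivity) (by positivity), ENNReal.ofReal_mul zero_le_two,
        ENNReal.ofReal_mul zero_le_two, ENNReal.ofReal_ofNat]

/-- Bounded weighted Hankel matrices satisfy the Carleson embedding condition of every order
`M - α ≥ 1` with an integer `M ≥ 2`. -/
theorem exists_carlesonBound {α : ℝ} {M : ℕ} (hM : 2 ≤ M) (hα : 0 < α) (hN : 1 ≤ M - α) :
    ∃ K : ℝ, 0 ≤ K ∧ ∀ (ψ : Hol (H →L[ℂ] H)) (C : ℝ), 0 ≤ C → HankelBound α ψ.coeff C →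
      CarlesonBound (M - α) ψ (K * C) := by
  obtain ⟨K₁, hK₁, hKer⟩ := exists_norm_powKernel_le M
  -- With a = α - 1 and b = N - 1 one has a + b + 3 = M + 1, the order of the kernel, and a + b = M
  -- - 2 ≥ 0, which is why M ≥ 2 is required.
  obtain ⟨K₂, hK₂, hdouble⟩ := exists_double_integral_le (H := H) (a := α - 1) (b := M - α - 1)
    (by linarith) (by linarith) (by linarith [show (2 : ℝ) ≤ M by exact_mod_cast hM])
  have hM' : (2 : ℝ) ≤ M := by exact_mod_cast hM
  have hM0 : (0 : ℝ) < M := by linarith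
  set N : ℝ := M - α with hNdef
  set c := (2 * ((M : ℝ) - 1)) ^ ((M : ℝ) - 1) with hc
  have hc0 : 0 ≤ c := Real.rpow_nonneg (by linarith) _
  set P := Real.pi * Real.Gamma M with hP
  have hP0 : 0 < P := by have := Real.Gamma_pos_of_pos hM0; positivity
  have hΓ : 0 < Real.Gamma (2 * N) := Real.Gamma_pos_of_pos (by linarith)
  have hbl : 0 ≤ blochConst M N := by
    have : 0 ≤ 2 * (N - 1) := by linarith
    unfold blochConst; positivity
  have hN0 : 0 < N := by linarith
  set A := (K₁ * blochConst M N * c) ^ 2 * (2 * Real.pi * (N⁻¹ + α⁻¹)) with hA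
  have hA0 : 0 ≤ A := by positivity
  set Q := 2 * (Real.pi * Real.Gamma (2 * N)) + 2 * (P⁻¹ ^ 2 * A * 2 ^ (2 * N - 1) * K₂) with hQ
  have hQ0 : 0 ≤ Q := by positivity
  refine ⟨√Q, Real.sqrt_nonneg _, fun ψ C hC h n g => ?_⟩
  set G := ∑ k ∈ Finset.range n, ‖g k‖ ^ 2 with hG
  have hG0 : 0 ≤ G := Finset.sum_nonneg fun _ _ => by positivity
  let U : Hol H := Hol.ofCoeff (hankelApply α ψ.coeff n g)
    (Hol.summable_of_bounded (h.norm_hankelApply_le n g))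
  have hU : ∀ j, U.coeff j = hankelApply α ψ.coeff n g j := fun j => Hol.coeff_ofCoeff _ j
  have hB : ∀ w ∈ ball (0 : ℂ) 1, ‖Hol.Dpow N ψ w‖ ≤ blochConst M N * C * (1 - ‖w‖) ^ (-N) :=
    fun w hw => h.norm_Dpow_le hα hN hC hw
  let E : ℂ → H := fun z => ∫ w in ball (0 : ℂ) 1, logWeight ‖w‖ ^ ((M : ℝ) - 1) •
    powKernel M (z * conj w) • Hol.Dpow N ψ w (∑ k ∈ Finset.range n, conj w ^ k • g k -
        ∑ k ∈ Finset.range n, conj z ^ k • g k)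
  -- The integrand of the embedding is an analytic function with known Bergman norm minus a
  -- commutator, and the two are estimated separately.
  have hform : ∀ z ∈ ball (0 : ℂ) 1, Hol.Dpow N ψ z (Hol.poly n g (conj z)) =
      Hol.Dpow N U z - P⁻¹ • E z := by
    intro z hz
    have hz' : conj z ∈ ball (0 : ℂ) 1 := by simpa using hz
    have := reproducing_formula hM hα hB (by positivity) n g hU hz
    simp only [E]
    rw [this, smul_smul, inv_mul_cancel₀ hP0.ne', one_smul, Hol.poly_apply _ _ hz']
    abel
  have hUnorm : U.h2Norm ^ 2 ≤ ENNReal.ofReal (C ^ 2 * G) := by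
    rw [Hol.h2Norm_sq]
    refine ENNReal.tsum_le_of_sum_range_le fun m => ?_
    simp only [hU, enorm_sq_eq_ofReal]
    rw [← ENNReal.ofReal_sum_of_nonneg fun _ _ => by positivity]
    exact ENNReal.ofReal_le_ofReal (h.sum_norm_sq_le n g m)
  have hI1 : ∫⁻ z in ball (0 : ℂ) 1, ‖Hol.Dpow N U z‖ₑ ^ 2 *
      ENNReal.ofReal ((1 - ‖z‖ ^ 2) ^ (2 * N - 1)) ≤
      ENNReal.ofReal (Real.pi * Real.Gamma (2 * N) * (C ^ 2 * G)) := by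
    rw [ENNReal.ofReal_mul (by positivity)]
    refine le_trans ?_ ((Hol.lintegral_Dpow_logWeight U hN0).trans_le (by gcongr))
    refine lintegral_mono_ae ?_
    filter_upwards [ae_ne_zero_restrict_ball] with z hz
    have hz1 := mem_ball_zero_iff.mp hz.2
    gcongr
    · nlinarith [norm_nonneg z]
    · linarith
    · exact one_sub_sq_le_logWeight (norm_pos_iff.mpr hz.1)
  have hI2 : ∫⁻ z in ball (0 : ℂ) 1, ‖P⁻¹ • E z‖ₑ ^ 2 *
      ENNReal.ofReal ((1 - ‖z‖ ^ 2) ^ (2 * N - 1)) ≤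
      ENNReal.ofReal (P⁻¹ ^ 2 * A * 2 ^ (2 * N - 1) * K₂ * (C ^ 2 * G)) := by
    have hpt : ∀ᵐ z ∂(volume.restrict (ball (0 : ℂ) 1)), ‖P⁻¹ • E z‖ₑ ^ 2 *
        ENNReal.ofReal ((1 - ‖z‖ ^ 2) ^ (2 * N - 1)) ≤
        ENNReal.ofReal (P⁻¹ ^ 2 * A * C ^ 2 * 2 ^ (2 * N - 1)) * (singWeight (N - 1) z *
          ∫⁻ w in ball (0 : ℂ) 1, singWeight (α - 1) w *
          (ENNReal.ofReal (‖1 - z * conj w‖ ^ (-(α - 1 + (N - 1) + 3))) *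
          ‖∑ k ∈ Finset.range n, conj w ^ k • g k - ∑ k ∈ Finset.range n, conj z ^ k • g k‖ₑ ^ 2)) := by
      filter_upwards [ae_ne_zero_restrict_ball] with z hz
      have hz1 := mem_ball_zero_iff.mp hz.2
      have hpos : 0 < 1 - ‖z‖ := by linarith
      have hz0 := norm_pos_iff.mpr hz.1
      have hE := enorm_singular_integral_sq_le hM hα (by linarith) hB (by positivity) hK₁ hKer
        (Δ := fun w => ∑ k ∈ Finset.range n, conj w ^ k • g k -
          ∑ k ∈ Finset.range n, conj z ^ k • g k) (by fun_prop) hz.2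
      rw [← hNdef, ← hc] at hE
      have hexp : α - 1 + (N - 1) + 3 = (M + 1 : ℝ) := by rw [hNdef]; ring
      rw [hexp]
      set I := ∫⁻ w in ball (0 : ℂ) 1, singWeight (α - 1) w *
          (ENNReal.ofReal (‖1 - z * conj w‖ ^ (-(M + 1 : ℝ))) *
          ‖∑ k ∈ Finset.range n, conj w ^ k • g k - ∑ k ∈ Finset.range n, conj z ^ k • g k‖ₑ ^ 2)
      -- The loss (1-|z|)^(-N) against the embedding weight leaves (1-|z|)^(N-1). The factor 1/|z| ≥
      -- 1 is inserted only to match `singWeight`.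
      have hw : (1 - ‖z‖) ^ (-N) * (1 - ‖z‖ ^ 2) ^ (2 * N - 1) ≤
          2 ^ (2 * N - 1) * ((1 - ‖z‖) ^ (N - 1) * ‖z‖⁻¹) := by
        have e : (1 - ‖z‖ ^ 2) ≤ 2 * (1 - ‖z‖) := by nlinarith
        calc _ ≤ (1 - ‖z‖) ^ (-N) * (2 * (1 - ‖z‖)) ^ (2 * N - 1) := by
              gcongr
              · nlinarith
              · linarith
          _ = 2 ^ (2 * N - 1) * ((1 - ‖z‖) ^ (N - 1) * 1) := by
              rw [Real.mul_rpow zero_le_two hpos.le, mul_left_comm, ← Real.rpow_add hpos, mul_one]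
              congr 2; ring
          _ ≤ _ := by
              gcongr
              exact (one_le_inv₀ hz0).mpr hz1.le
      have hom : 0 ≤ 1 - ‖z‖ ^ 2 := by nlinarith
      calc _ ≤ ENNReal.ofReal (P⁻¹ ^ 2) * (ENNReal.ofReal ((K₁ * (blochConst M N * C) * c) ^ 2 *
            (2 * Real.pi * (N⁻¹ + α⁻¹)) * (1 - ‖z‖) ^ (-N)) * I) *
            ENNReal.ofReal ((1 - ‖z‖ ^ 2) ^ (2 * N - 1)) := by
            rw [enorm_smul, mul_pow, Real.enorm_of_nonneg (by positivity),
              ← ENNReal.ofReal_pow (by positivity)]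
            gcongr ENNReal.ofReal (P⁻¹ ^ 2) * ?_ * _
        _ = ENNReal.ofReal (P⁻¹ ^ 2 * A * C ^ 2 * ((1 - ‖z‖) ^ (-N) *
            (1 - ‖z‖ ^ 2) ^ (2 * N - 1))) * I := by
            rw [← mul_assoc, ← ENNReal.ofReal_mul (by positivity), mul_right_comm,
              ← ENNReal.ofReal_mul (by positivity)]
            congr 2
            rw [hA]; ring
        _ ≤ ENNReal.ofReal (P⁻¹ ^ 2 * A * C ^ 2 * (2 ^ (2 * N - 1) *
            ((1 - ‖z‖) ^ (N - 1) * ‖z‖⁻¹))) * I := by gcongr ENNReal.ofReal (_ * ?_) * _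
        _ = _ := by
            rw [singWeight, ← mul_assoc,
              ENNReal.ofReal_mul (p := P⁻¹ ^ 2 * A * C ^ 2 * 2 ^ (2 * N - 1)) (by positivity), mul_assoc]
    refine (lintegral_mono_ae hpt).trans ?_
    rw [lintegral_const_mul' _ _ ENNReal.ofReal_ne_top]
    calc _ ≤ ENNReal.ofReal (P⁻¹ ^ 2 * A * C ^ 2 * 2 ^ (2 * N - 1)) * ENNReal.ofReal (K₂ * G) := by
          gcongr ENNReal.ofReal _ * ?_
          exact hdouble n g
      _ = _ := by
          rw [← ENNReal.ofReal_mul (by positivity)]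
          congr 1; ring
  have hmeas : AEMeasurable (fun z => 2 * (‖Hol.Dpow N U z‖ₑ ^ 2 *
      ENNReal.ofReal ((1 - ‖z‖ ^ 2) ^ (2 * N - 1)))) (volume.restrict (ball 0 1)) :=
    ((((Hol.continuousOn _).enorm.aemeasurable measurableSet_ball).pow_const 2).mul
      (by fun_prop)).const_mul 2
  have hpt : ∀ z ∈ ball (0 : ℂ) 1, ‖Hol.Dpow N ψ z (Hol.poly n g (conj z))‖ₑ ^ 2 *
      ENNReal.ofReal ((1 - ‖z‖ ^ 2) ^ (2 * N - 1)) ≤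
      2 * (‖Hol.Dpow N U z‖ₑ ^ 2 * ENNReal.ofReal ((1 - ‖z‖ ^ 2) ^ (2 * N - 1))) +
      2 * (‖P⁻¹ • E z‖ₑ ^ 2 * ENNReal.ofReal ((1 - ‖z‖ ^ 2) ^ (2 * N - 1))) := by
    intro z hz
    rw [hform z hz, ← mul_assoc, ← mul_assoc, ← add_mul]
    gcongr
    exact enorm_sub_sq_le _ _
  refine (setLIntegral_mono' measurableSet_ball hpt).trans ?_
  rw [lintegral_add_left' hmeas, lintegral_const_mul' _ _ (by simp),
    lintegral_const_mul' _ _ (by simp)]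
  calc _ ≤ 2 * ENNReal.ofReal (Real.pi * Real.Gamma (2 * N) * (C ^ 2 * G)) +
        2 * ENNReal.ofReal (P⁻¹ ^ 2 * A * 2 ^ (2 * N - 1) * K₂ * (C ^ 2 * G)) := by gcongr
    _ = _ := by
        rw [mul_pow, Real.sq_sqrt hQ0, ← ENNReal.ofReal_ofNat 2, ← ENNReal.ofReal_mul (by norm_num),
          ← ENNReal.ofReal_mul (by norm_num), ← ENNReal.ofReal_add (by positivity) (by positivity)]
        congr 1
        rw [hQ]; ring

/-- Bounded weighted Hankel matrices satisfy the Carleson embedding condition of order one. -/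
theorem exists_carlesonBound_one {α : ℝ} (hα : 0 < α) :
    ∃ K : ℝ, 0 ≤ K ∧ ∀ (ψ : Hol (H →L[ℂ] H)) (C : ℝ), 0 ≤ C → HankelBound α ψ.coeff C →
      CarlesonBound 1 ψ (K * C) := by
  -- This integer satisfies both M ≥ 2 and M - α ≥ 1.
  set M : ℕ := ⌈α⌉₊ + 1 with hM
  have h1 : 0 < ⌈α⌉₊ := Nat.ceil_pos.mpr hα
  have hM2 : 2 ≤ M := by omega
  have hN : 1 ≤ M - α := by
    have := Nat.le_ceil α
    rw [hM]; push_cast; linarith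
  obtain ⟨K₁, hK₁, H₁⟩ := exists_carlesonBound (H := H) hM2 hα hN
  have hβ : (0 : ℝ) < M - 1 := by
    have : (2 : ℝ) ≤ M := by exact_mod_cast hM2
    linarith
  have e : (M : ℝ) - (M - 1) = 1 := by ring
  -- Second passage with exponent M - 1 in place of α, for which the resulting embedding has order M
  -- - (M - 1) = 1. The order N = M - α of the first passage serves only to reach the exponent M -
  -- 1.
  obtain ⟨K₂, hK₂, H₂⟩ := exists_carlesonBound (H := H) hM2 hβ e.ge
  rw [e] at H₂
  set N : ℝ := M - α
  set q := (Real.pi * Real.Gamma ((M - 1) + N))⁻¹ * √(2 ^ (2 * N - 1) * Real.pi *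
        (Real.Gamma (2 * (M - 1)) + Real.Gamma (2 * (M - 1) + (2 * N - 1)))) with hq
  have hΓ := Real.Gamma_pos_of_pos (show (0 : ℝ) < (M - 1) + N by linarith)
  have hq0 : 0 ≤ q := by positivity
  refine ⟨K₂ * (q * K₁), by positivity, fun ψ C hC h => ?_⟩
  have h2 := (H₁ ψ C hC h).hankelBound hN hβ (by positivity)
  have h3 := H₂ ψ _ (by positivity) h2
  rwa [← mul_assoc q, ← mul_assoc] at h3

end VecBMOA
end

noncomputable section
namespace VecBMOA

variable {H : Type*} [NormedAddCommGroup H] [InnerProductSpace ℂ H] [CompleteSpace H]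

/-! ### Carleson BMOA and Hankel matrices -/

theorem Hol.extendsBeyond_poly {Y : Type*} [NormedAddCommGroup Y] [NormedSpace ℂ Y]
    [CompleteSpace Y] (n : ℕ) (g : ℕ → Y) : (Hol.poly n g).ExtendsBeyond :=
  ⟨2, by norm_num, fun z => ∑ k ∈ Finset.range n, z ^ k • g k,
    Differentiable.differentiableOn (by fun_prop), fun _ hz => (Hol.poly_apply n g hz).symm⟩

theorem lintegral_le_bmoaCNorm_sq (φ : Hol (H →L[ℂ] H)) {f : Hol H} (hf : f.ExtendsBeyond)
    (h1 : f.h2Norm = 1) :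
    ∫⁻ z in ball (0 : ℂ) 1, ‖(Hol.Dpow 1 φ z) (f (conj z))‖ₑ ^ 2 * ENNReal.ofReal (1 - ‖z‖ ^ 2) ≤
      bmoaCNorm φ ^ 2 := by
  have := le_iSup₂ (f := fun (f : Hol H) (_ : f.ExtendsBeyond ∧ f.h2Norm = 1) =>
    ∫⁻ z in ball (0 : ℂ) 1,
      ‖(Hol.Dpow 1 φ z) (f (conj z))‖ₑ ^ 2 * ENNReal.ofReal (1 - ‖z‖ ^ 2)) f ⟨hf, h1⟩
  refine this.trans_eq ?_
  rw [bmoaCNorm, ← ENNReal.rpow_natCast, ← ENNReal.rpow_mul]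
  norm_num

/-- Polynomials extend beyond the disc, so this is homogeneity, after normalizing the polynomial to
Hardy norm one. -/
theorem carlesonBound_bmoaCNorm {φ : Hol (H →L[ℂ] H)} (hφ : bmoaCNorm φ ≠ ∞) :
    CarlesonBound 1 φ (bmoaCNorm φ).toReal := by
  intro n g
  have hG : 0 ≤ ∑ k ∈ Finset.range n, ‖g k‖ ^ 2 := Finset.sum_nonneg fun _ _ => by positivity
  set G := ∑ k ∈ Finset.range n, ‖g k‖ ^ 2 with hGdef
  have hexp : (2 * (1 : ℝ) - 1) = 1 := by norm_num
  simp only [hexp, Real.rpow_one]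
  -- The zero polynomial cannot be normalized.
  rcases hG.eq_or_lt with h0 | h0
  · have hz : ∀ k ∈ Finset.range n, g k = 0 := by
      intro k hk
      have := (Finset.sum_eq_zero_iff_of_nonneg (fun _ _ => by positivity)).mp h0.symm k hk
      simpa using this
    have e : ∀ z ∈ ball (0 : ℂ) 1, ‖Hol.Dpow 1 φ z (Hol.poly n g (conj z))‖ₑ ^ 2 *
        ENNReal.ofReal (1 - ‖z‖ ^ 2) = 0 := by
      intro z hz'
      rw [Hol.poly_apply _ _ (by simpa using hz'), Finset.sum_eq_zero fun k hk => by rw [hz k hk, smul_zero]]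
      simp
    rw [setLIntegral_congr_fun measurableSet_ball e]
    simp
  · set s := √G with hs
    have hs0 : 0 < s := Real.sqrt_pos.mpr h0
    have hss : s ^ 2 = G := Real.sq_sqrt hG
    let g' : ℕ → H := fun k => ((s⁻¹ : ℝ) : ℂ) • g k
    have hn : (Hol.poly n g').h2Norm = 1 := by
      have h2 : (Hol.poly n g').h2Norm ^ 2 = 1 := by
        rw [Hol.h2Norm_poly_sq]
        have : ∑ k ∈ Finset.range n, ‖g' k‖ ^ 2 = 1 := by
          simp only [g', norm_smul, Complex.norm_real, mul_pow]
          rw [← Finset.mul_sum, ← hGdef, ← hss, Real.norm_of_nonneg (by positivity)]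
          field_simp
        rw [this, ENNReal.ofReal_one]
      exact (ENNReal.pow_right_strictMono two_ne_zero).injective (by simpa using h2)
    have key := lintegral_le_bmoaCNorm_sq φ (Hol.extendsBeyond_poly n g') hn
    have e : ∀ z ∈ ball (0 : ℂ) 1, ‖Hol.Dpow 1 φ z (Hol.poly n g (conj z))‖ₑ ^ 2 *
        ENNReal.ofReal (1 - ‖z‖ ^ 2) = ENNReal.ofReal G *
        (‖Hol.Dpow 1 φ z (Hol.poly n g' (conj z))‖ₑ ^ 2 * ENNReal.ofReal (1 - ‖z‖ ^ 2)) := by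
      intro z hz
      have hz' : conj z ∈ ball (0 : ℂ) 1 := by simpa using hz
      have : Hol.poly n g (conj z) = (s : ℂ) • Hol.poly n g' (conj z) := by
        rw [Hol.poly_apply _ _ hz', Hol.poly_apply _ _ hz', Finset.smul_sum]
        refine Finset.sum_congr rfl fun k _ => ?_
        simp only [g', smul_smul]
        congr 1
        rw [Complex.ofReal_inv]
        have : (s : ℂ) ≠ 0 := by exact_mod_cast hs0.ne'
        field_simp
      rw [this, map_smul, enorm_smul, mul_pow, enorm_sq_eq_ofReal (s : ℂ), Complex.norm_real,
        Real.norm_of_nonneg hs0.le, hss, mul_assoc]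
    rw [setLIntegral_congr_fun measurableSet_ball e, lintegral_const_mul' _ _ ENNReal.ofReal_ne_top,
      mul_comm (_ ^ 2) G, ENNReal.ofReal_mul hG, ENNReal.ofReal_pow ENNReal.toReal_nonneg, ENNReal.ofReal_toReal hφ]
    gcongr

/-- Fatou's lemma along the Taylor polynomials of f. It works for every f of Hardy norm one, so the
extension requirement in the supremum costs nothing. -/
theorem CarlesonBound.bmoaCNorm_le {φ : Hol (H →L[ℂ] H)} {C : ℝ} (h : CarlesonBound 1 φ C)
    (hC : 0 ≤ C) : bmoaCNorm φ ≤ ENNReal.ofReal C := by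
  have key : ∀ f : Hol H, f.h2Norm = 1 → ∫⁻ z in ball (0 : ℂ) 1,
      ‖(Hol.Dpow 1 φ z) (f (conj z))‖ₑ ^ 2 * ENNReal.ofReal (1 - ‖z‖ ^ 2) ≤
      ENNReal.ofReal (C ^ 2) := by
    intro f hf
    let F : ℕ → ℂ → ℝ≥0∞ := fun n z =>
      ‖Hol.Dpow 1 φ z (Hol.poly n f.coeff (conj z))‖ₑ ^ 2 * ENNReal.ofReal (1 - ‖z‖ ^ 2)
    have hlim : ∀ z ∈ ball (0 : ℂ) 1, ‖(Hol.Dpow 1 φ z) (f (conj z))‖ₑ ^ 2 *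
        ENNReal.ofReal (1 - ‖z‖ ^ 2) = liminf (fun n => F n z) atTop := by
      intro z hz
      have hz' : conj z ∈ ball (0 : ℂ) 1 := by simpa using hz
      refine (Tendsto.liminf_eq ?_).symm
      have h1 : Tendsto (fun n => Hol.poly n f.coeff (conj z)) atTop (𝓝 (f (conj z))) := by
        simp only [Hol.poly_apply _ _ hz']
        exact (f.hasSum_coeff hz').tendsto_sum_nat
      have h2 := ((Hol.Dpow 1 φ z).continuous.tendsto _).comp h1
      exact ENNReal.Tendsto.mul_const (ENNReal.Tendsto.pow h2.enorm) (Or.inr ENNReal.ofReal_ne_top)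
    have hm : ∀ n, AEMeasurable (F n) (volume.restrict (ball 0 1)) := fun n =>
      (((Hol.continuousOn_apply_conj _ _).enorm.aemeasurable measurableSet_ball).pow_const 2).mul
        (by fun_prop)
    rw [setLIntegral_congr_fun measurableSet_ball hlim]
    refine (lintegral_liminf_le' hm).trans (liminf_le_of_le (by isBoundedDefault) fun b hb => ?_)
    obtain ⟨n, hn⟩ := hb.exists
    refine hn.trans ?_
    have h1 := h n f.coeff
    have hexp : (2 * (1 : ℝ) - 1) = 1 := by norm_num
    simp only [hexp, Real.rpow_one] at h1
    refine h1.trans (ENNReal.ofReal_le_ofReal (mul_le_of_le_one_right (sq_nonneg C) ?_))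
    rw [← ENNReal.ofReal_le_one, ENNReal.ofReal_sum_of_nonneg fun _ _ => by positivity]
    have h2 := f.h2Norm_sq
    rw [hf, one_pow] at h2
    simp only [enorm_sq_eq_ofReal] at h2
    rw [h2]
    exact ENNReal.sum_le_tsum _
  rw [bmoaCNorm]
  calc _ ≤ (ENNReal.ofReal (C ^ 2)) ^ (1 / 2 : ℝ) := by
        gcongr
        exact iSup₂_le fun f hf => key f hf.2
    _ = _ := by
        rw [ENNReal.ofReal_rpow_of_nonneg (sq_nonneg C) (by norm_num), ← Real.sqrt_eq_rpow,
          Real.sqrt_sq hC]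

/-- The Carleson BMOA norm is equivalent to the norm of the weighted Hankel matrix. -/
theorem exists_bmoaCNorm_hankelBound {α : ℝ} (hα : 0 < α) :
    ∃ K : ℝ, 0 ≤ K ∧ ∀ φ : Hol (H →L[ℂ] H),
      (∀ C, 0 ≤ C → HankelBound α φ.coeff C → bmoaCNorm φ ≤ ENNReal.ofReal (K * C)) ∧
      (bmoaCNorm φ ≠ ∞ → HankelBound α φ.coeff (K * (bmoaCNorm φ).toReal)) := by
  obtain ⟨K, hK, h⟩ := exists_carlesonBound_one (H := H) hα
  set q := (Real.pi * Real.Gamma (α + 1))⁻¹ * √(2 ^ (2 * (1 : ℝ) - 1) * Real.pi *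
        (Real.Gamma (2 * α) + Real.Gamma (2 * α + (2 * (1 : ℝ) - 1)))) with hq
  have hΓ := Real.Gamma_pos_of_pos (show (0 : ℝ) < α + 1 by linarith)
  have hq0 : 0 ≤ q := by positivity
  refine ⟨max K q, le_max_of_le_left hK, fun φ => ⟨fun C hC hφ => ?_, fun hφ n f g => ?_⟩⟩
  · refine ((h φ C hC hφ).bmoaCNorm_le (by positivity)).trans (ENNReal.ofReal_le_ofReal ?_)
    gcongr
    exact le_max_left _ _
  · have := (carlesonBound_bmoaCNorm hφ).hankelBound le_rfl hα ENNReal.toReal_nonneg n f g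
    refine this.trans ?_
    gcongr
    exact le_max_right _ _

end VecBMOA
end

noncomputable section
namespace VecBMOA

set_option linter.unusedSectionVars false

variable {H : Type*} [NormedAddCommGroup H] [InnerProductSpace ℂ H] [CompleteSpace H]

/-! ### Traces of nuclear operators -/

/-- Bessel's inequality for both vectors together with Cauchy–Schwarz. -/
theorem summable_norm_inner_mul_inner (x y : H) :
    (Summable fun i => ‖inner ℂ x (onb H i) * inner ℂ (onb H i) y‖) ∧
      ∑' i, ‖inner ℂ x (onb H i) * inner ℂ (onb H i) y‖ ≤ ‖x‖ * ‖y‖ := by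
  have hle : ∀ s : Finset (basisIndex H),
      ∑ i ∈ s, ‖inner ℂ x (onb H i) * inner ℂ (onb H i) y‖ ≤ ‖x‖ * ‖y‖ := by
    intro s
    have h1 : ∑ i ∈ s, ‖inner ℂ (onb H i) x‖ ^ 2 ≤ ‖x‖ ^ 2 :=
      (onb H).orthonormal.sum_inner_products_le x
    have h2 : ∑ i ∈ s, ‖inner ℂ (onb H i) y‖ ^ 2 ≤ ‖y‖ ^ 2 :=
      (onb H).orthonormal.sum_inner_products_le y
    have h3 := Real.sum_mul_le_sqrt_mul_sqrt s (fun i => ‖inner ℂ (onb H i) x‖)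
      (fun i => ‖inner ℂ (onb H i) y‖)
    calc _ = ∑ i ∈ s, ‖inner ℂ (onb H i) x‖ * ‖inner ℂ (onb H i) y‖ :=
          Finset.sum_congr rfl fun i _ => by rw [norm_mul, norm_inner_symm]
      _ ≤ √(‖x‖ ^ 2) * √(‖y‖ ^ 2) := h3.trans (by gcongr)
      _ = _ := by rw [Real.sqrt_sq (norm_nonneg _), Real.sqrt_sq (norm_nonneg _)]
  exact ⟨summable_of_sum_le (fun _ => norm_nonneg _) hle,
    Real.tsum_le_of_sum_le (fun _ => norm_nonneg _) hle⟩

/-- The trace pairing of a nuclear operator `∑ xₖ ⊗ yₖ`. -/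
theorem nuclear_trace {ι : Type*} {x y : ι → H} {T : H →L[ℂ] H}
    (hs : Summable fun k => ‖x k‖ * ‖y k‖)
    (hT : HasSum (fun k => InnerProductSpace.rankOne ℂ (x k) (y k)) T) (B : H →L[ℂ] H) :
    (Summable fun i => inner ℂ (onb H i) ((ContinuousLinearMap.adjoint B ∘L T) (onb H i))) ∧
    HasSum (fun k => inner ℂ (B (y k)) (x k)) (tracePairing T B) := by
  let F : ι × basisIndex H → ℂ := fun p =>
    inner ℂ (y p.1) (onb H p.2) * inner ℂ (onb H p.2) (ContinuousLinearMap.adjoint B (x p.1))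
  have hF : Summable fun p => ‖F p‖ := by
    rw [summable_prod_of_nonneg fun p => norm_nonneg (F p)]
    refine ⟨fun k => (summable_norm_inner_mul_inner (y k) (ContinuousLinearMap.adjoint B (x k))).1,
      Summable.of_nonneg_of_le (g := fun k => ∑' i, ‖F (k, i)‖)
        (fun k => tsum_nonneg fun i => norm_nonneg (F (k, i))) (fun k => ?_)
        (hs.mul_left ‖ContinuousLinearMap.adjoint B‖)⟩
    refine (summable_norm_inner_mul_inner (y k) (ContinuousLinearMap.adjoint B (x k))).2.trans ?_
    calc _ ≤ ‖y k‖ * (‖ContinuousLinearMap.adjoint B‖ * ‖x k‖) := by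
          gcongr; exact ContinuousLinearMap.le_opNorm _ _
      _ = _ := by ring
  have h1 : ∀ k, HasSum (fun i => F (k, i)) (inner ℂ (B (y k)) (x k)) := by
    intro k
    have := (onb H).hasSum_inner_mul_inner (y k) (ContinuousLinearMap.adjoint B (x k))
    rwa [ContinuousLinearMap.adjoint_inner_right] at this
  have h2 : ∀ i, HasSum (fun k => F (k, i))
      (inner ℂ (onb H i) ((ContinuousLinearMap.adjoint B ∘L T) (onb H i))) := by
    intro i
    have h3 := (hT.mapL (ContinuousLinearMap.apply ℂ H (onb H i))).mapL
      (innerSL ℂ (onb H i) ∘L ContinuousLinearMap.adjoint B)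
    simpa [F, inner_smul_right] using h3
  have hsum := hF.of_norm.hasSum
  have h3 := hsum.prod_fiberwise h1
  have h4 := ((Equiv.prodComm _ _).hasSum_iff.mpr hsum).prod_fiberwise h2
  refine ⟨h4.summable, ?_⟩
  rw [tracePairing, opTrace, h4.tsum_eq]
  exact h3

theorem tracePairing_rankOne (x y : H) (B : H →L[ℂ] H) :
    tracePairing (InnerProductSpace.rankOne ℂ x y) B = inner ℂ (B y) x := by
  have h := (nuclear_trace (ι := Unit) (x := fun _ => x) (y := fun _ => y)
    (hasSum_fintype _).summable (hasSum_fintype _) B).2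
  simpa using h.unique (hasSum_fintype _)

theorem tracePairing_zero_left (B : H →L[ℂ] H) : tracePairing 0 B = 0 := by
  simp [tracePairing, opTrace]

/-! ### Elementary tensors -/

theorem hasSum_rankOne_left {ι : Type*} {a : ι → H} {x : H} (hx : HasSum a x) (y : H) :
    HasSum (fun i => InnerProductSpace.rankOne ℂ (a i) y) (InnerProductSpace.rankOne ℂ x y) :=
  hx.mapL (ContinuousLinearMap.smulRightL ℂ H H (innerSL ℂ y))

theorem hasSum_rankOne_right {ι : Type*} {b : ι → H} {y : H} (hy : HasSum b y) (x : H) :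
    HasSum (fun i => InnerProductSpace.rankOne ℂ x (b i)) (InnerProductSpace.rankOne ℂ x y) :=
  (InnerProductSpace.rankOne ℂ x).hasSum hy

theorem summable_rankOne_prod {a b : ℕ → H} (ha : Summable fun n => ‖a n‖)
    (hb : Summable fun n => ‖b n‖) :
    Summable fun p : ℕ × ℕ => ‖InnerProductSpace.rankOne ℂ (a p.1) (b p.2)‖ := by
  simp only [InnerProductSpace.norm_rankOne]
  exact ha.mul_of_nonneg hb (fun n => norm_nonneg (a n)) (fun n => norm_nonneg (b n))

theorem hasSum_rankOne_prod {a b : ℕ → H} (ha : Summable fun n => ‖a n‖)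
    (hb : Summable fun n => ‖b n‖) {x y : H} (hx : HasSum a x) (hy : HasSum b y) :
    HasSum (fun p : ℕ × ℕ => InnerProductSpace.rankOne ℂ (a p.1) (b p.2))
      (InnerProductSpace.rankOne ℂ x y) := by
  have hs := (summable_rankOne_prod ha hb).of_norm.hasSum
  have h2 := hs.prod_fiberwise fun i => hasSum_rankOne_right hy (a i)
  rw [h2.unique (hasSum_rankOne_left hx y)] at hs
  exact hs

theorem hasSum_antidiagonal {E : Type*} [NormedAddCommGroup E] [CompleteSpace E]
    {F : ℕ × ℕ → E} {s : E} (hs : HasSum F s) :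
    HasSum (fun n => ∑ p ∈ Finset.HasAntidiagonal.antidiagonal n, F p) s := by
  have h2 := (Finset.HasAntidiagonal.sigmaAntidiagonalEquivProd (A := ℕ)).hasSum_iff.mpr hs
  have h3 := h2.sigma fun n => hasSum_fintype _
  convert h3 using 2 with n
  exact (Finset.sum_coe_sort _ _).symm

namespace Hol

theorem summable_tensorCoeff (f g : Hol H) : ∀ r ∈ Set.Ico (0 : ℝ) 1, Summable fun n : ℕ =>
    r ^ n * ‖∑ p ∈ Finset.HasAntidiagonal.antidiagonal n,
      InnerProductSpace.rankOne ℂ (f.coeff p.1) (g.coeff p.2)‖ := by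
  intro r hr
  have h1 := f.summable_pow_mul_coeff hr.1 hr.2
  have h2 := g.summable_pow_mul_coeff hr.1 hr.2
  have h0 : ∀ (u : Hol H) n, 0 ≤ r ^ n * ‖u.coeff n‖ := fun u n =>
    mul_nonneg (pow_nonneg hr.1 _) (norm_nonneg _)
  have h3 := hasSum_antidiagonal (h1.mul_of_nonneg h2 (h0 f) (h0 g)).hasSum
  refine h3.summable.of_nonneg_of_le (fun n => mul_nonneg (pow_nonneg hr.1 _) (norm_nonneg _))
    fun n => ?_
  refine (mul_le_mul_of_nonneg_left (norm_sum_le _ _) (pow_nonneg hr.1 _)).trans_eq ?_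
  rw [Finset.mul_sum]
  refine Finset.sum_congr rfl fun p hp => ?_
  rw [InnerProductSpace.norm_rankOne, ← Finset.HasAntidiagonal.mem_antidiagonal.mp hp, pow_add]
  ring

/-- The operator-valued analytic function `z ↦ f(z) ⊗ g(z̄)`. -/
def tensor (f g : Hol H) : Hol (H →L[ℂ] H) := ofCoeff _ (summable_tensorCoeff f g)

theorem coeff_tensor (f g : Hol H) (n : ℕ) : (tensor f g).coeff n =
    ∑ p ∈ Finset.HasAntidiagonal.antidiagonal n,
      InnerProductSpace.rankOne ℂ (f.coeff p.1) (g.coeff p.2) := coeff_ofCoeff _ n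

theorem tensor_apply (f g : Hol H) {z : ℂ} (hz : z ∈ ball (0 : ℂ) 1) :
    tensor f g z = InnerProductSpace.rankOne ℂ (f z) (g (conj z)) := by
  have hz' : conj z ∈ ball (0 : ℂ) 1 := by simpa using hz
  have h1 := f.hasSum_coeff hz
  have h2 := g.hasSum_coeff hz'
  have hs : ∀ (u : Hol H) {w : ℂ}, w ∈ ball (0 : ℂ) 1 → Summable fun n => ‖w ^ n • u.coeff n‖ := by
    intro u w hw
    simpa [norm_smul] using u.summable_pow_mul_coeff (norm_nonneg w) (mem_ball_zero_iff.mp hw)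
  have h3 := hasSum_antidiagonal (hasSum_rankOne_prod (hs f hz) (hs g hz') h1 h2)
  refine ((ofCoeff_hasSum (summable_tensorCoeff f g) hz).unique ?_)
  refine (congrArg (fun v : ℕ → H →L[ℂ] H => HasSum v _) (funext fun n => ?_)).mpr h3
  rw [Finset.smul_sum]
  refine Finset.sum_congr rfl fun p hp => ?_
  rw [← Finset.HasAntidiagonal.mem_antidiagonal.mp hp, pow_add]
  simp [smul_smul]

theorem Dpow_zero {Y : Type*} [NormedAddCommGroup Y] [NormedSpace ℂ Y] [CompleteSpace Y]
    (f : Hol Y) : Dpow 0 f = f := ext_coeff fun n => by simp [coeff_Dpow]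

theorem Dpow_Dpow {Y : Type*} [NormedAddCommGroup Y] [NormedSpace ℂ Y] [CompleteSpace Y]
    (a b : ℝ) (f : Hol Y) : Dpow a (Dpow b f) = Dpow (a + b) f := ext_coeff fun n => by
  rw [coeff_Dpow, coeff_Dpow, coeff_Dpow, smul_smul, ← Complex.ofReal_mul,
    ← Real.rpow_add (by positivity)]

/-- Coefficientwise summation of a pointwise convergent series of analytic functions. -/
theorem hasSum_coeff_of_bound {Y : Type*} [NormedAddCommGroup Y] [NormedSpace ℂ Y]
    [CompleteSpace Y] {v : ℕ → Hol Y} {u : Hol Y} {b s : ℕ → ℝ}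
    (hv : ∀ k n, ‖(v k).coeff n‖ ≤ b n * s k) (hb0 : ∀ n, 0 ≤ b n) (hs0 : ∀ k, 0 ≤ s k)
    (hs : Summable s) (hb : ∀ r ∈ Set.Ico (0 : ℝ) 1, Summable fun n => r ^ n * b n)
    (hu : ∀ z ∈ ball (0 : ℂ) 1, HasSum (fun k => v k z) (u z)) (n : ℕ) :
    HasSum (fun k => (v k).coeff n) (u.coeff n) := by
  have h1 : ∀ n, Summable fun k => (v k).coeff n := fun n =>
    Summable.of_norm_bounded (hs.mul_left (b n)) fun k => hv k n
  rw [u.coeff_unique (p := fun n => ∑' k, (v k).coeff n) (fun z hz => ?_) n]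
  · exact (h1 n).hasSum
  have hz1 := mem_ball_zero_iff.mp hz
  have h2 : Summable fun p : ℕ × ℕ => z ^ p.2 • (v p.1).coeff p.2 := by
    refine Summable.of_norm_bounded (hs.mul_of_nonneg (hb ‖z‖ ⟨norm_nonneg z, hz1⟩) hs0
      fun n => mul_nonneg (pow_nonneg (norm_nonneg _) _) (hb0 n)) fun p => ?_
    rw [norm_smul, norm_pow]
    calc _ ≤ ‖z‖ ^ p.2 * (b p.2 * s p.1) := by gcongr; exact hv _ _
      _ = _ := by ring
  have h3 := h2.hasSum.prod_fiberwise fun k => (v k).hasSum_coeff hz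
  have h4 := ((Equiv.prodComm _ _).hasSum_iff.mpr h2.hasSum).prod_fiberwise
    fun n => ((h1 n).hasSum.const_smul (z ^ n))
  rw [(hu z hz).unique h3]
  exact h4

end Hol

end VecBMOA
end

/-! ### Representations in the predual and uniform bounds for Abel means -/

noncomputable section
namespace VecBMOA

set_option linter.unusedSectionVars false

variable {H : Type*} [NormedAddCommGroup H] [InnerProductSpace ℂ H] [CompleteSpace H]

theorem hankelWeight_nonneg (α : ℝ) (j k : ℕ) : 0 ≤ hankelWeight α j k := by
  unfold hankelWeight; positivity

theorem hankelWeight_le_one {α : ℝ} (hα : 0 ≤ α) (j k : ℕ) : hankelWeight α j k ≤ 1 := by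
  rw [hankelWeight, Real.rpow_neg (by positivity), ← div_eq_mul_inv, div_le_one (by positivity)]
  gcongr
  omega

namespace Hol

theorem sum_enorm_sq_coeff_le (f : Hol H) (s : Finset ℕ) :
    ∑ j ∈ s, ‖f.coeff j‖ₑ ^ 2 ≤ f.h2Norm ^ 2 := by
  rw [h2Norm_sq]; exact ENNReal.sum_le_tsum _

theorem sum_norm_sq_coeff_le {f : Hol H} (hf : f.h2Norm < ∞) (s : Finset ℕ) :
    ∑ j ∈ s, ‖f.coeff j‖ ^ 2 ≤ f.h2Norm.toReal ^ 2 := by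
  rw [← ENNReal.ofReal_le_ofReal_iff (by positivity), ENNReal.ofReal_sum_of_nonneg fun _ _ => by positivity,
    ENNReal.ofReal_pow ENNReal.toReal_nonneg, ENNReal.ofReal_toReal hf.ne]
  simp only [← enorm_sq_eq_ofReal]
  exact f.sum_enorm_sq_coeff_le s

theorem norm_coeff_le {f : Hol H} (hf : f.h2Norm < ∞) (n : ℕ) :
    ‖f.coeff n‖ ≤ f.h2Norm.toReal := by
  rw [← toReal_enorm]
  exact ENNReal.toReal_mono hf.ne (f.enorm_coeff_le n)

theorem coeff_sub {Y : Type*} [NormedAddCommGroup Y] [NormedSpace ℂ Y] [CompleteSpace Y]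
    (f g : Hol Y) (n : ℕ) : (f - g).coeff n = f.coeff n - g.coeff n := by
  rw [eq_sub_iff_add_eq, ← coeff_add, sub_add_cancel]

theorem coeff_zero {Y : Type*} [NormedAddCommGroup Y] [NormedSpace ℂ Y] [CompleteSpace Y] (n : ℕ) :
    (0 : Hol Y).coeff n = 0 := by
  have := coeff_smul (0 : ℂ) (0 : Hol Y) n
  simpa using this

theorem coeff_sum {Y ι : Type*} [NormedAddCommGroup Y] [NormedSpace ℂ Y] [CompleteSpace Y]
    (s : Finset ι) (f : ι → Hol Y) (n : ℕ) : (∑ i ∈ s, f i).coeff n = ∑ i ∈ s, (f i).coeff n := by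
  classical
  induction s using Finset.induction_on with
  | empty => simp [coeff_zero]
  | insert a s ha ih => rw [Finset.sum_insert ha, Finset.sum_insert ha, coeff_add, ih]

theorem sum_apply {Y ι : Type*} [NormedAddCommGroup Y] [NormedSpace ℂ Y]
    (s : Finset ι) (f : ι → Hol Y) (z : ℂ) : (∑ i ∈ s, f i) z = ∑ i ∈ s, f i z := by
  classical
  induction s using Finset.induction_on with
  | empty => simp
  | insert a s ha ih => rw [Finset.sum_insert ha, Finset.sum_insert ha, add_apply, ih]

theorem sub_apply {Y : Type*} [NormedAddCommGroup Y] [NormedSpace ℂ Y]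
    (f g : Hol Y) (z : ℂ) : (f - g) z = f z - g z := rfl

end Hol

/-- The elementary tensor `D^(-α) ((D^α f) ⊗ conj g)`. -/
def elemTensor (α : ℝ) (f g : Hol H) : Hol (H →L[ℂ] H) :=
  Hol.Dpow (-α) (Hol.tensor (Hol.Dpow α f) g)

theorem coeff_elemTensor (α : ℝ) (f g : Hol H) (n : ℕ) : (elemTensor α f g).coeff n =
    ∑ p ∈ Finset.HasAntidiagonal.antidiagonal n, (hankelWeight α p.1 p.2 : ℂ) •
      InnerProductSpace.rankOne ℂ (f.coeff p.1) (g.coeff p.2) := by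
  rw [elemTensor, Hol.coeff_Dpow, Hol.coeff_tensor, Finset.smul_sum]
  refine Finset.sum_congr rfl fun p hp => ?_
  rw [Hol.coeff_Dpow, map_smul, smul_apply, smul_smul, hankelWeight,
    Finset.HasAntidiagonal.mem_antidiagonal.mp hp, mul_comm]
  push_cast
  rfl

theorem elemTensor_sub (α : ℝ) (f g f' g' : Hol H) : elemTensor α f g - elemTensor α f' g' =
    elemTensor α (f - f') g + elemTensor α f' (g - g') := by
  refine Hol.ext_coeff fun n => ?_
  simp only [Hol.coeff_sub, Hol.coeff_add, coeff_elemTensor]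
  rw [← Finset.sum_sub_distrib, ← Finset.sum_add_distrib]
  refine Finset.sum_congr rfl fun p _ => ?_
  rw [map_sub, map_sub, sub_apply, smul_sub, smul_sub]
  abel

theorem isTensorSum_single {a b : ℝ} {f g : Hol H} (hf : f.h2Norm < ∞) (hg : g.h2Norm < ∞) :
    IsTensorSum a b (Hol.tensor (Hol.Dpow a f) (Hol.Dpow b g))
      (fun k => if k = 0 then f else 0) (fun k => if k = 0 then g else 0) := by
  refine ⟨fun k => ?_, fun k => ?_, fun z hz => ?_⟩
  · split_ifs
    · exact hf
    · simp [Hol.h2Norm_zero]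
  · split_ifs
    · exact hg
    · simp [Hol.h2Norm_zero]
  · rw [Hol.tensor_apply _ _ hz]
    convert hasSum_ite_eq 0 (InnerProductSpace.rankOne ℂ (Hol.Dpow a f z) (Hol.Dpow b g (conj z)))
      using 2 with k
    split_ifs <;> simp

theorem tensorNorm_tensor_le (a b : ℝ) {f g : Hol H} (hf : f.h2Norm < ∞) (hg : g.h2Norm < ∞) :
    tensorNorm a b (Hol.tensor (Hol.Dpow a f) (Hol.Dpow b g)) ≤ f.h2Norm * g.h2Norm := by
  refine (tensorNorm_le (isTensorSum_single hf hg)).trans_eq ?_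
  rw [tsum_eq_single 0]
  · simp
  · intro k hk
    simp [hk, Hol.h2Norm_zero]

theorem predualNorm_elemTensor_le (α : ℝ) {f g : Hol H} (hf : f.h2Norm < ∞) (hg : g.h2Norm < ∞) :
    predualNorm α 0 α (elemTensor α f g) ≤ f.h2Norm * g.h2Norm := by
  refine (iInf₂_le (Hol.tensor (Hol.Dpow α f) (Hol.Dpow 0 g)) ?_).trans
    (tensorNorm_tensor_le α 0 hf hg)
  rw [Hol.Dpow_zero, elemTensor]

/-- A representation of an element of the first predual. -/
structure IsPredualSum (α : ℝ) (h : Hol (H →L[ℂ] H)) (f g : ℕ → Hol H) : Prop where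
  left_mem : ∀ k, (f k).h2Norm < ∞
  right_mem : ∀ k, (g k).h2Norm < ∞
  summable : Summable fun k => (f k).h2Norm.toReal * (g k).h2Norm.toReal
  exists_tensorSum : ∃ u, h = Hol.Dpow (-α) u ∧ IsTensorSum α 0 u f g

theorem exists_isPredualSum {α : ℝ} {h : Hol (H →L[ℂ] H)} {c : ℝ≥0∞}
    (hc : predualNorm α 0 α h < c) : ∃ f g, IsPredualSum α h f g ∧
      ∑' k, (f k).h2Norm * (g k).h2Norm < c := by
  simp only [predualNorm, tensorNorm, iInf_lt_iff] at hc
  obtain ⟨u, hu, f, g, hfg, hlt⟩ := hc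
  refine ⟨f, g, ⟨hfg.left_mem, hfg.right_mem, ?_, u, hu, hfg⟩, hlt⟩
  simpa using ENNReal.summable_toReal hlt.ne_top

theorem IsPredualSum.tsum_ne_top {α : ℝ} {h : Hol (H →L[ℂ] H)} {f g : ℕ → Hol H}
    (hs : IsPredualSum α h f g) : ∑' k, (f k).h2Norm * (g k).h2Norm ≠ ∞ := by
  convert hs.summable.tsum_ofReal_ne_top using 3 with k
  rw [← ENNReal.toReal_mul, ENNReal.ofReal_toReal]
  exact (ENNReal.mul_lt_top (hs.left_mem k) (hs.right_mem k)).ne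

/-- There are n + 1 pairs on the antidiagonal, each costing at most (1+n)^α. Polynomial growth in n,
with the norms of f and g as a factor, is what permits summing a representation coefficientwise. -/
theorem norm_coeff_tensor_Dpow_le {α : ℝ} (hα : 0 ≤ α) {f g : Hol H} (hf : f.h2Norm < ∞)
    (hg : g.h2Norm < ∞) (n : ℕ) : ‖(Hol.tensor (Hol.Dpow α f) g).coeff n‖ ≤
      (1 + n : ℝ) ^ (α + 1) * (f.h2Norm.toReal * g.h2Norm.toReal) := by
  rw [Hol.coeff_tensor]
  refine (norm_sum_le_of_le (f := fun p : ℕ × ℕ => InnerProductSpace.rankOne ℂ ((Hol.Dpow α f).coeff p.1) (g.coeff p.2))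
    (n := fun _ => (1 + n : ℝ) ^ α * (f.h2Norm.toReal * g.h2Norm.toReal)) _
    fun p hp => ?_).trans_eq ?_
  · have h1 := Hol.norm_coeff_le hf p.1
    have h2 := Hol.norm_coeff_le hg p.2
    have h3 : p.1 ≤ n := by have := Finset.HasAntidiagonal.mem_antidiagonal.mp hp; omega
    rw [InnerProductSpace.norm_rankOne, Hol.coeff_Dpow, norm_smul, Complex.norm_real,
      Real.norm_of_nonneg (by positivity), mul_assoc]
    gcongr
  · rw [Finset.sum_const, Finset.Nat.card_antidiagonal, nsmul_eq_mul, Real.rpow_add (by positivity),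
      Real.rpow_one]
    push_cast
    ring

theorem IsPredualSum.hasSum_coeff {α : ℝ} (hα : 0 ≤ α) {h : Hol (H →L[ℂ] H)} {f g : ℕ → Hol H}
    (hs : IsPredualSum α h f g) (n : ℕ) :
    HasSum (fun k => (elemTensor α (f k) (g k)).coeff n) (h.coeff n) := by
  obtain ⟨u, rfl, hu⟩ := hs.exists_tensorSum
  have key := Hol.hasSum_coeff_of_bound (v := fun k => Hol.tensor (Hol.Dpow α (f k)) (g k)) (u := u)
    (b := fun n => (1 + n : ℝ) ^ (α + 1)) (s := fun k => (f k).h2Norm.toReal * (g k).h2Norm.toReal)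
    (fun k n => norm_coeff_tensor_Dpow_le hα (hs.left_mem k) (hs.right_mem k) n)
    (fun n => by positivity) (fun k => by positivity) hs.summable
    (fun r hr => by simpa [mul_comm] using Hol.summable_weight_geom (α + 1) hr.1 hr.2)
    (fun z hz => by
      have := hu.hasSum z hz
      simp only [Hol.Dpow_zero] at this
      simpa only [Hol.tensor_apply _ _ hz] using this) n
  simp only [elemTensor, Hol.coeff_Dpow]
  exact key.const_smul _

/-- This is where the Hankel form appears: summed over n, the right side is the form on which
`HankelBound` is a condition. -/
theorem tracePairing_coeff_elemTensor (α : ℝ) (f g : Hol H) (n : ℕ) (B : H →L[ℂ] H) :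
    tracePairing ((elemTensor α f g).coeff n) B = ∑ p ∈ Finset.HasAntidiagonal.antidiagonal n,
      (hankelWeight α p.1 p.2 : ℂ) * inner ℂ (B (g.coeff p.2)) (f.coeff p.1) := by
  have h := (nuclear_trace (ι := Finset.HasAntidiagonal.antidiagonal n) (T := (elemTensor α f g).coeff n)
    (x := fun p => (hankelWeight α p.1.1 p.1.2 : ℂ) • f.coeff p.1.1)
    (y := fun p => g.coeff p.1.2) (hasSum_fintype _).summable (by
      rw [coeff_elemTensor, ← Finset.sum_coe_sort]
      simp only [map_smul, smul_apply]
      exact hasSum_fintype _) B).2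
  rw [h.unique (hasSum_fintype _), ← Finset.sum_coe_sort (Finset.HasAntidiagonal.antidiagonal n)
    (fun p => (hankelWeight α p.1 p.2 : ℂ) * inner ℂ (B (g.coeff p.2)) (f.coeff p.1))]
  exact Finset.sum_congr rfl fun p _ => inner_smul_right _ _ _

theorem norm_tracePairing_coeff_elemTensor_le {α : ℝ} (hα : 0 ≤ α) {f g : Hol H}
    (hf : f.h2Norm < ∞) (hg : g.h2Norm < ∞) (n : ℕ) (B : H →L[ℂ] H) :
    ‖tracePairing ((elemTensor α f g).coeff n) B‖ ≤
      (1 + n : ℝ) * ‖B‖ * (f.h2Norm.toReal * g.h2Norm.toReal) := by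
  rw [tracePairing_coeff_elemTensor]
  refine (norm_sum_le_of_le (n := fun _ => ‖B‖ * (f.h2Norm.toReal * g.h2Norm.toReal)) _
    fun p hp => ?_).trans_eq ?_
  · have h1 := Hol.norm_coeff_le hf p.1
    have h2 := Hol.norm_coeff_le hg p.2
    rw [norm_mul, Complex.norm_real, Real.norm_of_nonneg (hankelWeight_nonneg _ _ _)]
    calc _ ≤ 1 * (‖B‖ * ‖g.coeff p.2‖ * ‖f.coeff p.1‖) := by
          gcongr
          · exact hankelWeight_le_one hα _ _
          · exact (norm_inner_le_norm _ _).trans (by gcongr; exact B.le_opNorm _)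
      _ ≤ 1 * (‖B‖ * g.h2Norm.toReal * f.h2Norm.toReal) := by gcongr
      _ = _ := by ring
  · rw [Finset.sum_const, Finset.Nat.card_antidiagonal, nsmul_eq_mul]
    push_cast
    ring

/-- The coefficients of the elements of the predual are nuclear. -/
theorem IsPredualSum.nuclear {α : ℝ} (hα : 0 ≤ α) {h : Hol (H →L[ℂ] H)} {f g : ℕ → Hol H}
    (hs : IsPredualSum α h f g) (n : ℕ) :
    (Summable fun q : ℕ × Finset.HasAntidiagonal.antidiagonal n =>
      ‖(hankelWeight α q.2.1.1 q.2.1.2 : ℂ) • (f q.1).coeff q.2.1.1‖ * ‖(g q.1).coeff q.2.1.2‖) ∧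
    HasSum (fun q : ℕ × Finset.HasAntidiagonal.antidiagonal n => InnerProductSpace.rankOne ℂ
      ((hankelWeight α q.2.1.1 q.2.1.2 : ℂ) • (f q.1).coeff q.2.1.1) ((g q.1).coeff q.2.1.2))
      (h.coeff n) := by
  let x : ℕ × Finset.HasAntidiagonal.antidiagonal n → H := fun q =>
    (hankelWeight α q.2.1.1 q.2.1.2 : ℂ) • (f q.1).coeff q.2.1.1
  let y : ℕ × Finset.HasAntidiagonal.antidiagonal n → H := fun q => (g q.1).coeff q.2.1.2
  have hsum : Summable fun q => ‖x q‖ * ‖y q‖ := by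
    have h1 : Summable fun q : ℕ × Finset.HasAntidiagonal.antidiagonal n =>
        ((f q.1).h2Norm.toReal * (g q.1).h2Norm.toReal) * 1 :=
      hs.summable.mul_of_nonneg (g := fun _ : Finset.HasAntidiagonal.antidiagonal n => (1 : ℝ))
        (hasSum_fintype _).summable (fun k => by positivity) (fun _ => zero_le_one)
    refine h1.of_nonneg_of_le (fun q => by positivity) fun q => ?_
    have h2 := Hol.norm_coeff_le (hs.left_mem q.1) q.2.1.1
    have h3 := Hol.norm_coeff_le (hs.right_mem q.1) q.2.1.2
    simp only [x, y]
    rw [norm_smul, Complex.norm_real, Real.norm_of_nonneg (hankelWeight_nonneg _ _ _), mul_one]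
    calc _ ≤ (1 * (f q.1).h2Norm.toReal) * (g q.1).h2Norm.toReal := by
          gcongr
          exact hankelWeight_le_one hα _ _
      _ = _ := by rw [one_mul]
  have hfib : ∀ k, ∑ p : Finset.HasAntidiagonal.antidiagonal n,
      InnerProductSpace.rankOne ℂ (x (k, p)) (y (k, p)) = (elemTensor α (f k) (g k)).coeff n := by
    intro k
    rw [coeff_elemTensor, ← Finset.sum_coe_sort (Finset.HasAntidiagonal.antidiagonal n)
      (fun p => (hankelWeight α p.1 p.2 : ℂ) •
        InnerProductSpace.rankOne ℂ ((f k).coeff p.1) ((g k).coeff p.2))]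
    exact Finset.sum_congr rfl fun p _ => by simp only [x, y, map_smul, smul_apply]
  have hT : HasSum (fun q => InnerProductSpace.rankOne ℂ (x q) (y q)) (h.coeff n) := by
    have h1 : Summable fun q => InnerProductSpace.rankOne ℂ (x q) (y q) := by
      refine Summable.of_norm ?_
      simpa only [InnerProductSpace.norm_rankOne] using hsum
    have h2 := h1.hasSum.prod_fiberwise fun k => hasSum_fintype _
    simp only [hfib] at h2
    rw [(hs.hasSum_coeff hα n).unique h2]
    exact h1.hasSum
  exact ⟨hsum, hT⟩

/-- `opTrace` is an unconditional sum with default value 0, so its linearity has to be justified.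
The first part supplies the summability along the basis, the second exchanges the trace with the
representing series. -/
theorem IsPredualSum.trace {α : ℝ} (hα : 0 ≤ α) {h : Hol (H →L[ℂ] H)} {f g : ℕ → Hol H}
    (hs : IsPredualSum α h f g) (n : ℕ) (B : H →L[ℂ] H) :
    (Summable fun i => inner ℂ (onb H i)
      ((ContinuousLinearMap.adjoint B ∘L h.coeff n) (onb H i))) ∧
    HasSum (fun k => tracePairing ((elemTensor α (f k) (g k)).coeff n) B)
      (tracePairing (h.coeff n) B) := by
  obtain ⟨h1, h2⟩ := nuclear_trace (hs.nuclear hα n).1 (hs.nuclear hα n).2 B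
  refine ⟨h1, ?_⟩
  have h3 := h2.prod_fiberwise fun k => hasSum_fintype _
  convert h3 using 2 with k
  rw [tracePairing_coeff_elemTensor, ← Finset.sum_coe_sort (Finset.HasAntidiagonal.antidiagonal n)
    (fun p => (hankelWeight α p.1 p.2 : ℂ) *
      inner ℂ (B ((g k).coeff p.2)) ((f k).coeff p.1))]
  exact Finset.sum_congr rfl fun p _ => (inner_smul_right _ _ _).symm

/-- The Abel means of the pairing of two operator-valued analytic functions. -/
def abelMean (r : ℝ) (h ψ : Hol (H →L[ℂ] H)) : ℂ :=
  ∑' n : ℕ, (r : ℂ) ^ n * tracePairing (h.coeff n) (ψ.coeff n)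

/-- Since r^(j+k) = r^j r^k, the Abel mean is the Hankel form at the dilated sequences r^j f_j and
r^k g_k. Their norms do not exceed those of f and g, so the bound is uniform in r. -/
theorem abelMean_elemTensor_le {α C : ℝ} (hα : 0 ≤ α) (hC : 0 ≤ C) {ψ : Hol (H →L[ℂ] H)}
    (hψ : HankelBound α ψ.coeff C) {f g : Hol H} (hf : f.h2Norm < ∞) (hg : g.h2Norm < ∞) {r : ℝ}
    (hr : r ∈ Set.Ico (0 : ℝ) 1) :
    ‖abelMean r (elemTensor α f g) ψ‖ ≤ C * (f.h2Norm.toReal * g.h2Norm.toReal) := by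
  have hr0 := hr.1
  let f' : ℕ → H := fun j => (r : ℂ) ^ j • f.coeff j
  let g' : ℕ → H := fun k => (r : ℂ) ^ k • g.coeff k
  let F : ℕ × ℕ → ℂ := fun p => (hankelWeight α p.1 p.2 : ℂ) *
    inner ℂ (ψ.coeff (p.1 + p.2) (g' p.2)) (f' p.1)
  have hFe : ∀ p, F p = (r : ℂ) ^ (p.1 + p.2) * ((hankelWeight α p.1 p.2 : ℂ) *
      inner ℂ (ψ.coeff (p.1 + p.2) (g.coeff p.2)) (f.coeff p.1)) := by
    intro p
    simp only [F, f', g', map_smul, inner_smul_left, inner_smul_right, map_pow, Complex.conj_ofReal,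
      pow_add]
    ring
  have hsumF : Summable fun p => ‖F p‖ := by
    refine summable_of_antidiagonal_bound (b := fun n => r ^ n * ‖ψ.coeff n‖ *
      (f.h2Norm.toReal * g.h2Norm.toReal)) ?_ fun j k => ?_
    · refine ((ψ.summable_coeff 1 hr.1 hr.2).mul_right (f.h2Norm.toReal * g.h2Norm.toReal)).congr
        fun n => ?_
      rw [Real.rpow_one]; ring
    · have h2 := Hol.norm_coeff_le hf j
      have h3 := Hol.norm_coeff_le hg k
      rw [hFe, norm_mul, norm_mul, norm_pow, Complex.norm_real, Complex.norm_real,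
        Real.norm_of_nonneg hr0, Real.norm_of_nonneg (hankelWeight_nonneg _ _ _)]
      calc _ ≤ r ^ (j + k) * (1 * (‖ψ.coeff (j + k)‖ * g.h2Norm.toReal * f.h2Norm.toReal)) := by
            gcongr
            · exact hankelWeight_le_one hα _ _
            · refine (norm_inner_le_norm _ _).trans ?_
              gcongr
              exact ((ψ.coeff (j + k)).le_opNorm _).trans (by gcongr)
        _ = _ := by ring
  have hs := hsumF.of_norm.hasSum
  have h1 := hasSum_antidiagonal hs
  have e : abelMean r (elemTensor α f g) ψ = ∑' p, F p := by
    rw [abelMean, ← h1.tsum_eq]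
    refine tsum_congr fun n => ?_
    rw [tracePairing_coeff_elemTensor, Finset.mul_sum]
    refine Finset.sum_congr rfl fun p hp => ?_
    rw [hFe, Finset.HasAntidiagonal.mem_antidiagonal.mp hp]
  rw [e]
  refine le_of_tendsto (tendsto_sum_range_prod hs).norm (Eventually.of_forall fun n => ?_)
  refine (hψ n f' g').trans ?_
  have hb : ∀ u : Hol H, u.h2Norm < ∞ → √(∑ j ∈ Finset.range n, ‖(r : ℂ) ^ j • u.coeff j‖ ^ 2) ≤
      u.h2Norm.toReal := by
    intro u hu
    refine Real.sqrt_le_iff.mpr ⟨ENNReal.toReal_nonneg, le_trans (Finset.sum_le_sum fun j _ => ?_)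
      (Hol.sum_norm_sq_coeff_le hu (Finset.range n))⟩
    rw [norm_smul, norm_pow, Complex.norm_real, Real.norm_of_nonneg hr0]
    gcongr
    exact mul_le_of_le_one_left (norm_nonneg _) (pow_le_one₀ hr0 hr.2.le)
  rw [mul_assoc]
  gcongr
  · exact hb f hf
  · exact hb g hg

/-- Fubini over the terms of the representation and the Taylor index: for r < 1 the geometric decay
absorbs the factor 1 + n and the growth of the coefficients of ψ. -/
theorem IsPredualSum.summable_abel {α : ℝ} (hα : 0 ≤ α) {h : Hol (H →L[ℂ] H)} {f g : ℕ → Hol H}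
    (hs : IsPredualSum α h f g) (ψ : Hol (H →L[ℂ] H)) {r : ℝ} (hr : r ∈ Set.Ico (0 : ℝ) 1) :
    Summable (fun n : ℕ => (r : ℂ) ^ n * tracePairing (h.coeff n) (ψ.coeff n)) ∧
    HasSum (fun k => abelMean r (elemTensor α (f k) (g k)) ψ) (abelMean r h ψ) := by
  let G : ℕ × ℕ → ℂ := fun p =>
    (r : ℂ) ^ p.2 * tracePairing ((elemTensor α (f p.1) (g p.1)).coeff p.2) (ψ.coeff p.2)
  have hG : Summable G := by
    have h1 : Summable fun n : ℕ => (1 + n : ℝ) * (r ^ n * ‖ψ.coeff n‖) :=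
      (ψ.summable_coeff 1 hr.1 hr.2).congr fun n => by rw [Real.rpow_one]; ring
    have h2 := hs.summable.mul_of_nonneg h1 (fun k => by positivity)
      (fun n => mul_nonneg (by positivity) (mul_nonneg (pow_nonneg hr.1 _) (norm_nonneg _)))
    refine Summable.of_norm_bounded h2 fun p => ?_
    have h3 := norm_tracePairing_coeff_elemTensor_le hα (hs.left_mem p.1) (hs.right_mem p.1) p.2
      (ψ.coeff p.2)
    have hr0 := hr.1
    simp only [G]
    rw [norm_mul, norm_pow, Complex.norm_real, Real.norm_of_nonneg hr.1]
    calc _ ≤ r ^ p.2 * ((1 + p.2 : ℝ) * ‖ψ.coeff p.2‖ *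
          ((f p.1).h2Norm.toReal * (g p.1).h2Norm.toReal)) := by gcongr
      _ = _ := by ring
  have h1 := hG.hasSum.prod_fiberwise fun k => (hG.prod_factor k).hasSum
  have h2 := ((Equiv.prodComm _ _).hasSum_iff.mpr hG.hasSum).prod_fiberwise
    fun n => ((hs.trace hα n (ψ.coeff n)).2.mul_left ((r : ℂ) ^ n))
  refine ⟨h2.summable, ?_⟩
  rw [abelMean, h2.tsum_eq]
  exact h1

/-- The uniform bound for elementary tensors is summed over a representation whose cost is
arbitrarily close to the norm of h. -/
theorem norm_abelMean_le {α C : ℝ} (hα : 0 ≤ α) (hC : 0 ≤ C) {ψ : Hol (H →L[ℂ] H)}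
    (hψ : HankelBound α ψ.coeff C) (h : predual H α 0 α) {r : ℝ} (hr : r ∈ Set.Ico (0 : ℝ) 1) :
    ‖abelMean r h.1 ψ‖ ≤ C * ‖h‖ := by
  have key : ∀ c : ℝ, ‖h‖ < c → ‖abelMean r h.1 ψ‖ ≤ C * c := by
    intro c hc
    have hc' : predualNorm α 0 α h.1 < ENNReal.ofReal c :=
      (ENNReal.lt_ofReal_iff_toReal_lt (predualNorm_ne_top h)).mpr hc
    obtain ⟨f, g, hs, hlt⟩ := exists_isPredualSum hc'
    have h1 := (hs.summable_abel hα ψ hr).2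
    have h2 := h1.norm_le_of_bounded (hs.summable.mul_left C).hasSum fun k =>
      abelMean_elemTensor_le hα hC hψ (hs.left_mem k) (hs.right_mem k) hr
    refine h2.trans ?_
    rw [tsum_mul_left]
    gcongr
    have h3 := ENNReal.toReal_le_of_le_ofReal ((norm_nonneg h).trans hc.le) hlt.le
    rw [ENNReal.tsum_toReal_eq fun k =>
      (ENNReal.mul_lt_top (hs.left_mem k) (hs.right_mem k)).ne] at h3
    simpa using h3
  refine le_of_forall_gt_imp_ge_of_dense ?_
  intro a ha
  -- The cost is chosen as a/C, so C = 0 has to be treated apart.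
  rcases hC.eq_or_lt with h0 | h0
  · have := key (‖h‖ + 1) (by linarith)
    rw [← h0, zero_mul] at this ha
    linarith
  · have := key (a / C) (by rw [lt_div_iff₀ h0]; linarith)
    rwa [mul_div_cancel₀ _ h0.ne'] at this

end VecBMOA
end

noncomputable section
namespace VecBMOA

set_option linter.unusedSectionVars false

variable {H : Type*} [NormedAddCommGroup H] [InnerProductSpace ℂ H] [CompleteSpace H]

/-! ### Monomials and density -/

namespace Hol

section
variable {Y : Type*} [NormedAddCommGroup Y] [NormedSpace ℂ Y] [CompleteSpace Y]

/-- The monomial `y z^n`. -/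
def monomial (n : ℕ) (y : Y) : Hol Y := poly (n + 1) (Pi.single n y)

theorem coeff_monomial (n : ℕ) (y : Y) (m : ℕ) :
    (monomial n y).coeff m = if m = n then y else 0 := by
  rw [monomial, coeff_poly]
  by_cases h : m = n
  · subst h; simp
  · simp [h]

theorem monomial_add (n : ℕ) (x y : Y) : monomial n (x + y) = monomial n x + monomial n y :=
  ext_coeff fun m => by
    rw [coeff_add, coeff_monomial, coeff_monomial, coeff_monomial]; split_ifs <;> simp

theorem monomial_smul (n : ℕ) (c : ℂ) (y : Y) : monomial n (c • y) = c • monomial n y :=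
  ext_coeff fun m => by
    rw [coeff_smul, coeff_monomial, coeff_monomial]; split_ifs <;> simp

theorem h2Norm_monomial (n : ℕ) (y : Y) : (monomial n y).h2Norm = ‖y‖ₑ := by
  rw [h2Norm, tsum_eq_single n]
  · rw [coeff_monomial, if_pos rfl, ← ENNReal.rpow_natCast, ← ENNReal.rpow_mul]
    norm_num
  · intro m hm
    simp [coeff_monomial, hm]

theorem h2Norm_mono {f g : Hol Y} (h : ∀ n, ‖f.coeff n‖ₑ ≤ ‖g.coeff n‖ₑ) : f.h2Norm ≤ g.h2Norm := by
  rw [h2Norm, h2Norm]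
  gcongr with n
  exact h n

theorem tendsto_h2Norm_sub_poly {f : Hol Y} (hf : f.h2Norm < ∞) :
    Tendsto (fun n => (f - poly n f.coeff).h2Norm) atTop (𝓝 0) := by
  have h1 : ∑' k, ‖f.coeff k‖ₑ ^ 2 ≠ ∞ := by
    rw [← h2Norm_sq]; exact ENNReal.pow_ne_top hf.ne
  have h2 := (ENNReal.tendsto_tsum_compl_atTop_zero h1).comp tendsto_finset_range
  have h3 := h2.ennrpow_const (1 / 2 : ℝ)
  rw [ENNReal.zero_rpow_of_pos (by norm_num)] at h3
  refine h3.congr fun n => ?_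
  rw [h2Norm, Function.comp_apply]
  congr 1
  refine (tsum_subtype {k | k ∉ Finset.range n} (fun k => ‖f.coeff k‖ₑ ^ 2)).trans
    (tsum_congr fun k => ?_)
  rw [coeff_sub, coeff_poly, Set.indicator_apply]
  by_cases hk : k < n <;> simp [hk]

end
end Hol

theorem elemTensor_poly (α : ℝ) (n : ℕ) (f g : ℕ → H) :
    elemTensor α (Hol.poly n f) (Hol.poly n g) = ∑ j ∈ Finset.range n, ∑ k ∈ Finset.range n,
      (hankelWeight α j k : ℂ) • Hol.monomial (j + k) (InnerProductSpace.rankOne ℂ (f j) (g k)) := by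
  refine Hol.ext_coeff fun m => ?_
  rw [coeff_elemTensor, ← Finset.sum_product', Hol.coeff_sum]
  let F : ℕ × ℕ → H →L[ℂ] H := fun p => if p.1 < n ∧ p.2 < n ∧ p.1 + p.2 = m then
    (hankelWeight α p.1 p.2 : ℂ) • InnerProductSpace.rankOne ℂ (f p.1) (g p.2) else 0
  have e1 : ∀ p ∈ Finset.HasAntidiagonal.antidiagonal m, (hankelWeight α p.1 p.2 : ℂ) •
      InnerProductSpace.rankOne ℂ ((Hol.poly n f).coeff p.1) ((Hol.poly n g).coeff p.2) = F p := by
    intro p hp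
    have := Finset.HasAntidiagonal.mem_antidiagonal.mp hp
    simp only [F, Hol.coeff_poly]
    by_cases h1 : p.1 < n <;> by_cases h2 : p.2 < n <;> simp [h1, h2, this]
  have e2 : ∀ p ∈ Finset.range n ×ˢ Finset.range n, Hol.coeff ((hankelWeight α p.1 p.2 : ℂ) •
      Hol.monomial (p.1 + p.2) (InnerProductSpace.rankOne ℂ (f p.1) (g p.2))) m = F p := by
    intro p hp
    simp only [Finset.mem_product, Finset.mem_range] at hp
    rw [Hol.coeff_smul, Hol.coeff_monomial]
    simp only [F, hp.1, hp.2, true_and]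
    by_cases h : p.1 + p.2 = m
    · rw [if_pos h.symm, if_pos h]
    · rw [if_neg (Ne.symm h), if_neg h, smul_zero]
  rw [Finset.sum_congr rfl e1, Finset.sum_congr rfl e2]
  have s1 : ∑ p ∈ Finset.HasAntidiagonal.antidiagonal m, F p = ∑ p ∈ Finset.HasAntidiagonal.antidiagonal m ∪
      Finset.range n ×ˢ Finset.range n, F p :=
    Finset.sum_subset Finset.subset_union_left fun p _ hp =>
      if_neg fun h => hp (Finset.HasAntidiagonal.mem_antidiagonal.mpr h.2.2)
  have s2 : ∑ p ∈ Finset.range n ×ˢ Finset.range n, F p = ∑ p ∈ Finset.HasAntidiagonal.antidiagonal m ∪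
      Finset.range n ×ˢ Finset.range n, F p :=
    Finset.sum_subset Finset.subset_union_right fun p _ hp =>
      if_neg fun h => hp (Finset.mem_product.mpr ⟨Finset.mem_range.mpr h.1, Finset.mem_range.mpr h.2.1⟩)
  rw [s1, s2]

/-- Putting the whole power of z on the first factor makes the Hankel weight equal to 1. -/
theorem monomial_rankOne (α : ℝ) (n : ℕ) (x y : H) :
    Hol.monomial n (InnerProductSpace.rankOne ℂ x y) =
      elemTensor α (Hol.monomial n x) (Hol.monomial 0 y) := by
  refine Hol.ext_coeff fun m => ?_
  rw [coeff_elemTensor, Hol.coeff_monomial]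
  have e : ∀ p ∈ Finset.HasAntidiagonal.antidiagonal m, (hankelWeight α p.1 p.2 : ℂ) •
      InnerProductSpace.rankOne ℂ ((Hol.monomial n x).coeff p.1) ((Hol.monomial 0 y).coeff p.2) =
      if p = (m, 0) then (if m = n then InnerProductSpace.rankOne ℂ x y else 0) else 0 := by
    intro p hp
    have := Finset.HasAntidiagonal.mem_antidiagonal.mp hp
    rw [Hol.coeff_monomial, Hol.coeff_monomial]
    by_cases h : p = (m, 0)
    · subst h
      have hw : hankelWeight α m 0 = 1 := by
        rw [hankelWeight, add_zero, ← Real.rpow_add (by positivity)]; simp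
      rw [if_pos rfl, hw]
      by_cases h2 : m = n <;> simp [h2]
    · have h2 : p.2 ≠ 0 := fun h2 => h (Prod.ext (by simpa [h2] using this) h2)
      simp [h, h2]
  rw [Finset.sum_congr rfl e, Finset.sum_ite_eq',
    if_pos (Finset.HasAntidiagonal.mem_antidiagonal.mpr (add_zero m))]

theorem predualNorm_monomial_le (α : ℝ) (n : ℕ) (x y : H) :
    predualNorm α 0 α (Hol.monomial n (InnerProductSpace.rankOne ℂ x y)) ≤ ‖x‖ₑ * ‖y‖ₑ := by
  rw [monomial_rankOne α]
  refine (predualNorm_elemTensor_le α ?_ ?_).trans_eq ?_ <;> simp [Hol.h2Norm_monomial]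

/-- The monomial `z^n x ⊗ y` as an element of the predual. -/
def predualMonomial (α : ℝ) (n : ℕ) (x y : H) : predual H α 0 α :=
  ⟨Hol.monomial n (InnerProductSpace.rankOne ℂ x y),
    (predualNorm_monomial_le α n x y).trans_lt (ENNReal.mul_lt_top (by simp) (by simp))⟩

theorem norm_predualMonomial_le (α : ℝ) (n : ℕ) (x y : H) :
    ‖predualMonomial α n x y‖ ≤ ‖x‖ * ‖y‖ := by
  have := ENNReal.toReal_mono (by finiteness) (predualNorm_monomial_le α n x y)
  change (predualNorm α 0 α (Hol.monomial n (InnerProductSpace.rankOne ℂ x y))).toReal ≤ _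
  simpa using this

theorem tendsto_predual {a b c : ℝ} {x : ℕ → predual H a b c} {h : predual H a b c}
    (hx : Tendsto (fun n => predualNorm a b c (h.1 - (x n).1)) atTop (𝓝 0)) :
    Tendsto x atTop (𝓝 h) := by
  rw [tendsto_iff_norm_sub_tendsto_zero]
  have := (ENNReal.tendsto_toReal ENNReal.zero_ne_top).comp hx
  refine this.congr fun n => ?_
  rw [norm_sub_rev]
  rfl

/-- The monomials `z^n x ⊗ y` span a dense subspace of the predual. -/
theorem mem_of_isClosed_of_monomial {α : ℝ} {S : Submodule ℂ (predual H α 0 α)}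
    (hS : IsClosed (S : Set (predual H α 0 α))) (hm : ∀ n x y, predualMonomial α n x y ∈ S)
    (h : predual H α 0 α) : h ∈ S := by
  have hmem : ∀ {f g : Hol H}, f.h2Norm < ∞ → g.h2Norm < ∞ → elemTensor α f g ∈ predual H α 0 α :=
    fun hf hg => (predualNorm_elemTensor_le α hf hg).trans_lt (ENNReal.mul_lt_top hf hg)
  have hpoly : ∀ (n : ℕ) (f : Hol H), (Hol.poly n f.coeff).h2Norm ≤ f.h2Norm := fun n f =>
    Hol.h2Norm_mono fun k => by
      rw [Hol.coeff_poly]; split_ifs <;> simp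
  have h1 : ∀ (n : ℕ) (f g : Hol H) (hf : f.h2Norm < ∞) (hg : g.h2Norm < ∞),
      (⟨elemTensor α (Hol.poly n f.coeff) (Hol.poly n g.coeff),
        hmem ((hpoly n f).trans_lt hf) ((hpoly n g).trans_lt hg)⟩ : predual H α 0 α) ∈ S := by
    intro n f g hf hg
    have e : (⟨elemTensor α (Hol.poly n f.coeff) (Hol.poly n g.coeff),
        hmem ((hpoly n f).trans_lt hf) ((hpoly n g).trans_lt hg)⟩ : predual H α 0 α) =
        ∑ j ∈ Finset.range n, ∑ k ∈ Finset.range n, (hankelWeight α j k : ℂ) •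
          predualMonomial α (j + k) (f.coeff j) (g.coeff k) := by
      refine Subtype.ext ?_
      rw [Submodule.coe_sum]
      simp only [Submodule.coe_sum]
      exact elemTensor_poly α n f.coeff g.coeff
    rw [e]
    exact S.sum_mem fun j _ => S.sum_mem fun k _ => S.smul_mem _ (hm _ _ _)
  have h2 : ∀ (f g : Hol H) (hf : f.h2Norm < ∞) (hg : g.h2Norm < ∞),
      (⟨elemTensor α f g, hmem hf hg⟩ : predual H α 0 α) ∈ S := by
    intro f g hf hg
    refine hS.mem_of_tendsto (tendsto_predual ?_) (Eventually.of_forall fun n => h1 n f g hf hg)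
    have hfn : ∀ (u : Hol H) (n : ℕ), (u - Hol.poly n u.coeff).h2Norm ≤ u.h2Norm := fun u n =>
      Hol.h2Norm_mono fun k => by
        rw [Hol.coeff_sub, Hol.coeff_poly]; split_ifs <;> simp
    have hlim : Tendsto (fun n => (f - Hol.poly n f.coeff).h2Norm * g.h2Norm +
        f.h2Norm * (g - Hol.poly n g.coeff).h2Norm) atTop (𝓝 0) := by
      have t1 := ENNReal.Tendsto.mul_const (Hol.tendsto_h2Norm_sub_poly hf) (Or.inr hg.ne)
      have t2 := ENNReal.Tendsto.const_mul (Hol.tendsto_h2Norm_sub_poly hg) (Or.inr hf.ne)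
      simpa using t1.add t2
    refine tendsto_of_tendsto_of_tendsto_of_le_of_le tendsto_const_nhds hlim
      (fun _ => zero_le) fun n => ?_
    simp only [elemTensor_sub]
    refine (predualNorm_add_le _ _ _ _ _).trans (add_le_add ?_ ?_)
    · exact predualNorm_elemTensor_le α ((hfn f n).trans_lt hf) hg
    · refine (predualNorm_elemTensor_le α ((hpoly n f).trans_lt hf)
        ((hfn g n).trans_lt hg)).trans ?_
      gcongr
      exact hpoly n f
  obtain ⟨f, g, hs, -⟩ := exists_isPredualSum h.2
  let x : ℕ → predual H α 0 α := fun n => ∑ k ∈ Finset.range n,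
    ⟨elemTensor α (f k) (g k), hmem (hs.left_mem k) (hs.right_mem k)⟩
  refine hS.mem_of_tendsto (f := x) (b := atTop) (tendsto_predual ?_) (Eventually.of_forall fun n =>
    S.sum_mem fun k _ => h2 _ _ (hs.left_mem k) (hs.right_mem k))
  refine tendsto_of_tendsto_of_tendsto_of_le_of_le tendsto_const_nhds
    (ENNReal.tendsto_sum_nat_add _ hs.tsum_ne_top) (fun _ => zero_le) fun n => ?_
  obtain ⟨u, hu, hu'⟩ := hs.exists_tensorSum
  -- The shifted sequences represent the remainder, so its norm is at most a tail of the convergent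
  -- series of norms.
  refine (iInf₂_le (u - ∑ k ∈ Finset.range n, Hol.tensor (Hol.Dpow α (f k)) (g k)) ?_).trans
    (tensorNorm_le (f := fun k => f (k + n)) (g := fun k => g (k + n)) ?_)
  · rw [map_sub, map_sum, hu, Submodule.coe_sum]
    rfl
  · refine ⟨fun k => hs.left_mem _, fun k => hs.right_mem _, fun z hz => ?_⟩
    rw [Hol.sub_apply, Hol.sum_apply]
    have := (hasSum_nat_add_iff' n).mpr (hu'.hasSum z hz)
    simp only [Hol.tensor_apply _ _ hz]
    simpa only [Hol.Dpow_zero] using this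

end VecBMOA
end

noncomputable section
namespace VecBMOA

set_option linter.unusedSectionVars false

variable {H : Type*} [NormedAddCommGroup H] [InnerProductSpace ℂ H] [CompleteSpace H]

/-! ### Duality -/

theorem exists_isPredualSum' {α : ℝ} (h : predual H α 0 α) : ∃ f g, IsPredualSum α h.1 f g := by
  obtain ⟨f, g, hs, -⟩ := exists_isPredualSum h.2
  exact ⟨f, g, hs⟩

theorem abelMean_add {α : ℝ} (hα : 0 ≤ α) (h k : predual H α 0 α) (ψ : Hol (H →L[ℂ] H)) {r : ℝ}
    (hr : r ∈ Set.Ico (0 : ℝ) 1) :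
    abelMean r (h + k).1 ψ = abelMean r h.1 ψ + abelMean r k.1 ψ := by
  obtain ⟨f, g, hs⟩ := exists_isPredualSum' h
  obtain ⟨f', g', hs'⟩ := exists_isPredualSum' k
  rw [abelMean, abelMean, abelMean,
    ← (hs.summable_abel hα ψ hr).1.tsum_add (hs'.summable_abel hα ψ hr).1]
  refine tsum_congr fun n => ?_
  rw [← mul_add]
  congr 1
  have e : (h + k).1.coeff n = h.1.coeff n + k.1.coeff n := Hol.coeff_add _ _ _
  rw [e, tracePairing, tracePairing, tracePairing, opTrace, opTrace, opTrace,
    ← (hs.trace hα n _).1.tsum_add (hs'.trace hα n _).1]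
  refine tsum_congr fun i => ?_
  simp

theorem abelMean_smul {α : ℝ} (c : ℂ) (h : predual H α 0 α) (ψ : Hol (H →L[ℂ] H)) (r : ℝ) :
    abelMean r (c • h).1 ψ = c * abelMean r h.1 ψ := by
  rw [abelMean, abelMean, ← tsum_mul_left]
  refine tsum_congr fun n => ?_
  have e : (c • h).1.coeff n = c • h.1.coeff n := Hol.coeff_smul _ _ _
  have e2 : tracePairing (c • h.1.coeff n) (ψ.coeff n) = c * tracePairing (h.1.coeff n) (ψ.coeff n) := by
    rw [tracePairing, tracePairing, opTrace, opTrace, ← tsum_mul_left]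
    exact tsum_congr fun i => by simp
  rw [e, e2, mul_left_comm]

theorem abelMean_predualMonomial (α : ℝ) (n : ℕ) (x y : H) (ψ : Hol (H →L[ℂ] H)) (r : ℝ) :
    abelMean r (predualMonomial α n x y).1 ψ = (r : ℂ) ^ n * inner ℂ (ψ.coeff n y) x := by
  have e : (predualMonomial α n x y).1 = Hol.monomial n (InnerProductSpace.rankOne ℂ x y) := rfl
  rw [abelMean, tsum_eq_single n]
  · rw [e, Hol.coeff_monomial, if_pos rfl, tracePairing_rankOne]
  · intro m hm
    rw [e, Hol.coeff_monomial, if_neg hm, tracePairing_zero_left, mul_zero]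

theorem tendsto_abelMean_predualMonomial (α : ℝ) (n : ℕ) (x y : H) (ψ : Hol (H →L[ℂ] H)) :
    Tendsto (fun r : ℝ => abelMean r (predualMonomial α n x y).1 ψ) (𝓝[<] 1)
      (𝓝 (inner ℂ (ψ.coeff n y) x)) := by
  simp only [abelMean_predualMonomial]
  have h : Continuous fun r : ℝ => (r : ℂ) ^ n * inner ℂ (ψ.coeff n y) x := by fun_prop
  have h1 := (h.tendsto 1).mono_left (nhdsWithin_le_nhds (s := Set.Iio 1))
  simpa using h1

theorem eventually_mem_Ico : ∀ᶠ r : ℝ in 𝓝[<] 1, r ∈ Set.Ico (0 : ℝ) 1 :=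
  Ico_mem_nhdsLT zero_lt_one

/-- The Abel means of the pairing converge to any bounded functional that agrees with it on
monomials. -/
theorem tendsto_abelMean {α C : ℝ} (hα : 0 ≤ α) (hC : 0 ≤ C) {ψ : Hol (H →L[ℂ] H)}
    (hψ : HankelBound α ψ.coeff C) (l : predual H α 0 α →L[ℂ] ℂ)
    (hl : ∀ n x y, l (predualMonomial α n x y) = inner ℂ (ψ.coeff n y) x) (h : predual H α 0 α) :
    Tendsto (fun r : ℝ => abelMean r h.1 ψ) (𝓝[<] 1) (𝓝 (l h)) := by
  -- The elements for which convergence holds form a subspace. It is closed because the Abel means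
  -- are equicontinuous, and it contains the monomials.
  let S : Submodule ℂ (predual H α 0 α) :=
    { carrier := {h | Tendsto (fun r : ℝ => abelMean r h.1 ψ) (𝓝[<] 1) (𝓝 (l h))}
      add_mem' := fun {a b} ha hb => by
        change Tendsto _ _ _
        rw [map_add]
        refine (Tendsto.add ha hb).congr' ?_
        filter_upwards [eventually_mem_Ico] with r hr using (abelMean_add hα a b ψ hr).symm
      zero_mem' := by
        change Tendsto _ _ _
        rw [map_zero]
        refine tendsto_const_nhds.congr' ?_
        filter_upwards [eventually_mem_Ico] with r hr
        have := norm_abelMean_le hα hC hψ 0 hr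
        rw [norm_zero, mul_zero, norm_le_zero_iff] at this
        exact this.symm
      smul_mem' := fun c a ha => by
        change Tendsto _ _ _
        rw [map_smul, smul_eq_mul]
        simp only [abelMean_smul]
        exact Tendsto.const_mul c ha }
  refine mem_of_isClosed_of_monomial (S := S) ?_ (fun n x y => ?_) h
  · refine isClosed_of_closure_subset fun a ha => ?_
    change Tendsto _ _ _
    rw [Metric.tendsto_nhds]
    intro ε hε
    obtain ⟨b, hb, hab⟩ := Metric.mem_closure_iff.mp ha (ε / (2 * (C + ‖l‖ + 1))) (by positivity)
    filter_upwards [eventually_mem_Ico, Metric.tendsto_nhds.mp hb (ε / 2) (by positivity)] with r hr hr'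
    have e1 : abelMean r a.1 ψ = abelMean r (a - b).1 ψ + abelMean r b.1 ψ := by
      rw [← abelMean_add hα _ _ _ hr, sub_add_cancel]
    have e2 : l a = l (a - b) + l b := by rw [← map_add, sub_add_cancel]
    have h1 := norm_abelMean_le hα hC hψ (a - b) hr
    have h2 := l.le_opNorm (a - b)
    rw [dist_eq_norm] at hab hr' ⊢
    have h3 : (C + ‖l‖ + 1) * ‖a - b‖ < ε / 2 := by
      rw [lt_div_iff₀ (by positivity)] at hab
      linarith
    have h4 := norm_nonneg (a - b)
    calc ‖abelMean r a.1 ψ - l a‖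
        = ‖abelMean r (a - b).1 ψ - l (a - b) + (abelMean r b.1 ψ - l b)‖ := by
          rw [e1, e2]; congr 1; ring
      _ ≤ ‖abelMean r (a - b).1 ψ‖ + ‖l (a - b)‖ + ‖abelMean r b.1 ψ - l b‖ :=
          (norm_add_le _ _).trans (by gcongr; exact norm_sub_le _ _)
      _ < ε := by nlinarith
  · change Tendsto _ _ _
    rw [hl]
    exact tendsto_abelMean_predualMonomial α n x y ψ

/-- Every symbol with bounded weighted Hankel matrices induces a bounded functional. -/
theorem exists_functional {α C : ℝ} (hα : 0 ≤ α) (hC : 0 ≤ C) {ψ : Hol (H →L[ℂ] H)}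
    (hψ : HankelBound α ψ.coeff C) : ∃ l : predual H α 0 α →L[ℂ] ℂ,
      ∀ n x y, l (predualMonomial α n x y) = inner ℂ (ψ.coeff n y) x := by
  -- The Abel means are bounded but not yet known to converge, so a limit along an ultrafilter finer
  -- than r ↑ 1 is used to define the functional. Genuine convergence follows from
  -- `tendsto_abelMean`.
  let U : Ultrafilter ℝ := Ultrafilter.of (𝓝[<] 1)
  have hU : (U : Filter ℝ) ≤ 𝓝[<] 1 := Ultrafilter.of_le _
  have hIco : ∀ᶠ r in (U : Filter ℝ), r ∈ Set.Ico (0 : ℝ) 1 := hU eventually_mem_Ico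
  have hlim : ∀ h : predual H α 0 α, ∃ L : ℂ, Tendsto (fun r => abelMean r h.1 ψ) U (𝓝 L) := by
    intro h
    obtain ⟨L, -, hL⟩ := (isCompact_closedBall (0 : ℂ) (C * ‖h‖)).ultrafilter_le_nhds
      (U.map fun r => abelMean r h.1 ψ) (by
        rw [le_principal_iff]
        change ∀ᶠ r in (U : Filter ℝ), abelMean r h.1 ψ ∈ closedBall 0 (C * ‖h‖)
        filter_upwards [hIco] with r hr
        rw [mem_closedBall_zero_iff]
        exact norm_abelMean_le hα hC hψ h hr)
    exact ⟨L, hL⟩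
  choose L hL using hlim
  let l₀ : predual H α 0 α →ₗ[ℂ] ℂ :=
    { toFun := L
      map_add' := fun a b => tendsto_nhds_unique (hL (a + b)) (((hL a).add (hL b)).congr' (by
        filter_upwards [hIco] with r hr using (abelMean_add hα a b ψ hr).symm))
      map_smul' := fun c a => tendsto_nhds_unique (hL (c • a)) (by
        simp only [abelMean_smul, RingHom.id_apply, smul_eq_mul]
        exact (hL a).const_mul c) }
  refine ⟨l₀.mkContinuous C fun h => le_of_tendsto (hL h).norm ?_, fun n x y => ?_⟩
  · filter_upwards [hIco] with r hr using norm_abelMean_le hα hC hψ h hr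
  · exact tendsto_nhds_unique (hL _) ((tendsto_abelMean_predualMonomial α n x y ψ).mono_left hU)

/-! ### Symbols of functionals -/

theorem predualMonomial_add_left (α : ℝ) (n : ℕ) (x x' y : H) :
    predualMonomial α n (x + x') y = predualMonomial α n x y + predualMonomial α n x' y :=
  Subtype.ext (by
    change Hol.monomial _ _ = Hol.monomial _ _ + Hol.monomial _ _
    rw [map_add, add_apply, Hol.monomial_add])

theorem predualMonomial_add_right (α : ℝ) (n : ℕ) (x y y' : H) :
    predualMonomial α n x (y + y') = predualMonomial α n x y + predualMonomial α n x y' :=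
  Subtype.ext (by
    change Hol.monomial _ _ = Hol.monomial _ _ + Hol.monomial _ _
    rw [map_add, Hol.monomial_add])

theorem predualMonomial_smul_left (α : ℝ) (n : ℕ) (c : ℂ) (x y : H) :
    predualMonomial α n (c • x) y = c • predualMonomial α n x y :=
  Subtype.ext (by
    change Hol.monomial _ _ = c • Hol.monomial _ _
    rw [map_smul, smul_apply, Hol.monomial_smul])

theorem predualMonomial_smul_right (α : ℝ) (n : ℕ) (c : ℂ) (x y : H) :
    predualMonomial α n x (c • y) = conj c • predualMonomial α n x y :=
  Subtype.ext (by
    change Hol.monomial _ _ = conj c • Hol.monomial _ _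
    rw [map_smulₛₗ, Hol.monomial_smul])

/-- The operator `B` with `⟨x, B y⟩ = l (z^n x ⊗ y)`. -/
def symbolCoeff {α : ℝ} (l : predual H α 0 α →L[ℂ] ℂ) (n : ℕ) : H →L[ℂ] H :=
  InnerProductSpace.continuousLinearMapOfBilin
    ((LinearMap.mk₂'ₛₗ (starRingEnd ℂ) (RingHom.id ℂ) (fun y x => l (predualMonomial α n x y))
      (fun y y' x => by rw [predualMonomial_add_right, map_add])
      (fun c y x => by rw [predualMonomial_smul_right, map_smul])
      (fun y x x' => by rw [predualMonomial_add_left, map_add])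
      (fun c y x => by rw [predualMonomial_smul_left, map_smul]; rfl)).mkContinuous₂ ‖l‖
      fun y x => by
        change ‖l (predualMonomial α n x y)‖ ≤ _
        refine (l.le_opNorm _).trans ?_
        rw [mul_assoc, mul_comm ‖y‖]
        gcongr
        exact norm_predualMonomial_le α n x y)

theorem inner_symbolCoeff {α : ℝ} (l : predual H α 0 α →L[ℂ] ℂ) (n : ℕ) (x y : H) :
    inner ℂ (symbolCoeff l n y) x = l (predualMonomial α n x y) :=
  InnerProductSpace.continuousLinearMapOfBilin_apply _ _ _

theorem norm_symbolCoeff_le {α : ℝ} (l : predual H α 0 α →L[ℂ] ℂ) (n : ℕ) :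
    ‖symbolCoeff l n‖ ≤ ‖l‖ := by
  refine ContinuousLinearMap.opNorm_le_bound _ (norm_nonneg l) fun y => ?_
  set v := symbolCoeff l n y with hv
  rcases (norm_nonneg v).eq_or_lt with h0 | h0
  · rw [← h0]; positivity
  have h1 : ‖v‖ * ‖v‖ ≤ ‖l‖ * (‖v‖ * ‖y‖) := by
    calc ‖v‖ * ‖v‖ = ‖inner ℂ v v‖ := by rw [inner_self_eq_norm_sq_to_K]; simp [sq]
      _ = ‖l (predualMonomial α n v y)‖ := by rw [hv, inner_symbolCoeff]
      _ ≤ _ := (l.le_opNorm _).trans (by gcongr; exact norm_predualMonomial_le α n v y)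
  rw [← mul_le_mul_iff_left₀ h0]
  linarith

/-- The symbol of a bounded functional. -/
def symbol {α : ℝ} (l : predual H α 0 α →L[ℂ] ℂ) : Hol (H →L[ℂ] H) :=
  Hol.ofCoeff (symbolCoeff l) (Hol.summable_of_bounded (norm_symbolCoeff_le l))

theorem inner_coeff_symbol {α : ℝ} (l : predual H α 0 α →L[ℂ] ℂ) (n : ℕ) (x y : H) :
    l (predualMonomial α n x y) = inner ℂ ((symbol l).coeff n y) x := by
  rw [symbol, Hol.coeff_ofCoeff, inner_symbolCoeff]

theorem symbol_eq_of_inner {α : ℝ} {l : predual H α 0 α →L[ℂ] ℂ} {ψ : Hol (H →L[ℂ] H)}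
    (h : ∀ n x y, l (predualMonomial α n x y) = inner ℂ (ψ.coeff n y) x) : symbol l = ψ := by
  refine Hol.ext_coeff fun n => ContinuousLinearMap.ext fun y => ext_inner_right ℂ fun x => ?_
  rw [← inner_coeff_symbol, h]

/-- The Hankel form of the symbol at (f, g) is l evaluated at the elementary tensor of the two
polynomials, and the predual norm of that tensor is at most the product of their Hardy norms. -/
theorem hankelBound_symbol {α : ℝ} (l : predual H α 0 α →L[ℂ] ℂ) :
    HankelBound α (symbol l).coeff ‖l‖ := by
  intro n f g
  have hf : ∀ u : ℕ → H, (Hol.poly n u).h2Norm = ENNReal.ofReal (√(∑ j ∈ Finset.range n, ‖u j‖ ^ 2)) := by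
    intro u
    refine (ENNReal.pow_right_strictMono two_ne_zero).injective ?_
    rw [Hol.h2Norm_poly_sq, ← ENNReal.ofReal_pow (Real.sqrt_nonneg _),
      Real.sq_sqrt (Finset.sum_nonneg fun _ _ => by positivity)]
  have hfin : ∀ u : ℕ → H, (Hol.poly n u).h2Norm < ∞ := fun u => by rw [hf]; simp
  have hle := predualNorm_elemTensor_le α (hfin f) (hfin g)
  let T : predual H α 0 α := ∑ j ∈ Finset.range n, ∑ k ∈ Finset.range n, (hankelWeight α j k : ℂ) •
    predualMonomial α (j + k) (f j) (g k)
  have hT : T.1 = elemTensor α (Hol.poly n f) (Hol.poly n g) := by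
    rw [elemTensor_poly]
    change ((∑ j ∈ Finset.range n, ∑ k ∈ Finset.range n, (hankelWeight α j k : ℂ) •
      predualMonomial α (j + k) (f j) (g k) : predual H α 0 α) : Hol (H →L[ℂ] H)) = _
    rw [Submodule.coe_sum]
    simp only [Submodule.coe_sum]
    rfl
  have hTn : ‖T‖ ≤ √(∑ j ∈ Finset.range n, ‖f j‖ ^ 2) * √(∑ k ∈ Finset.range n, ‖g k‖ ^ 2) := by
    change (predualNorm α 0 α T.1).toReal ≤ _
    rw [hf, hf, ← hT, ← ENNReal.ofReal_mul (Real.sqrt_nonneg _)] at hle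
    exact ENNReal.toReal_le_of_le_ofReal (by positivity) hle
  have e : ∑ j ∈ Finset.range n, ∑ k ∈ Finset.range n,
      (hankelWeight α j k : ℂ) * inner ℂ ((symbol l).coeff (j + k) (g k)) (f j) = l T := by
    simp only [T, map_sum, map_smul, inner_coeff_symbol, smul_eq_mul]
  rw [e, mul_assoc]
  exact (l.le_opNorm T).trans (by gcongr)

/-- The conjugate-linear map from functionals to symbols. -/
def symbolMap (α : ℝ) : (predual H α 0 α →L[ℂ] ℂ) →ₛₗ[starRingEnd ℂ] Hol (H →L[ℂ] H) where
  toFun := symbol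
  map_add' l l' := symbol_eq_of_inner fun n x y => by
    rw [Hol.coeff_add, add_apply, add_apply, inner_add_left, inner_coeff_symbol, inner_coeff_symbol]
  map_smul' c l := symbol_eq_of_inner fun n x y => by
    rw [Hol.coeff_smul, smul_apply, smul_apply, inner_smul_left, Complex.conj_conj,
      inner_coeff_symbol, smul_eq_mul]

/-- Abel's theorem for absolutely convergent series. -/
theorem tendsto_abel_of_summable {a : ℕ → ℂ} (ha : Summable a) :
    Tendsto (fun r : ℝ => ∑' n : ℕ, (r : ℂ) ^ n * a n) (𝓝[<] 1) (𝓝 (∑' n, a n)) := by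
  refine tendsto_tsum_of_dominated_convergence ha.norm (fun n => ?_) ?_
  · have h : Continuous fun r : ℝ => (r : ℂ) ^ n * a n := by fun_prop
    have h1 := (h.tendsto 1).mono_left (nhdsWithin_le_nhds (s := Set.Iio 1))
    simpa using h1
  · filter_upwards [eventually_mem_Ico] with r hr n
    rw [norm_mul, norm_pow, Complex.norm_real, Real.norm_of_nonneg hr.1]
    exact mul_le_of_le_one_left (norm_nonneg _) (pow_le_one₀ hr.1 hr.2.le)

/-- A functional has a Hankel-bounded symbol and conversely; the equivalence of Hankel bounds with
the Carleson norm transfers this to BMOA. The norm comparisons use that a functional is the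
pointwise limit of the Abel means of its symbol. -/
theorem isDualOfPredual_left {α : ℝ} (hα : 0 < α) :
    IsDualOfPredual α 0 α (BMOAC H) bmoaCNorm := by
  obtain ⟨K, hK, hKφ⟩ := exists_bmoaCNorm_hankelBound (H := H) hα
  have hlim : ∀ (l : predual H α 0 α →L[ℂ] ℂ) h,
      Tendsto (fun r : ℝ => abelMean r h.1 (symbol l)) (𝓝[<] 1) (𝓝 (l h)) := fun l h =>
    tendsto_abelMean hα.le (norm_nonneg l) (hankelBound_symbol l) l (inner_coeff_symbol l) h
  have hle : ∀ l : predual H α 0 α →L[ℂ] ℂ, bmoaCNorm (symbol l) ≤ ENNReal.ofReal (K * ‖l‖) :=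
    fun l => (hKφ _).1 _ (norm_nonneg l) (hankelBound_symbol l)
  have hfin : ∀ l : predual H α 0 α →L[ℂ] ℂ, bmoaCNorm (symbol l) ≠ ∞ := fun l =>
    ((hle l).trans_lt ENNReal.ofReal_lt_top).ne
  refine ⟨symbolMap α, fun l l' h => ?_, ?_, ⟨K.toNNReal, fun l => ⟨?_, ?_⟩⟩, fun l h => ⟨?_, ?_, ?_⟩⟩
  -- The symbol determines all Abel means and hence the functional.
  · ext h'
    have h1 := hlim l h'
    have e : symbol l = symbol l' := h
    rw [e] at h1
    exact tendsto_nhds_unique h1 (hlim l' h')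
  · ext ψ
    constructor
    · rintro ⟨l, rfl⟩
      exact (hfin l).lt_top
    · intro hψ
      obtain ⟨l, hl⟩ := exists_functional hα.le (by positivity) ((hKφ ψ).2 (ne_of_lt hψ))
      exact ⟨l, symbol_eq_of_inner hl⟩
  · refine (hle l).trans_eq ?_
    rw [ENNReal.ofReal_mul hK, ofReal_norm]
    rfl
  · change ‖l‖ₑ ≤ ENNReal.ofReal K * bmoaCNorm (symbol l)
    have h1 : ‖l‖ ≤ K * (bmoaCNorm (symbol l)).toReal := by
      refine l.opNorm_le_bound (by positivity) fun h => le_of_tendsto (hlim l h).norm ?_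
      filter_upwards [eventually_mem_Ico] with r hr
      exact norm_abelMean_le hα.le (by positivity) ((hKφ _).2 (hfin l)) h hr
    rw [← ofReal_norm, ← ENNReal.ofReal_toReal (hfin l), ← ENNReal.ofReal_mul hK]
    exact ENNReal.ofReal_le_ofReal h1
  · intro r hr
    obtain ⟨f, g, hs⟩ := exists_isPredualSum' h
    exact (hs.summable_abel hα.le _ hr).1
  · exact hlim l h
  · intro hsum
    exact tendsto_nhds_unique (hlim l h) (tendsto_abel_of_summable hsum)

end VecBMOA
end

noncomputable section
namespace VecBMOA

set_option linter.unusedSectionVars false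

variable {H : Type*} [NormedAddCommGroup H] [InnerProductSpace ℂ H] [CompleteSpace H]

/-! ### Coefficient conjugation -/

theorem sharp_apply (φ : Hol (H →L[ℂ] H)) (z : ℂ) :
    sharp φ z = ContinuousLinearMap.adjoint (φ (conj z)) := rfl

theorem coeff_sharp (φ : Hol (H →L[ℂ] H)) (n : ℕ) :
    (sharp φ).coeff n = ContinuousLinearMap.adjoint (φ.coeff n) := by
  refine Hol.coeff_unique _ (p := fun n => ContinuousLinearMap.adjoint (φ.coeff n)) (fun z hz => ?_) n
  have hz' : conj z ∈ ball (0 : ℂ) 1 := by simpa using hz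
  have h := (φ.hasSum_coeff hz').mapL
    (ContinuousLinearMap.adjoint (𝕜 := ℂ) (E := H) (F := H)).toContinuousLinearEquiv.toContinuousLinearMap
  refine (congrArg (fun v : ℕ → H →L[ℂ] H => HasSum v _) (funext fun n => ?_)).mpr h
  change _ = ContinuousLinearMap.adjoint (conj z ^ n • φ.coeff n)
  rw [map_smulₛₗ, map_pow, Complex.conj_conj]

theorem sharp_sharp (φ : Hol (H →L[ℂ] H)) : sharp (sharp φ) = φ := Hol.ext_coeff fun n => by
  rw [coeff_sharp, coeff_sharp, ContinuousLinearMap.adjoint_adjoint]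

theorem sharp_add (φ ψ : Hol (H →L[ℂ] H)) : sharp (φ + ψ) = sharp φ + sharp ψ :=
  Hol.ext_coeff fun n => by
    rw [coeff_sharp, Hol.coeff_add, Hol.coeff_add, coeff_sharp, coeff_sharp, map_add]

theorem sharp_smul (c : ℂ) (φ : Hol (H →L[ℂ] H)) : sharp (c • φ) = conj c • sharp φ :=
  Hol.ext_coeff fun n => by
    rw [coeff_sharp, Hol.coeff_smul, Hol.coeff_smul, coeff_sharp, map_smulₛₗ]

theorem sharp_Dpow (a : ℝ) (φ : Hol (H →L[ℂ] H)) : sharp (Hol.Dpow a φ) = Hol.Dpow a (sharp φ) :=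
  Hol.ext_coeff fun n => by
    rw [coeff_sharp, Hol.coeff_Dpow, Hol.coeff_Dpow, coeff_sharp, map_smulₛₗ, Complex.conj_ofReal]

theorem IsTensorSum.sharp {a b : ℝ} {u : Hol (H →L[ℂ] H)} {f g : ℕ → Hol H}
    (h : IsTensorSum a b u f g) : IsTensorSum b a (sharp u) g f := by
  refine ⟨h.right_mem, h.left_mem, fun z hz => ?_⟩
  have hz' : conj z ∈ ball (0 : ℂ) 1 := by simpa using hz
  have h1 := (h.hasSum _ hz').mapL
    (ContinuousLinearMap.adjoint (𝕜 := ℂ) (E := H) (F := H)).toContinuousLinearEquiv.toContinuousLinearMap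
  refine (congrArg (fun v : ℕ → H →L[ℂ] H => HasSum v _) (funext fun n => ?_)).mpr h1
  change _ = ContinuousLinearMap.adjoint (InnerProductSpace.rankOne ℂ _ _)
  rw [InnerProductSpace.adjoint_rankOne, Complex.conj_conj]

theorem tensorNorm_sharp_le (a b : ℝ) (u : Hol (H →L[ℂ] H)) :
    tensorNorm b a (sharp u) ≤ tensorNorm a b u := by
  refine le_iInf₂ fun f g => le_iInf fun h => (tensorNorm_le h.sharp).trans_eq ?_
  exact tsum_congr fun k => mul_comm _ _

theorem predualNorm_sharp_le (a b c : ℝ) (h : Hol (H →L[ℂ] H)) :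
    predualNorm b a c (sharp h) ≤ predualNorm a b c h := by
  refine le_iInf₂ fun u hu => (iInf₂_le (sharp u) ?_).trans (tensorNorm_sharp_le a b u)
  rw [hu, sharp_Dpow]

theorem predualNorm_sharp (a b c : ℝ) (h : Hol (H →L[ℂ] H)) :
    predualNorm b a c (sharp h) = predualNorm a b c h := by
  refine le_antisymm (predualNorm_sharp_le a b c h) ?_
  simpa only [sharp_sharp] using predualNorm_sharp_le b a c (sharp h)

/-- Coefficient conjugation on the preduals. -/
def predualSharp {a b c : ℝ} (h : predual H a b c) : predual H b a c :=
  ⟨sharp h.1, (predualNorm_sharp a b c h.1).trans_lt h.2⟩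

theorem predualSharp_predualSharp {a b c : ℝ} (h : predual H a b c) :
    predualSharp (predualSharp h) = h := Subtype.ext (sharp_sharp h.1)

theorem norm_predualSharp {a b c : ℝ} (h : predual H a b c) : ‖predualSharp h‖ = ‖h‖ :=
  congrArg ENNReal.toReal (predualNorm_sharp a b c h.1)

/-- The transpose of coefficient conjugation. -/
def dualSharp {a b c : ℝ} (l : predual H b a c →L[ℂ] ℂ) : predual H a b c →L[ℂ] ℂ :=
  LinearMap.mkContinuous
    { toFun := fun h => conj (l (predualSharp h))
      map_add' := fun h k => by
        have e : predualSharp (h + k) = predualSharp h + predualSharp k :=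
          Subtype.ext (sharp_add h.1 k.1)
        rw [e, map_add, map_add]
      map_smul' := fun t h => by
        have e : predualSharp (t • h) = conj t • predualSharp h := Subtype.ext (sharp_smul t h.1)
        rw [e, map_smul, smul_eq_mul, map_mul, Complex.conj_conj]
        rfl } ‖l‖ fun h => by
      change ‖conj (l (predualSharp h))‖ ≤ _
      rw [RCLike.norm_conj, ← norm_predualSharp h]
      exact l.le_opNorm _

theorem dualSharp_apply {a b c : ℝ} (l : predual H b a c →L[ℂ] ℂ) (h : predual H a b c) :
    dualSharp l h = conj (l (predualSharp h)) := rfl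

theorem dualSharp_dualSharp {a b c : ℝ} (l : predual H b a c →L[ℂ] ℂ) :
    dualSharp (dualSharp l) = l := by
  ext h
  rw [dualSharp_apply, dualSharp_apply, Complex.conj_conj, predualSharp_predualSharp]

theorem norm_dualSharp_le {a b c : ℝ} (l : predual H b a c →L[ℂ] ℂ) : ‖dualSharp l‖ ≤ ‖l‖ :=
  LinearMap.mkContinuous_norm_le _ (norm_nonneg l) _

theorem norm_dualSharp {a b c : ℝ} (l : predual H b a c →L[ℂ] ℂ) : ‖dualSharp l‖ = ‖l‖ := by
  refine le_antisymm (norm_dualSharp_le l) ?_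
  simpa only [dualSharp_dualSharp] using norm_dualSharp_le (dualSharp l)

/-- With T the coefficient, this says tr(B T*) = tr(T* B), a cyclicity of the trace. It is proved
through a nuclear representation of T, since `tracePairing` alone is a sum over a fixed basis. -/
theorem tracePairing_adjoint {α : ℝ} (hα : 0 ≤ α) (h : predual H α 0 α) (n : ℕ) (B : H →L[ℂ] H) :
    tracePairing (ContinuousLinearMap.adjoint (h.1.coeff n)) (ContinuousLinearMap.adjoint B) =
      conj (tracePairing (h.1.coeff n) B) := by
  obtain ⟨f, g, hs⟩ := exists_isPredualSum' h
  obtain ⟨h1, h2⟩ := hs.nuclear hα n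
  have h3 := h2.mapL
    (ContinuousLinearMap.adjoint (𝕜 := ℂ) (E := H) (F := H)).toContinuousLinearEquiv.toContinuousLinearMap
  have h4 : HasSum (fun q : ℕ × Finset.HasAntidiagonal.antidiagonal n => InnerProductSpace.rankOne ℂ
      ((g q.1).coeff q.2.1.2) ((hankelWeight α q.2.1.1 q.2.1.2 : ℂ) • (f q.1).coeff q.2.1.1))
      (ContinuousLinearMap.adjoint (h.1.coeff n)) := by
    refine (congrArg (fun v : _ → H →L[ℂ] H => HasSum v _) (funext fun q => ?_)).mpr h3
    exact (InnerProductSpace.adjoint_rankOne _ _).symm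
  have h5 := (nuclear_trace (h1.congr fun q => mul_comm _ _) h4 (ContinuousLinearMap.adjoint B)).2
  have h6 := (nuclear_trace h1 h2 B).2.star
  refine h5.unique ((congrArg (fun v : _ → ℂ => HasSum v _) (funext fun q => ?_)).mpr h6)
  rw [ContinuousLinearMap.adjoint_inner_left]
  exact (inner_conj_symm _ _).symm

/-- Transport of structure by φ ↦ φ^#. The new symbol map composes three conjugate-linear maps, so
it is again conjugate-linear, and the pairing is complex conjugated. -/
theorem isDualOfPredual_sharp {α : ℝ} (hα : 0 ≤ α) {W : Set (Hol (H →L[ℂ] H))}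
    {N : Hol (H →L[ℂ] H) → ℝ≥0∞} (h : IsDualOfPredual α 0 α W N) :
    IsDualOfPredual 0 α α {φ | sharp φ ∈ W} fun φ => N (sharp φ) := by
  obtain ⟨J, hJ, hW, ⟨C, hC⟩, hlim⟩ := h
  let J' : (predual H 0 α α →L[ℂ] ℂ) →ₛₗ[starRingEnd ℂ] Hol (H →L[ℂ] H) :=
    { toFun := fun l => sharp (J (dualSharp l))
      map_add' := fun l l' => by
        have e : dualSharp (l + l') = dualSharp l + dualSharp l' := by
          ext h; simp [dualSharp_apply]
        rw [e, map_add, sharp_add]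
      map_smul' := fun c l => by
        have e : dualSharp (c • l) = conj c • dualSharp l := by
          ext h; simp [dualSharp_apply]
        rw [e, map_smulₛₗ, sharp_smul, Complex.conj_conj] }
  have hJ' : ∀ l, J' l = sharp (J (dualSharp l)) := fun l => rfl
  refine ⟨J', fun l l' hl => ?_, ?_, ⟨C, fun l => ?_⟩, fun l k => ?_⟩
  · have h1 := congrArg sharp (show sharp (J (dualSharp l)) = sharp (J (dualSharp l')) from hl)
    rw [sharp_sharp, sharp_sharp] at h1
    rw [← dualSharp_dualSharp l, hJ h1, dualSharp_dualSharp]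
  · ext φ
    constructor
    · rintro ⟨l, rfl⟩
      rw [Set.mem_ofPred_eq, hJ', sharp_sharp, ← hW]
      exact ⟨_, rfl⟩
    · intro hφ
      rw [Set.mem_ofPred_eq, ← hW] at hφ
      obtain ⟨l, hl⟩ := hφ
      exact ⟨dualSharp l, by rw [hJ', dualSharp_dualSharp, hl, sharp_sharp]⟩
  · have e : ‖l‖ₑ = ‖dualSharp l‖ₑ := by rw [← ofReal_norm, ← ofReal_norm, norm_dualSharp]
    simp only [hJ', sharp_sharp, e]
    exact hC _
  · have e : ∀ n, tracePairing (k.1.coeff n) ((J' l).coeff n) =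
        conj (tracePairing ((predualSharp k).1.coeff n) ((J (dualSharp l)).coeff n)) := by
      intro n
      rw [← tracePairing_adjoint hα, hJ', coeff_sharp]
      have : k.1.coeff n = ContinuousLinearMap.adjoint ((predualSharp k).1.coeff n) := by
        rw [← coeff_sharp]
        exact congrArg (fun u : Hol (H →L[ℂ] H) => u.coeff n) (sharp_sharp k.1).symm
      rw [← this]
    have e' : ∀ (r : ℝ) (n : ℕ), (r : ℂ) ^ n * tracePairing (k.1.coeff n) ((J' l).coeff n) =
        star ((r : ℂ) ^ n * tracePairing ((predualSharp k).1.coeff n) ((J (dualSharp l)).coeff n)) := by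
      intro r n
      rw [e, star_mul', star_pow]
      simp
    obtain ⟨h1, h2, h3⟩ := hlim (dualSharp l) (predualSharp k)
    have hl : star (dualSharp l (predualSharp k)) = l k := by
      rw [dualSharp_apply, predualSharp_predualSharp]
      exact Complex.conj_conj _
    refine ⟨fun r hr => ?_, ?_, fun hs => ?_⟩
    · simp only [e']
      exact (h1 r hr).star
    · simp only [e', ← tsum_star]
      rw [← hl]
      exact (continuous_star.tendsto _).comp h2
    · simp only [e] at hs ⊢
      rw [← hl, h3 (by simpa using hs.star)]
      exact tsum_star

theorem isDualOfPredual_right {α : ℝ} (hα : 0 < α) :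
    IsDualOfPredual 0 α α (BMOACsharp H) fun φ => bmoaCNorm (sharp φ) :=
  isDualOfPredual_sharp hα.le (isDualOfPredual_left hα)

end VecBMOA
end

noncomputable section
namespace VecBMOA

/-! ### Harmonic majorants of the norm of a Hardy function -/

set_option linter.unusedSectionVars false

section Majorant

variable {Y : Type*} [NormedAddCommGroup Y] [InnerProductSpace ℂ Y] [CompleteSpace Y]

theorem circleAverage_norm_sq (f : Hol Y) {r : ℝ} (hr : r ∈ Set.Ioo (0 : ℝ) 1) :
    Real.circleAverage (fun ζ => ‖f ζ‖ ^ 2) 0 r = ∑' n : ℕ, ‖(r : ℂ) ^ n • f.coeff n‖ ^ 2 := by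
  have hc : Summable fun n : ℕ => ‖(r : ℂ) ^ n • f.coeff n‖ := by
    simpa [norm_smul, abs_of_pos hr.1] using f.summable_pow_mul_coeff hr.1.le hr.2
  have h := integral_norm_sq_trigSeries (q := fun n : ℕ => (n : ℤ)) hc Nat.cast_injective
  rw [Real.circleAverage_eq_integral_add (-Real.pi),
    intervalIntegral.integral_comp_add_right
      (fun t => ‖f (circleMap 0 r t)‖ ^ 2) (-Real.pi), zero_add,
    show 2 * Real.pi + -Real.pi = Real.pi by ring,
    intervalIntegral.integral_of_le (by linarith [Real.pi_pos]), integral_Ioc_eq_integral_Ioo]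
  simp only [circleMap_zero, f.apply_polar hr]
  rw [h, smul_eq_mul, ← mul_assoc, inv_mul_cancel₀ (by positivity), one_mul]

theorem mem_ball_of_mem_sphere {r : ℝ} (hr : r ∈ Set.Ioo (0 : ℝ) 1) {ζ : ℂ}
    (hζ : ζ ∈ sphere (0 : ℂ) |r|) : ζ ∈ ball (0 : ℂ) 1 ∧ ζ ≠ 0 ∧ ‖ζ‖ = r := by
  have h : ‖ζ‖ = r := by simpa [abs_of_pos hr.1] using hζ
  refine ⟨by simpa [h] using hr.2, norm_ne_zero_iff.mp (by rw [h]; exact hr.1.ne'), h⟩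

/-- The expansion 1 + 2 Σ_{n≥1} x^n; it explains the factor 1 at n = 0 and 2 otherwise in the
analytic completion below. -/
theorem hasSum_herglotz {x : ℂ} (hx : ‖x‖ < 1) :
    HasSum (fun n : ℕ => (if n = 0 then 1 else 2 : ℂ) * x ^ n) ((1 + x) / (1 - x)) := by
  have h0 : (1 - x) ≠ 0 := by
    intro h
    rw [← sub_eq_zero.mp h, norm_one] at hx
    exact lt_irrefl _ hx
  have h1 := (hasSum_geometric_of_norm_lt_one hx).mul_left 2
  have h2 := h1.sub (hasSum_ite_eq (0 : ℕ) (1 : ℂ))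
  have e : 2 * (1 - x)⁻¹ - 1 = (1 + x) / (1 - x) := by field_simp; ring
  rw [e] at h2
  refine (congrArg (fun v : ℕ → ℂ => HasSum v _) (funext fun n => ?_)).mpr h2
  rcases eq_or_ne n 0 with rfl | hn
  · norm_num
  · simp [hn]

/-- The Fourier coefficients of `‖f‖` on a circle. -/
def normCoeff (f : Hol Y) (r : ℝ) (n : ℕ) : ℂ :=
  Real.circleAverage (fun ζ => (‖f ζ‖ : ℂ) * (r / ζ) ^ n) 0 r

theorem continuousOn_sphere (f : Hol Y) {r : ℝ} (hr : r ∈ Set.Ioo (0 : ℝ) 1) :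
    ContinuousOn f (sphere 0 |r|) :=
  f.continuousOn.mono fun _ h => (mem_ball_of_mem_sphere hr h).1

/-- Bessel's inequality for the scalar function ‖f‖ on a circle: average 2 Re(‖f‖ q̄) ≤ ‖f‖² + |q|²,
where q is the partial Fourier sum. The left side averages to 2B and |q|² to B. -/
theorem sum_norm_sq_normCoeff_le (f : Hol Y) {r : ℝ} (hr : r ∈ Set.Ioo (0 : ℝ) 1) (N : ℕ) :
    ∑ n ∈ Finset.range N, ‖normCoeff f r n‖ ^ 2 ≤
      Real.circleAverage (fun ζ => ‖f ζ‖ ^ 2) 0 r := by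
  set b := normCoeff f r
  set B := ∑ n ∈ Finset.range N, ‖b n‖ ^ 2 with hB
  let q : Hol ℂ := Hol.poly N fun n => ((r : ℂ) ^ n)⁻¹ * b n
  have hr0 : (r : ℂ) ≠ 0 := Complex.ofReal_ne_zero.mpr hr.1.ne'
  have hq : Real.circleAverage (fun ζ => ‖q ζ‖ ^ 2) 0 r = B := by
    rw [circleAverage_norm_sq q hr, tsum_eq_sum (s := Finset.range N)]
    · refine Finset.sum_congr rfl fun n hn => ?_
      rw [Hol.coeff_poly, if_pos (Finset.mem_range.mp hn), smul_eq_mul,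
        mul_inv_cancel_left₀ (pow_ne_zero _ hr0)]
    · intro n hn
      rw [Hol.coeff_poly, if_neg (by simpa using hn)]
      simp
  have hf := continuousOn_sphere f hr
  have hqc := continuousOn_sphere q hr
  have hinv : ContinuousOn (fun ζ : ℂ => (r : ℂ) / ζ) (sphere 0 |r|) :=
    continuousOn_const.div continuousOn_id fun ζ h => (mem_ball_of_mem_sphere hr h).2.1
  have hnf : ContinuousOn (fun ζ => (‖f ζ‖ : ℂ)) (sphere 0 |r|) :=
    Complex.continuous_ofReal.comp_continuousOn hf.norm
  have hterm : ∀ n, CircleIntegrable (fun ζ => (‖f ζ‖ : ℂ) * (r / ζ) ^ n) 0 r := fun n =>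
    (hnf.mul (hinv.pow n)).circleIntegrable'
  have hS : Real.circleAverage (fun ζ => (‖f ζ‖ : ℂ) * conj (q ζ)) 0 r = B := by
    have e : Set.EqOn (fun ζ => (‖f ζ‖ : ℂ) * conj (q ζ))
        (fun ζ => ∑ n ∈ Finset.range N, conj (b n) • ((‖f ζ‖ : ℂ) * (r / ζ) ^ n))
        (sphere 0 |r|) := by
      intro ζ hζ
      obtain ⟨h1, h2, h3⟩ := mem_ball_of_mem_sphere hr hζ
      simp only
      rw [Hol.poly_apply _ _ h1, map_sum, Finset.mul_sum]
      refine Finset.sum_congr rfl fun n _ => ?_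
      have hc : conj ζ = r ^ 2 / ζ := by
        rw [eq_div_iff h2, mul_comm, Complex.mul_conj', h3]
      rw [smul_eq_mul, smul_eq_mul, map_mul, map_mul, map_pow, map_inv₀, map_pow, hc,
        Complex.conj_ofReal]
      field_simp
      ring
    rw [Real.circleAverage_congr_sphere e,
      Real.circleAverage_fun_sum (f := fun n ζ => conj (b n) • ((‖f ζ‖ : ℂ) * (r / ζ) ^ n))
        fun n _ => (hterm n).const_smul]
    rw [hB]
    push_cast
    refine Finset.sum_congr rfl fun n _ => ?_
    rw [show (fun ζ => conj (b n) • ((‖f ζ‖ : ℂ) * (r / ζ) ^ n)) =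
      conj (b n) • fun ζ => (‖f ζ‖ : ℂ) * (r / ζ) ^ n from rfl, Real.circleAverage_smul]
    exact Complex.conj_mul' _
  have hre : Real.circleAverage (fun ζ => ((‖f ζ‖ : ℂ) * conj (q ζ)).re) 0 r = B := by
    have h := Complex.reCLM.circleAverage_comp_comm
      (f := fun ζ => (‖f ζ‖ : ℂ) * conj (q ζ)) (c := 0) (R := r)
      (hnf.mul (Complex.continuous_conj.comp_continuousOn hqc)).circleIntegrable'
    rw [hS] at h
    simpa [Function.comp_def] using h
  have hmono := Real.circleAverage_mono (c := 0) (R := r)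
    (f₁ := fun ζ => (2 : ℝ) • ((‖f ζ‖ : ℂ) * conj (q ζ)).re)
    (f₂ := fun ζ => ‖f ζ‖ ^ 2 + ‖q ζ‖ ^ 2)
    (ContinuousOn.circleIntegrable' (ContinuousOn.fun_const_smul
      (Complex.continuous_re.comp_continuousOn
        (hnf.mul (Complex.continuous_conj.comp_continuousOn hqc))) (2 : ℝ)))
    ((hf.norm.pow 2).add (hqc.norm.pow 2)).circleIntegrable' (fun ζ _ => by
      have h1 : ((‖f ζ‖ : ℂ) * conj (q ζ)).re ≤ ‖f ζ‖ * ‖q ζ‖ := by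
        refine (Complex.re_le_norm _).trans (le_of_eq ?_)
        simp
      rw [smul_eq_mul]
      nlinarith [sq_nonneg (‖f ζ‖ - ‖q ζ‖)])
  rw [Real.circleAverage_fun_add (f₁ := fun ζ => ‖f ζ‖ ^ 2) (f₂ := fun ζ => ‖q ζ‖ ^ 2)
    (hf.norm.pow 2).circleIntegrable' (hqc.norm.pow 2).circleIntegrable', hq,
    show (fun ζ => (2 : ℝ) • ((‖f ζ‖ : ℂ) * conj (q ζ)).re) =
      (2 : ℝ) • fun ζ => ((‖f ζ‖ : ℂ) * conj (q ζ)).re from rfl, Real.circleAverage_smul, hre,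
    smul_eq_mul] at hmono
  linarith

/-- Since f is its own Poisson integral and the Poisson kernel is positive, ‖f‖ is at most the
Poisson integral of its boundary norm. That integral is the real part of the Herglotz integral,
whose Taylor coefficients in z are the Fourier coefficients of ‖f‖ times 1 or 2. -/
theorem norm_apply_le_re_normCoeff (f : Hol Y) {r : ℝ} (hr : r ∈ Set.Ioo (0 : ℝ) 1) {z : ℂ}
    (hz : z ∈ ball (0 : ℂ) 1) :
    ‖f (r * z)‖ ≤ (∑' n : ℕ, z ^ n • ((if n = 0 then 1 else 2 : ℂ) * normCoeff f r n)).re := by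
  have hz1 := mem_ball_zero_iff.mp hz
  have hr0 : (r : ℂ) ≠ 0 := Complex.ofReal_ne_zero.mpr hr.1.ne'
  have hf := continuousOn_sphere f hr
  have hw : (r * z : ℂ) ∈ ball (0 : ℂ) r := by
    rw [mem_ball_zero_iff, norm_mul, Complex.norm_real, Real.norm_of_nonneg hr.1.le]
    exact mul_lt_of_lt_one_right hr.1 hz1
  have hnf : ContinuousOn (fun ζ => (‖f ζ‖ : ℂ)) (sphere 0 |r|) :=
    Complex.continuous_ofReal.comp_continuousOn hf.norm
  have hcf : Continuous fun t => ‖f (circleMap 0 r t)‖ :=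
    hf.norm.comp_continuous (continuous_circleMap 0 r) (circleMap_mem_sphere' 0 r)
  have hcm : ∀ t, circleMap 0 r t ≠ 0 := fun t =>
    (mem_ball_of_mem_sphere hr (circleMap_mem_sphere' 0 r t)).2.1
  have hnm : ∀ t, ‖(r : ℂ) / circleMap 0 r t‖ = 1 := fun t => by
    rw [norm_div, (mem_ball_of_mem_sphere hr (circleMap_mem_sphere' 0 r t)).2.2,
      Complex.norm_real, Real.norm_of_nonneg hr.1.le, div_self hr.1.ne']
  have hgeo : HasSum (fun n : ℕ => 2 * ‖z‖ ^ n) (2 * (1 - ‖z‖)⁻¹) :=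
    (hasSum_geometric_of_lt_one (norm_nonneg z) hz1).mul_left 2
  have hsum : HasSum (fun n : ℕ => z ^ n • ((if n = 0 then 1 else 2 : ℂ) * normCoeff f r n))
      (Real.circleAverage (fun ζ => herglotzRieszKernel 0 (r * z) ζ • (‖f ζ‖ : ℂ)) 0 r) := by
    have h := intervalIntegral.hasSum_integral_of_dominated_convergence (a := 0)
      (b := 2 * Real.pi) (μ := volume)
      (F := fun (n : ℕ) t => ((if n = 0 then 1 else 2 : ℂ) * z ^ n) •
        ((‖f (circleMap 0 r t)‖ : ℂ) * (r / circleMap 0 r t) ^ n))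
      (f := fun t => herglotzRieszKernel 0 (r * z) (circleMap 0 r t) •
        (‖f (circleMap 0 r t)‖ : ℂ))
      (fun n t => 2 * ‖z‖ ^ n * ‖f (circleMap 0 r t)‖) (fun n => ?_) (fun n => ?_) ?_ ?_ ?_
    · refine (congrArg (fun v : ℕ → ℂ => HasSum v _) (funext fun n => ?_)).mpr
        (h.const_smul (2 * Real.pi)⁻¹)
      rw [intervalIntegral.integral_smul, normCoeff, Real.circleAverage_def, Complex.real_smul,
        Complex.real_smul, smul_eq_mul, smul_eq_mul]
      ring
    · refine Continuous.aestronglyMeasurable (Continuous.fun_const_smul ?_ _)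
      exact (Complex.continuous_ofReal.comp hcf).mul
        ((continuous_const.div (continuous_circleMap 0 r) hcm).pow n)
    · refine Eventually.of_forall fun t _ => ?_
      rw [norm_smul, norm_mul, norm_mul, norm_pow, norm_pow, hnm, one_pow, mul_one,
        Complex.norm_real, norm_norm]
      gcongr
      split_ifs <;> norm_num
    · exact Eventually.of_forall fun t _ => hgeo.summable.mul_right _
    · simp only [tsum_mul_right]
      exact (hcf.const_mul _).intervalIntegrable _ _
    · refine Eventually.of_forall fun t _ => ?_
      have hx : ‖z * (r / circleMap 0 r t)‖ < 1 := by rw [norm_mul, hnm, mul_one]; exact hz1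
      have hs := (hasSum_herglotz hx).mul_right (‖f (circleMap 0 r t)‖ : ℂ)
      have e : (1 + z * (r / circleMap 0 r t)) / (1 - z * (r / circleMap 0 r t)) =
          herglotzRieszKernel 0 (r * z) (circleMap 0 r t) := by
        rw [herglotzRieszKernel_def, sub_zero, sub_zero, ← mul_div_mul_left _ _ (hcm t), mul_add,
          mul_sub, mul_one, mul_left_comm, mul_div_cancel₀ _ (hcm t), mul_comm z]
      rw [e] at hs
      refine (congrArg (fun v : ℕ → ℂ => HasSum v _) (funext fun n => ?_)).mpr hs
      rw [smul_eq_mul, mul_pow]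
      ring
  rw [hsum.tsum_eq, re_circleAverage_herglotzRieszKernel_smul hf.norm.circleIntegrable' hw]
  have hd : DiffContOnCl ℂ f (ball 0 r) := by
    refine DifferentiableOn.diffContOnCl (f.diffOn.mono fun ζ hζ => ?_)
    have := closure_ball_subset_closedBall hζ
    rw [mem_closedBall_zero_iff] at this
    exact mem_ball_zero_iff.mpr (this.trans_lt hr.2)
  rw [← hd.circleAverage_re_herglotzRieszKernel_smul hw, Real.circleAverage_def,
    Real.circleAverage_def, norm_smul, Real.norm_of_nonneg (by positivity), smul_eq_mul]
  refine mul_le_mul_of_nonneg_left ?_ (by positivity)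
  refine (intervalIntegral.norm_integral_le_integral_norm (by positivity)).trans (le_of_eq ?_)
  refine intervalIntegral.integral_congr fun t _ => ?_
  simp only [Pi.smul_apply', norm_smul, smul_eq_mul]
  congr 1
  refine Real.norm_of_nonneg ?_
  have ht : circleMap 0 r t ∈ sphere (0 : ℂ) r := circleMap_mem_sphere 0 hr.1.le t
  refine le_trans ?_ (le_re_herglotzRieszKernel ht hw)
  have := mem_ball_zero_iff.mp hw
  rw [sub_zero]
  exact div_nonneg (by linarith) (by linarith [norm_nonneg ((r : ℂ) * z), hr.1])

theorem circleAverage_norm_sq_le {f : Hol Y} {s : ℝ} (hf : f.h2Norm ≤ ENNReal.ofReal s)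
    (hs : 0 ≤ s) {r : ℝ} (hr : r ∈ Set.Ioo (0 : ℝ) 1) :
    Real.circleAverage (fun ζ => ‖f ζ‖ ^ 2) 0 r ≤ s ^ 2 := by
  have hf' : f.h2Norm < ∞ := hf.trans_lt ENNReal.ofReal_lt_top
  have hn : f.h2Norm.toReal ≤ s := ENNReal.toReal_le_of_le_ofReal hs hf
  rw [circleAverage_norm_sq f hr]
  refine Real.tsum_le_of_sum_le (fun n => by positivity) fun t => ?_
  refine le_trans ?_ ((Hol.sum_norm_sq_coeff_le hf' t).trans
    (pow_le_pow_left₀ ENNReal.toReal_nonneg hn 2))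
  refine Finset.sum_le_sum fun n _ => ?_
  rw [norm_smul, norm_pow, Complex.norm_real, Real.norm_of_nonneg hr.1.le]
  exact pow_le_pow_left₀ (by have := hr.1.le; positivity)
    (mul_le_of_le_one_left (norm_nonneg _) (pow_le_one₀ hr.1.le hr.2.le)) 2

/-- The norm of a Hardy function is dominated by the modulus of a zero-free scalar Hardy
function. -/
theorem exists_majorant {f : Hol Y} {s : ℝ} (hs : 0 < s) (hf : f.h2Norm ≤ ENNReal.ofReal s) :
    ∃ v : Hol ℂ, v.h2Norm ≤ ENNReal.ofReal (3 * s) ∧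
      ∀ z ∈ ball (0 : ℂ) 1, v z ≠ 0 ∧ ‖f z‖ ≤ ‖v z‖ := by
  let r : ℕ → ℝ := fun m => 1 - 1 / ((m : ℝ) + 2)
  have hr : ∀ m, r m ∈ Set.Ioo (0 : ℝ) 1 := fun m => by
    have h1 : (0 : ℝ) < 1 / ((m : ℝ) + 2) := by positivity
    have h2 : 1 / ((m : ℝ) + 2) < 1 := by
      rw [div_lt_one (by positivity)]
      linarith [Nat.cast_nonneg (α := ℝ) m]
    exact ⟨by simp only [r]; linarith, by simp only [r]; linarith⟩
  have hrlim : Tendsto r atTop (𝓝 1) := by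
    have h := (tendsto_const_div_atTop_nhds_zero_nat (1 : ℝ)).comp (tendsto_add_atTop_nat 2)
    simpa [r, Function.comp_def] using h.const_sub 1
  -- The Herglotz functions for the radii r_m → 1 have uniformly bounded coefficients, so a
  -- coefficientwise limit along an ultrafilter replaces the choice of a convergent subsequence.
  let U : Ultrafilter ℕ := Filter.hyperfilter ℕ
  have hU : (U : Filter ℕ) ≤ atTop := Nat.hyperfilter_le_atTop
  let a : ℕ → ℕ → ℂ := fun m n => (if n = 0 then 1 else 2 : ℂ) * normCoeff f (r m) n
  have hasum : ∀ m N, ∑ n ∈ Finset.range N, ‖a m n‖ ^ 2 ≤ (2 * s) ^ 2 := fun m N => by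
    calc ∑ n ∈ Finset.range N, ‖a m n‖ ^ 2
        ≤ ∑ n ∈ Finset.range N, 2 ^ 2 * ‖normCoeff f (r m) n‖ ^ 2 := by
          refine Finset.sum_le_sum fun n _ => ?_
          rw [norm_mul, mul_pow]
          gcongr
          split_ifs <;> norm_num
      _ ≤ 2 ^ 2 * s ^ 2 := by
          rw [← Finset.mul_sum]
          gcongr
          exact (sum_norm_sq_normCoeff_le f (hr m) N).trans
            (circleAverage_norm_sq_le hf hs.le (hr m))
      _ = _ := by ring
  have ha : ∀ m n, ‖a m n‖ ≤ 2 * s := fun m n => by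
    refine abs_le_of_sq_le_sq' ?_ (by positivity) |>.2
    refine (Finset.single_le_sum (f := fun n => ‖a m n‖ ^ 2) (fun _ _ => by positivity)
      (Finset.mem_range.mpr n.lt_succ_self)).trans (hasum m (n + 1))
  have hex : ∀ n, ∃ A : ℂ, Tendsto (fun m => a m n) U (𝓝 A) := fun n => by
    obtain ⟨A, -, hA⟩ := (isCompact_closedBall (0 : ℂ) (2 * s)).ultrafilter_le_nhds
      (U.map fun m => a m n) (by
        rw [le_principal_iff]
        exact Filter.mem_map.mpr (Eventually.of_forall fun m => by simpa using ha m n))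
    exact ⟨A, hA⟩
  choose A hA using hex
  have hAsum : ∀ N, ∑ n ∈ Finset.range N, ‖A n‖ ^ 2 ≤ (2 * s) ^ 2 := fun N =>
    le_of_tendsto (tendsto_finsetSum _ fun n _ => (hA n).norm.pow 2)
      (Eventually.of_forall fun m => hasum m N)
  have hA' : ∀ n, ‖A n‖ ≤ 2 * s := fun n =>
    le_of_tendsto (hA n).norm (Eventually.of_forall fun m => ha m n)
  -- Adding s > 0 to the constant coefficient makes the real part at least ‖f‖ + s, so the majorant
  -- has no zeros even where f vanishes.
  have hb : ∀ r ∈ Set.Ico (0 : ℝ) 1,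
      Summable fun n => r ^ n * ‖A n + (Pi.single 0 (s : ℂ) : ℕ → ℂ) n‖ :=
    Hol.summable_of_bounded (C := 3 * s) fun n => by
      refine (norm_add_le _ _).trans ?_
      have h1 : ‖(Pi.single 0 (s : ℂ) : ℕ → ℂ) n‖ ≤ s := by
        rcases eq_or_ne n 0 with rfl | hn
        · simp [abs_of_pos hs]
        · simp [hn, hs.le]
      linarith [hA' n]
  refine ⟨Hol.ofCoeff _ hb, ?_, fun z hz => ?_⟩
  · refine (ENNReal.pow_le_pow_left_iff two_ne_zero).mp ?_
    rw [Hol.h2Norm_sq, ← ENNReal.ofReal_pow (by positivity)]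
    refine ENNReal.tsum_le_of_sum_range_le fun N => ?_
    simp only [Hol.coeff_ofCoeff, enorm_sq_eq_ofReal]
    rw [← ENNReal.ofReal_sum_of_nonneg fun _ _ => by positivity]
    refine ENNReal.ofReal_le_ofReal ?_
    rcases N with _ | N
    · simp; positivity
    have h := hAsum (N + 1)
    rw [Finset.sum_range_succ'] at h ⊢
    simp only [Pi.single_eq_same, Pi.single_eq_of_ne (Nat.succ_ne_zero _), add_zero]
    have h1 := norm_add_le (A 0) (s : ℂ)
    rw [Complex.norm_real, Real.norm_of_nonneg hs.le] at h1
    -- The change of the constant term adds at most 2s|A 0| + s² ≤ 5s² to the bound 4s², which gives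
    -- (3s)².
    nlinarith [hA' 0, norm_nonneg (A 0), norm_nonneg (A 0 + s)]
  · have hz1 := mem_ball_zero_iff.mp hz
    have h1 : HasSum (fun n => z ^ n • A n) (Hol.ofCoeff _ hb z - s) := by
      have h2 := (Hol.ofCoeff_hasSum hb hz).sub (hasSum_ite_eq (0 : ℕ) (s : ℂ))
      refine (congrArg (fun v : ℕ → ℂ => HasSum v _) (funext fun n => ?_)).mpr h2
      rcases eq_or_ne n 0 with rfl | hn
      · simp
      · simp [hn]
    have hlim : Tendsto (fun m => ∑' n, z ^ n • a m n) U (𝓝 (∑' n, z ^ n • A n)) :=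
      tendsto_tsum_of_dominated_convergence (bound := fun n => ‖z‖ ^ n * (2 * s))
        ((summable_geometric_of_lt_one (norm_nonneg z) hz1).mul_right _)
        (fun n => (hA n).const_smul _)
        (Eventually.of_forall fun m n => by
          rw [norm_smul, norm_pow]
          exact mul_le_mul_of_nonneg_left (ha m n) (by positivity))
    rw [h1.tsum_eq] at hlim
    have hfl : Tendsto (fun m => ‖f (r m * z)‖) U (𝓝 ‖f z‖) := by
      have h3 : Tendsto (fun m => (r m : ℂ) * z) U (𝓝 z) := by
        have := ((Complex.continuous_ofReal.tendsto 1).comp (hrlim.mono_left hU)).mul_const z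
        simpa [Function.comp_def] using this
      exact ((f.continuousOn.continuousAt (isOpen_ball.mem_nhds hz)).tendsto.comp h3).norm
    have h4 := le_of_tendsto_of_tendsto' hfl ((Complex.continuous_re.tendsto _).comp hlim)
      fun m => norm_apply_le_re_normCoeff f (hr m) hz
    rw [Complex.sub_re, Complex.ofReal_re] at h4
    have h5 := Complex.re_le_norm (Hol.ofCoeff _ hb z)
    refine ⟨fun h0 => ?_, by linarith⟩
    rw [h0, Complex.zero_re] at h4
    linarith [norm_nonneg (f z)]

end Majorant

end VecBMOA
end

noncomputable section
namespace VecBMOA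

set_option linter.unusedSectionVars false

variable {H : Type*} [NormedAddCommGroup H] [InnerProductSpace ℂ H] [CompleteSpace H]

/-! ### Products of Hilbert-Schmidt valued Hardy functions are tensor sums -/

/-- Distinct orthonormal vectors are at distance at least 1, so the balls of radius 1/2 about them
are disjoint; a separable space has only countably many disjoint nonempty open sets. -/
theorem Orthonormal.countable [TopologicalSpace.SeparableSpace H] {ι : Type*} {e : ι → H}
    (he : Orthonormal ℂ e) : Countable ι := by
  refine Pairwise.countable_of_isOpen_disjoint (s := fun i => ball (e i) (1 / 2))
    (fun i j hij => ball_disjoint_ball ?_) (fun i => isOpen_ball)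
    fun i => ⟨e i, mem_ball_self (by norm_num)⟩
  have h1 : (inner ℂ (e i) (e i - e j) : ℂ) = 1 := by
    rw [inner_sub_right, he.2 hij, inner_self_eq_norm_sq_to_K, he.1]
    simp
  have h2 := norm_inner_le_norm (𝕜 := ℂ) (e i) (e i - e j)
  rw [h1, he.1, norm_one, one_mul] at h2
  rw [dist_eq_norm]
  linarith

theorem tsum_mul_sq_le {ι : Type*} (f g : ι → ℝ≥0∞) :
    ∑' i, f i * g i ≤ (∑' i, f i ^ 2) ^ (1 / 2 : ℝ) * (∑' i, g i ^ 2) ^ (1 / 2 : ℝ) := by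
  rw [ENNReal.tsum_eq_iSup_sum]
  refine iSup_le fun s => (ENNReal.inner_le_Lp_mul_Lq s f g Real.HolderConjugate.two_two).trans ?_
  simp only [ENNReal.rpow_ofNat]
  gcongr <;> exact ENNReal.sum_le_tsum s

theorem tensorNorm_le_of_countable {ι : Type*} [Countable ι] {a b : ℝ} {u : Hol (H →L[ℂ] H)}
    {f g : ι → Hol H} (hf : ∀ i, (f i).h2Norm < ∞) (hg : ∀ i, (g i).h2Norm < ∞)
    (h : ∀ z ∈ ball (0 : ℂ) 1, HasSum
      (fun i => InnerProductSpace.rankOne ℂ (Hol.Dpow a (f i) z) (Hol.Dpow b (g i) (conj z)))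
      (u z)) :
    tensorNorm a b u ≤ ∑' i, (f i).h2Norm * (g i).h2Norm := by
  obtain ⟨e, he⟩ := exists_injective_nat ι
  have h0 : ∀ (p : ι → Hol H), ∀ k ∉ Set.range e, Function.extend e p 0 k = 0 := fun p k hk =>
    Function.extend_apply' _ _ _ fun ⟨i, hi⟩ => hk ⟨i, hi⟩
  have h1 : IsTensorSum a b u (Function.extend e f 0) (Function.extend e g 0) := by
    refine ⟨fun k => ?_, fun k => ?_, fun z hz => ?_⟩
    · by_cases hk : k ∈ Set.range e
      · obtain ⟨i, rfl⟩ := hk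
        rw [he.extend_apply]
        exact hf i
      · rw [h0 f k hk, Hol.h2Norm_zero]
        exact ENNReal.zero_lt_top
    · by_cases hk : k ∈ Set.range e
      · obtain ⟨i, rfl⟩ := hk
        rw [he.extend_apply]
        exact hg i
      · rw [h0 g k hk, Hol.h2Norm_zero]
        exact ENNReal.zero_lt_top
    · rw [← he.hasSum_iff]
      · simpa only [Function.comp_def, he.extend_apply] using h z hz
      · intro k hk
        rw [h0 f k hk, map_zero, Hol.zero_apply, map_zero, _root_.zero_apply]
  refine (tensorNorm_le h1).trans (le_of_eq ?_)
  rw [← he.tsum_eq]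
  · simp only [he.extend_apply]
  · intro k hk
    by_contra h2
    rw [Function.mem_support, h0 f k h2, Hol.h2Norm_zero, zero_mul] at hk
    exact hk rfl

/-- The analytic function `z ↦ F(z) x`. -/
def Hol.column (F : Hol (H →L[ℂ] H)) (x : H) : Hol H :=
  ⟨fun z => F z x, F.diffOn.clm_apply (differentiableOn_const x), fun z hz => by
    change F z x = 0
    rw [show F z = 0 from F.2.2 z hz, _root_.zero_apply]⟩

theorem Hol.column_apply (F : Hol (H →L[ℂ] H)) (x : H) (z : ℂ) : F.column x z = F z x := rfl

theorem Hol.coeff_column (F : Hol (H →L[ℂ] H)) (x : H) (n : ℕ) :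
    (F.column x).coeff n = F.coeff n x := by
  refine Hol.coeff_unique _ (p := fun n => F.coeff n x) (fun z hz => ?_) n
  rw [Hol.column_apply]
  simpa using (F.hasSum_coeff hz).mapL (ContinuousLinearMap.apply ℂ H x)

theorem Hol.Dpow_column (a : ℝ) (F : Hol (H →L[ℂ] H)) (x : H) :
    Hol.Dpow a (F.column x) = (Hol.Dpow a F).column x := by
  refine Hol.ext_coeff fun n => ?_
  rw [Hol.coeff_Dpow, Hol.coeff_column, Hol.coeff_column, Hol.coeff_Dpow]
  rfl

theorem sq_rpow_half (x : ℝ≥0∞) : (x ^ (1 / 2 : ℝ)) ^ 2 = x := by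
  rw [← ENNReal.rpow_natCast, ← ENNReal.rpow_mul]
  norm_num

theorem hsNorm_sq (T : H →L[ℂ] H) : hsNorm T ^ 2 = ∑' i, ‖T (onb H i)‖ₑ ^ 2 := sq_rpow_half _

theorem h2HSNorm_sq (F : Hol (H →L[ℂ] H)) :
    h2HSNorm F ^ 2 = ∑' i, (F.column (onb H i)).h2Norm ^ 2 := by
  rw [h2HSNorm, sq_rpow_half]
  simp only [hsNorm_sq, Hol.h2Norm_sq, Hol.coeff_column]
  exact ENNReal.tsum_comm

theorem h2HSNorm_eq (F : Hol (H →L[ℂ] H)) :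
    h2HSNorm F = (∑' i, (F.column (onb H i)).h2Norm ^ 2) ^ (1 / 2 : ℝ) := by
  rw [← h2HSNorm_sq, ← ENNReal.rpow_natCast, ← ENNReal.rpow_mul]
  norm_num

theorem HilbertBasis.tsum_enorm_inner_sq {ι : Type*} (e : HilbertBasis ι ℂ H) (x : H) :
    ∑' i, ‖(inner ℂ (e i) x : ℂ)‖ₑ ^ 2 = ‖x‖ₑ ^ 2 := by
  have h := (e.hasSum_inner_mul_inner x x).mapL Complex.reCLM
  have e1 : ∀ i, Complex.reCLM (inner ℂ x (e i) * inner ℂ (e i) x) =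
      ‖(inner ℂ (e i) x : ℂ)‖ ^ 2 := fun i => by
    rw [← inner_conj_symm x (e i), Complex.conj_mul', Complex.reCLM_apply, ← Complex.ofReal_pow,
      Complex.ofReal_re]
  simp only [e1, Complex.reCLM_apply, inner_self_eq_norm_sq_to_K] at h
  have h2 : ((‖x‖ : ℂ) ^ 2).re = ‖x‖ ^ 2 := by rw [← Complex.ofReal_pow, Complex.ofReal_re]
  have h3 := h.tsum_eq.trans h2
  rw [tsum_enorm_sq h.summable, h3, enorm_sq_eq_ofReal]

theorem hsNorm_adjoint (T : H →L[ℂ] H) : hsNorm (ContinuousLinearMap.adjoint T) = hsNorm T := by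
  rw [hsNorm, hsNorm]
  congr 1
  simp only [← HilbertBasis.tsum_enorm_inner_sq (onb H)]
  rw [ENNReal.tsum_comm]
  refine tsum_congr fun i => tsum_congr fun j => ?_
  rw [ContinuousLinearMap.adjoint_inner_right, ← ofReal_norm, norm_inner_symm, ofReal_norm]

theorem h2HSNorm_sharp (F : Hol (H →L[ℂ] H)) : h2HSNorm (sharp F) = h2HSNorm F := by
  simp only [h2HSNorm, coeff_sharp, hsNorm_adjoint]

theorem comp_adjoint_apply_hasSum {ι : Type*} (e : HilbertBasis ι ℂ H) (A B : H →L[ℂ] H) (w : H) :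
    HasSum (fun i => InnerProductSpace.rankOne ℂ (A (e i)) (B (e i)) w)
      ((A ∘L ContinuousLinearMap.adjoint B) w) := by
  have h := (e.hasSum_repr (ContinuousLinearMap.adjoint B w)).mapL A
  refine (congrArg (fun v : ι → H => HasSum v _) (funext fun i => ?_)).mpr h
  rw [InnerProductSpace.rankOne_apply, map_smul, e.repr_apply_apply,
    ContinuousLinearMap.adjoint_inner_right]

/-- For operators, A B = Σ (A e_i) ⊗ (B* e_i). Hence the columns of F and of G^# give a tensor
representation of the product, and by Cauchy–Schwarz its cost is at most the product of the
Hilbert–Schmidt Hardy norms. Separability makes the index set countable. -/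
theorem IsProduct.predualNorm_le [TopologicalSpace.SeparableSpace H] {a b c : ℝ}
    {h F G : Hol (H →L[ℂ] H)} (hp : IsProduct a b c h F G) :
    predualNorm a b c h ≤ h2HSNorm F * h2HSNorm G := by
  obtain ⟨hF, hG, u, hu, rfl⟩ := hp
  have := Orthonormal.countable (onb H).orthonormal
  refine (iInf₂_le (f := fun v (_ : Hol.Dpow (-c) u = Hol.Dpow (-c) v) => tensorNorm a b v) u
    rfl).trans ?_
  have hle : ∑' i, (F.column (onb H i)).h2Norm * ((sharp G).column (onb H i)).h2Norm ≤
      h2HSNorm F * h2HSNorm G := by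
    rw [← h2HSNorm_sharp G, h2HSNorm_eq F, h2HSNorm_eq (sharp G)]
    exact tsum_mul_sq_le _ _
  have hmem : ∀ {K : Hol (H →L[ℂ] H)}, h2HSNorm K < ∞ → ∀ i, (K.column (onb H i)).h2Norm < ∞ := by
    intro K hK i
    have h1 : (K.column (onb H i)).h2Norm ^ 2 ≤ h2HSNorm K ^ 2 := by
      rw [h2HSNorm_sq]
      exact ENNReal.le_tsum (f := fun i => (K.column (onb H i)).h2Norm ^ 2) i
    exact ((ENNReal.pow_le_pow_left_iff two_ne_zero).mp h1).trans_lt hK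
  refine (tensorNorm_le_of_countable (f := fun i => F.column (onb H i))
    (g := fun i => (sharp G).column (onb H i)) (hmem hF)
    (hmem (by rwa [h2HSNorm_sharp])) fun z hz => ?_).trans hle
  have hz' : conj z ∈ ball (0 : ℂ) 1 := by simpa using hz
  have hs : Summable fun i => InnerProductSpace.rankOne ℂ (Hol.Dpow a (F.column (onb H i)) z)
      (Hol.Dpow b ((sharp G).column (onb H i)) (conj z)) := by
    obtain ⟨C, hC, hC'⟩ := Hol.exists_enorm_Dpow_le (Y := H) a hz
    obtain ⟨K, hK, hK'⟩ := Hol.exists_enorm_Dpow_le (Y := H) b hz'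
    refine Summable.of_enorm (ne_top_of_le_ne_top (b := C * K * (h2HSNorm F * h2HSNorm G)) ?_ ?_)
    · exact ENNReal.mul_ne_top (ENNReal.mul_ne_top hC hK) (ENNReal.mul_ne_top hF.ne hG.ne)
    · refine le_trans ?_ (mul_le_mul_right hle (C * K))
      rw [← ENNReal.tsum_mul_left]
      refine ENNReal.tsum_le_tsum fun i => ?_
      rw [InnerProductSpace.enorm_rankOne, mul_mul_mul_comm]
      exact mul_le_mul' (hC' _) (hK' _)
  -- The series converges absolutely in operator norm; its sum is identified by evaluating at
  -- vectors, where the basis expansion holds.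
  convert hs.hasSum using 1
  ext w
  have h1 := comp_adjoint_apply_hasSum (onb H) (Hol.Dpow a F z)
    (Hol.Dpow b (sharp G) (conj z)) w
  have h2 : ContinuousLinearMap.adjoint (Hol.Dpow b (sharp G) (conj z)) = Hol.Dpow b G z := by
    rw [← sharp_Dpow, sharp_apply, Complex.conj_conj, ContinuousLinearMap.adjoint_adjoint]
  rw [h2, ← hu z hz] at h1
  have h3 := hs.hasSum.mapL (ContinuousLinearMap.apply ℂ H w)
  simp only [Hol.Dpow_column, Hol.column_apply, ContinuousLinearMap.apply_apply] at h3 ⊢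
  exact h1.unique h3

theorem predualNorm_le_prodNorm [TopologicalSpace.SeparableSpace H] (a b c : ℝ)
    (h : Hol (H →L[ℂ] H)) : predualNorm a b c h ≤ prodNorm a b c h :=
  le_iInf₂ fun _ _ => le_iInf fun hp => hp.predualNorm_le

end VecBMOA
end

noncomputable section
namespace VecBMOA

set_option linter.unusedSectionVars false

variable {H : Type*} [NormedAddCommGroup H] [InnerProductSpace ℂ H] [CompleteSpace H]

/-! ### Tensor sums are products of Hilbert-Schmidt valued Hardy functions -/

theorem Hol.eq_zero_of_h2Norm {f : Hol H} (hf : f.h2Norm = 0) : f = 0 :=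
  Hol.ext_coeff fun n => by
    have h := f.enorm_coeff_le n
    rw [hf, nonpos_iff_eq_zero, enorm_eq_zero] at h
    rw [h, Hol.coeff_zero]

/-- The two factors of an elementary tensor can be given the same norm. -/
theorem exists_balanced {f g : Hol H} (hf : f.h2Norm < ∞) (hg : g.h2Norm < ∞) :
    ∃ f' g' : Hol H, f'.h2Norm ^ 2 ≤ f.h2Norm * g.h2Norm ∧ g'.h2Norm ^ 2 ≤ f.h2Norm * g.h2Norm ∧
      ∀ (a b : ℝ) (z w : ℂ), InnerProductSpace.rankOne ℂ (Hol.Dpow a f' z) (Hol.Dpow b g' w) =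
        InnerProductSpace.rankOne ℂ (Hol.Dpow a f z) (Hol.Dpow b g w) := by
  by_cases h0 : f.h2Norm = 0 ∨ g.h2Norm = 0
  · refine ⟨0, 0, by simp [Hol.h2Norm_zero], by simp [Hol.h2Norm_zero], fun a b z w => ?_⟩
    rcases h0 with h | h
    · rw [Hol.eq_zero_of_h2Norm h]; simp
    · rw [Hol.eq_zero_of_h2Norm h]; simp
  push Not at h0
  set x := f.h2Norm.toReal
  set y := g.h2Norm.toReal
  have hx : 0 < x := ENNReal.toReal_pos h0.1 hf.ne
  have hy : 0 < y := ENNReal.toReal_pos h0.2 hg.ne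
  have ex : f.h2Norm = ENNReal.ofReal x := (ENNReal.ofReal_toReal hf.ne).symm
  have ey : g.h2Norm = ENNReal.ofReal y := (ENNReal.ofReal_toReal hg.ne).symm
  have key : ∀ {p q : ℝ}, 0 < p → 0 < q →
      (‖((√(q / p) : ℝ) : ℂ)‖ₑ * ENNReal.ofReal p) ^ 2 = ENNReal.ofReal (p * q) := by
    intro p q hp hq
    rw [← ofReal_norm, Complex.norm_real, Real.norm_of_nonneg (Real.sqrt_nonneg _),
      ← ENNReal.ofReal_mul (Real.sqrt_nonneg _), ← ENNReal.ofReal_pow (by positivity), mul_pow,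
      Real.sq_sqrt (by positivity)]
    congr 1
    field_simp
  refine ⟨((√(y / x) : ℝ) : ℂ) • f, ((√(x / y) : ℝ) : ℂ) • g, ?_, ?_, fun a b z w => ?_⟩
  · rw [Hol.h2Norm_smul, ex, ey, key hx hy, ENNReal.ofReal_mul hx.le]
  · rw [Hol.h2Norm_smul, ex, ey, key hy hx, mul_comm, ENNReal.ofReal_mul hx.le]
  · have e : √(x / y) * √(y / x) = 1 := by
      rw [← Real.sqrt_mul (by positivity), div_mul_div_comm, mul_comm, div_self (by positivity),
        Real.sqrt_one]
    ext v
    rw [InnerProductSpace.rankOne_apply, InnerProductSpace.rankOne_apply, map_smul, map_smul,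
      Hol.smul_apply, Hol.smul_apply, inner_smul_left, smul_smul, Complex.conj_ofReal,
      mul_right_comm, ← Complex.ofReal_mul, e, Complex.ofReal_one, one_mul]

/-- A representation of an element of the first predual by square summable sequences. -/
theorem exists_balanced_sum {α : ℝ} {h : Hol (H →L[ℂ] H)} {c : ℝ≥0∞}
    (hc : predualNorm α 0 α h < c) : ∃ (u : Hol (H →L[ℂ] H)) (f g : ℕ → Hol H),
      h = Hol.Dpow (-α) u ∧
      (∀ z ∈ ball (0 : ℂ) 1, HasSum (fun k => InnerProductSpace.rankOne ℂ
        (Hol.Dpow α (f k) z) (g k (conj z))) (u z)) ∧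
      ∑' k, (f k).h2Norm ^ 2 ≤ c ∧ ∑' k, (g k).h2Norm ^ 2 ≤ c := by
  obtain ⟨f, g, hfg, hlt⟩ := exists_isPredualSum hc
  obtain ⟨u, hu, hs⟩ := hfg.exists_tensorSum
  choose f' g' h1 h2 h3 using fun k => exists_balanced (hs.left_mem k) (hs.right_mem k)
  refine ⟨u, f', g', hu, fun z hz => ?_, (ENNReal.tsum_le_tsum h1).trans hlt.le,
    (ENNReal.tsum_le_tsum h2).trans hlt.le⟩
  refine (congrArg (fun v : ℕ → H →L[ℂ] H => HasSum v _) (funext fun k => ?_)).mpr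
    (hs.hasSum z hz)
  have h4 := h3 k α 0 z (conj z)
  rwa [Hol.Dpow_zero] at h4

/-- The operator with prescribed square summable columns. -/
theorem exists_operator_of_columns {ι : Type*} (e : HilbertBasis ι ℂ H) {x : ι → H}
    (hx : Summable fun i => ‖x i‖ ^ 2) :
    ∃ T : H →L[ℂ] H, (∀ i, T (e i) = x i) ∧ ‖T‖ ≤ √(∑' i, ‖x i‖ ^ 2) := by
  set S := √(∑' i, ‖x i‖ ^ 2)
  have hle : ∀ (v : H) (s : Finset ι), ∑ i ∈ s, ‖(inner ℂ (e i) v : ℂ) • x i‖ ≤ S * ‖v‖ := by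
    intro v s
    have h1 : ∑ i ∈ s, ‖(inner ℂ (e i) v : ℂ)‖ ^ 2 ≤ ‖v‖ ^ 2 :=
      e.orthonormal.sum_inner_products_le v
    have h2 : ∑ i ∈ s, ‖x i‖ ^ 2 ≤ ∑' i, ‖x i‖ ^ 2 :=
      hx.sum_le_tsum s fun _ _ => by positivity
    calc ∑ i ∈ s, ‖(inner ℂ (e i) v : ℂ) • x i‖
        = ∑ i ∈ s, ‖x i‖ * ‖(inner ℂ (e i) v : ℂ)‖ :=
          Finset.sum_congr rfl fun i _ => by rw [norm_smul, mul_comm]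
      _ ≤ _ := Real.sum_mul_le_sqrt_mul_sqrt s _ _
      _ ≤ S * √(‖v‖ ^ 2) :=
          mul_le_mul (Real.sqrt_le_sqrt h2) (Real.sqrt_le_sqrt h1) (Real.sqrt_nonneg _)
            (Real.sqrt_nonneg _)
      _ = _ := by rw [Real.sqrt_sq (norm_nonneg v)]
  have hsum : ∀ v : H, Summable fun i => ‖(inner ℂ (e i) v : ℂ) • x i‖ := fun v =>
    summable_of_sum_le (fun _ => norm_nonneg _) (hle v)
  let L : H →ₗ[ℂ] H :=
    { toFun := fun v => ∑' i, (inner ℂ (e i) v : ℂ) • x i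
      map_add' := fun v w => by
        rw [← (hsum v).of_norm.tsum_add (hsum w).of_norm]
        exact tsum_congr fun i => by rw [inner_add_right, add_smul]
      map_smul' := fun c v => by
        rw [RingHom.id_apply, ← (hsum v).of_norm.tsum_const_smul c]
        exact tsum_congr fun i => by rw [inner_smul_right, smul_smul] }
  have hL : ∀ v, ‖L v‖ ≤ S * ‖v‖ := fun v =>
    (norm_tsum_le_tsum_norm (hsum v)).trans
      (Real.tsum_le_of_sum_le (fun _ => norm_nonneg _) (hle v))
  refine ⟨L.mkContinuous S hL, fun i => ?_, L.mkContinuous_norm_le (Real.sqrt_nonneg _) hL⟩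
  classical
  change ∑' j, (inner ℂ (e j) (e i) : ℂ) • x j = x i
  rw [tsum_eq_single i fun j hj => by rw [e.orthonormal.2 hj, zero_smul],
    inner_self_eq_norm_sq_to_K, e.orthonormal.1]
  simp

/-- The operator-valued function with prescribed square summable columns. -/
theorem exists_hol_of_columns {ι : Type*} (e : HilbertBasis ι ℂ H) {f : ι → Hol H}
    (hf : ∑' i, (f i).h2Norm ^ 2 ≠ ∞) :
    ∃ F : Hol (H →L[ℂ] H), ∀ i, F.column (e i) = f i := by
  set M := (∑' i, (f i).h2Norm ^ 2).toReal
  have hle : ∀ n, ∑' i, ‖(f i).coeff n‖ₑ ^ 2 ≤ ∑' i, (f i).h2Norm ^ 2 := fun n =>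
    ENNReal.tsum_le_tsum fun i => pow_le_pow_left' ((f i).enorm_coeff_le n) 2
  have hs : ∀ n, Summable fun i => ‖(f i).coeff n‖ ^ 2 := fun n => by
    have h := ENNReal.summable_toReal (ne_top_of_le_ne_top hf (hle n))
    simpa using h
  have hM : ∀ n, ∑' i, ‖(f i).coeff n‖ ^ 2 ≤ M := fun n => by
    have h := hle n
    rw [tsum_enorm_sq (hs n)] at h
    exact (ENNReal.ofReal_le_iff_le_toReal hf).mp h
  choose T hT hTn using fun n => exists_operator_of_columns e (hs n)
  refine ⟨Hol.ofCoeff T (Hol.summable_of_bounded (C := √M) fun n =>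
    (hTn n).trans (Real.sqrt_le_sqrt (hM n))), fun i => Hol.ext_coeff fun n => ?_⟩
  rw [Hol.coeff_column, Hol.coeff_ofCoeff, hT]

/-- The bijection σ gives one basis vector to each term of a balanced representation. The f_k become
the columns of F and the g_k those of K, so the factorization is F times K^# and the squared norms
are the given sums. -/
theorem exists_isProduct_of_infinite {α : ℝ} (σ : basisIndex H ≃ ℕ) {h : Hol (H →L[ℂ] H)}
    {c : ℝ≥0∞} (hc : predualNorm α 0 α h < c) (hc' : c ≠ ∞) :
    ∃ F G, IsProduct α 0 α h F G ∧ h2HSNorm F ^ 2 ≤ c ∧ h2HSNorm G ^ 2 ≤ c := by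
  obtain ⟨u, f, g, hu, hs, hf, hg⟩ := exists_balanced_sum hc
  rw [← σ.tsum_eq] at hf hg
  obtain ⟨F, hF⟩ := exists_hol_of_columns (onb H) (f := fun i => f (σ i))
    (ne_top_of_le_ne_top hc' hf)
  obtain ⟨K, hK⟩ := exists_hol_of_columns (onb H) (f := fun i => g (σ i))
    (ne_top_of_le_ne_top hc' hg)
  have hF2 : h2HSNorm F ^ 2 ≤ c := by simpa only [h2HSNorm_sq, hF] using hf
  have hK2 : h2HSNorm K ^ 2 ≤ c := by simpa only [h2HSNorm_sq, hK] using hg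
  have hlt : ∀ {x : ℝ≥0∞}, x ^ 2 ≤ c → x < ∞ := fun hx => by
    rw [lt_top_iff_ne_top]
    rintro rfl
    simp [hc'] at hx
  refine ⟨F, sharp K, ⟨hlt hF2, ?_, u, fun z hz => ?_, hu⟩, hF2, ?_⟩
  · rw [h2HSNorm_sharp]
    exact hlt hK2
  · ext w
    have h1 := comp_adjoint_apply_hasSum (onb H) (Hol.Dpow α F z) (K (conj z)) w
    have h2 := ((σ.hasSum_iff (f := fun k => InnerProductSpace.rankOne ℂ
      (Hol.Dpow α (f k) z) (g k (conj z)))).mpr (hs z hz)).mapL (ContinuousLinearMap.apply ℂ H w)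
    have e1 : ∀ i, Hol.Dpow α F z (onb H i) = Hol.Dpow α (f (σ i)) z := fun i => by
      rw [← Hol.column_apply, ← Hol.Dpow_column, hF]
    have e2 : ∀ i, K (conj z) (onb H i) = g (σ i) (conj z) := fun i => by
      rw [← Hol.column_apply, hK]
    simp only [e1, e2] at h1
    rw [Hol.Dpow_zero, sharp_apply]
    exact h2.unique h1
  · rwa [h2HSNorm_sharp]

/-- A square summable sequence of Hardy functions as an `ℓ²`-valued Hardy function. -/
theorem exists_hol_lp {g : ℕ → Hol H} {s : ℝ} (hs : 0 ≤ s)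
    (hg : ∑' k, (g k).h2Norm ^ 2 ≤ ENNReal.ofReal s ^ 2) :
    ∃ G : Hol (lp (fun _ : ℕ => H) 2), G.h2Norm ≤ ENNReal.ofReal s ∧
      ∀ z ∈ ball (0 : ℂ) 1, ∑' k, ‖g k z‖ₑ ^ 2 = ‖G z‖ₑ ^ 2 := by
  have hle : ∀ n, ∑' k, ‖(g k).coeff n‖ₑ ^ 2 ≤ ENNReal.ofReal s ^ 2 := fun n =>
    (ENNReal.tsum_le_tsum fun k => pow_le_pow_left' ((g k).enorm_coeff_le n) 2).trans hg
  have hsum : ∀ n, Summable fun k => ‖(g k).coeff n‖ ^ 2 := fun n => by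
    have h := ENNReal.summable_toReal (ne_top_of_le_ne_top (by simp) (hle n))
    simpa using h
  let p : ℕ → lp (fun _ : ℕ => H) 2 := fun n =>
    ⟨fun k => (g k).coeff n, memℓp_gen (by simpa using hsum n)⟩
  have hnorm : ∀ x : lp (fun _ : ℕ => H) 2, ‖x‖ₑ ^ 2 = ∑' k, ‖x k‖ₑ ^ 2 := fun x => by
    have h1 := lp.hasSum_norm (p := 2) (by norm_num) x
    simp only [ENNReal.toReal_ofNat, Real.rpow_ofNat] at h1
    rw [tsum_enorm_sq h1.summable, h1.tsum_eq, enorm_sq_eq_ofReal]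
  have hp : ∀ n, ‖p n‖ ≤ s := fun n => by
    have h1 : ‖p n‖ₑ ^ 2 ≤ ENNReal.ofReal s ^ 2 := (hnorm (p n)).trans_le (hle n)
    have h2 := (ENNReal.pow_le_pow_left_iff two_ne_zero).mp h1
    rw [← ofReal_norm] at h2
    exact (ENNReal.ofReal_le_ofReal_iff hs).mp h2
  refine ⟨Hol.ofCoeff p (Hol.summable_of_bounded hp), ?_, fun z hz => ?_⟩
  · refine (ENNReal.pow_le_pow_left_iff two_ne_zero).mp (le_trans (le_of_eq ?_) hg)
    simp only [Hol.h2Norm_sq, Hol.coeff_ofCoeff, hnorm]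
    exact ENNReal.tsum_comm
  · rw [hnorm]
    refine tsum_congr fun k => ?_
    have h1 := (Hol.ofCoeff_hasSum (Hol.summable_of_bounded hp) hz).mapL
      (lp.evalCLM (p := 2) ℂ (fun _ : ℕ => H) k)
    rw [((g k).hasSum_coeff hz).unique h1]
    rfl

/-- The scalar function `z ↦ conj (v (conj z))`. -/
theorem exists_hol_conj (v : Hol ℂ) : ∃ w : Hol ℂ, w.h2Norm = v.h2Norm ∧
    ∀ z ∈ ball (0 : ℂ) 1, w z = conj (v (conj z)) := by
  have hp : ∀ r ∈ Set.Ico (0 : ℝ) 1, Summable fun n => r ^ n * ‖conj (v.coeff n)‖ := fun r hr => by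
    simpa only [RCLike.norm_conj] using v.summable_pow_mul_coeff hr.1 hr.2
  refine ⟨Hol.ofCoeff _ hp, ?_, fun z hz => ?_⟩
  · simp only [Hol.h2Norm, Hol.coeff_ofCoeff, ← ofReal_norm, RCLike.norm_conj]
  · have hz' : conj z ∈ ball (0 : ℂ) 1 := by simpa using hz
    refine (Hol.ofCoeff_hasSum hp hz).unique ?_
    simpa using (v.hasSum_coeff hz').mapL
      (Complex.conjCLE : ℂ →L[ℝ] ℂ)

end VecBMOA
end

/-! ### Factorization in finite dimension and the equality of the two descriptions -/

noncomputable section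
namespace VecBMOA

set_option linter.unusedSectionVars false

variable {H : Type*} [NormedAddCommGroup H] [InnerProductSpace ℂ H] [CompleteSpace H]

/-- The scalar multiple `z ↦ v(z) 1` of the identity operator. -/
def Hol.scalar (v : Hol ℂ) : Hol (H →L[ℂ] H) :=
  ⟨fun z => v z • ContinuousLinearMap.id ℂ H, v.diffOn.smul_const _, fun z hz => by
    change v z • _ = _
    rw [show v z = 0 from v.2.2 z hz, zero_smul]⟩

theorem Hol.scalar_apply (v : Hol ℂ) (z : ℂ) :
    (Hol.scalar v : Hol (H →L[ℂ] H)) z = v z • ContinuousLinearMap.id ℂ H := rfl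

theorem Hol.coeff_scalar_column (v : Hol ℂ) (x : H) (n : ℕ) :
    ((Hol.scalar v).column x).coeff n = v.coeff n • x := by
  refine Hol.coeff_unique _ (p := fun n => v.coeff n • x) (fun z hz => ?_) n
  rw [Hol.column_apply, Hol.scalar_apply]
  have h := (v.hasSum_coeff hz).smul_const x
  simpa [smul_smul] using h

theorem h2HSNorm_scalar_sq [Fintype (basisIndex H)] (v : Hol ℂ) :
    h2HSNorm (Hol.scalar v : Hol (H →L[ℂ] H)) ^ 2 =
      Fintype.card (basisIndex H) * v.h2Norm ^ 2 := by
  have e : ∀ i, ((Hol.scalar v).column (onb H i)).h2Norm = v.h2Norm := fun i => by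
    simp only [Hol.h2Norm, Hol.coeff_scalar_column, enorm_smul]
    rw [← ofReal_norm (onb H i), (onb H).orthonormal.1]
    simp
  simp only [h2HSNorm_sq, e, tsum_fintype, Finset.sum_const, Finset.card_univ, nsmul_eq_mul]

/-- The quotient of a vector-valued function by a zero-free scalar function. -/
def Hol.quot {Y : Type*} [NormedAddCommGroup Y] [NormedSpace ℂ Y] (u : Hol Y) (v : Hol ℂ)
    (hv : ∀ z ∈ ball (0 : ℂ) 1, v z ≠ 0) : Hol Y :=
  ⟨fun z => (v z)⁻¹ • u z, (v.diffOn.inv hv).smul u.diffOn, fun z hz => by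
    change _ • u z = 0
    rw [show u z = 0 from u.2.2 z hz, smul_zero]⟩

theorem Hol.quot_apply {Y : Type*} [NormedAddCommGroup Y] [NormedSpace ℂ Y] (u : Hol Y) (v : Hol ℂ)
    (hv : ∀ z ∈ ball (0 : ℂ) 1, v z ≠ 0) (z : ℂ) : Hol.quot u v hv z = (v z)⁻¹ • u z := rfl

/-- A function dominated by the square function of `D^α fₖ` is `D^α` of a Hardy function. -/
theorem h2Norm_sq_le_of_Dpow {α : ℝ} (hα : 0 < α) {f : Hol H} {g : ℕ → Hol H}
    (h : ∀ z ∈ ball (0 : ℂ) 1, ‖Hol.Dpow α f z‖ₑ ^ 2 ≤ ∑' k, ‖Hol.Dpow α (g k) z‖ₑ ^ 2) :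
    f.h2Norm ^ 2 ≤ ∑' k, (g k).h2Norm ^ 2 := by
  have hG : 0 < Real.pi * Real.Gamma (2 * α) :=
    mul_pos Real.pi_pos (Real.Gamma_pos_of_pos (by positivity))
  refine (ENNReal.mul_le_mul_iff_right (a := ENNReal.ofReal (Real.pi * Real.Gamma (2 * α)))
    (by simpa using hG) ENNReal.ofReal_ne_top).mp ?_
  rw [← ENNReal.tsum_mul_left]
  simp only [← Hol.lintegral_Dpow_logWeight _ hα]
  rw [← lintegral_tsum fun k => ?_]
  · refine setLIntegral_mono' measurableSet_ball fun z hz => ?_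
    rw [ENNReal.tsum_mul_right]
    gcongr
    exact h z hz
  · refine AEMeasurable.mul ?_ (ENNReal.measurable_ofReal.comp
      ((measurable_logWeight.comp measurable_norm).pow_const (2 * α - 1))).aemeasurable
    have h1 : ContinuousOn (fun z => ‖Hol.Dpow α (g k) z‖ₑ ^ 2) (ball 0 1) :=
      (ENNReal.continuous_pow 2).comp_continuousOn (Hol.continuousOn _).enorm
    exact h1.aemeasurable measurableSet_ball

theorem enorm_apply_sq_le_of_hasSum {x y : ℕ → H} {T : H →L[ℂ] H}
    (hT : HasSum (fun k => InnerProductSpace.rankOne ℂ (x k) (y k)) T) {w : H} (hw : ‖w‖ = 1) :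
    ‖T w‖ₑ ^ 2 ≤ (∑' k, ‖x k‖ₑ ^ 2) * ∑' k, ‖y k‖ₑ ^ 2 := by
  have h1 := hT.mapL (ContinuousLinearMap.apply ℂ H w)
  have h2 : ‖T w‖ₑ ≤ ∑' k, ‖x k‖ₑ * ‖y k‖ₑ := by
    rw [← ContinuousLinearMap.apply_apply (𝕜 := ℂ) w T, ← h1.tsum_eq]
    refine enorm_tsum_le_tsum_enorm.trans (ENNReal.tsum_le_tsum fun k => ?_)
    rw [ContinuousLinearMap.apply_apply, InnerProductSpace.rankOne_apply, enorm_smul, mul_comm]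
    gcongr
    refine (enorm_inner_le _ _).trans ?_
    rw [← ofReal_norm w, hw, ENNReal.ofReal_one, mul_one]
  refine (pow_le_pow_left' (h2.trans (tsum_mul_sq_le _ _)) 2).trans (le_of_eq ?_)
  rw [mul_pow, sq_rpow_half, sq_rpow_half]

/-- Take G = v·1, where |v(z)|² dominates Σ ‖g_k(z̄)‖², and F = D^(-α)(u/v). By Cauchy–Schwarz each
column of D^α F is bounded pointwise by the square function of the D^α f_k, hence in norm since α >
0. The dimension enters through the number of columns. -/
theorem exists_isProduct_of_finite [Fintype (basisIndex H)] {α : ℝ} (hα : 0 < α)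
    {h : Hol (H →L[ℂ] H)} {c : ℝ≥0∞} (hc : predualNorm α 0 α h < c) (hc' : c ≠ ∞) :
    ∃ F G, IsProduct α 0 α h F G ∧ h2HSNorm F ^ 2 ≤ Fintype.card (basisIndex H) * c ∧
      h2HSNorm G ^ 2 ≤ Fintype.card (basisIndex H) * (9 * c) := by
  obtain ⟨u, f, g, hu, hs, hf, hg⟩ := exists_balanced_sum hc
  set s := √c.toReal
  have hs0 : 0 < s := Real.sqrt_pos.mpr (ENNReal.toReal_pos (zero_le.trans_lt hc).ne' hc')
  have hcs : c = ENNReal.ofReal s ^ 2 := by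
    rw [← ENNReal.ofReal_pow hs0.le, Real.sq_sqrt ENNReal.toReal_nonneg, ENNReal.ofReal_toReal hc']
  obtain ⟨G, hG, hG'⟩ := exists_hol_lp hs0.le (hg.trans_eq hcs)
  obtain ⟨v₀, hv₀, hv₀'⟩ := exists_majorant hs0 hG
  obtain ⟨v, hv, hv'⟩ := exists_hol_conj v₀
  have hconj : ∀ z ∈ ball (0 : ℂ) 1, conj z ∈ ball (0 : ℂ) 1 := fun z hz => by simpa using hz
  have hne : ∀ z ∈ ball (0 : ℂ) 1, v z ≠ 0 := fun z hz => by
    rw [hv' z hz]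
    exact (map_ne_zero _).mpr (hv₀' _ (hconj z hz)).1
  let F := Hol.Dpow (-α) (Hol.quot u v hne)
  have hDF : Hol.Dpow α F = Hol.quot u v hne := by
    rw [Hol.Dpow_Dpow, add_neg_cancel, Hol.Dpow_zero]
  have hF : h2HSNorm F ^ 2 ≤ Fintype.card (basisIndex H) * c := by
    rw [h2HSNorm_sq, tsum_fintype, ← nsmul_eq_mul]
    refine Finset.sum_le_card_nsmul _ _ _ fun i _ => le_trans ?_ hf
    refine h2Norm_sq_le_of_Dpow hα fun z hz => ?_
    rw [Hol.Dpow_column, hDF, Hol.column_apply, Hol.quot_apply, smul_apply, enorm_smul, mul_pow,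
      enorm_inv (hne z hz), ← ENNReal.inv_pow, mul_comm, ← div_eq_mul_inv]
    refine ENNReal.div_le_of_le_mul ?_
    refine (enorm_apply_sq_le_of_hasSum (hs z hz) ((onb H).orthonormal.1 i)).trans ?_
    gcongr
    rw [hG' _ (hconj z hz), hv' z hz, ← ofReal_norm, ← ofReal_norm, RCLike.norm_conj]
    gcongr
    exact (hv₀' _ (hconj z hz)).2
  have hGs : h2HSNorm (Hol.scalar v : Hol (H →L[ℂ] H)) ^ 2 ≤
      Fintype.card (basisIndex H) * (9 * c) := by
    rw [h2HSNorm_scalar_sq]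
    gcongr
    rw [hv]
    refine (pow_le_pow_left' hv₀ 2).trans (le_of_eq ?_)
    rw [ENNReal.ofReal_mul (by norm_num), mul_pow, hcs, ENNReal.ofReal_ofNat]
    norm_num
  have hlt : ∀ {x y : ℝ≥0∞}, x ^ 2 ≤ y → y ≠ ∞ → x < ∞ := fun hx hy => by
    rw [lt_top_iff_ne_top]
    rintro rfl
    simp [hy] at hx
  refine ⟨F, Hol.scalar v, ⟨hlt hF (ENNReal.mul_ne_top (by simp) hc'),
    hlt hGs (ENNReal.mul_ne_top (by simp) (ENNReal.mul_ne_top (by simp) hc')), u,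
    fun z hz => ?_, hu⟩, hF, hGs⟩
  rw [hDF, Hol.Dpow_zero, Hol.scalar_apply, Hol.quot_apply, ContinuousLinearMap.comp_smul,
    ContinuousLinearMap.comp_id, smul_smul, mul_inv_cancel₀ (hne z hz), one_smul]

variable (H) in
-- The dichotomy is on the dimension of H. The constant is 1 in infinite dimension and 3 dim H in
-- finite dimension, the 3 being that of the scalar majorant.
theorem exists_isProduct [TopologicalSpace.SeparableSpace H] {α : ℝ} (hα : 0 < α) :
    ∃ C : ℝ≥0, ∀ (h : Hol (H →L[ℂ] H)) (c : ℝ≥0∞), predualNorm α 0 α h < c → c ≠ ∞ →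
      ∃ F G, IsProduct α 0 α h F G ∧ h2HSNorm F * h2HSNorm G ≤ C * c := by
  have := Orthonormal.countable (onb H).orthonormal
  rcases finite_or_infinite (basisIndex H) with hfin | hinf
  · have := Fintype.ofFinite (basisIndex H)
    refine ⟨Fintype.card (basisIndex H) * 3, fun h c hc hc' => ?_⟩
    obtain ⟨F, G, hp, hF, hG⟩ := exists_isProduct_of_finite hα hc hc'
    refine ⟨F, G, hp, (ENNReal.pow_le_pow_left_iff two_ne_zero).mp ?_⟩
    rw [mul_pow]
    refine (mul_le_mul' hF hG).trans (le_of_eq ?_)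
    push_cast
    ring
  · have := (nonempty_equiv_of_countable (α := basisIndex H) (β := ℕ))
    refine ⟨1, fun h c hc hc' => ?_⟩
    obtain ⟨F, G, hp, hF, hG⟩ := exists_isProduct_of_infinite this.some hc hc'
    refine ⟨F, G, hp, (ENNReal.pow_le_pow_left_iff two_ne_zero).mp ?_⟩
    rw [mul_pow]
    refine (mul_le_mul' hF hG).trans (le_of_eq ?_)
    push_cast
    ring

theorem IsProduct.sharp {a b c : ℝ} {h F G : Hol (H →L[ℂ] H)} (hp : IsProduct a b c h F G) :
    IsProduct b a c (sharp h) (sharp G) (sharp F) := by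
  obtain ⟨hF, hG, u, hu, rfl⟩ := hp
  refine ⟨by rwa [h2HSNorm_sharp], by rwa [h2HSNorm_sharp], VecBMOA.sharp u, fun z hz => ?_,
    sharp_Dpow _ _⟩
  rw [sharp_apply, hu _ (by simpa using hz), ContinuousLinearMap.adjoint_comp, ← sharp_Dpow,
    ← sharp_Dpow, sharp_apply, sharp_apply]

variable (H) in
theorem exists_isProduct_sharp [TopologicalSpace.SeparableSpace H] {α : ℝ} (hα : 0 < α) :
    ∃ C : ℝ≥0, ∀ (h : Hol (H →L[ℂ] H)) (c : ℝ≥0∞), predualNorm 0 α α h < c → c ≠ ∞ →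
      ∃ F G, IsProduct 0 α α h F G ∧ h2HSNorm F * h2HSNorm G ≤ C * c := by
  obtain ⟨C, hC⟩ := exists_isProduct H hα
  refine ⟨C, fun h c hc hc' => ?_⟩
  obtain ⟨F, G, hp, hFG⟩ := hC (sharp h) c (by rwa [predualNorm_sharp]) hc'
  refine ⟨sharp G, sharp F, ?_, ?_⟩
  · rw [← sharp_sharp h]
    exact hp.sharp
  · rwa [h2HSNorm_sharp, h2HSNorm_sharp, mul_comm]

/-- The tensor product and product descriptions of a space agree as soon as tensor sums
factorize. -/
theorem predual_eq_prodSpace [TopologicalSpace.SeparableSpace H] {a b d : ℝ} {C : ℝ≥0}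
    (hC : ∀ (h : Hol (H →L[ℂ] H)) (c : ℝ≥0∞), predualNorm a b d h < c → c ≠ ∞ →
      ∃ F G, IsProduct a b d h F G ∧ h2HSNorm F * h2HSNorm G ≤ C * c) :
    (predual H a b d : Set (Hol (H →L[ℂ] H))) = prodSpace H a b d ∧
      ∃ C : ℝ≥0, ∀ h : Hol (H →L[ℂ] H),
        predualNorm a b d h ≤ C * prodNorm a b d h ∧
        prodNorm a b d h ≤ C * predualNorm a b d h := by
  refine ⟨Set.ext fun h => ⟨fun hh => ?_, fun ⟨F, G, hp⟩ => ?_⟩, C + 1, fun h => ⟨?_, ?_⟩⟩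
  · obtain ⟨c, hc, hc'⟩ := exists_between (show predualNorm a b d h < ∞ from hh)
    obtain ⟨F, G, hp, -⟩ := hC h c hc hc'.ne
    exact ⟨F, G, hp⟩
  · exact hp.predualNorm_le.trans_lt (ENNReal.mul_lt_top hp.1 hp.2.1)
  · refine (predualNorm_le_prodNorm a b d h).trans (le_mul_of_one_le_left' ?_)
    push_cast
    exact le_add_self
  -- The constant C + 1 is nonzero, so one may divide by it, and it is at least 1, which serves the
  -- opposite inequality.
  · have h0 : ((C + 1 : ℝ≥0) : ℝ≥0∞) ≠ 0 := by simp
    rw [mul_comm, ← ENNReal.div_le_iff h0 ENNReal.coe_ne_top]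
    refine le_of_forall_gt_imp_ge_of_dense fun c hc => ?_
    rcases eq_or_ne c ∞ with rfl | hc'
    · exact le_top
    obtain ⟨F, G, hp, hFG⟩ := hC h c hc hc'
    rw [ENNReal.div_le_iff h0 ENNReal.coe_ne_top, mul_comm]
    refine ((iInf₂_le F G).trans (iInf_le _ hp)).trans (hFG.trans ?_)
    gcongr
    exact le_self_add

end VecBMOA
end

theorem mainTheorem5 {H : Type*} [NormedAddCommGroup H] [InnerProductSpace ℂ H] [CompleteSpace H]
    [TopologicalSpace.SeparableSpace H] (α : ℝ) (hα : 0 < α) :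
    -- the two descriptions of the first space: equal sets, comparable norms
    ((VecBMOA.predual H α 0 α : Set (VecBMOA.Hol (H →L[ℂ] H))) = VecBMOA.prodSpace H α 0 α ∧
      ∃ C : ℝ≥0, ∀ h : VecBMOA.Hol (H →L[ℂ] H),
        VecBMOA.predualNorm α 0 α h ≤ C * VecBMOA.prodNorm α 0 α h ∧
        VecBMOA.prodNorm α 0 α h ≤ C * VecBMOA.predualNorm α 0 α h) ∧
    -- its dual
    VecBMOA.IsDualOfPredual α 0 α (VecBMOA.BMOAC H) VecBMOA.bmoaCNorm ∧
    -- the two descriptions of the second space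
    ((VecBMOA.predual H 0 α α : Set (VecBMOA.Hol (H →L[ℂ] H))) = VecBMOA.prodSpace H 0 α α ∧
      ∃ C : ℝ≥0, ∀ h : VecBMOA.Hol (H →L[ℂ] H),
        VecBMOA.predualNorm 0 α α h ≤ C * VecBMOA.prodNorm 0 α α h ∧
        VecBMOA.prodNorm 0 α α h ≤ C * VecBMOA.predualNorm 0 α α h) ∧
    -- its dual
    VecBMOA.IsDualOfPredual 0 α α (VecBMOA.BMOACsharp H)
      (fun φ => VecBMOA.bmoaCNorm (VecBMOA.sharp φ)) := by
  obtain ⟨C, hC⟩ := VecBMOA.exists_isProduct H hα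
  obtain ⟨K, hK⟩ := VecBMOA.exists_isProduct_sharp H hα
  exact ⟨VecBMOA.predual_eq_prodSpace hC, VecBMOA.isDualOfPredual_left hα,
    VecBMOA.predual_eq_prodSpace hK, VecBMOA.isDualOfPredual_right hα⟩
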